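/- Let $(\mathbb K,\tau)$ be one of $(\mathbb R\times\mathbb R,\text{swap})$, $(\mathbb C\times\mathbb C,\text{swap})$, $(\mathbb C,\text{conjugation})$, $(\mathbb R,\mathrm{id})$, $(\mathbb C,\mathrm{id})$, let $a\mapsto\bar a$ be componentwise complex conjugation, and let $\mathbb K_+^\times\subset\mathbb K$ be $\mathbb R_{>0}$, or $\mathbb R_{>0}\times\mathbb R_{>0}$ in the first two cases, with the measure $d^\times t$ given by $dt/t$ on each factor. Let $E$ be a free $\mathbb K$-module of finite rank with a non-degenerate $\mathbb R$-bilinear form $\langle\,,\,\rangle:E\times E\to\mathbb K$ such that $\langle u,v\rangle=\langle v,u\rangle^\tau$ and $\langle au,v\rangle=a\langle u,v\rangle$, and let $G=\mathrm U(E)$ be its group of $\mathbb K$-linear isometries. Let $r\ge 0$ and let $0=X_0\subset X_1\subset\cdots\subset X_r$ be free submodules of $E$, $X_i$ of rank $i$, with $X_r$ totally isotropic. Let $v_0'\in E$ be orthogonal to $X_r$ with $\langle v_0',v_0'\rangle=-1$, and put $X_{r+1}=X_r\oplus\mathbb Kv_0'$ and $$S_r=\{x\in G:\ (x-1)X_{i+1}\subset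 X_i,\ i=0,1,\dots,r\}.$$ Let $Y_r\subset v_0'^{\perp}$ be a totally isotropic free submodule of rank $r$ such that the pairing $\langle\,,\,\rangle:X_r\times Y_r\to\mathbb K$ is non-degenerate, and put $E_0=v_0'^\perp\cap(X_r\oplus Y_r)^\perp$, $E_0'=E_0\oplus\mathbb Kv_0'$. Assume that $E_0'$ contains a torsion-free isotropic vector, choose $v_0\in E_0$ with $\langle v_0,v_0\rangle=1$, and let $Z_0$ be the orthogonal complement of $v_0$ in $E_0$. Let $[\,,\,]$ be a commuting positive form on $E$: it is $\mathbb R$-bilinear with values in $\mathbb K$, $[u,v]=\overline{[v,u]}$, $[au,v]=a[u,v]$, $[u,u]\in\mathbb K_+^\times$ for torsion-free $u$, and the map $\theta$ with $[u,v]=\langle u,\theta v\rangle$ satisfies $\theta^2=1$. Assume that $E=X_r\oplus Y_r\oplus Z_0\oplus\mathbb Kv_0\oplus\mathbb Kv_0'$ is an orthogonal sum of five submodules for $[\,,\,]$, and that $[v_0,v_0]=[v_0',v_0']=1$. Let $K$ be the stabilizer of $[\,,\,]$ in $G$ (a maximal compact subgroup), and let $dk$ be its normalized Haar measure. Let $P_r\subset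 G$ be the stabilizer of $X_r$, let $\mathrm{GL}_r=\mathrm{GL}_{\mathbb K}(X_r)$, embedded in $G$ as the group of all elements of $G$ that preserve $X_r$ and $Y_r$ and fix $E_0'$ pointwise, and let $B_r\subset\mathrm{GL}_r$ be the stabilizer of the flag $(X_i)$. For a Lie group $H$ let $\delta_H(x)=|\det(\mathrm{Ad}_x)|$, with $\mathrm{Ad}$ acting on the Lie algebra of $H$. For $\mathbf t=(t_1,\dots,t_r)\in(\mathbb K_+^\times)^r$ let $a_{\mathbf t}\in \mathrm{GL}_r$ be the element that acts on $\{v\in X_i:[v,X_{i-1}]=0\}$ as the scalar $t_i$, $i=1,\dots,r$. For $t\in\mathbb K_+^\times$ let $g_t\in G$ be the element with $g_t(v_0+v_0')=t(v_0+v_0')$, $g_t(v_0-v_0')=t^{-\tau}(v_0-v_0')$ and $g_t=1$ on $X_r\oplus Y_r\oplus Z_0$. Put $F=E_0'$, and let $F_\pm$ be the $\pm1$-eigenspaces of $\theta$ in $F$. Let $S_F$ be the manifold of all $w=u+v$ with $u\in F_+$, $v\in F_-$, $[u,u]=[v,v]=1$, $[u,v]=0$, with the Riemannian metric $\frac1{\dim_{\mathbb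 R}\mathbb K}\mathrm{tr}_{\mathbb K/\mathbb R}[\,,\,]$, and let $\Gamma_{F,-1}=\{u\in F:\langle u,u\rangle=-1\}$, with the pseudo-Riemannian metric $\frac1{\dim_{\mathbb R}\mathbb K}\mathrm{tr}_{\mathbb K/\mathbb R}\langle\,,\,\rangle$. Give each factor $\mathbb R_{>0}$ of $\mathbb K_+^\times$ the metric for which $t\frac{d}{dt}$ has length $1$. Then $v_0+v_0'\in S_F$, the Jacobian with respect to these metrics of the map $$\eta_F:S_F\times\mathbb K_+^\times\to\Gamma_{F,-1},\qquad (u+v,t)\mapsto\tfrac{t-t^{-\tau}}2u+\tfrac{t+t^{-\tau}}2v$$ at $(w,t)$ does not depend on $w$, and we write $J_{E_0'}(t)$ for it. Proposition. There is a nonzero right $G$-invariant Radon measure $dg$ on $S_r\backslash G$ such that for every continuous function $\phi:S_r\backslash G\to\mathbb C$ $$\int_{S_r\backslash G}\phi(g)\,dg=\int_{(\mathbb K_+^\times)^r\times\mathbb K_+^\times\times K}\phi(a_{\mathbf t}\,g_t\,k)\,\delta_{P_r}^{-1}(a_{\mathbf t})\,\delta_{B_r}^{-1}(a_{\mathbf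 t})\,J_{E_0'}(t)\,d^\times\mathbf t\,d^\times t\,dk,$$ in the sense that one side converges absolutely if and only if the other does, and then they are equal. -/

import Mathlib

open MeasureTheory

/-- The three types of scalar rings with involution over `L = ℝ` or `ℂ`:
`split` is `L × L` with the interchange of coordinates, `herm` is `L` with complex conjugation,
`orth` is `L` with the identity. -/
inductive ScalarKind where
  | split : ScalarKind
  | herm : ScalarKind
  | orth : ScalarKind

/-- The number `d_𝕂` of simple factors of `𝕂`. -/
def ScalarKind.card : ScalarKind → ℕ
  | .split => 2
  | .herm => 1
  | .orth => 1

/-- The commutative `ℝ`-algebra `𝕂`, equal to `L × L` in the split case and to `L` otherwise. -/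
abbrev Scalar (L : Type*) (k : ScalarKind) := Fin k.card → L

section Scalars

variable {L : Type*} [RCLike L] {k : ScalarKind}

/-- The involution `τ` of `𝕂`. -/
def tau : {k : ScalarKind} → Scalar L k → Scalar L k
  | .split, z => fun i => z i.rev
  | .herm, z => star z
  | .orth, z => z

/-- The normalized trace `(dim_ℝ 𝕂)⁻¹ tr_{𝕂/ℝ}`: the trace of `z ∈ L` over `ℝ` is `[L : ℝ] Re z`,
so that the normalized trace is the mean of the real parts of the coordinates. -/
noncomputable def normTrace (z : Scalar L k) : ℝ := (∑ i, RCLike.re (z i)) / (k.card : ℝ)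

/-- The group `𝕂₊ˣ`, that is `ℝ₊ˣ` or `ℝ₊ˣ × ℝ₊ˣ`. -/
abbrev PosScalar (k : ScalarKind) := Fin k.card → {x : ℝ // 0 < x}

/-- The inclusion of `𝕂₊ˣ` into `𝕂`. -/
noncomputable def posCoe (L : Type*) [RCLike L] {k : ScalarKind} (t : PosScalar k) : Scalar L k :=
  fun i => ((t i : ℝ) : L)

/-- `t^{-τ}` for `t ∈ 𝕂₊ˣ` (inverses in `𝕂` are taken componentwise). -/
noncomputable def posInvTau (L : Type*) [RCLike L] {k : ScalarKind} (t : PosScalar k) :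
    Scalar L k := tau (fun i => (((t i : ℝ) : L))⁻¹)

/-- The point `t exp(ξ)` of `𝕂₊ˣ`, for `t ∈ 𝕂₊ˣ` and a logarithmic direction `ξ`. -/
noncomputable def posFlow (t : PosScalar k) (ξ : Fin k.card → ℝ) : PosScalar k :=
  fun i => ⟨(t i : ℝ) * Real.exp (ξ i), mul_pos (t i).2 (Real.exp_pos _)⟩

/-- The multiplicative measure `dt / t` on `ℝ₊ˣ`, the Riemannian measure of the metric for which
`t d/dt` has length one: the image of Lebesgue measure under the exponential. -/
noncomputable def posRealMeasure : Measure {x : ℝ // 0 < x} :=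
  Measure.map (fun s : ℝ => (⟨Real.exp s, Real.exp_pos s⟩ : {x : ℝ // 0 < x})) volume

/-- The multiplicative measure `dˣt` on `𝕂₊ˣ`. -/
noncomputable def posMeasure (k : ScalarKind) : Measure (PosScalar k) :=
  Measure.pi (fun _ => posRealMeasure)

end Scalars

/-- A non-degenerate `τ`-hermitian form `⟨ , ⟩` on a `𝕂`-module. -/
structure HermitianForm (L : Type*) [RCLike L] (k : ScalarKind) (E : Type*)
    [NormedAddCommGroup E] [NormedSpace ℝ E] [Module (Scalar L k) E] where
  form : E →ₗ[ℝ] E →ₗ[ℝ] Scalar L k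
  smul_left : ∀ (a : Scalar L k) (u v : E), form (a • u) v = a * form u v
  tau_symm : ∀ u v : E, form u v = tau (form v u)
  nondegenerate : ∀ u : E, (∀ v : E, form u v = 0) → u = 0

/-- A positive form `[ , ]` on a `𝕂`-module: it is hermitian for the componentwise complex
conjugation, and `[u, u] ∈ 𝕂₊ˣ` for torsion free `u`. -/
structure PositiveForm (L : Type*) [RCLike L] (k : ScalarKind) (E : Type*)
    [NormedAddCommGroup E] [NormedSpace ℝ E] [Module (Scalar L k) E] where
  form : E →ₗ[ℝ] E →ₗ[ℝ] Scalar L k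
  smul_left : ∀ (a : Scalar L k) (u v : E), form (a • u) v = a * form u v
  conj_symm : ∀ u v : E, form u v = star (form v u)
  pos : ∀ u : E, (∀ a : Scalar L k, a • u = 0 → a = 0) →
    ∃ t : PosScalar k, form u u = posCoe L t

section Groups

variable {L : Type*} [RCLike L] {k : ScalarKind} {E : Type*} [NormedAddCommGroup E]
  [NormedSpace ℝ E] [Module (Scalar L k) E]

/-- The positive form commutes with the hermitian form: the `ℝ`-linear map `θ` with
`[u, v] = ⟨u, θ v⟩` satisfies `θ² = 1`. -/
def PositiveForm.IsCommuting (B : PositiveForm L k E) (h : HermitianForm L k E) : Prop :=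
  ∃ θ : E →ₗ[ℝ] E, (∀ u v, B.form u v = h.form u (θ v)) ∧ ∀ v, θ (θ v) = v

/-- The submodule of all vectors orthogonal to `W` for the hermitian form. -/
def HermitianForm.orthogonal (h : HermitianForm L k E) (W : Submodule (Scalar L k) E) :
    Submodule (Scalar L k) E where
  carrier := {u | ∀ x ∈ W, h.form u x = 0}
  add_mem' := by
    intro a b ha hb x hx
    simp [ha x hx, hb x hx]
  zero_mem' := by
    intro x _
    simp
  smul_mem' := by
    intro c a ha x hx
    rw [h.smul_left, ha x hx, mul_zero]

/-- The group `U(E)` of all `𝕂`-module automorphisms of `E` that preserve the hermitian form,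
inside the topological group of all invertible `ℝ`-linear endomorphisms. -/
def HermitianForm.unitary (h : HermitianForm L k E) : Subgroup (E →L[ℝ] E)ˣ where
  carrier := {x | (∀ (a : Scalar L k) (v : E), x.val (a • v) = a • x.val v) ∧
    ∀ u v : E, h.form (x.val u) (x.val v) = h.form u v}
  mul_mem' := by
    rintro x y ⟨hx, hx'⟩ ⟨hy, hy'⟩
    refine ⟨fun a v => ?_, fun u v => ?_⟩
    · simp [hx, hy]
    · simp [hx', hy']
  one_mem' := by simp
  inv_mem' := by
    rintro x ⟨hx, hx'⟩
    have e : ∀ v, x.val (x⁻¹.val v) = v := fun v => by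
      rw [← mul_apply_eq_comp]; simp
    have e' : ∀ v, x⁻¹.val (x.val v) = v := fun v => by
      rw [← mul_apply_eq_comp]; simp
    refine ⟨fun a v => ?_, fun u v => ?_⟩
    · have := hx a (x⁻¹.val v)
      rw [e] at this
      rw [← this, e']
    · rw [← hx', e, e]

/-- The maximal compact subgroup `K(E)`: the stabilizer of the positive form in `U(E)`. -/
def HermitianForm.compact (h : HermitianForm L k E) (B : PositiveForm L k E) :
    Subgroup h.unitary where
  carrier := {x | ∀ u v : E, B.form (x.1.val u) (x.1.val v) = B.form u v}
  mul_mem' := by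
    intro x y hx hy u v
    have := hx (y.1.val u) (y.1.val v)
    rw [hy u v] at this
    simpa using this
  one_mem' := by simp
  inv_mem' := by
    intro x hx u v
    have e : ∀ v, x.1.val ((x⁻¹).1.val v) = v := fun v => by
      rw [← mul_apply_eq_comp]; simp
    rw [← hx, e, e]

/-- The Lie algebra of `U(E)`: all `𝕂`-linear skew-hermitian endomorphisms of `E`. -/
def HermitianForm.lieUnitary [IsScalarTower ℝ (Scalar L k) E] (h : HermitianForm L k E) :
    Submodule ℝ (E →L[ℝ] E) where
  carrier := {A | (∀ (a : Scalar L k) (v : E), A (a • v) = a • A v) ∧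
    ∀ u v : E, h.form (A u) v + h.form u (A v) = 0}
  add_mem' := by
    rintro A C ⟨hA, hA'⟩ ⟨hC, hC'⟩
    refine ⟨fun a v => by simp [hA, hC], fun u v => ?_⟩
    have h1 := hA' u v
    have h2 := hC' u v
    simp only [add_apply, map_add, LinearMap.add_apply]
    calc _ = (h.form (A u) v + h.form u (A v)) + (h.form (C u) v + h.form u (C v)) := by abel
      _ = 0 := by rw [h1, h2, add_zero]
  zero_mem' := by simp
  smul_mem' := by
    rintro c A ⟨hA, hA'⟩
    refine ⟨fun a v => ?_, fun u v => ?_⟩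
    · rw [smul_apply, smul_apply, hA,
        ← algebraMap_smul (Scalar L k) c (A v), ← algebraMap_smul (Scalar L k) c (a • A v),
        smul_smul, smul_smul, mul_comm]
    · have h1 := hA' u v
      simp only [smul_apply, map_smul, LinearMap.smul_apply]
      rw [← smul_add, h1, smul_zero]

/-- The conjugation action `A ↦ x A x⁻¹` on endomorphisms. -/
def conjEnd (x : (E →L[ℝ] E)ˣ) : (E →L[ℝ] E) →ₗ[ℝ] (E →L[ℝ] E) :=
  (LinearMap.mulLeft ℝ x.val).comp (LinearMap.mulRight ℝ x⁻¹.val)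

theorem unit_apply_inv (x : (E →L[ℝ] E)ˣ) (v : E) : x.val (x⁻¹.val v) = v := by
  rw [← mul_apply_eq_comp]; simp

theorem unit_inv_apply (x : (E →L[ℝ] E)ˣ) (v : E) : x⁻¹.val (x.val v) = v := by
  rw [← mul_apply_eq_comp]; simp

theorem conjEnd_apply (x : (E →L[ℝ] E)ˣ) (A : E →L[ℝ] E) (v : E) :
    conjEnd x A v = x.val (A (x⁻¹.val v)) := rfl

theorem conjEnd_mem_lieUnitary [IsScalarTower ℝ (Scalar L k) E] (h : HermitianForm L k E)
    (x : h.unitary) {A : E →L[ℝ] E} (hA : A ∈ h.lieUnitary) :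
    conjEnd x.1 A ∈ h.lieUnitary := by
  refine ⟨fun a v => ?_, fun u v => ?_⟩
  · rw [conjEnd_apply, conjEnd_apply]
    have h1 : (x.1)⁻¹.val (a • v) = a • (x.1)⁻¹.val v := (x⁻¹).2.1 a v
    rw [h1, hA.1, x.2.1]
  · rw [conjEnd_apply, conjEnd_apply]
    have h1 := hA.2 ((x.1)⁻¹.val u) ((x.1)⁻¹.val v)
    rw [← x.2.2, ← x.2.2 ((x.1)⁻¹.val u), unit_apply_inv, unit_apply_inv] at h1
    exact h1

end Groups

section BesselGroups

variable {L : Type*} [RCLike L] {k : ScalarKind} {E : Type*} [NormedAddCommGroup E]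
  [NormedSpace ℝ E] [Module (Scalar L k) E]

/-- The data that define an `r`-th Bessel subgroup: a flag `0 = X₀ ⊂ X₁ ⊂ ⋯ ⊂ X_r` of free
submodules with `X_r` totally isotropic, a vector `v₀'` orthogonal to `X_r` with
`⟨v₀', v₀'⟩ = -1` (then `X_{r+1} = X_r ⊕ 𝕂 v₀'`), a totally isotropic free submodule `Y` of rank `r`
of `v₀'^⊥` in duality with `X_r`, and a vector `v₀` orthogonal to `X_r`, `Y` and `v₀'` with
`⟨v₀, v₀⟩ = 1`. -/
structure BesselData (h : HermitianForm L k E) (r : ℕ) where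
  X : Fin (r + 1) → Submodule (Scalar L k) E
  X_zero : X 0 = ⊥
  X_le : ∀ i : Fin r, X i.castSucc ≤ X i.succ
  X_free : ∀ i, Module.Free (Scalar L k) (X i)
  X_rank : ∀ i, Module.finrank (Scalar L k) (X i) = i
  X_isotropic : ∀ x ∈ X (Fin.last r), ∀ y ∈ X (Fin.last r), h.form x y = 0
  v₀' : E
  v₀'_norm : h.form v₀' v₀' = -1
  X_orthogonal : ∀ x ∈ X (Fin.last r), h.form x v₀' = 0
  Y : Submodule (Scalar L k) E
  Y_free : Module.Free (Scalar L k) Y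
  Y_rank : Module.finrank (Scalar L k) Y = r
  Y_isotropic : ∀ x ∈ Y, ∀ y ∈ Y, h.form x y = 0
  Y_orthogonal : ∀ y ∈ Y, h.form y v₀' = 0
  pairing_left : ∀ x ∈ X (Fin.last r), (∀ y ∈ Y, h.form x y = 0) → x = 0
  pairing_right : ∀ y ∈ Y, (∀ x ∈ X (Fin.last r), h.form x y = 0) → y = 0
  v₀ : E
  v₀_norm : h.form v₀ v₀ = 1
  v₀_orthogonal_X : ∀ x ∈ X (Fin.last r), h.form v₀ x = 0
  v₀_orthogonal_Y : ∀ y ∈ Y, h.form v₀ y = 0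
  v₀_orthogonal_v₀' : h.form v₀ v₀' = 0

namespace BesselData

variable {h : HermitianForm L k E} {r : ℕ} (D : BesselData h r)

/-- `X_r`. -/
def Xr : Submodule (Scalar L k) E := D.X (Fin.last r)

/-- The line `𝕂 v₀'`. -/
def line' : Submodule (Scalar L k) E := Submodule.span (Scalar L k) {D.v₀'}

/-- The line `𝕂 v₀`. -/
def line : Submodule (Scalar L k) E := Submodule.span (Scalar L k) {D.v₀}

/-- `E₀ = v₀'^⊥ ∩ (X_r ⊕ Y)^⊥`. -/
def E₀ : Submodule (Scalar L k) E := h.orthogonal D.line' ⊓ h.orthogonal (D.Xr ⊔ D.Y)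

/-- `E₀' = E₀ ⊕ 𝕂 v₀'`. -/
def E₀' : Submodule (Scalar L k) E := D.E₀ ⊔ D.line'

/-- `Z₀`, the orthogonal complement of `v₀` in `E₀`. -/
def Z₀ : Submodule (Scalar L k) E := D.E₀ ⊓ h.orthogonal D.line

/-- The decomposition `E = X_r ⊕ Y ⊕ Z₀ ⊕ 𝕂 v₀ ⊕ 𝕂 v₀'` is orthogonal for the positive form, and
`v₀`, `v₀'` have length one for it. -/
def IsAdapted (B : PositiveForm L k E) : Prop :=
  (∀ i j : Fin 5, i ≠ j →
    ∀ x ∈ (![D.Xr, D.Y, D.Z₀, D.line, D.line'] : Fin 5 → Submodule (Scalar L k) E) i,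
    ∀ y ∈ (![D.Xr, D.Y, D.Z₀, D.line, D.line'] : Fin 5 → Submodule (Scalar L k) E) j,
      B.form x y = 0) ∧
  B.form D.v₀ D.v₀ = 1 ∧ B.form D.v₀' D.v₀' = 1

/-- The Bessel subgroup `S_r = {x ∈ U(E) | (x - 1) X_{i+1} ⊂ X_i, i = 0, …, r}`, where
`X_{r+1} = X_r ⊕ 𝕂 v₀'`. -/
def bessel : Subgroup h.unitary where
  carrier := {x | (∀ i : Fin r, ∀ v ∈ D.X i.succ, x.1.val v - v ∈ D.X i.castSucc) ∧
    ∀ v ∈ D.Xr ⊔ D.line', x.1.val v - v ∈ D.Xr}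
  mul_mem' := by
    rintro x y ⟨hx, hx'⟩ ⟨hy, hy'⟩
    have key : ∀ v, (x * y).1.val v - v =
        (x.1.val (y.1.val v - v) - (y.1.val v - v)) + (x.1.val v - v) + (y.1.val v - v) := by
      intro v
      have : (x * y).1.val v = x.1.val (y.1.val v) := rfl
      rw [this, map_sub]; abel
    refine ⟨fun i v hv => ?_, fun v hv => ?_⟩
    · rw [key]
      exact add_mem (add_mem (hx i _ (D.X_le i (hy i v hv))) (hx i v hv)) (hy i v hv)
    · rw [key]
      exact add_mem (add_mem (hx' _ (le_sup_left (a := D.Xr) (hy' v hv))) (hx' v hv)) (hy' v hv)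
  one_mem' := by simp
  inv_mem' := by
    rintro x ⟨hx, hx'⟩
    have key : ∀ v, (x⁻¹).1.val v - v = -((x⁻¹).1.val (x.1.val v - v)) := by
      intro v
      have : (x⁻¹).1.val (x.1.val v) = v := unit_inv_apply x.1 v
      rw [map_sub, this]; abel
    have stab : ∀ i : Fin (r + 1), ∀ v ∈ D.X i, (x⁻¹).1.val v ∈ D.X i := by
      intro i
      induction i using Fin.induction with
      | zero =>
        intro v hv
        rw [D.X_zero, Submodule.mem_bot] at hv
        rw [hv, map_zero]
        exact zero_mem _
      | succ i ih =>
        intro v hv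
        have h1 : (x⁻¹).1.val v = v + -((x⁻¹).1.val (x.1.val v - v)) := by
          rw [← key]; abel
        rw [h1]
        exact add_mem hv (neg_mem (D.X_le i (ih _ (hx i v hv))))
    refine ⟨fun i v hv => ?_, fun v hv => ?_⟩
    · rw [key]
      exact neg_mem (stab _ _ (hx i v hv))
    · rw [key]
      exact neg_mem (stab _ _ (hx' v hv))

/-- The parabolic subgroup `P_r` of `U(E)` preserving `X_r`. -/
def parabolic : Subgroup h.unitary where
  carrier := {x | ∀ v, x.1.val v ∈ D.Xr ↔ v ∈ D.Xr}
  mul_mem' := by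
    intro x y hx hy v
    exact (hx (y.1.val v)).trans (hy v)
  one_mem' := by simp
  inv_mem' := by
    intro x hx v
    have h1 := hx ((x⁻¹).1.val v)
    have h2 : x.1.val ((x⁻¹).1.val v) = v := unit_apply_inv x.1 v
    rw [h2] at h1
    exact h1.symm

/-- The Borel subgroup `B_r` of `GL_r = GL(X_r)`. Here `GL_r` is the subgroup of `U(E)` of all
elements that preserve `X_r` and `Y` and fix `E₀'` pointwise, and `B_r` is the stabilizer of the
flag in it. -/
def borelGroup : Subgroup h.unitary where
  carrier := {x | (∀ i v, x.1.val v ∈ D.X i ↔ v ∈ D.X i) ∧ (∀ v, x.1.val v ∈ D.Y ↔ v ∈ D.Y) ∧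
    ∀ v ∈ D.E₀', x.1.val v = v}
  mul_mem' := by
    rintro x y ⟨hx, hx1, hx2⟩ ⟨hy, hy1, hy2⟩
    refine ⟨fun i v => (hx i (y.1.val v)).trans (hy i v),
      fun v => (hx1 (y.1.val v)).trans (hy1 v), fun v hv => ?_⟩
    have : (x * y).1.val v = x.1.val (y.1.val v) := rfl
    rw [this, hy2 v hv, hx2 v hv]
  one_mem' := by simp
  inv_mem' := by
    rintro x ⟨hx, hx1, hx2⟩
    have e : ∀ v, x.1.val ((x⁻¹).1.val v) = v := unit_apply_inv x.1
    refine ⟨fun i v => ?_, fun v => ?_, fun v hv => ?_⟩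
    · have h1 := hx i ((x⁻¹).1.val v)
      rw [e] at h1
      exact h1.symm
    · have h1 := hx1 ((x⁻¹).1.val v)
      rw [e] at h1
      exact h1.symm
    · have h1 : (x⁻¹).1.val (x.1.val v) = v := unit_inv_apply x.1 v
      rw [hx2 v hv] at h1
      exact h1

theorem borelGroup_le_parabolic : D.borelGroup ≤ D.parabolic :=
  fun _ hx => hx.1 (Fin.last r)

variable [IsScalarTower ℝ (Scalar L k) E]

/-- The Lie algebra of `P_r`. -/
def lieParabolic : Submodule ℝ (E →L[ℝ] E) where
  carrier := {A | A ∈ h.lieUnitary ∧ ∀ v ∈ D.Xr, A v ∈ D.Xr}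
  add_mem' := by
    rintro A C ⟨hA, hA'⟩ ⟨hC, hC'⟩
    exact ⟨add_mem hA hC, fun v hv => add_mem (hA' v hv) (hC' v hv)⟩
  zero_mem' := ⟨zero_mem _, fun v _ => by simp⟩
  smul_mem' := by
    rintro c A ⟨hA, hA'⟩
    exact ⟨Submodule.smul_mem _ c hA, fun v hv => Submodule.smul_of_tower_mem _ c (hA' v hv)⟩

/-- The Lie algebra of `B_r`. -/
def lieBorel : Submodule ℝ (E →L[ℝ] E) where
  carrier := {A | A ∈ h.lieUnitary ∧ (∀ i, ∀ v ∈ D.X i, A v ∈ D.X i) ∧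
    (∀ v ∈ D.Y, A v ∈ D.Y) ∧ ∀ v ∈ D.E₀', A v = 0}
  add_mem' := by
    rintro A C ⟨hA, hA1, hA2, hA3⟩ ⟨hC, hC1, hC2, hC3⟩
    refine ⟨add_mem hA hC, fun i v hv => add_mem (hA1 i v hv) (hC1 i v hv),
      fun v hv => add_mem (hA2 v hv) (hC2 v hv), fun v hv => ?_⟩
    rw [add_apply, hA3 v hv, hC3 v hv, add_zero]
  zero_mem' := ⟨zero_mem _, fun i v _ => by simp, fun v _ => by simp, fun v _ => by simp⟩
  smul_mem' := by
    rintro c A ⟨hA, hA1, hA2, hA3⟩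
    refine ⟨Submodule.smul_mem _ c hA, fun i v hv => Submodule.smul_of_tower_mem _ c (hA1 i v hv),
      fun v hv => Submodule.smul_of_tower_mem _ c (hA2 v hv), fun v hv => ?_⟩
    rw [smul_apply, hA3 v hv, smul_zero]

theorem conjEnd_mem_lieParabolic (x : D.parabolic) :
    ∀ A ∈ D.lieParabolic, conjEnd x.1.1 A ∈ D.lieParabolic := by
  rintro A ⟨hA, hA'⟩
  exact ⟨conjEnd_mem_lieUnitary h x.1 hA,
    fun v hv => (x.2 _).2 (hA' _ (((x⁻¹).2 v).2 hv))⟩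

theorem conjEnd_mem_lieBorel (x : D.borelGroup) :
    ∀ A ∈ D.lieBorel, conjEnd x.1.1 A ∈ D.lieBorel := by
  rintro A ⟨hA, hA1, hA2, hA3⟩
  refine ⟨conjEnd_mem_lieUnitary h x.1 hA,
    fun i v hv => (x.2.1 i _).2 (hA1 i _ (((x⁻¹).2.1 i v).2 hv)),
    fun v hv => (x.2.2.1 _).2 (hA2 _ (((x⁻¹).2.2.1 v).2 hv)), fun v hv => ?_⟩
  have h1 : (x.1.1)⁻¹.val v = v := (x⁻¹).2.2.2 v hv
  rw [conjEnd_apply, h1, hA3 v hv, map_zero]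

/-- The modular character `δ_{P_r}(x) = |det Ad_x|`, with `Ad` on the Lie algebra of `P_r`. -/
noncomputable def deltaP (x : D.parabolic) : ℝ :=
  |LinearMap.det ((conjEnd x.1.1).restrict (D.conjEnd_mem_lieParabolic x))|

/-- The modular character `δ_{B_r}(x) = |det Ad_x|`, with `Ad` on the Lie algebra of `B_r`. -/
noncomputable def deltaB (x : D.borelGroup) : ℝ :=
  |LinearMap.det ((conjEnd x.1.1).restrict (D.conjEnd_mem_lieBorel x))|

end BesselData

end BesselGroups

section Jacobian

variable {L : Type*} [RCLike L] {k : ScalarKind} {E : Type*} [NormedAddCommGroup E]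
  [NormedSpace ℝ E] [Module (Scalar L k) E]

/-- For a submodule `F` of `E` on which the hermitian form is non-degenerate and `ε = ± 1`, the
`ε`-eigenspace of the map `θ_F` of `F` with `[u, v] = ⟨u, θ_F v⟩` for `u, v ∈ F`. -/
def thetaEigen (h : HermitianForm L k E) (B : PositiveForm L k E) (F : Submodule (Scalar L k) E)
    (ε : ℝ) : Set E :=
  {v | v ∈ F ∧ ∀ x ∈ F, B.form x v = ε • h.form x v}

/-- The manifold `S_F` of all `w = u + v` with `u ∈ F₊`, `v ∈ F₋`, `[u, u] = [v, v] = 1` and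
`[u, v] = 0`; the point `w` is recorded as the pair `(u, v)` of its components. -/
def sphereF (h : HermitianForm L k E) (B : PositiveForm L k E) (F : Submodule (Scalar L k) E) :
    Set (E × E) :=
  {w | w.1 ∈ thetaEigen h B F 1 ∧ w.2 ∈ thetaEigen h B F (-1) ∧
    B.form w.1 w.1 = 1 ∧ B.form w.2 w.2 = 1 ∧ B.form w.1 w.2 = 0}

/-- The map `η_F(u + v, t) = (t - t^{-τ})/2 u + (t + t^{-τ})/2 v`. -/
noncomputable def etaF (w : E × E) (t : PosScalar k) : E :=
  (2⁻¹ : ℝ) • ((posCoe L t - posInvTau L t) • w.1 + (posCoe L t + posInvTau L t) • w.2)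

/-- The tangent space of `S_F` at `w = (u, v)`: all `(x, y)` in `F₊ × F₋` that satisfy the
linearizations of the three equations which define `S_F`. -/
def tangentF (h : HermitianForm L k E) (B : PositiveForm L k E) (F : Submodule (Scalar L k) E)
    [IsScalarTower ℝ (Scalar L k) E] (w : E × E) : Submodule ℝ (E × E) where
  carrier := {z | z.1 ∈ thetaEigen h B F 1 ∧ z.2 ∈ thetaEigen h B F (-1) ∧
    B.form z.1 w.1 + B.form w.1 z.1 = 0 ∧ B.form z.2 w.2 + B.form w.2 z.2 = 0 ∧
    B.form z.1 w.2 + B.form w.1 z.2 = 0}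
  add_mem' := by
    rintro a b ⟨⟨ha, ha'⟩, ⟨ha1, ha1'⟩, ha2, ha3, ha4⟩ ⟨⟨hb, hb'⟩, ⟨hb1, hb1'⟩, hb2, hb3, hb4⟩
    refine ⟨⟨add_mem ha hb, fun x hx => ?_⟩, ⟨add_mem ha1 hb1, fun x hx => ?_⟩, ?_, ?_, ?_⟩
    · simp only [Prod.fst_add, map_add, ha' x hx, hb' x hx, smul_add]
    · simp only [Prod.snd_add, map_add, ha1' x hx, hb1' x hx, smul_add]
    · simp only [Prod.fst_add, map_add, LinearMap.add_apply]
      rw [add_add_add_comm, ha2, hb2, add_zero]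
    · simp only [Prod.snd_add, map_add, LinearMap.add_apply]
      rw [add_add_add_comm, ha3, hb3, add_zero]
    · simp only [Prod.fst_add, Prod.snd_add, map_add, LinearMap.add_apply]
      rw [add_add_add_comm, ha4, hb4, add_zero]
  zero_mem' := by
    refine ⟨⟨zero_mem _, fun x _ => ?_⟩, ⟨zero_mem _, fun x _ => ?_⟩, ?_, ?_, ?_⟩ <;> simp
  smul_mem' := by
    rintro c a ⟨⟨ha, ha'⟩, ⟨ha1, ha1'⟩, ha2, ha3, ha4⟩
    refine ⟨⟨Submodule.smul_of_tower_mem _ c ha, fun x hx => ?_⟩,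
      ⟨Submodule.smul_of_tower_mem _ c ha1, fun x hx => ?_⟩, ?_, ?_, ?_⟩
    · simp only [Prod.smul_fst, map_smul, ha' x hx]
      rw [smul_comm]
    · simp only [Prod.smul_snd, map_smul, ha1' x hx]
      rw [smul_comm]
    · simp only [Prod.smul_fst, map_smul, LinearMap.smul_apply]
      rw [← smul_add, ha2, smul_zero]
    · simp only [Prod.smul_snd, map_smul, LinearMap.smul_apply]
      rw [← smul_add, ha3, smul_zero]
    · simp only [Prod.smul_fst, Prod.smul_snd, map_smul, LinearMap.smul_apply]
      rw [← smul_add, ha4, smul_zero]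

/-- The derivative of `η_F` at `(w, t)` in the direction of `((x, y), t ξ)`. -/
noncomputable def etaDeriv (L : Type*) [RCLike L] {k : ScalarKind} {E : Type*}
    [NormedAddCommGroup E] [NormedSpace ℝ E] [Module (Scalar L k) E] (w : E × E) (t : PosScalar k)
    (z : (E × E) × (Fin k.card → ℝ)) : E :=
  deriv (fun s : ℝ => etaF (L := L) (w + s • z.1) (posFlow t (s • z.2))) 0

/-- The tangent space of `S_F × 𝕂₊ˣ` at `(w, t)`, where a tangent vector `t ξ` of `𝕂₊ˣ` at `t` is
recorded as `ξ`. -/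
abbrev TangentSK (h : HermitianForm L k E) (B : PositiveForm L k E)
    (F : Submodule (Scalar L k) E) [IsScalarTower ℝ (Scalar L k) E] (w : E × E) : Type _ :=
  tangentF h B F w × (Fin k.card → ℝ)

/-- The Riemannian metric of `S_F × 𝕂₊ˣ`: on `S_F` it is the normalized trace of `[ , ]`, and
`t d/dt` has length one on each factor of `𝕂₊ˣ`. -/
noncomputable def metricSK (h : HermitianForm L k E) (B : PositiveForm L k E)
    (F : Submodule (Scalar L k) E) [IsScalarTower ℝ (Scalar L k) E] (w : E × E)
    (a b : TangentSK h B F w) : ℝ :=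
  normTrace (B.form (a.1.1.1 + a.1.1.2) (b.1.1.1 + b.1.1.2)) + ∑ i, a.2 i * b.2 i

theorem finite_tangentSK (h : HermitianForm L k E) (B : PositiveForm L k E)
    (F : Submodule (Scalar L k) E) [IsScalarTower ℝ (Scalar L k) E] [Module.Finite (Scalar L k) E]
    (w : E × E) : Module.Finite ℝ (TangentSK h B F w) := by
  have : Module.Finite ℝ E := Module.Finite.trans (Scalar L k) E
  infer_instance

/-- The Jacobian `J_{η_F}(w, t)` of `η_F`, with respect to the Riemannian metric of `S_F × 𝕂₊ˣ` and
the pseudo-Riemannian metric of `{u ∈ F | ⟨u, u⟩ = -1}` (the normalized trace of `⟨ , ⟩`), computed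
from Gram determinants in a basis of the tangent space. -/
noncomputable def jacobianEta (h : HermitianForm L k E) (B : PositiveForm L k E)
    (F : Submodule (Scalar L k) E) [IsScalarTower ℝ (Scalar L k) E] [Module.Finite (Scalar L k) E]
    (w : E × E) (t : PosScalar k) : ℝ :=
  haveI := finite_tangentSK h B F w
  let b := Module.finBasis ℝ (TangentSK h B F w)
  let z := fun i => (((b i).1 : E × E), (b i).2)
  √|(Matrix.of fun i j =>
      normTrace (h.form (etaDeriv L w t (z i)) (etaDeriv L w t (z j)))).det| /
    √((Matrix.of fun i j => metricSK h B F w (b i) (b j)).det)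

end Jacobian

section Quotient

/-- The space `S \ G` of cosets `S g`. -/
def LeftQuotient {G : Type*} [Group G] (S : Subgroup G) : Type _ :=
  Quotient (QuotientGroup.rightRel S)

namespace LeftQuotient

variable {G : Type*} [Group G] (S : Subgroup G)

/-- The coset `S g`. -/
def mk (g : G) : LeftQuotient S := Quotient.mk (QuotientGroup.rightRel S) g

/-- Right translation `S x ↦ S x g`. -/
def translate (g : G) : LeftQuotient S → LeftQuotient S :=
  Quotient.map (fun x => x * g) (by
    intro x y hxy
    change (QuotientGroup.rightRel S) _ _ at hxy
    change (QuotientGroup.rightRel S) _ _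
    rw [QuotientGroup.rightRel_apply] at hxy ⊢
    simpa [mul_assoc] using hxy)

/-- The quotient topology on `S \ G`. -/
instance [TopologicalSpace G] : TopologicalSpace (LeftQuotient S) :=
  inferInstanceAs (TopologicalSpace (Quotient (QuotientGroup.rightRel S)))

/-- The Borel `σ`-algebra of `S \ G`. -/
instance [TopologicalSpace G] : MeasurableSpace (LeftQuotient S) := borel _

instance [TopologicalSpace G] : BorelSpace (LeftQuotient S) := ⟨rfl⟩

end LeftQuotient

end Quotient

/-- The `σ`-algebra on the group of invertible endomorphisms, and hence on its subgroups, is the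
Borel one. -/
instance borelSpace_units {R : Type*} [NormedRing R] [CompleteSpace R] [MeasurableSpace R]
    [BorelSpace R] : BorelSpace Rˣ :=
  ⟨by
    have e := (Units.isOpenEmbedding_val (R := R)).eq_induced
    change MeasurableSpace.comap Units.val _ = _
    rw [BorelSpace.measurable_eq (α := R), ← borel_comap, ← e]⟩

namespace BesselData

variable {L : Type*} [RCLike L] {k : ScalarKind} {E : Type*} [NormedAddCommGroup E]
  [NormedSpace ℝ E] [Module (Scalar L k) E] {h : HermitianForm L k E} {r : ℕ}

/-- The element `x` is `g_t`: it is `t` on `v₀ + v₀'`, `t^{-τ}` on `v₀ - v₀'`, and the identity on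
`X_r ⊕ Y ⊕ Z₀`. -/
def IsHyperbolic (D : BesselData h r) (t : PosScalar k) (x : h.unitary) : Prop :=
  x.1.val (D.v₀ + D.v₀') = posCoe L t • (D.v₀ + D.v₀') ∧
  x.1.val (D.v₀ - D.v₀') = posInvTau L t • (D.v₀ - D.v₀') ∧
  ∀ v ∈ D.Xr ⊔ D.Y ⊔ D.Z₀, x.1.val v = v

/-- The element `x` of `B_r ⊂ GL_r` is `a_t`, for `t = (t₁, …, t_r)`: it is the scalar `t_i` on
`{v ∈ X_i | [v, X_{i-1}] = 0}`. -/
def IsTorus (D : BesselData h r) (B : PositiveForm L k E) (t : Fin r → PosScalar k)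
    (x : D.borelGroup) : Prop :=
  ∀ i : Fin r, ∀ v ∈ D.X i.succ, (∀ y ∈ D.X i.castSucc, B.form v y = 0) →
    x.1.1.val v = posCoe L (t i) • v

end BesselData

set_option linter.unusedSectionVars false
set_option autoImplicit false
set_option linter.unusedSimpArgs false

section Iwasawa

open LinearMap renaming add_apply → add_app, sub_apply → sub_app, sum_apply → sum_app
open LinearMap (BilinForm det toContinuousLinearMap ker comp_apply prodMap_apply trace id_apply
  mem_ker mulLeft det_comp mk₂ mulRight flip_apply continuous_of_finiteDimensional)
open RCLike (re mul_conj ofReal_re reCLM)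
open Real (exp exp_add log cosh exp_pos arcosh exp_zero)
open ENNReal (ofReal mul_ne_top ofReal_ne_top div_ne_top mul_top mul_lt_top)
open Submodule (smul_mem span span_induction subset_span mem_bot mem_span_singleton_self coe_smul
  mem_sup_right mem_sup_left coe_add span_mono span_union)
open Module (Basis finBasis finrank)
open Metric (closedBall)
open Function (Injective Surjective update_of_ne update_self)
open Finset (mem_univ sum_congr sum_eq_zero smul_sum sum_add_distrib univ)
open Pi (single)
open MeasurableEquiv (piCongrRight piCongrLeft symm_apply_apply)
open Fin (rev_rev revPerm)
open Set (indicator_of_mem indicator_of_notMem)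
open MeasureTheory.Measure (haar map_apply measure_pos_of_mem_nhds)
open Continuous (subtype_mk)
open Subgroup (inclusion)
open Topology (IsInducing IsClosedEmbedding)
open Units (coeHom isOpenEmbedding_val)
open FiniteDimensional (proper complete)
open LinearEquiv (refl_apply funCongrLeft)
open Filter (inter_mem)
open Prod (snd_add smul_snd)
open ContinuousLinearMap (coeLM)
open LinearMap.BilinForm (toMatrix toMatrix_apply)
open scoped ENNReal NNReal Topology

section CayleyChart

variable {R : Type*} [NormedRing R]

/-- `X` is the Cayley transform `(1 + A) (1 - A)⁻¹` of `A`. -/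
def IsCayley (X A : R) : Prop := X * (1 - A) = 1 + A

theorem IsCayley.sub_mul {X X' A A' : R} (h : IsCayley X A) (h' : IsCayley X' A') :
    (X - X') * (1 - A') = (1 + X) * (A - A') := by
  unfold IsCayley at h h'
  have e : X * (1 - A') = X * (1 - A) + X * (A - A') := by noncomm_ring
  rw [_root_.sub_mul, h', e, h]
  noncomm_ring

theorem isCayley_one_zero : IsCayley (1 : R) 0 := by simp [IsCayley]

theorem IsCayley.norm_sub_le {X X' A A' : R} (h : IsCayley X A) (h' : IsCayley X' A')
    (hA' : ‖A'‖ ≤ 1 / 2) : ‖X - X'‖ ≤ 2 * ‖1 + X‖ * ‖A - A'‖ := by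
  have e : X - X' = (X - X') * A' + (1 + X) * (A - A') := by
    rw [← h.sub_mul h']; noncomm_ring
  have h1 : ‖X - X'‖ ≤ ‖X - X'‖ * ‖A'‖ + ‖1 + X‖ * ‖A - A'‖ := by
    calc ‖X - X'‖ = ‖(X - X') * A' + (1 + X) * (A - A')‖ := by rw [← e]
      _ ≤ _ := (norm_add_le _ _).trans (add_le_add (norm_mul_le _ _) (norm_mul_le _ _))
  nlinarith [norm_nonneg (X - X'), norm_nonneg A']

theorem IsCayley.norm_sub_le' [NormedAlgebra ℝ R] {X X' A A' : R} (h : IsCayley X A) (h' : IsCayley X' A')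
    (hA' : ‖A'‖ ≤ 1) (hX : ‖X - 1‖ ≤ 1) : ‖A - A'‖ ≤ 2 * ‖X - X'‖ := by
  have e : (2 : ℝ) • (A - A') = (X - X') - (X - X') * A' - (X - 1) * (A - A') := by
    have := h.sub_mul h'
    rw [two_smul]
    have e2 : (X - X') - (X - X') * A' = (X - X') * (1 - A') := by noncomm_ring
    rw [e2, this]; noncomm_ring
  have h1 : 2 * ‖A - A'‖ ≤ ‖X - X'‖ + ‖X - X'‖ * ‖A'‖ + ‖X - 1‖ * ‖A - A'‖ := by
    calc 2 * ‖A - A'‖ = ‖(2 : ℝ) • (A - A')‖ := by rw [norm_smul]; simp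
      _ = ‖(X - X') - (X - X') * A' - (X - 1) * (A - A')‖ := by rw [e]
      _ ≤ _ := (_root_.norm_sub_le _ _).trans (add_le_add ((_root_.norm_sub_le _ _).trans
          (add_le_add le_rfl (norm_mul_le _ _))) (norm_mul_le _ _))
  nlinarith [norm_nonneg (X - X'), norm_nonneg A', norm_nonneg (A - A')]

theorem IsCayley.norm_sub_one_le {X A : R} [NormedAlgebra ℝ R] (h : IsCayley X A) (hA : ‖A‖ ≤ 1 / 2) :
    ‖X - 1‖ ≤ 4 * ‖A‖ := by
  have e : X - 1 = (2 : ℝ) • A + (X - 1) * A := by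
    unfold IsCayley at h
    have : X = 1 + A + X * A := by rw [← h]; noncomm_ring
    rw [two_smul, _root_.sub_mul, one_mul]
    grind
  have h1 : ‖X - 1‖ ≤ 2 * ‖A‖ + ‖X - 1‖ * ‖A‖ := by
    calc ‖X - 1‖ = ‖(2 : ℝ) • A + (X - 1) * A‖ := by rw [← e]
      _ ≤ ‖(2 : ℝ) • A‖ + ‖X - 1‖ * ‖A‖ :=
        (norm_add_le _ _).trans (add_le_add le_rfl (norm_mul_le _ _))
      _ = _ := by rw [norm_smul]; simp
  nlinarith [norm_nonneg (X - 1), norm_nonneg A]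

theorem IsCayley.norm_le {X A : R} [NormedAlgebra ℝ R] (h : IsCayley X A) (hA : ‖X - 1‖ ≤ 1) :
    ‖A‖ ≤ 2 * ‖X - 1‖ := by
  have := h.norm_sub_le' isCayley_one_zero (by simp) hA
  simpa using this

variable [NormedAlgebra ℝ R] [FiniteDimensional ℝ R]

theorem IsCayley.unique {X X' A : R} (h : IsCayley X A) (h' : IsCayley X' A) (hA : ‖A‖ ≤ 1 / 2) :
    X = X' := by
  have := h.norm_sub_le h' hA
  simp only [sub_self, norm_zero, mul_zero] at this
  exact sub_eq_zero.1 (norm_le_zero_iff.1 this)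

theorem isCayley_ringInverse {A : R} (hA : ‖A‖ < 1) : IsCayley ((1 + A) * Ring.inverse (1 - A)) A := by
  have : CompleteSpace R := complete ℝ R
  unfold IsCayley
  rw [mul_assoc, Ring.inverse_mul_cancel (1 - A) (Units.oneSub A hA).isUnit, mul_one]

theorem exists_isCayley {X : R} (hX : ‖X - 1‖ < 1) : ∃ A, IsCayley X A := by
  have : CompleteSpace R := complete ℝ R
  have h1 : ‖(2⁻¹ : ℝ) • (1 - X)‖ < 1 := by
    rw [norm_smul, norm_sub_rev]; norm_num; linarith
  obtain ⟨u, hu⟩ := (Units.oneSub _ h1).isUnit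
  have hu2 : (u : R) = (2⁻¹ : ℝ) • (1 + X) := by
    rw [hu, Units.val_oneSub]
    module
  refine ⟨(2⁻¹ : ℝ) • (↑u⁻¹ * (X - 1)), ?_⟩
  unfold IsCayley
  have hc : X * ↑u⁻¹ = ↑u⁻¹ * X := by
    have : (u : R) * X = X * u := by rw [hu2]; simp only [smul_mul_assoc, mul_smul_comm]; congr 1; noncomm_ring
    calc X * ↑u⁻¹ = ↑u⁻¹ * (u * X) * ↑u⁻¹ := by rw [← mul_assoc, Units.inv_mul, one_mul]
      _ = ↑u⁻¹ * X := by rw [this, ← mul_assoc, mul_assoc, Units.mul_inv, mul_one]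
  have h2 : X + 1 = (2 : ℝ) • (u : R) := by rw [hu2, smul_smul]; norm_num; abel
  have key : (X + 1) * ((2⁻¹ : ℝ) • (↑u⁻¹ * (X - 1))) = X - 1 := by simp [h2]
  grind [add_mul, one_mul, mul_sub, mul_one, eq_sub_of_add_eq]

/-- If `X` and `A` are related by the Cayley transform in a matrix group `H` with Lie algebra `𝔥`,
the Hausdorff measures of corresponding small sets are comparable. -/
structure IsCayleyChart {H : Type*} [Group H] (ρ : H →* R) (𝔥 : Submodule ℝ R) : Prop where
  exists_of_mem : ∀ A ∈ 𝔥, ‖A‖ < 1 → ∃ x : H, IsCayley (ρ x) A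
  mem_of_isCayley : ∀ (x : H) (A : R), ‖ρ x - 1‖ < 1 → IsCayley (ρ x) A → A ∈ 𝔥

variable [MeasurableSpace R] [BorelSpace R] {H : Type*} [Group H] {ρ : H →* R} {𝔥 : Submodule ℝ R}

/-- The set of all group elements whose Cayley parameter lies in `S`. -/
def cayleySet (ρ : H →* R) (S : Set 𝔥) : Set H := {x | ∃ A ∈ S, IsCayley (ρ x) (A : R)}

theorem IsCayleyChart.exists_lipschitz (hc : IsCayleyChart ρ 𝔥) :
    ∃ (L : ℝ≥0) (f : 𝔥 → R), LipschitzOnWith L f (closedBall 0 (1 / 4)) ∧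
      ∀ S ⊆ closedBall (0 : 𝔥) (1 / 4), ρ '' cayleySet ρ S = f '' S := by
  classical
  have h0 : ∀ A : 𝔥, A ∈ closedBall (0 : 𝔥) (1 / 4) → ‖(A : R)‖ ≤ 1 / 4 := by
    intro A hA; simpa using hA
  have : ∀ A : 𝔥, ∃ X : R, A ∈ closedBall (0 : 𝔥) (1 / 4) → IsCayley X (A : R) ∧ ∃ x, ρ x = X := by
    intro A
    by_cases hA : A ∈ closedBall (0 : 𝔥) (1 / 4)
    · obtain ⟨x, hx⟩ := hc.exists_of_mem A A.2 (by linarith [h0 A hA])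
      grind
    · exact ⟨0, fun h => absurd h hA⟩
  choose f hf using this
  refine ⟨⟨2 * (2 * ‖(1 : R)‖ + 1), by positivity⟩, f, ?_, ?_⟩
  · refine LipschitzOnWith.of_dist_le_mul fun A hA A' hA' => ?_
    rw [dist_eq_norm, dist_eq_norm]
    have h1 := (hf A hA).1.norm_sub_le (hf A' hA').1 (by linarith [h0 A' hA'])
    have h2 : ‖1 + f A‖ ≤ 2 * ‖(1 : R)‖ + 1 := by
      have h3 := (hf A hA).1.norm_sub_one_le (by linarith [h0 A hA])
      calc ‖1 + f A‖ = ‖1 + 1 + (f A - 1)‖ := by congr 1; abel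
        _ ≤ ‖(1 : R)‖ + ‖(1 : R)‖ + ‖f A - 1‖ := (norm_add_le _ _).trans (by gcongr; exact norm_add_le _ _)
        _ ≤ _ := by linarith [h0 A hA]
    calc _ ≤ _ := h1
      _ ≤ 2 * (2 * ‖(1 : R)‖ + 1) * ‖(A : R) - A'‖ := by gcongr
      _ = _ := rfl
  · intro S hS
    ext X
    constructor
    · rintro ⟨x, ⟨A, hA, hx⟩, rfl⟩
      exact ⟨A, hA, (hf A (hS hA)).1.unique hx (by linarith [h0 A (hS hA)])⟩
    · rintro ⟨A, hA, rfl⟩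
      obtain ⟨x, hx⟩ := (hf A (hS hA)).2
      exact ⟨x, ⟨A, hA, hx ▸ (hf A (hS hA)).1⟩, hx⟩

theorem IsCayleyChart.hausdorffMeasure_le (hc : IsCayleyChart ρ 𝔥) (d : ℝ) (hd : 0 ≤ d) (S : Set 𝔥)
    (hS : S ⊆ closedBall (0 : 𝔥) (1 / 4)) :
    μH[d] S ≤ 2 ^ d * μH[d] (ρ '' cayleySet ρ S) := by
  classical
  have h0 : ∀ A : 𝔥, A ∈ S → ‖(A : R)‖ ≤ 1 / 4 := by
    intro A hA; simpa using hS hA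
  have : ∀ X : R, ∃ A : 𝔥, X ∈ ρ '' cayleySet ρ S → A ∈ S ∧ IsCayley X (A : R) := by
    intro X
    by_cases hX : X ∈ ρ '' cayleySet ρ S
    · obtain ⟨x, ⟨A, hA, hx⟩, rfl⟩ := hX
      grind
    grind
  choose g hg using this
  have hn : ∀ X ∈ ρ '' cayleySet ρ S, ‖X - 1‖ ≤ 1 := fun X hX => by
    have := (hg X hX).2.norm_sub_one_le (by grind)
    linarith [h0 _ (hg X hX).1]
  have hl : LipschitzOnWith 2 g (ρ '' cayleySet ρ S) := by
    refine LipschitzOnWith.of_dist_le_mul fun X hX X' hX' => ?_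
    rw [dist_eq_norm, dist_eq_norm]
    exact (hg X hX).2.norm_sub_le' (hg X' hX').2 (by linarith [h0 _ (hg X' hX').1]) (hn X hX)
  have hsub : S ⊆ g '' (ρ '' cayleySet ρ S) := by
    intro A hA
    obtain ⟨x, hx⟩ := hc.exists_of_mem A A.2 (by linarith [h0 A hA])
    have hX : ρ x ∈ ρ '' cayleySet ρ S := ⟨x, ⟨A, hA, hx⟩, rfl⟩
    refine ⟨ρ x, hX, ?_⟩
    have := (hg _ hX).2.norm_sub_le' hx (by linarith [h0 A hA]) (hn _ hX)
    rw [sub_self, norm_zero, mul_zero] at this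
    exact Subtype.ext (sub_eq_zero.1 (norm_le_zero_iff.1 this))
  calc μH[d] S ≤ μH[d] (g '' (ρ '' cayleySet ρ S)) := measure_mono hsub
    _ ≤ _ := by simpa using hl.hausdorffMeasure_image_le hd

end CayleyChart

section HaarComparison

open scoped ENNReal NNReal Topology Pointwise
open Module

variable {R : Type*} [NormedRing R] [NormedAlgebra ℝ R] [FiniteDimensional ℝ R]
  [MeasurableSpace R] [BorelSpace R] {H : Type*} [Group H] [TopologicalSpace H]
  [IsTopologicalGroup H] [T2Space H] [LocallyCompactSpace H] [SecondCountableTopology H] [MeasurableSpace H]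
  [BorelSpace H] {ρ : H →* R} {𝔥 : Submodule ℝ R}

theorem hausdorffMeasure_image_mul_le (ρ : H →* R) (d : ℝ) (hd : 0 ≤ d) (g : H) (D : Set H) :
    μH[d] (ρ '' ((fun x => x * g) '' D)) ≤ (‖ρ g‖₊ : ℝ≥0∞) ^ d * μH[d] (ρ '' D) := by
  have h1 : LipschitzWith ‖ρ g‖₊ (fun X : R => X * ρ g) := by
    refine LipschitzWith.of_dist_le_mul fun X Y => ?_
    rw [dist_eq_norm, dist_eq_norm, ← sub_mul, mul_comm]
    exact norm_mul_le _ _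
  have h2 : ρ '' ((fun x => x * g) '' D) = (fun X : R => X * ρ g) '' (ρ '' D) := by grind
  rw [h2]
  exact h1.hausdorffMeasure_image_le hd _

theorem exists_norm_nhds (hρ : IsInducing ρ) {U : Set H} (hU : U ∈ 𝓝 (1 : H)) :
    ∃ ε > 0, {x : H | ‖ρ x - 1‖ < ε} ⊆ U := by
  rw [hρ.nhds_eq_comap, map_one] at hU
  obtain ⟨ε, hε, h⟩ := (Metric.nhds_basis_ball.comap ρ).mem_iff.1 hU
  refine ⟨ε, hε, fun x hx => h ?_⟩
  simpa [dist_eq_norm] using hx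

theorem isOpen_norm_ball (hρ : IsInducing ρ) (ε : ℝ) : IsOpen {x : H | ‖ρ x - 1‖ < ε} :=
  isOpen_lt ((hρ.continuous.sub continuous_const).norm) continuous_const

theorem norm_ball_mem_nhds (hρ : IsInducing ρ) {ε : ℝ} (hε : 0 < ε) :
    {x : H | ‖ρ x - 1‖ < ε} ∈ 𝓝 (1 : H) :=
  (isOpen_norm_ball hρ ε).mem_nhds (by simpa using hε)

/-- The Haar measure of a matrix group is comparable near the identity with the Hausdorff measure
of the dimension of its Lie algebra. -/
theorem IsCayleyChart.haar_comparable (hc : IsCayleyChart ρ 𝔥) (hρ : IsInducing ρ)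
    (hme : MeasurableEmbedding ρ) (μ : Measure H) [μ.IsHaarMeasure] :
    ∃ ε > 0, ∃ c : ℝ≥0∞, c ≠ ∞ ∧ ∀ D : Set H, MeasurableSet D → D ⊆ {x | ‖ρ x - 1‖ < ε} →
      μ D ≤ c * μH[finrank ℝ 𝔥] (ρ '' D) ∧ μH[finrank ℝ 𝔥] (ρ '' D) ≤ c * μ D := by
  set d : ℝ := ((finrank ℝ 𝔥 : ℕ) : ℝ) with hd
  have hd0 : 0 ≤ d := by positivity
  obtain ⟨U, hU, hUc⟩ : ∃ U ∈ 𝓝 (1 : H), IsCompact U := by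
    obtain ⟨U, hUc, hU⟩ := exists_compact_mem_nhds (1 : H); exact ⟨U, hU, hUc⟩
  obtain ⟨C, hC⟩ : ∃ C : ℝ≥0, ∀ g ∈ U, ‖ρ g‖₊ ≤ C ∧ ‖ρ g⁻¹‖₊ ≤ C := by
    obtain ⟨c1, h1⟩ := (hUc.image (hρ.continuous.nnnorm)).bddAbove
    obtain ⟨c2, h2⟩ := (hUc.image ((hρ.continuous.comp continuous_inv).nnnorm)).bddAbove
    exact ⟨max c1 c2, fun g hg => ⟨le_max_of_le_left (h1 ⟨g, hg, rfl⟩),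
      le_max_of_le_right (h2 ⟨g, hg, rfl⟩)⟩⟩
  have hmul : ∀ W ∈ 𝓝 (1 : H), ∃ ε > 0, ∀ x y : H, ‖ρ x - 1‖ < ε → ‖ρ y - 1‖ < ε →
      x⁻¹ * y ∈ W ∧ x * y⁻¹ ∈ W ∧ y ∈ W := by
    intro W hW
    have t1 : Filter.Tendsto (fun p : H × H => p.1⁻¹ * p.2) (𝓝 (1, 1)) (𝓝 1) := by
      have : Continuous fun p : H × H => p.1⁻¹ * p.2 := by fun_prop
      simpa using this.tendsto (1, 1)
    have t2 : Filter.Tendsto (fun p : H × H => p.1 * p.2⁻¹) (𝓝 (1, 1)) (𝓝 1) := by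
      have : Continuous fun p : H × H => p.1 * p.2⁻¹ := by fun_prop
      simpa using this.tendsto (1, 1)
    have := inter_mem (Filter.mem_map.1 (t1 hW)) (Filter.mem_map.1 (t2 hW))
    rw [nhds_prod_eq, Filter.mem_prod_iff] at this
    obtain ⟨A, hA, B, hB, hAB⟩ := this
    obtain ⟨ε, hε, h⟩ := exists_norm_nhds hρ (inter_mem (inter_mem hA hB) hW)
    refine ⟨ε, hε, fun x y hx hy => ?_⟩
    have h3 : (x, y) ∈ A ×ˢ B := ⟨(h hx).1.1, (h hy).1.2⟩
    exact ⟨(hAB h3).1, (hAB h3).2, (h hy).2⟩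
  obtain ⟨ε₀, hε₀, hN⟩ := hmul U hU
  set ε₁ := min ε₀ (1 / 8) with hε₁
  have hε₁0 : 0 < ε₁ := by positivity
  set N : Set H := {x | ‖ρ x - 1‖ < ε₁} with hNdef
  obtain ⟨ε₂, hε₂, hN2⟩ := hmul N (norm_ball_mem_nhds hρ hε₁0)
  set N₂ : Set H := {x | ‖ρ x - 1‖ < ε₂} with hN2def
  have hNm : MeasurableSet N := (isOpen_norm_ball hρ _).measurableSet
  have hN2m : MeasurableSet N₂ := (isOpen_norm_ball hρ _).measurableSet
  set lam : Measure H := Measure.comap ρ μH[d] with hlam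
  have hlamD : ∀ D, lam D = μH[d] (ρ '' D) := fun D => hme.comap_apply _ _
  -- finiteness and positivity of `lam N`
  obtain ⟨L, f, hf, hfS⟩ := hc.exists_lipschitz
  have hNfin : lam N ≠ ∞ := by
    have hsub : N ⊆ cayleySet ρ (closedBall (0 : 𝔥) (1 / 4)) := by
      intro x hx
      have hx' : ‖ρ x - 1‖ < 1 / 8 := lt_of_lt_of_le hx (min_le_right _ _)
      obtain ⟨A, hA⟩ := exists_isCayley (by linarith : ‖ρ x - 1‖ < 1)
      refine ⟨⟨A, hc.mem_of_isCayley x A (by linarith) hA⟩, ?_, hA⟩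
      have := hA.norm_le (by linarith)
      simp only [Metric.mem_closedBall, dist_zero_right, Submodule.coe_norm]
      linarith
    refine ne_top_of_le_ne_top ?_ (measure_mono hsub)
    rw [hlamD, hfS _ subset_rfl]
    refine ne_top_of_le_ne_top ?_ (hf.hausdorffMeasure_image_le hd0)
    refine mul_ne_top (ENNReal.rpow_ne_top_of_nonneg hd0 ENNReal.coe_ne_top) ?_
    exact (isCompact_closedBall (0 : 𝔥) _).measure_lt_top.ne
  have hNpos : lam N ≠ 0 := by
    set δ := min (1 / 4) (ε₁ / 8) with hδ
    have hδ0 : 0 < δ := by positivity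
    have hsub : cayleySet ρ (closedBall (0 : 𝔥) δ) ⊆ N := by
      rintro x ⟨A, hA, hx⟩
      have hA' : ‖(A : R)‖ ≤ δ := by simpa using hA
      have h1 := hx.norm_sub_one_le (by linarith [min_le_left (1 / 4) (ε₁ / 8)])
      have : δ ≤ ε₁ / 8 := min_le_right _ _
      simp only [hNdef, Set.mem_ofPred_eq]
      linarith
    intro h0
    have h1 := measure_mono_null hsub h0
    rw [hlamD] at h1
    have h2 := hc.hausdorffMeasure_le d hd0 (closedBall (0 : 𝔥) δ)
      (Metric.closedBall_subset_closedBall (min_le_left _ _))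
    rw [h1, mul_zero, nonpos_iff_eq_zero] at h2
    exact (Metric.measure_closedBall_pos μH[finrank ℝ 𝔥] (0 : 𝔥) hδ0).ne' h2
  -- right translates
  have htr : ∀ (g : H) (D : Set H), lam {y | y * g ∈ D} ≤ (‖ρ g⁻¹‖₊ : ℝ≥0∞) ^ d * lam D := by
    intro g D
    have : {y | y * g ∈ D} = (fun x => x * g⁻¹) '' D := by
      ext y; constructor
      all_goals simp
    rw [this, hlamD, hlamD]
    exact hausdorffMeasure_image_mul_le ρ d hd0 _ _
  have htr' : ∀ (g : H) (D : Set H), lam D ≤ (‖ρ g‖₊ : ℝ≥0∞) ^ d * lam {y | y * g ∈ D} := by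
    intro g D
    have : D = (fun x => x * g) '' {y | y * g ∈ D} := by
      ext y; constructor
      · intro hy; exact ⟨y * g⁻¹, by simpa using hy, by simp⟩
      · rintro ⟨z, hz, rfl⟩; simpa using hz
    nth_rewrite 1 [this]
    rw [hlamD, hlamD]
    exact hausdorffMeasure_image_mul_le ρ d hd0 _ _
  have hlamfin : IsFiniteMeasure (lam.restrict N) := ⟨by rw [Measure.restrict_apply_univ]; exact hNfin.lt_top⟩
  -- Tonelli
  have key : ∀ D : Set H, MeasurableSet D → D ⊆ {x | ‖ρ x - 1‖ < min ε₁ ε₂} →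
      ∫⁻ g in U, lam.restrict N {y | y * g ∈ D} ∂μ = lam N * μ D := by
    intro D hD hDs
    have hm : MeasurableSet {p : H × H | p.2 * p.1 ∈ D} := by
      have : Measurable fun p : H × H => p.2 * p.1 := measurable_snd.mul measurable_fst
      exact this hD
    calc ∫⁻ g in U, lam.restrict N {y | y * g ∈ D} ∂μ
        = ((μ.restrict U).prod (lam.restrict N)) {p : H × H | p.2 * p.1 ∈ D} :=
          (Measure.prod_apply hm).symm
      _ = ∫⁻ y in N, μ.restrict U {g | y * g ∈ D} ∂lam := Measure.prod_apply_symm hm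
      _ = ∫⁻ y in N, μ D ∂lam := by
          refine setLIntegral_congr_fun hNm fun y hy => ?_
          have hDm : MeasurableSet {g | y * g ∈ D} := (measurable_const_mul y) hD
          rw [Measure.restrict_apply hDm]
          have : {g | y * g ∈ D} ∩ U = {g | y * g ∈ D} := by
            refine Set.inter_eq_left.2 fun g hg => ?_
            have h1 : ‖ρ y - 1‖ < ε₀ := lt_of_lt_of_le hy (min_le_left _ _)
            have h2 : ‖ρ (y * g) - 1‖ < ε₀ := lt_of_lt_of_le (hDs hg)
              ((min_le_left _ _).trans (min_le_left _ _))
            have := (hN y (y * g) h1 h2).1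
            simpa using this
          rw [this]
          exact measure_preimage_mul μ y D
      _ = lam N * μ D := by rw [setLIntegral_const, mul_comm]
  have hUfin : μ U ≠ ∞ := hUc.measure_lt_top.ne
  have hN2pos : μ (N₂ ∩ U) ≠ 0 := by
    have : N₂ ∩ U ∈ 𝓝 (1 : H) := inter_mem (norm_ball_mem_nhds hρ hε₂) hU
    exact (measure_pos_of_mem_nhds μ this).ne'
  have hCd : (C : ℝ≥0∞) ^ d ≠ ∞ := ENNReal.rpow_ne_top_of_nonneg hd0 ENNReal.coe_ne_top
  refine ⟨min ε₁ ε₂, by positivity, max ((lam N)⁻¹ * (μ U * C ^ d)) ((μ (N₂ ∩ U))⁻¹ * (C ^ d * lam N)), ?_,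
    fun D hD hDs => ⟨?_, ?_⟩⟩
  · refine (max_lt ?_ ?_).ne
    · exact mul_lt_top (ENNReal.inv_lt_top.2 (pos_iff_ne_zero.2 hNpos))
        (mul_lt_top hUfin.lt_top hCd.lt_top)
    · exact mul_lt_top (ENNReal.inv_lt_top.2 (pos_iff_ne_zero.2 hN2pos))
        (mul_lt_top hCd.lt_top hNfin.lt_top)
  · have h1 : lam N * μ D ≤ μ U * C ^ d * lam D := by
      rw [← key D hD hDs]
      calc ∫⁻ g in U, lam.restrict N {y | y * g ∈ D} ∂μ ≤ ∫⁻ g in U, C ^ d * lam D ∂μ := by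
            refine setLIntegral_mono' hUc.measurableSet fun g hg => ?_
            calc _ ≤ lam {y | y * g ∈ D} := Measure.restrict_apply_le _ _
              _ ≤ _ := htr g D
              _ ≤ _ := by
                gcongr
                exact (hC g hg).2
        _ = _ := by rw [setLIntegral_const]; ring
    rw [← hlamD]
    calc μ D = (lam N)⁻¹ * (lam N * μ D) := by
          rw [← mul_assoc, ENNReal.inv_mul_cancel hNpos hNfin, one_mul]
      _ ≤ (lam N)⁻¹ * (μ U * C ^ d * lam D) := by gcongr
      _ = ((lam N)⁻¹ * (μ U * C ^ d)) * lam D := by ring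
      _ ≤ _ := by gcongr; exact le_max_left _ _
  · have h1 : μ (N₂ ∩ U) * lam D ≤ C ^ d * lam N * μ D := by
      rw [mul_assoc, ← key D hD hDs]
      calc μ (N₂ ∩ U) * lam D = ∫⁻ g in N₂ ∩ U, lam D ∂μ := by rw [setLIntegral_const, mul_comm]
        _ ≤ ∫⁻ g in N₂ ∩ U, C ^ d * lam.restrict N {y | y * g ∈ D} ∂μ := by
            refine setLIntegral_mono' (hN2m.inter hUc.measurableSet) fun g hg => ?_
            have hDm : MeasurableSet {y | y * g ∈ D} := (measurable_mul_const g) hD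
            have : {y | y * g ∈ D} ∩ N = {y | y * g ∈ D} := by
              refine Set.inter_eq_left.2 fun y hy => ?_
              have h2 : ‖ρ (y * g) - 1‖ < ε₂ := lt_of_lt_of_le (hDs hy) (min_le_right _ _)
              have := (hN2 (y * g) g h2 hg.1).2.1
              simpa using this
            rw [Measure.restrict_apply hDm, this]
            refine (htr' g D).trans ?_
            gcongr
            exact (hC g hg.2).1
        _ = C ^ d * ∫⁻ g in N₂ ∩ U, lam.restrict N {y | y * g ∈ D} ∂μ :=
            lintegral_const_mul' _ _ hCd
        _ ≤ _ := by gcongr; exact Set.inter_subset_right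
    rw [← hlamD]
    calc lam D = (μ (N₂ ∩ U))⁻¹ * (μ (N₂ ∩ U) * lam D) := by
          rw [← mul_assoc, ENNReal.inv_mul_cancel hN2pos
            (ne_top_of_le_ne_top hUfin (measure_mono Set.inter_subset_right)), one_mul]
      _ ≤ (μ (N₂ ∩ U))⁻¹ * (C ^ d * lam N * μ D) := by gcongr
      _ = ((μ (N₂ ∩ U))⁻¹ * (C ^ d * lam N)) * μ D := by ring
      _ ≤ _ := by gcongr; exact le_max_right _ _

theorem pow_le_mul_pow_imp_le {a b : ℝ} (hb : 0 < b) (c : ℝ)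
    (h : ∀ m : ℕ, a ^ m ≤ c * b ^ m) : a ≤ b := by
  by_contra! hlt
  have h1 : 1 < a / b := (one_lt_div hb).2 hlt
  obtain ⟨m, hm⟩ := pow_unbounded_of_one_lt c h1
  have := h m
  rw [div_pow, lt_div_iff₀ (by positivity)] at hm
  linarith

theorem IsCayleyChart.abs_det_le (hc : IsCayleyChart ρ 𝔥) (hρ : IsInducing ρ)
    (hme : MeasurableEmbedding ρ) (μ : Measure H) [μ.IsHaarMeasure] (α : H ≃ₜ* H) (T : 𝔥 →ₗ[ℝ] 𝔥)
    (hT : ∀ (x : H) (A : 𝔥), IsCayley (ρ x) (A : R) → IsCayley (ρ (α x)) (T A : R))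
    (χ : ℝ≥0) (hχ0 : χ ≠ 0) (hχ : ∀ D, MeasurableSet D → μ (α '' D) = χ * μ D) :
    |det T| ≤ χ := by
  obtain ⟨ε, hε, c, hcf, hcD⟩ := hc.haar_comparable hρ hme μ
  obtain ⟨L, f, hf, hfS⟩ := hc.exists_lipschitz
  set d : ℝ := ((finrank ℝ 𝔥 : ℕ) : ℝ) with hd
  have hd0 : 0 ≤ d := by positivity
  set δ := min (1 / 4) (ε / 8) with hδ
  have hδ0 : 0 < δ := by positivity
  have hball : ∀ S ⊆ closedBall (0 : 𝔥) δ, S ⊆ closedBall (0 : 𝔥) (1 / 4) := fun S hS =>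
    hS.trans (Metric.closedBall_subset_closedBall (min_le_left _ _))
  have hsub : ∀ S ⊆ closedBall (0 : 𝔥) δ, cayleySet ρ S ⊆ {x | ‖ρ x - 1‖ < ε} := by
    rintro S hS x ⟨A, hA, hx⟩
    have hA' : ‖(A : R)‖ ≤ δ := by simpa using hS hA
    have h1 := hx.norm_sub_one_le (by linarith [min_le_left (1 / 4) (ε / 8)])
    have : δ ≤ ε / 8 := min_le_right _ _
    simp only [Set.mem_ofPred_eq]
    linarith
  have hmeas : ∀ S ⊆ closedBall (0 : 𝔥) δ, IsCompact S → MeasurableSet (cayleySet ρ S) := by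
    intro S hS hSc
    have h1 : IsCompact (f '' S) := hSc.image_of_continuousOn (hf.continuousOn.mono (hball S hS))
    have h2 : cayleySet ρ S = ρ ⁻¹' (f '' S) := by
      rw [← hfS S (hball S hS), Set.preimage_image_eq _ hme.injective]
    rw [h2]
    exact (h1.isClosed.preimage hρ.continuous).measurableSet
  have hLd : (L : ℝ≥0∞) ^ d ≠ ∞ := ENNReal.rpow_ne_top_of_nonneg hd0 ENNReal.coe_ne_top
  have h2d : (2 : ℝ≥0∞) ^ d ≠ ∞ := ENNReal.rpow_ne_top_of_nonneg hd0 (by simp)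
  set cc : ℝ≥0∞ := 2 ^ d * (c * (c * L ^ d)) with hcc
  have hccf : cc ≠ ∞ := mul_ne_top h2d (mul_ne_top hcf (mul_ne_top hcf hLd))
  have hiter : ∀ (m : ℕ) (x : H) (A : 𝔥), IsCayley (ρ x) (A : R) →
      IsCayley (ρ (α^[m] x)) ((T ^ m) A : R) := by
    intro m
    induction m with
    | zero => intro x A h; simpa using h
    | succ m ih =>
      tauto
  have hμiter : ∀ (m : ℕ) (D : Set H), MeasurableSet D →
      MeasurableSet (α^[m] '' D) ∧ μ (α^[m] '' D) = χ ^ m * μ D := by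
    intro m D hD
    induction m with
    | zero => simpa using hD
    | succ m ih =>
      have : α^[m + 1] '' D = α '' (α^[m] '' D) := by
        rw [Function.iterate_succ', Set.image_comp]
      rw [this, hχ _ ih.1, ih.2, pow_succ', mul_assoc]
      exact ⟨α.toHomeomorph.toMeasurableEquiv.measurableSet_image.2 ih.1, rfl⟩
  refine pow_le_mul_pow_imp_le (by positivity) cc.toReal fun m => ?_
  have hcont : Continuous (T ^ m : 𝔥 →ₗ[ℝ] 𝔥) := continuous_of_finiteDimensional _
  obtain ⟨η, hη, hηs⟩ : ∃ η > 0, (T ^ m : 𝔥 →ₗ[ℝ] 𝔥) '' closedBall 0 η ⊆ closedBall 0 δ := by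
    have := hcont.tendsto 0
    rw [map_zero] at this
    obtain ⟨η, hη, h⟩ := Metric.nhds_basis_closedBall.mem_iff.1
      (this (Metric.closedBall_mem_nhds 0 hδ0))
    exact ⟨η, hη, Set.image_subset_iff.2 h⟩
  set S := closedBall (0 : 𝔥) (min η δ) with hS
  have hS1 : S ⊆ closedBall 0 δ := Metric.closedBall_subset_closedBall (min_le_right _ _)
  have hS2 : (T ^ m : 𝔥 →ₗ[ℝ] 𝔥) '' S ⊆ closedBall 0 δ :=
    (Set.image_mono (Metric.closedBall_subset_closedBall (min_le_left _ _))).trans hηs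
  have hSc : IsCompact S := isCompact_closedBall _ _
  have hTSc : IsCompact ((T ^ m : 𝔥 →ₗ[ℝ] 𝔥) '' S) := hSc.image hcont
  have hincl : cayleySet ρ ((T ^ m : 𝔥 →ₗ[ℝ] 𝔥) '' S) ⊆ α^[m] '' cayleySet ρ S := by
    rintro x ⟨_, ⟨A, hA, rfl⟩, hx⟩
    have hA' : ‖(A : R)‖ ≤ 1 / 4 := by simpa using hball S hS1 hA
    obtain ⟨y, hy⟩ := hc.exists_of_mem A A.2 (by linarith)
    refine ⟨y, ⟨A, hA, hy⟩, hme.injective ?_⟩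
    have h3 : ‖((T ^ m) A : R)‖ ≤ 1 / 4 := by simpa using hball _ hS2 ⟨A, hA, rfl⟩
    exact (hiter m y A hy).unique hx (by linarith)
  have hv : μH[d] S ≠ 0 := (Metric.measure_closedBall_pos μH[finrank ℝ 𝔥] (0 : 𝔥) (by positivity)).ne'
  have hv' : μH[d] S ≠ ∞ := hSc.measure_lt_top.ne
  have main : ofReal |det (T ^ m)| * μH[d] S ≤ cc * χ ^ m * μH[d] S := by
    calc ofReal |det (T ^ m)| * μH[d] S = μH[d] ((T ^ m : 𝔥 →ₗ[ℝ] 𝔥) '' S) :=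
          (Measure.addHaar_image_linearMap _ _ _).symm
      _ ≤ 2 ^ d * μH[d] (ρ '' cayleySet ρ ((T ^ m : 𝔥 →ₗ[ℝ] 𝔥) '' S)) :=
          hc.hausdorffMeasure_le d hd0 _ (hball _ hS2)
      _ ≤ 2 ^ d * (c * μ (cayleySet ρ ((T ^ m : 𝔥 →ₗ[ℝ] 𝔥) '' S))) := by
          gcongr; exact (hcD _ (hmeas _ hS2 hTSc) (hsub _ hS2)).2
      _ ≤ 2 ^ d * (c * (χ ^ m * μ (cayleySet ρ S))) := by
          rw [← (hμiter m _ (hmeas S hS1 hSc)).2]; gcongr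
      _ ≤ 2 ^ d * (c * (χ ^ m * (c * μH[d] (ρ '' cayleySet ρ S)))) := by
          gcongr; exact (hcD _ (hmeas _ hS1 hSc) (hsub _ hS1)).1
      _ ≤ 2 ^ d * (c * (χ ^ m * (c * (L ^ d * μH[d] S)))) := by
          rw [hfS S (hball S hS1)]
          gcongr
          exact (hf.mono (hball S hS1)).hausdorffMeasure_image_le hd0
      _ = _ := by rw [hcc]; ring
  have main2 := (ENNReal.mul_le_mul_iff_left hv hv').1 main
  rw [map_pow, abs_pow] at main2
  have := (ENNReal.ofReal_le_iff_le_toReal (mul_ne_top hccf (by simp))).1 main2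
  simpa using this

/-- An automorphism of a matrix group that acts on Cayley parameters by a linear automorphism of
the Lie algebra multiplies the Haar measure by the absolute value of its determinant. -/
theorem IsCayleyChart.lintegral_comp_automorphism (hc : IsCayleyChart ρ 𝔥) (hρ : IsInducing ρ)
    (hme : MeasurableEmbedding ρ) (μ : Measure H) [μ.IsHaarMeasure]  [μ.Regular] (α : H ≃ₜ* H)
    (T T' : 𝔥 →ₗ[ℝ] 𝔥)
    (hT : ∀ (x : H) (A : 𝔥), IsCayley (ρ x) (A : R) → IsCayley (ρ (α x)) (T A : R))
    (hT' : ∀ (x : H) (A : 𝔥), IsCayley (ρ x) (A : R) → IsCayley (ρ (α.symm x)) (T' A : R))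
    (hTT' : T' ∘ₗ T = LinearMap.id) (f : H → ℝ≥0∞) (hf : Measurable f) :
    ofReal |det T| * ∫⁻ x, f (α x) ∂μ = ∫⁻ x, f x ∂μ := by
  have e := mulEquivHaarChar_smul_map μ α
  have hχ0 := (mulEquivHaarChar_pos α).ne'
  set χ := mulEquivHaarChar α with hχ
  have hmul : det T' * det T = 1 := by rw [← det_comp, hTT', LinearMap.det_id]
  have h1 : |det T| ≤ χ := by
    refine hc.abs_det_le hρ hme μ α T hT χ hχ0 fun D hD => ?_
    have hD' : MeasurableSet (α '' D) := α.toHomeomorph.toMeasurableEquiv.measurableSet_image.2 hD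
    have hm : Measurable α := α.continuous.measurable
    conv_lhs => rw [← e]
    rw [Measure.smul_apply, map_apply hm hD', Set.preimage_image_eq _ α.injective]
    rfl
  have h2 : |det T'| ≤ (χ⁻¹ : ℝ≥0) := by
    refine hc.abs_det_le hρ hme μ α.symm T' hT' χ⁻¹ (inv_ne_zero hχ0) fun D hD => ?_
    have hm : Measurable α := α.continuous.measurable
    have : α.symm '' D = α ⁻¹' D := by
      ext x; constructor
      · rintro ⟨y, hy, rfl⟩; simpa using hy
      · intro hx; exact ⟨α x, hx, by simp⟩
    conv_rhs => rw [← e]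
    rw [this, Measure.smul_apply, map_apply hm hD, ENNReal.smul_def, smul_eq_mul,
      ENNReal.coe_inv hχ0, ← mul_assoc, ENNReal.inv_mul_cancel (by simpa using hχ0) (by simp), one_mul]
  have hchi : (0 : ℝ) < χ := by positivity
  have h3 : (χ : ℝ) = |det T| := by
    refine le_antisymm ?_ h1
    have h4 : |det T'| * |det T| = 1 := by rw [← abs_mul, hmul, abs_one]
    rw [NNReal.coe_inv] at h2
    have h5 : 1 ≤ (χ : ℝ)⁻¹ * |det T| := by
      rw [← h4]; gcongr
    rwa [inv_mul_eq_div, one_le_div hchi] at h5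
  have hm : Measurable α := α.continuous.measurable
  rw [← h3, ENNReal.ofReal_coe_nnreal, ← lintegral_map hf hm]
  conv_rhs => rw [← e]
  rw [lintegral_smul_measure]
  rfl

end HaarComparison

section InvariantMeasures

/-- A right invariant measure is proportional to a bi-invariant one. -/
theorem lintegral_mul_lintegral_of_right_invariant {H : Type*} [Group H] [MeasurableSpace H]
    [MeasurableMul₂ H] [MeasurableInv H] (μ Λ : Measure H) [SFinite μ] [SFinite Λ]
    [μ.IsMulLeftInvariant] [μ.IsMulRightInvariant] [Λ.IsMulRightInvariant]
    (f g : H → ℝ≥0∞) (hf : Measurable f) (hg : Measurable g) :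
    (∫⁻ x, g x ∂μ) * ∫⁻ x, f x ∂Λ = (∫⁻ x, g x⁻¹ ∂Λ) * ∫⁻ x, f x ∂μ := by
  calc (∫⁻ x, g x ∂μ) * ∫⁻ x, f x ∂Λ = ∫⁻ x, ∫⁻ y, f x * g (y * x⁻¹) ∂μ ∂Λ := by
        rw [← lintegral_const_mul _ hf]
        refine lintegral_congr fun x => ?_
        rw [lintegral_const_mul _ (by fun_prop), lintegral_mul_right_eq_self (fun y => g y), mul_comm]
    _ = ∫⁻ y, ∫⁻ x, f x * g (y * x⁻¹) ∂Λ ∂μ := lintegral_lintegral_swap (by fun_prop)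
    _ = ∫⁻ y, ∫⁻ x, f (x * y) * g x⁻¹ ∂Λ ∂μ := by
        refine lintegral_congr fun y => ?_
        rw [← lintegral_mul_right_eq_self (fun x => f x * g (y * x⁻¹)) y]
        simp
    _ = ∫⁻ x, ∫⁻ y, f (x * y) * g x⁻¹ ∂μ ∂Λ := lintegral_lintegral_swap (by fun_prop)
    _ = ∫⁻ x, g x⁻¹ * ∫⁻ y, f y ∂μ ∂Λ := by
        refine lintegral_congr fun x => ?_
        rw [lintegral_mul_const _ (by fun_prop), lintegral_mul_left_eq_self (fun y => f y), mul_comm]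
    _ = _ := by rw [lintegral_mul_const _ (by fun_prop)]

variable {G : Type*} [Group G] [MeasurableSpace G] [MeasurableMul₂ G] [MeasurableInv G]

/-- The integration formula for a bi-invariant measure on a group `G = H A K` in which `A`
normalizes `H`: the measure is proportional to the image of `w(a) dx da dk`, where conjugation by
`a` multiplies the Haar measure of `H` by `w(a)⁻¹`. -/
theorem lintegral_iwasawa {H K A : Type*} [Group H] [MeasurableSpace H] [MeasurableMul₂ H]
    [MeasurableInv H] [Group K] [MeasurableSpace K] [MeasurableMul₂ K] [AddCommGroup A]
    [MeasurableSpace A] [MeasurableAdd₂ A]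
    (μ : Measure G) [SFinite μ] [μ.IsMulLeftInvariant] [μ.IsMulRightInvariant]
    (m : Measure H) [SFinite m] [m.IsMulLeftInvariant] [m.IsMulRightInvariant]
    (κ : Measure K) [IsProbabilityMeasure κ] [κ.IsMulLeftInvariant]
    (vol : Measure A) [SFinite vol] [vol.IsAddLeftInvariant]
    (ι : H →* G) (hι : Measurable ι) (j : K →* G) (hj : Measurable j)
    (a : A → G) (ha : Measurable a) (ha_add : ∀ s t, a (s + t) = a s * a t)
    (c : A → H → H) (hcm : ∀ s, Measurable (c s)) (hc : ∀ s x, ι (c s x) = a s * ι x * (a s)⁻¹)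
    (w : A → ℝ≥0∞) (hw : Measurable w) (hw0 : ∀ s, w s ≠ 0) (hw1 : ∀ s, w s ≠ ∞)
    (hw_add : ∀ s t, w (s + t) = w s * w t)
    (hcw : ∀ s (f : H → ℝ≥0∞), Measurable f → ∫⁻ x, f (c s x) ∂m = w s * ∫⁻ x, f x ∂m)
    (hG : ∀ g, ∃ x s k, g = ι x * a s * j k)
    (β : G → ℝ≥0∞) (hβ : Measurable β) (hβK : ∀ g k, β (g * j k) = β g)
    (hb0 : ∫⁻ s, w s * ∫⁻ x, β (ι x * a s)⁻¹ ∂m ∂vol ≠ 0)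
    (hb1 : ∫⁻ s, w s * ∫⁻ x, β (ι x * a s)⁻¹ ∂m ∂vol ≠ ∞)
    (hL0 : ∫⁻ s, w s * ∫⁻ x, β (ι x * a s) ∂m ∂vol ≠ 0)
    (hL1 : ∫⁻ s, w s * ∫⁻ x, β (ι x * a s) ∂m ∂vol ≠ ∞)
    (f : G → ℝ≥0∞) (hf : Measurable f) :
    (∫⁻ s, w s * ∫⁻ x, β (ι x * a s) ∂m ∂vol) * ∫⁻ g, f g ∂μ =
      (∫⁻ g, β g ∂μ) * ∫⁻ s, w s * ∫⁻ x, ∫⁻ k, f (ι x * a s * j k) ∂κ ∂m ∂vol := by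
  have ha0 : a 0 = 1 := by
    have := ha_add 0 0
    aesop
  have haneg : ∀ s, a (-s) = (a s)⁻¹ := fun s => by
    rw [eq_inv_iff_mul_eq_one, ← ha_add, neg_add_cancel, ha0]
  have hwneg : ∀ s, w (-s) * w s = 1 := fun s => by
    have h0 : w 0 = 1 := by
      have := hw_add 0 0
      rw [add_zero] at this
      have h1 : w 0 * 1 = w 0 * w 0 := by grind
      exact ((ENNReal.mul_right_inj (hw0 0) (hw1 0)).1 h1).symm
    rw [← hw_add, neg_add_cancel, h0]
  set L : (G → ℝ≥0∞) → ℝ≥0∞ := fun F => ∫⁻ s, w s * ∫⁻ x, F (ι x * a s) ∂m ∂vol with hLdef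
  set b : ℝ≥0∞ := ∫⁻ s, w s * ∫⁻ x, β (ι x * a s)⁻¹ ∂m ∂vol with hb
  have hLright : ∀ F : G → ℝ≥0∞, Measurable F → (∀ g k, F (g * j k) = F g) → ∀ x' s' k',
      L (fun g => F (g * (ι x' * a s' * j k'))) = w (-s') * L F := by
    intro F hF hFK x' s' k'
    have e1 : ∀ s, ∫⁻ x, F (ι x * a s * (ι x' * a s' * j k')) ∂m = ∫⁻ x, F (ι x * a (s + s')) ∂m := by
      intro s
      rw [← lintegral_mul_right_eq_self (fun x => F (ι x * a (s + s'))) (c s x')]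
      refine lintegral_congr fun x => ?_
      rw [map_mul, hc, ha_add, ← mul_assoc, hFK]
      congr 1; group
    have e2 : L (fun g => F (g * (ι x' * a s' * j k'))) =
        ∫⁻ s, w (-s') * (w (s + s') * ∫⁻ x, F (ι x * a (s + s')) ∂m) ∂vol := by
      refine lintegral_congr fun s => ?_
      rw [e1, hw_add, ← mul_assoc, ← mul_assoc, mul_comm (w (-s')) (w s), mul_assoc (w s), hwneg, mul_one]
    rw [e2, lintegral_add_right_eq_self (fun s => w (-s') * (w s * ∫⁻ x, F (ι x * a s) ∂m)),
      lintegral_const_mul' _ _ (hw1 _)]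
  have hbconst : ∀ g, ∫⁻ s, w s * ∫⁻ x, β ((ι x * a s)⁻¹ * g) ∂m ∂vol = b := by
    intro g
    obtain ⟨x', s', k', rfl⟩ := hG g
    have e1 : ∀ s, ∫⁻ x, β ((ι x * a s)⁻¹ * (ι x' * a s' * j k')) ∂m
        = w (-s') * ∫⁻ x, β (ι x * a (s - s'))⁻¹ ∂m := by
      intro s
      rw [← hcw (-s') (fun x => β (ι x * a (s - s'))⁻¹) (by fun_prop),
        ← lintegral_mul_left_eq_self (fun x => β ((ι x * a s)⁻¹ * (ι x' * a s' * j k'))) x']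
      refine lintegral_congr fun x => ?_
      rw [← mul_assoc, hβK, hc, haneg, sub_eq_add_neg, add_comm, ha_add, haneg, map_mul]
      congr 1; group
    rw [hb, ← lintegral_sub_right_eq_self (fun s => w s * ∫⁻ x, β (ι x * a s)⁻¹ ∂m) s']
    refine lintegral_congr fun s => ?_
    rw [e1, sub_eq_add_neg, hw_add, mul_assoc]
  have main : ∀ F : G → ℝ≥0∞, Measurable F →
      b * ∫⁻ g, F g ∂μ = ∫⁻ g, β g * L (fun g' => F (g' * g)) ∂μ := by
    intro F hF
    calc b * ∫⁻ g, F g ∂μ = ∫⁻ g, ∫⁻ s, ∫⁻ x, w s * (β ((ι x * a s)⁻¹ * g) * F g) ∂m ∂vol ∂μ := by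
          rw [← lintegral_const_mul _ hF]
          refine lintegral_congr fun g => ?_
          rw [← hbconst g, ← lintegral_mul_const _ (by fun_prop)]
          refine lintegral_congr fun s => ?_
          rw [mul_assoc, ← lintegral_mul_const _ (by fun_prop), lintegral_const_mul _ (by fun_prop)]
      _ = ∫⁻ s, ∫⁻ g, ∫⁻ x, w s * (β ((ι x * a s)⁻¹ * g) * F g) ∂m ∂μ ∂vol :=
          lintegral_lintegral_swap (by fun_prop)
      _ = ∫⁻ s, ∫⁻ x, ∫⁻ g, w s * (β ((ι x * a s)⁻¹ * g) * F g) ∂μ ∂m ∂vol := by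
          refine lintegral_congr fun s => ?_
          exact lintegral_lintegral_swap (by fun_prop)
      _ = ∫⁻ s, ∫⁻ x, ∫⁻ g, w s * (β g * F (ι x * a s * g)) ∂μ ∂m ∂vol := by
          refine lintegral_congr fun s => lintegral_congr fun x => ?_
          rw [← lintegral_mul_left_eq_self (fun g => w s * (β ((ι x * a s)⁻¹ * g) * F g)) (ι x * a s)]
          simp only [inv_mul_cancel_left]
      _ = ∫⁻ s, ∫⁻ g, ∫⁻ x, w s * (β g * F (ι x * a s * g)) ∂m ∂μ ∂vol := by
          refine lintegral_congr fun s => ?_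
          exact (lintegral_lintegral_swap (by fun_prop)).symm
      _ = ∫⁻ g, ∫⁻ s, ∫⁻ x, w s * (β g * F (ι x * a s * g)) ∂m ∂vol ∂μ :=
          (lintegral_lintegral_swap (by fun_prop)).symm
      _ = _ := by
          refine lintegral_congr fun g => ?_
          rw [hLdef, ← lintegral_const_mul _ (by fun_prop)]
          refine lintegral_congr fun s => ?_
          rw [lintegral_const_mul _ (by fun_prop), lintegral_const_mul _ (by fun_prop)]
          ring
  have hratio : ∀ F : G → ℝ≥0∞, Measurable F → (∀ g k, F (g * j k) = F g) → ∀ g,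
      L (fun g' => F (g' * g)) = L (fun g' => β (g' * g)) * (L β)⁻¹ * L F := by
    intro F hF hFK g
    obtain ⟨x', s', k', rfl⟩ := hG g
    rw [hLright F hF hFK, hLright β hβ hβK, mul_assoc (w (-s')), ENNReal.mul_inv_cancel hL0 hL1, mul_one]
  have hDm : Measurable fun g => L (fun g' => β (g' * g)) := by
    simp only [hLdef]; fun_prop
  have main2 : ∀ F : G → ℝ≥0∞, Measurable F → (∀ g k, F (g * j k) = F g) →
      b * ∫⁻ g, F g ∂μ = (∫⁻ g, β g * (L (fun g' => β (g' * g)) * (L β)⁻¹) ∂μ) * L F := by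
    intro F hF hFK
    have hm : Measurable fun g => β g * (L (fun g' => β (g' * g)) * (L β)⁻¹) :=
      hβ.mul (hDm.mul_const _)
    rw [main F hF, ← lintegral_mul_const _ hm]
    refine lintegral_congr fun g => ?_
    rw [hratio F hF hFK]; ring
  have main3 : ∀ F : G → ℝ≥0∞, Measurable F → (∀ g k, F (g * j k) = F g) →
      L β * ∫⁻ g, F g ∂μ = (∫⁻ g, β g ∂μ) * L F := by
    intro F hF hFK
    have h1 := main2 F hF hFK
    have h2 := main2 β hβ hβK
    refine (ENNReal.mul_right_inj hb0 hb1).1 ?_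
    calc b * (L β * ∫⁻ g, F g ∂μ) = L β * (b * ∫⁻ g, F g ∂μ) := by ring
      _ = (b * ∫⁻ g, β g ∂μ) * L F := by rw [h1, h2]; ring
      _ = _ := by ring
  have hav : ∫⁻ g, f g ∂μ = ∫⁻ g, ∫⁻ k, f (g * j k) ∂κ ∂μ := by
    rw [lintegral_lintegral_swap (by fun_prop)]
    simp_rw [lintegral_mul_right_eq_self (fun g => f g)]
    simp
  rw [hav]
  refine main3 _ (by fun_prop) fun g k => ?_
  rw [← lintegral_mul_left_eq_self (fun k' => f (g * j k')) k]
  simp [mul_assoc]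

/-- If the right invariant measure of `G` disintegrates over `S` along a family `j` of group
elements, then the image of the parameter measure in `S \ G` is invariant. -/
theorem map_translate_eq_of_disintegration {S P Q : Type*} [Group S] [MeasurableSpace S]
    [MeasurableMul S] [MeasurableSpace P] [MeasurableSpace Q]
    (μ : Measure G) [SigmaFinite μ] [μ.IsMulRightInvariant]
    (σ : Measure S) [SFinite σ] [σ.IsMulRightInvariant] (hσ : σ ≠ 0)
    (π : Measure P) [SFinite π] (i : S →* G) (hi : Measurable i) (j : P → G) (hj : Measurable j)
    (C : ℝ≥0∞) (hC0 : C ≠ 0) (hC1 : C ≠ ∞)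
    (hdis : ∀ f : G → ℝ≥0∞, Measurable f → ∫⁻ g, f g ∂μ = C * ∫⁻ p, ∫⁻ s, f (i s * j p) ∂σ ∂π)
    (q : G → Q) (hq : Measurable q) (hqS : ∀ s g, q (i s * g) = q g)
    (x : G) (τ : Q → Q) (hτ : Measurable τ) (hτq : ∀ g, τ (q g) = q (g * x)) :
    (π.map (fun p => q (j p))).map τ = π.map (fun p => q (j p)) := by
  obtain ⟨β₀, hβpos, hβm, hβ⟩ := exists_pos_lintegral_lt_of_sigmaFinite μ (ε := 1) one_ne_zero
  set β : G → ℝ≥0∞ := fun g => β₀ g with hβdef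
  have hβm' : Measurable β := by fun_prop
  set I : G → ℝ≥0∞ := fun g => ∫⁻ s, β (i s * g) ∂σ with hI
  have hIm : Measurable I := by fun_prop
  have hIS : ∀ s g, I (i s * g) = I g := by
    intro s g
    simp only [hI]
    rw [← lintegral_mul_right_eq_self (fun s' => β (i s' * g)) s]
    simp [mul_assoc]
  have hI0 : ∀ g, I g ≠ 0 := by
    intro g h0
    rw [hI, lintegral_eq_zero_iff (by fun_prop)] at h0
    have : ∀ᵐ s ∂σ, False := by
      filter_upwards [h0] with s hs
      simp only [hβdef, Pi.zero_apply, ENNReal.coe_eq_zero] at hs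
      exact (hβpos _).ne' hs
    rw [Filter.eventually_false_iff_eq_bot, ae_eq_bot] at this
    exact hσ this
  have key : ∀ (φ : Q → ℝ≥0∞), Measurable φ → ∀ y : G,
      C * ∫⁻ p, φ (q (j p * y)) ∂π = ∫⁻ g, φ (q g) * (β g * (I g)⁻¹) ∂μ := by
    intro φ hφ y
    have hfin : ∀ᵐ p ∂π, I (j p * y) < ∞ := by
      have h1 : ∫⁻ g, β (g * y) ∂μ ≠ ∞ := by
        rw [lintegral_mul_right_eq_self]; exact ne_top_of_lt hβ
      rw [hdis (fun g => β (g * y)) (by fun_prop)] at h1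
      have h2 : ∫⁻ p, I (j p * y) ∂π ≠ ∞ := by grind [mul_assoc, mul_top]
      exact ae_lt_top (by fun_prop) h2
    rw [← lintegral_mul_right_eq_self (fun g => φ (q g) * (β g * (I g)⁻¹)) y,
      hdis (fun g => φ (q (g * y)) * (β (g * y) * (I (g * y))⁻¹)) (by fun_prop)]
    congr 1
    refine lintegral_congr_ae ?_
    filter_upwards [hfin] with p hp
    have e1 : ∀ s, φ (q (i s * j p * y)) * (β (i s * j p * y) * (I (i s * j p * y))⁻¹) =
        (φ (q (j p * y)) * (I (j p * y))⁻¹) * β (i s * (j p * y)) := by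
      intro s
      rw [mul_assoc (i s), hqS, hIS]; ring
    simp_rw [e1]
    rw [lintegral_const_mul _ (by fun_prop), mul_assoc]
    change _ = φ (q (j p * y)) * ((I (j p * y))⁻¹ * I (j p * y))
    rw [ENNReal.inv_mul_cancel (hI0 _) hp.ne, mul_one]
  have hqj : Measurable fun p => q (j p) := hq.comp hj
  ext A hA
  rw [map_apply hτ hA, map_apply hqj (hτ hA), map_apply hqj hA]
  have hφ : Measurable (A.indicator (1 : Q → ℝ≥0∞)) := measurable_one.indicator hA
  have h1 := key _ hφ x
  have h2 := key _ hφ 1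
  rw [← h2] at h1
  have h3 := (ENNReal.mul_right_inj hC0 hC1).1 h1
  have e1 : ∀ p, A.indicator (1 : Q → ℝ≥0∞) (q (j p * x)) =
      ((fun p => q (j p)) ⁻¹' (τ ⁻¹' A)).indicator 1 p := by
    intro p; rw [← hτq]; rfl
  have e2 : ∀ p, A.indicator (1 : Q → ℝ≥0∞) (q (j p * 1)) =
      ((fun p => q (j p)) ⁻¹' A).indicator 1 p := by
    intro p; rw [mul_one]; rfl
  simp_rw [e1, e2] at h3
  rwa [lintegral_indicator_one (hqj (hτ hA)), lintegral_indicator_one (hqj hA)] at h3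

/-- The image in `S \ G` of the parameter measure of a disintegration is finite on the images of
sets of the form `V` with `μ (W V) < ∞` for some `W` of positive measure. -/
theorem map_apply_ne_top_of_disintegration {S P Q : Type*} [Group S] [MeasurableSpace S]
    [MeasurableMul S] [MeasurableSpace P] [MeasurableSpace Q]
    (μ : Measure G) (σ : Measure S) [SFinite σ] [σ.IsMulRightInvariant]
    (π : Measure P) (i : S →* G) (hi : Measurable i) (j : P → G) (hj : Measurable j)
    (C : ℝ≥0∞) (hC0 : C ≠ 0)
    (hdis : ∀ f : G → ℝ≥0∞, Measurable f → ∫⁻ g, f g ∂μ = C * ∫⁻ p, ∫⁻ s, f (i s * j p) ∂σ ∂π)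
    (q : G → Q) (hq : Measurable q) (hqS : ∀ g g', q g = q g' → ∃ s, g = i s * g')
    (V : Set G) (W : Set S) (D : Set G) (hD : MeasurableSet D)
    (hDW : ∀ s ∈ W, ∀ v ∈ V, i s * v ∈ D)
    (hWσ : σ W ≠ 0) (hDμ : μ D ≠ ∞) (T : Set Q) (hT : MeasurableSet T) (hTV : T ⊆ q '' V) :
    (π.map (fun p => q (j p))) T ≠ ∞ := by
  have hqj : Measurable fun p => q (j p) := hq.comp hj
  rw [map_apply hqj hT]
  have h1 : C * (σ W * π ((fun p => q (j p)) ⁻¹' T)) ≤ μ D := by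
    have := hdis (D.indicator 1) (measurable_one.indicator hD)
    rw [lintegral_indicator_one hD] at this
    rw [this]
    gcongr
    calc σ W * π ((fun p => q (j p)) ⁻¹' T) = ∫⁻ p in (fun p => q (j p)) ⁻¹' T, σ W ∂π := by
          rw [setLIntegral_const]
      _ ≤ ∫⁻ p in (fun p => q (j p)) ⁻¹' T, ∫⁻ s, D.indicator 1 (i s * j p) ∂σ ∂π := by
          refine setLIntegral_mono' (hqj hT) fun p hp => ?_
          obtain ⟨v, hv, hvq⟩ := hTV hp
          obtain ⟨s₀, hs₀⟩ := hqS _ _ hvq.symm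
          have hm : MeasurableSet {s | i s * j p ∈ D} :=
            ((hi.mul_const (j p))) hD
          calc σ W = σ ((fun s => s * s₀) ⁻¹' W) := (measure_preimage_mul_right σ s₀ W).symm
            _ ≤ σ {s | i s * j p ∈ D} := by
                refine measure_mono fun s hs => ?_
                have := hDW _ hs v hv
                grind [map_mul, mul_assoc]
            _ = ∫⁻ s, {s | i s * j p ∈ D}.indicator 1 s ∂σ := (lintegral_indicator_one hm).symm
            _ = _ := rfl
      _ ≤ _ := setLIntegral_le_lintegral _ _
  intro htop
  rw [htop, mul_top hWσ, mul_top hC0] at h1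
  exact hDμ (top_le_iff.1 h1)

end InvariantMeasures

variable {L : Type*} [RCLike L] {k : ScalarKind} {E : Type*} [NormedAddCommGroup E]
  [NormedSpace ℝ E] [Module (Scalar L k) E] [IsScalarTower ℝ (Scalar L k) E]
  {h : HermitianForm L k E} {B : PositiveForm L k E} {θ : E →ₗ[ℝ] E}

local notation "𝕂" => Scalar L k
local notation "𝔞" => Fin k.card → ℝ

variable {u v γ : E} {w : E × E} {x : h.unitary}

local notation "𝕊" => sphereF h B ⊤
local notation "𝐉" => jacobianEta h B ⊤

theorem tau_apply_eq (z : 𝕂) (i : Fin k.card) : tau z i = z i.rev ∨ tau z i = star (z i.rev) := by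
  cases k
  · exact Or.inl rfl
  · right
    have : i.rev = i := Subsingleton.elim (α := Fin 1) _ _
    rw [this]; rfl
  · left
    have : i.rev = i := Subsingleton.elim (α := Fin 1) _ _
    rw [this]; rfl

theorem re_tau (z : 𝕂) (i : Fin k.card) : re (tau z i) = re (z i.rev) := by
  rcases tau_apply_eq z i with h | h <;> simp [h]

theorem norm_tau_apply (z : 𝕂) (i : Fin k.card) : ‖tau z i‖ = ‖z i.rev‖ := by
  rcases tau_apply_eq z i with h | h <;> simp [h]

@[simp] theorem tau_tau (z : 𝕂) : tau (tau z) = z := by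
  cases k
  all_goals simp [tau]

@[simp] theorem tau_add (z w : 𝕂) : tau (z + w) = tau z + tau w := by
  cases k
  · rfl
  · exact star_add z w
  · rfl

@[simp] theorem tau_mul (z w : 𝕂) : tau (z * w) = tau z * tau w := by
  cases k
  · rfl
  · exact star_mul' z w
  · rfl

@[simp] theorem tau_one : tau (1 : 𝕂) = 1 := by
  cases k
  · rfl
  · exact star_one _
  · rfl

@[simp] theorem tau_zero : tau (0 : 𝕂) = 0 := by
  cases k
  · rfl
  · exact star_zero _
  · rfl

@[simp] theorem tau_smul (c : ℝ) (z : 𝕂) : tau (c • z) = c • tau z := by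
  cases k
  · rfl
  all_goals simp [tau]

theorem tau_star (z : 𝕂) : tau (star z) = star (tau z) := by
  cases k <;> rfl

/-- The involution `τ` as an `ℝ`-linear map. -/
def tauLinear (L : Type*) [RCLike L] (k : ScalarKind) : Scalar L k →ₗ[ℝ] Scalar L k where
  toFun := tau
  map_add' := tau_add
  map_smul' := tau_smul

@[simp] theorem tauLinear_apply (z : 𝕂) : tauLinear L k z = tau z := rfl

@[simp] theorem tau_neg (z : 𝕂) : tau (-z) = -tau z := map_neg (tauLinear L k) z

@[simp] theorem tau_sub (z w : 𝕂) : tau (z - w) = tau z - tau w :=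
  map_sub (tauLinear L k) z w

/-- The involution `σ`, the composition of `τ` with the componentwise conjugation. -/
def sigma (z : 𝕂) : 𝕂 := star (tau z)

theorem sigma_def (z : 𝕂) : sigma z = star (tau z) := rfl

@[simp] theorem sigma_sigma (z : 𝕂) : sigma (sigma z) = z := by
  simp [sigma, tau_star]

@[simp] theorem sigma_mul (z w : 𝕂) : sigma (z * w) = sigma z * sigma w := by
  simp [sigma]

@[simp] theorem sigma_add (z w : 𝕂) : sigma (z + w) = sigma z + sigma w := by
  simp [sigma]

@[simp] theorem sigma_neg (z : 𝕂) : sigma (-z) = -sigma z := by simp [sigma]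

@[simp] theorem sigma_sub (z w : 𝕂) : sigma (z - w) = sigma z - sigma w := by simp [sigma]

@[simp] theorem sigma_one : sigma (1 : 𝕂) = 1 := by simp [sigma]

@[simp] theorem sigma_zero : sigma (0 : 𝕂) = 0 := by simp [sigma]

theorem star_sigma (z : 𝕂) : star (sigma z) = tau z := by simp [sigma]

theorem sigma_star (z : 𝕂) : sigma (star z) = tau z := by simp [sigma, tau_star]

/-- Vectors of real numbers as elements of `𝕂`. -/
def realCoe (L : Type*) [RCLike L] {k : ScalarKind} : (Fin k.card → ℝ) →ₐ[ℝ] Scalar L k where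
  toFun x := fun i => ((x i : ℝ) : L)
  map_one' := by funext i; simp
  map_mul' x y := by funext i; simp
  map_zero' := by funext i; simp
  map_add' x y := by funext i; simp
  commutes' c := by abel

theorem realCoe_apply (x : 𝔞) (i : Fin k.card) : realCoe L x i = ((x i : ℝ) : L) := rfl

theorem realCoe_injective : Injective (realCoe L (k := k)) := by
  intro x y hxy
  funext i
  have := congrFun hxy i
  simpa [realCoe_apply] using this

@[simp] theorem star_realCoe (x : 𝔞) : star (realCoe L x) = realCoe L x := by
  funext i; simp [realCoe_apply]

@[simp] theorem tau_realCoe (x : 𝔞) :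
    tau (realCoe L x) = realCoe L fun i => x i.rev := by
  funext i
  rcases tau_apply_eq (realCoe L x) i with h | h <;> rw [h] <;> simp [realCoe_apply]

@[simp] theorem sigma_realCoe (x : 𝔞) :
    sigma (realCoe L x) = realCoe L fun i => x i.rev := by
  rw [sigma, tau_realCoe, star_realCoe]

theorem exists_realCoe_of_star {z : 𝕂} (hz : star z = z) : z = realCoe L fun i => re (z i) :=
    by
  funext i
  have := congrFun hz i
  rw [Pi.star_apply] at this
  rw [realCoe_apply]
  exact (RCLike.conj_eq_iff_re.1 this).symm

theorem posCoe_eq (t : PosScalar k) : posCoe L t = realCoe L fun i => (t i : ℝ) := rfl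

theorem posInvTau_eq (t : PosScalar k) : posInvTau L t = realCoe L fun i => ((t i.rev : ℝ))⁻¹ := by
  have : (fun i => (((t i : ℝ) : L))⁻¹) = realCoe L fun i => ((t i : ℝ))⁻¹ := by
    funext i; simp [realCoe_apply]
  rw [posInvTau, this, tau_realCoe]

theorem card_pos' (k : ScalarKind) : 0 < k.card := by cases k <;> decide

theorem normTrace_tau (z : 𝕂) : normTrace (tau z) = normTrace z := by
  rw [normTrace, normTrace]
  congr 1
  rw [← Equiv.sum_comp revPerm (fun i => re (z i))]
  exact sum_congr rfl fun i _ => re_tau z i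

theorem normTrace_star (z : 𝕂) : normTrace (star z) = normTrace z := by
  simp [normTrace]

theorem normTrace_sigma (z : 𝕂) : normTrace (sigma z) = normTrace z := by
  rw [sigma, normTrace_star, normTrace_tau]

/-- The normalized trace as an `ℝ`-linear functional. -/
noncomputable def normTraceLinear (L : Type*) [RCLike L] (k : ScalarKind) : Scalar L k →ₗ[ℝ] ℝ where
  toFun := normTrace
  map_add' z w := by simp [normTrace, sum_add_distrib, add_div]
  map_smul' c z := by
    simp [normTrace, RCLike.smul_re, ← Finset.mul_sum, mul_div_assoc]

theorem normTraceLinear_apply (z : 𝕂) : normTraceLinear L k z = normTrace z := rfl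

theorem normTrace_add (z w : 𝕂) : normTrace (z + w) = normTrace z + normTrace w :=
  map_add (normTraceLinear L k) z w

theorem normTrace_neg (z : 𝕂) : normTrace (-z) = -normTrace z :=
  map_neg (normTraceLinear L k) z

theorem eq_zero_of_normTrace_mul {z : 𝕂} (hz : ∀ w, normTrace (w * z) = 0) : z = 0 := by
  have h := hz (star z)
  rw [normTrace, div_eq_zero_iff] at h
  have hk : (k.card : ℝ) ≠ 0 := Nat.cast_ne_zero.2 (card_pos' k).ne'
  have h1 := h.resolve_right hk
  have h2 : ∀ i, re ((star z * z) i) = ‖z i‖ ^ 2 := by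
    simp [Pi.mul_apply, Pi.star_apply, RCLike.conj_mul]
  simp_rw [h2] at h1
  rw [Finset.sum_eq_zero_iff_of_nonneg fun i _ => by positivity] at h1
  funext i
  have := h1 i (mem_univ i)
  simpa using this

variable (h) in
theorem HermitianForm.smul_right (a : 𝕂) (u v : E) : h.form u (a • v) = tau a * h.form u v := by
  rw [h.tau_symm, h.smul_left, tau_mul, ← h.tau_symm]

variable (B) in
theorem PositiveForm.smul_right (a : 𝕂) (u v : E) : B.form u (a • v) = star a * B.form u v := by
  rw [B.conj_symm, B.smul_left, star_mul, ← B.conj_symm, mul_comm]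

variable (h) in
theorem HermitianForm.torsionFree {c : ℝ} (hc : c ≠ 0) (hv : h.form v v = algebraMap ℝ _ c) (a : 𝕂)
    (ha : a • v = 0) : a = 0 := by
  have h1 := h.smul_left a v v
  rw [ha, map_zero, LinearMap.zero_apply, hv] at h1
  have h2 : a * algebraMap ℝ 𝕂 c * algebraMap ℝ 𝕂 c⁻¹ = 0 := by
    rw [← h1, zero_mul]
  rwa [mul_assoc, ← map_mul, mul_inv_cancel₀ hc, map_one, mul_one] at h2

variable (B) in
/-- The positive form at `(u, u)`, a vector of real numbers. -/
noncomputable def PositiveForm.quad (u : E) : 𝔞 :=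
  fun i => re (B.form u u i)

variable (B) in
theorem PositiveForm.form_self (u : E) : B.form u u = realCoe L (B.quad u) :=
  exists_realCoe_of_star (B.conj_symm u u).symm

theorem single_mul_single (i : Fin k.card) : (single i 1 : 𝕂) * single i 1 = single i 1 :=
    by
  rw [← Pi.single_mul_left]; simp

theorem star_single_one (i : Fin k.card) : star (single i 1 : 𝕂) = single i 1 := by aesop

theorem mul_single_one (a : 𝕂) (i : Fin k.card) : a * single i 1 = single i (a i) := by
  funext j
  by_cases h : j = i
  all_goals aesop

variable (B) in
theorem PositiveForm.quad_single (u : E) (i : Fin k.card) : B.quad ((single i 1 : 𝕂) • u) i =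
    B.quad u i := by
  rw [quad, quad, B.smul_left, B.smul_right, star_single_one]
  simp

variable (B) in
theorem PositiveForm.quad_pos (hE : ∃ v : E, ∀ a : 𝕂, a • v = 0 → a = 0) {i : Fin k.card}
    (hu : (single i 1 : 𝕂) • u ≠ 0) : 0 < B.quad u i := by
  obtain ⟨v, hv⟩ := hE
  set p : 𝕂 := single i 1 with hp
  have hpp : p * p = p := single_mul_single i
  have hq : p • (p • u + (1 - p) • v) = p • u := by
    simp [smul_add, smul_smul, hpp, mul_sub, mul_one, sub_self, zero_smul, add_zero]
  have htf : ∀ a : 𝕂, a • (p • u + (1 - p) • v) = 0 → a = 0 := by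
    intro a ha
    have h1 : (a * p) • u = 0 := by
      have : p • (a • (p • u + (1 - p) • v)) = 0 := by rw [ha, smul_zero]
      rw [smul_comm, hq, smul_smul] at this
      exact this
    have hai : a i = 0 := by
      by_contra hne
      apply hu
      have : p = (fun _ => (a i)⁻¹ : 𝕂) * (a * p) := by
        funext j
        by_cases hj : j = i
        · subst hj; simp [hp, hne]
        · simp [hp, Pi.single_eq_of_ne hj]
      rw [this, mul_smul, h1, smul_zero]
    have h2 : a * p = 0 := by rw [hp, mul_single_one, hai, Pi.single_zero]
    apply hv
    rw [smul_add, smul_smul, smul_smul, mul_sub, h2, zero_smul, zero_add, sub_zero, mul_one] at ha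
    exact ha
  obtain ⟨t, ht⟩ := B.pos _ htf
  have h3 := B.quad_single (p • u + (1 - p) • v) i
  rw [← hp, hq] at h3
  have h4 := B.quad_single u i
  rw [← hp] at h4
  rw [← h4, h3, quad, ht]
  simpa [posCoe] using (t i).2

variable (B) in
theorem PositiveForm.quad_nonneg (hE : ∃ v : E, ∀ a : 𝕂, a • v = 0 → a = 0) (u : E)
    (i : Fin k.card) : 0 ≤ B.quad u i := by
  by_cases hu : (single i 1 : 𝕂) • u = 0
  · rw [← B.quad_single, hu, quad]; simp
  · exact (B.quad_pos hE hu).le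

theorem eq_zero_of_single_smul (hu : ∀ i, (single i 1 : 𝕂) • u = 0) : u = 0 := by
  have : (1 : 𝕂) = ∑ i, single i 1 := by aesop
  rw [← one_smul 𝕂 u, this, Finset.sum_smul]
  aesop

variable (B) in
theorem PositiveForm.eq_zero_of_quad (hE : ∃ v : E, ∀ a : 𝕂, a • v = 0 → a = 0)
    (hu : B.quad u = 0) : u = 0 := by
  apply eq_zero_of_single_smul (L := L) (k := k)
  intro i
  by_contra h
  have := B.quad_pos hE h
  aesop

variable (B) in
theorem PositiveForm.eq_zero_of_normTrace (hE : ∃ v : E, ∀ a : 𝕂, a • v = 0 → a = 0)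
    (hu : normTrace (B.form u u) = 0) : u = 0 := by
  apply B.eq_zero_of_quad hE
  rw [normTrace, div_eq_zero_iff] at hu
  have h1 : ∑ i, B.quad u i = 0 := hu.resolve_right (Nat.cast_ne_zero.2 (card_pos' k).ne')
  rw [Finset.sum_eq_zero_iff_of_nonneg fun i _ => B.quad_nonneg hE u i] at h1
  funext i
  simp_all

variable (B) in
theorem PositiveForm.normTrace_nonneg (hE : ∃ v : E, ∀ a : 𝕂, a • v = 0 → a = 0) (u : E) : 0 ≤
    normTrace (B.form u u) :=
  div_nonneg (Finset.sum_nonneg fun i _ => B.quad_nonneg hE u i) (Nat.cast_nonneg _)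

/-- The map `θ` relates the hermitian form and the positive form. -/
structure IsCartan (h : HermitianForm L k E) (B : PositiveForm L k E) (θ : E →ₗ[ℝ] E) : Prop where
  form_eq : ∀ u v, B.form u v = h.form u (θ v)
  theta_theta : ∀ v, θ (θ v) = v
  exists_torsionFree : ∃ v : E, ∀ a : 𝕂, a • v = 0 → a = 0

variable (c : IsCartan h B θ)

namespace IsCartan

include c

theorem form_eq' (u v : E) : h.form u v = B.form u (θ v) := by
  rw [c.form_eq, c.theta_theta]

theorem form_theta_left (u v : E) : h.form (θ u) v = sigma (B.form u v) := by
  rw [B.conj_symm, c.form_eq, h.tau_symm v, sigma_star, tau_tau]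

theorem pos_theta_left (u v : E) : B.form (θ u) v = sigma (h.form u v) := by
  rw [c.form_eq, c.form_theta_left, ← c.form_eq']

theorem pos_theta_theta (u v : E) : B.form (θ u) (θ v) = sigma (B.form u v) := by
  rw [c.pos_theta_left, ← c.form_eq]

theorem form_theta_theta (u v : E) : h.form (θ u) (θ v) = sigma (h.form u v) := by
  rw [c.form_theta_left, ← c.form_eq']

theorem pos_nondegenerate (hu : ∀ v, B.form u v = 0) : u = 0 :=
  h.nondegenerate u fun v => by rw [c.form_eq', hu]

theorem pos_ext_right (huv : ∀ w, B.form w u = B.form w v) : u = v := by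
  rw [← sub_eq_zero]
  apply c.pos_nondegenerate
  intro w
  rw [B.conj_symm, map_sub, huv w, sub_self, star_zero]

theorem theta_smul (a : 𝕂) (v : E) : θ (a • v) = sigma a • θ v := by
  apply c.pos_ext_right
  intro w
  rw [← c.form_eq', h.smul_right, B.smul_right, ← c.form_eq', star_sigma]

theorem eq_zero_of_quad (hu : B.form u u = 0) : u = 0 := by
  apply B.eq_zero_of_quad c.exists_torsionFree
  rw [B.form_self] at hu
  apply realCoe_injective (L := L)
  rw [hu, map_zero]

theorem quad_nonneg (u : E) (i : Fin k.card) : 0 ≤ B.quad u i :=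
  B.quad_nonneg c.exists_torsionFree u i

end IsCartan

variable (h) in
theorem HermitianForm.ext_left (huv : ∀ w, h.form u w = h.form v w) : u = v := by
  rw [← sub_eq_zero]
  apply h.nondegenerate
  aesop

variable (h) in
theorem HermitianForm.eq_zero_of_normTrace (hu : ∀ v, normTrace (h.form u v) = 0) : u = 0 := by
  apply h.nondegenerate
  intro v
  apply eq_zero_of_normTrace_mul
  intro w
  rw [← hu (tau w • v), h.smul_right, tau_tau]

/-- The principal square root. -/
noncomputable def csqrt (z : L) : L :=
  ((√(2 * (‖z‖ + re z)) : ℝ) : L)⁻¹ * (z + ((‖z‖ : ℝ) : L))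

theorem csqrt_mul_self {z : L} (hz : 0 < ‖z‖ + re z) : csqrt z * csqrt z = z := by
  have h1 : (z + ((‖z‖ : ℝ) : L)) * (z + ((‖z‖ : ℝ) : L)) =
      ((2 * (‖z‖ + re z) : ℝ) : L) * z := by
    have h2 := mul_conj z
    have h3 : z + (starRingEnd L) z = ((2 * re z : ℝ) : L) := by
      rw [RCLike.add_conj]; push_cast; ring
    push_cast at h3 ⊢
    grind
  have h4 : ((√(2 * (‖z‖ + re z)) : ℝ) : L) * ((√(2 * (‖z‖ + re z)) : ℝ) : L) =
      ((2 * (‖z‖ + re z) : ℝ) : L) := by grind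
  have h5 : ((2 * (‖z‖ + re z) : ℝ) : L) ≠ 0 := by grind [RCLike.ofReal_eq_zero]
  rw [csqrt, mul_mul_mul_comm, h1, ← mul_inv, h4, ← mul_assoc, inv_mul_cancel₀ h5, one_mul]

theorem re_csqrt_pos {z : L} (hz : 0 < ‖z‖ + re z) : 0 < re (csqrt z) := by
  rw [csqrt, ← RCLike.ofReal_inv, RCLike.re_ofReal_mul, map_add, ofReal_re]
  have : 0 < re z + ‖z‖ := by linarith
  positivity

theorem norm_add_re_mul_self (w : L) : ‖w * w‖ + re (w * w) = 2 * re w ^ 2 := by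
  rw [norm_mul, RCLike.mul_re, ← sq, ← RCLike.normSq_eq_def', RCLike.normSq_apply]
  ring

theorem csqrt_self_mul {w : L} (hw : 0 < re w) : csqrt (w * w) = w := by
  have h1 : w * w + ((‖w * w‖ : ℝ) : L) = ((2 * re w : ℝ) : L) * w := by
    have h2 := mul_conj w
    have h3 : w + (starRingEnd L) w = ((2 * re w : ℝ) : L) := by
      rw [RCLike.add_conj]; push_cast; ring
    rw [norm_mul]
    grind
  have h4 : √(2 * (‖w * w‖ + re (w * w))) = 2 * re w := by
    rw [norm_add_re_mul_self]
    rw [show 2 * (2 * re w ^ 2) = (2 * re w) ^ 2 by ring]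
    grind [Real.sqrt_sq]
  rw [csqrt, h1, h4, ← mul_assoc, inv_mul_cancel₀, one_mul]
  aesop

theorem csqrt_star (z : L) : csqrt (star z) = star (csqrt z) := by
  have : star z = (starRingEnd L) z := rfl
  simp [csqrt, this]

theorem differentiableAt_csqrt {z : L} (hz : 0 < ‖z‖ + re z) : DifferentiableAt ℝ
    (csqrt : L → L) z := by
  have hz0 : z ≠ 0 := by rintro rfl; simp at hz
  have h1 : DifferentiableAt ℝ (fun z : L => ‖z‖) z := differentiableAt_id.norm ℝ hz0
  have h2 : DifferentiableAt ℝ (fun z : L => re z) z :=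
    (reCLM (K := L)).differentiableAt
  have h3 : DifferentiableAt ℝ (fun z : L => (√(2 * (‖z‖ + re z)))⁻¹) z := by
    refine DifferentiableAt.inv (((h1.add h2).const_mul 2).sqrt ?_) ?_
    all_goals positivity
  have h4 : DifferentiableAt ℝ (fun z : L => (((√(2 * (‖z‖ + re z)))⁻¹ : ℝ) : L)) z :=
    (RCLike.ofRealCLM (K := L)).differentiableAt.comp z h3
  have h5 : DifferentiableAt ℝ (fun z : L => ((‖z‖ : ℝ) : L)) z :=
    (RCLike.ofRealCLM (K := L)).differentiableAt.comp z h1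
  have h6 : (csqrt : L → L) = fun z => (((√(2 * (‖z‖ + re z)))⁻¹ : ℝ) : L) *
      (z + ((‖z‖ : ℝ) : L)) := by
    funext z; rw [csqrt, RCLike.ofReal_inv]
  rw [h6]
  fun_prop

/-- The exponential parametrization of `𝕂₊ˣ`. -/
noncomputable def expPos (s : 𝔞) : PosScalar k :=
  fun i => ⟨exp (s i), exp_pos _⟩

/-- The coefficient `(t - t^{-τ})/2` at `t = exp s`. -/
noncomputable def hypSub (s : 𝔞) : 𝔞 :=
  fun i => (exp (s i) - exp (-s i.rev)) / 2

/-- The coefficient `(t + t^{-τ})/2` at `t = exp s`. -/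
noncomputable def hypAdd (s : 𝔞) : 𝔞 :=
  fun i => (exp (s i) + exp (-s i.rev)) / 2

/-- The chamber `t t^τ > 1` in logarithmic coordinates. -/
def chamber (k : ScalarKind) : Set (Fin k.card → ℝ) := {s | ∀ i, 0 < s i + s i.rev}

theorem hyp_mul_rev (s : 𝔞) (i : Fin k.card) : hypSub s i * hypSub s i.rev - hypAdd s i * hypAdd s
    i.rev = -1 := by
  simp only [hypSub, hypAdd, rev_rev]
  have h1 := exp_add (s i) (-s i)
  have h2 := exp_add (s i.rev) (-s i.rev)
  grind [add_neg_cancel, exp_zero]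

theorem hyp_sq_add_sq (s : 𝔞) (i : Fin k.card) : hypSub s i ^ 2 + hypAdd s i ^ 2 = exp
    (s i - s i.rev) * cosh (s i + s i.rev) := by
  rw [Real.cosh_eq, mul_div_assoc', mul_add, ← exp_add, ← exp_add]
  simp only [hypSub, hypAdd]
  have e1 : s i - s i.rev + (s i + s i.rev) = s i + s i := by ring
  have e2 : s i - s i.rev + -(s i + s i.rev) = -s i.rev + -s i.rev := by ring
  grind [exp_add]

theorem exp_rev_mul_hypSub (s : 𝔞) (i : Fin k.card) : exp (s i.rev) * hypSub s i =
    (exp (s i + s i.rev) - 1) / 2 := by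
  rw [hypSub, mul_div_assoc', mul_sub, ← exp_add, ← exp_add, add_neg_cancel,
    exp_zero, add_comm]

theorem exp_rev_mul_hypAdd (s : 𝔞) (i : Fin k.card) : exp (s i.rev) * hypAdd s i =
    (exp (s i + s i.rev) + 1) / 2 := by
  rw [hypAdd, mul_div_assoc', mul_add, ← exp_add, ← exp_add, add_neg_cancel,
    exp_zero, add_comm (s i.rev)]

local notation "η[" w "," s "]" => etaF (L := L) w (expPos s)

variable (h) in
abbrev HermitianForm.IsTimelike (γ : E) : Prop :=
  ∀ i, 0 < ‖h.form γ γ i‖ - re (h.form γ γ i)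

theorem realCoe_const (c : ℝ) : realCoe L (fun _ : Fin k.card => c) = algebraMap ℝ _ c :=
  (realCoe L).commutes c

theorem eq_zero_of_realCoe_mul {x : 𝔞} (hx : ∀ i, x i ≠ 0) {z : 𝕂} (hz : realCoe L x * z = 0) : z =
    0 := by
  funext i
  have h1 := congrFun hz i
  simp_all [Pi.mul_apply, Pi.zero_apply, mul_eq_zero, realCoe_apply]

theorem eq_zero_of_realCoe_smul {x : 𝔞} (hx : ∀ i, x i ≠ 0) (hv : realCoe L x • v = 0) : v = 0 := by
  have h1 := congrArg (fun y => realCoe L (fun i => (x i)⁻¹) • y) hv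
  simp only [smul_smul, ← map_mul, smul_zero] at h1
  have h2 : ((fun i => (x i)⁻¹) * x) = 1 := by
    funext i; exact inv_mul_cancel₀ (hx i)
  simp_all

theorem etaF_expPos (w : E × E) (s : 𝔞) : η[w, s] = realCoe L (hypSub s) • w.1 + realCoe L
    (hypAdd s) • w.2 := by
  have e : ∀ (x : 𝔞) (v : E), (2⁻¹ : ℝ) • (realCoe L x • v) =
      realCoe L (fun i => x i / 2) • v := by
    intro x v
    rw [← smul_assoc, ← map_smul]
    congr 2; funext i; simp [div_eq_inv_mul]
  rw [etaF, posCoe_eq, posInvTau_eq, ← map_sub, ← map_add, smul_add, e, e]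
  simp only [Pi.sub_apply, Pi.add_apply, expPos, ← Real.exp_neg]
  rfl

include c in
theorem IsCartan.mem_thetaEigen_top (ε : ℝ) (v : E) : v ∈ thetaEigen h B ⊤ ε ↔ θ v = ε • v := by
  constructor
  · rintro ⟨-, hv⟩
    apply c.pos_ext_right
    intro w
    rw [← c.form_eq']
    have h1 : B.form (θ w) v = ε • h.form (θ w) v := hv _ trivial
    rw [c.pos_theta_left, c.form_theta_left] at h1
    have h2 := congrArg sigma h1
    rw [sigma_sigma] at h2
    simp [h2, map_smul, sigma, tau_smul, tau_star]
  · intro hv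
    refine ⟨trivial, fun x _ => ?_⟩
    rw [c.form_eq, hv, map_smul]

include c in
theorem IsCartan.mem_sphereF_top (w : E × E) : w ∈ 𝕊 ↔ θ w.1 = w.1 ∧ θ w.2 = -w.2 ∧ B.form w.1 w.1 =
    1 ∧ B.form w.2 w.2 = 1 ∧ B.form w.1 w.2 = 0 := by
  simp [sphereF, Set.mem_ofPred_eq, c.mem_thetaEigen_top, one_smul, neg_one_smul]

/-- The polar decomposition `γ = ζ η(w, exp s)`. -/
structure IsPolar (h : HermitianForm L k E) (B : PositiveForm L k E) (γ : E) (ζ : 𝕂)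
    (w : E × E) (s : 𝔞) : Prop where
  tau_eq : tau ζ = ζ
  re_pos : ∀ i, 0 < re (ζ i)
  mem_sphere : w ∈ sphereF h B ⊤
  mem_chamber : s ∈ chamber k
  eq : γ = ζ • η[w, s]

variable (h) in
/-- The radial scalar part `√(-⟨γ, γ⟩)`. -/
noncomputable def polarScalar (γ : E) : 𝕂 :=
  fun i => csqrt (-h.form γ γ i)

variable (h) in
/-- The normalized vector `γ / √(-⟨γ, γ⟩)`. -/
noncomputable def polarUnit (γ : E) : E :=
  (fun i => (polarScalar h γ i)⁻¹ : 𝕂) • γ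

variable (h B) in
/-- The coordinate `log t`. -/
noncomputable def polarLog (γ : E) : 𝔞 :=
  fun i => (arcosh √(B.quad (polarUnit h γ) i * B.quad (polarUnit h γ) i.rev) +
    (log (B.quad (polarUnit h γ) i) - log (B.quad (polarUnit h γ) i.rev)) / 2) / 2

local notation "ℓ" => polarLog h B

variable (h B) in
/-- The vector `t^τ γ`, for the normalized vector `γ`. -/
noncomputable def polarAux (γ : E) : E :=
  realCoe L (fun i => exp (ℓ γ i.rev)) • polarUnit h γ

variable (h B θ) in
/-- The coordinate `w`. -/
noncomputable def polarSphere (γ : E) : E × E :=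
  (realCoe L (fun i => (exp (ℓ γ i + ℓ γ i.rev) - 1)⁻¹) •
      (polarAux h B γ + θ (polarAux h B γ)),
    realCoe L (fun i => (exp (ℓ γ i + ℓ γ i.rev) + 1)⁻¹) •
      (polarAux h B γ - θ (polarAux h B γ)))

variable (h B) in
/-- The domain of regularity of the polar decomposition. -/
def polarDomain : Set E :=
  {γ | h.IsTimelike γ ∧
    ∀ i, 1 < B.quad (polarUnit h γ) i * B.quad (polarUnit h γ) i.rev}

theorem polarScalar_mul_self (hγ : h.IsTimelike γ) : polarScalar h γ * polarScalar h γ = -h.form γ γ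
    := by
  funext i
  refine csqrt_mul_self ?_
  simpa [sub_eq_add_neg] using hγ i

theorem re_polarScalar_pos (hγ : h.IsTimelike γ) (i : Fin k.card) : 0 < re
    (polarScalar h γ i) := by
  refine re_csqrt_pos ?_
  simpa [sub_eq_add_neg] using hγ i

theorem tau_csqrt (z : 𝕂) : tau (fun i => csqrt (z i)) = fun i => csqrt (tau z i) := by
  cases k
  · rfl
  · funext i
    exact (csqrt_star (z i)).symm
  · rfl

theorem tau_polarScalar (γ : E) : tau (polarScalar h γ) = polarScalar h γ := by
  have := tau_csqrt (-h.form γ γ)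
  rw [tau_neg, ← h.tau_symm] at this
  exact this

theorem tau_inv (z : 𝕂) : tau (fun i => (z i)⁻¹) = fun i => (tau z i)⁻¹ := by
  cases k
  · rfl
  · funext i
    simp [tau]
  · rfl

theorem polarScalar_smul_polarUnit (hγ : h.IsTimelike γ) : polarScalar h γ • polarUnit h γ = γ := by
  rw [polarUnit, smul_smul]
  have : polarScalar h γ * (fun i => (polarScalar h γ i)⁻¹ : 𝕂) = 1 := by
    funext i
    have h1 := re_polarScalar_pos hγ i
    have h2 : polarScalar h γ i ≠ 0 := by grind
    exact mul_inv_cancel₀ h2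
  rw [this, one_smul]

theorem form_polarUnit (hγ : h.IsTimelike γ) : h.form (polarUnit h γ) (polarUnit h γ) = -1 := by
  have h1 := polarScalar_mul_self hγ
  have hne : ∀ i, polarScalar h γ i ≠ 0 := by
    intro i h0
    have h1 := re_polarScalar_pos hγ i
    aesop
  rw [polarUnit, h.smul_left, h.smul_right, tau_inv, tau_polarScalar]
  funext i
  have h2 := congrFun h1 i
  simp only [Pi.mul_apply, Pi.neg_apply, Pi.one_apply] at h2 ⊢
  have h3 := hne i
  field_simp
  rw [sq, h2, neg_neg]

include c in
theorem IsCartan.form_etaF (hw : w ∈ 𝕊) (s : 𝔞) : h.form η[w, s] η[w, s] = -1 := by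
  obtain ⟨hu, hv, huu, hvv, huv⟩ := (c.mem_sphereF_top w).1 hw
  have e1 : h.form w.1 w.1 = 1 := by rw [c.form_eq', hu, huu]
  have e2 : h.form w.2 w.2 = -1 := by rw [c.form_eq', hv, map_neg, hvv]
  have e3 : h.form w.1 w.2 = 0 := by rw [c.form_eq', hv, map_neg, huv, neg_zero]
  have e4 : h.form w.2 w.1 = 0 := by rw [h.tau_symm, e3, tau_zero]
  rw [etaF_expPos]
  simp only [map_add, add_app, h.smul_left, h.smul_right, e1, e2, e3, e4, tau_realCoe]
  have : -1 = realCoe L (fun i : Fin k.card => (-1 : ℝ)) := by rw [realCoe_const]; simp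
  rw [this]
  simp only [mul_zero, add_zero, zero_add, mul_one, mul_neg, ← map_mul, ← map_neg, ← map_add]
  congr 1
  funext i
  have := hyp_mul_rev s i
  simp only [Pi.add_apply, Pi.mul_apply, Pi.neg_apply]
  linarith

include c in
theorem IsCartan.quad_etaF (hw : w ∈ 𝕊) (s : 𝔞) (i : Fin k.card) : B.quad η[w, s] i = exp
    (s i - s i.rev) * cosh (s i + s i.rev) := by
  obtain ⟨hu, hv, huu, hvv, huv⟩ := (c.mem_sphereF_top w).1 hw
  have hvu : B.form w.2 w.1 = 0 := by rw [B.conj_symm, huv, star_zero]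
  have : B.form η[w, s] η[w, s] =
      realCoe L fun i => exp (s i - s i.rev) * cosh (s i + s i.rev) := by
    rw [etaF_expPos]
    simp only [map_add, add_app, B.smul_left, B.smul_right, huu, hvv, huv, hvu,
      star_realCoe]
    simp only [mul_zero, add_zero, zero_add, mul_one, ← map_mul, ← map_add]
    congr 1
    funext i
    rw [← hyp_sq_add_sq]
    simp only [Pi.add_apply, Pi.mul_apply]
    ring
  rw [B.form_self] at this
  exact congrFun (realCoe_injective this) i

include c in
theorem IsCartan.theta_realCoe_smul (x : 𝔞) (v : E) : θ (realCoe L x • v) = realCoe L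
    (fun i => x i.rev) • θ v := by
  rw [c.theta_smul, sigma_realCoe]

namespace IsPolar

variable {γ : E} {ζ : Scalar L k} {w : E × E} {s : Fin k.card → ℝ}
  (hp : IsPolar h B γ ζ w s)

include c hp

theorem polarScalar_eq : polarScalar h γ = ζ := by
  funext i
  rw [polarScalar, hp.eq, h.smul_left, h.smul_right, c.form_etaF hp.mem_sphere, hp.tau_eq]
  simp only [Pi.mul_apply, Pi.neg_apply, Pi.one_apply, mul_neg, mul_one, neg_neg]
  exact csqrt_self_mul (hp.re_pos i)

theorem form_condition (i : Fin k.card) : 0 < ‖h.form γ γ i‖ - re (h.form γ γ i) := by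
  rw [hp.eq, h.smul_left, h.smul_right, c.form_etaF hp.mem_sphere, hp.tau_eq]
  have := norm_add_re_mul_self (ζ i)
  have h1 := hp.re_pos i
  simp only [Pi.mul_apply, Pi.neg_apply, Pi.one_apply, mul_neg, mul_one, norm_neg, map_neg,
    sub_neg_eq_add]
  rw [this]
  positivity

theorem polarUnit_eq : polarUnit h γ = η[w, s] := by
  rw [polarUnit, hp.polarScalar_eq c, hp.eq, smul_smul]
  have : (fun i => (ζ i)⁻¹ : 𝕂) * ζ = 1 := by
    funext i
    have h1 := hp.re_pos i
    have h2 : ζ i ≠ 0 := by grind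
    exact inv_mul_cancel₀ h2
  rw [this, one_smul]

theorem mem_polarDomain : γ ∈ polarDomain h B := by
  refine ⟨hp.form_condition c, fun i => ?_⟩
  rw [hp.polarUnit_eq c, c.quad_etaF hp.mem_sphere, c.quad_etaF hp.mem_sphere, rev_rev,
    mul_mul_mul_comm, ← exp_add, add_comm (s i.rev), sub_add_sub_cancel', sub_self,
    exp_zero, one_mul]
  have : 1 < cosh (s i + s i.rev) := Real.one_lt_cosh.2 (hp.mem_chamber i).ne'
  nlinarith

theorem polarLog_eq : ℓ γ = s := by
  funext i
  have hc : 0 < cosh (s i + s i.rev) := Real.cosh_pos _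
  have e1 : √(B.quad (polarUnit h γ) i * B.quad (polarUnit h γ) i.rev) =
      cosh (s i + s i.rev) := by
    rw [hp.polarUnit_eq c, c.quad_etaF hp.mem_sphere, c.quad_etaF hp.mem_sphere, rev_rev,
      mul_mul_mul_comm, ← exp_add, add_comm (s i.rev), sub_add_sub_cancel', sub_self,
      exp_zero, one_mul, Real.sqrt_mul_self hc.le]
  rw [polarLog, e1, Real.arcosh_cosh (hp.mem_chamber i).le, hp.polarUnit_eq c,
    c.quad_etaF hp.mem_sphere, c.quad_etaF hp.mem_sphere, rev_rev,
    Real.log_mul (exp_pos _).ne' hc.ne', add_comm (s i.rev),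
    Real.log_mul (exp_pos _).ne' hc.ne', Real.log_exp, Real.log_exp]
  ring

theorem polarAux_eq : polarAux h B γ = realCoe L (fun i => (exp (s i + s i.rev) - 1) / 2) • w.1
    + realCoe L (fun i => (exp (s i + s i.rev) + 1) / 2) • w.2 := by
  rw [polarAux, hp.polarUnit_eq c, hp.polarLog_eq c, etaF_expPos, smul_add, smul_smul, smul_smul,
    ← map_mul, ← map_mul]
  congr 3
  · funext i; exact exp_rev_mul_hypSub s i
  · funext i; exact exp_rev_mul_hypAdd s i

theorem polarSphere_eq : polarSphere h B θ γ = w := by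
  obtain ⟨hu, hv, -, -, -⟩ := (c.mem_sphereF_top w).1 hp.mem_sphere
  have hθ : θ (polarAux h B γ) = realCoe L (fun i => (exp (s i + s i.rev) - 1) / 2) • w.1 -
      realCoe L (fun i => (exp (s i + s i.rev) + 1) / 2) • w.2 := by
    rw [hp.polarAux_eq c, map_add, c.theta_realCoe_smul, c.theta_realCoe_smul, hu, hv, smul_neg,
      ← sub_eq_add_neg]
    grind
  have e1 : polarAux h B γ + θ (polarAux h B γ) =
      realCoe L (fun i => exp (s i + s i.rev) - 1) • w.1 := by
    rw [hθ, hp.polarAux_eq c, add_add_sub_cancel, ← add_smul, ← map_add]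
    congr 2; funext i; simp
  have e2 : polarAux h B γ - θ (polarAux h B γ) =
      realCoe L (fun i => exp (s i + s i.rev) + 1) • w.2 := by
    rw [hθ, hp.polarAux_eq c, add_sub_sub_cancel, ← add_smul, ← map_add]
    congr 2; funext i; simp
  rw [polarSphere, e1, e2, hp.polarLog_eq c, smul_smul, smul_smul, ← map_mul, ← map_mul]
  have e3 : (fun i => (exp (s i + s i.rev) - 1)⁻¹) * (fun i => exp (s i + s i.rev) - 1) =
      1 := by
    funext i
    have : 1 < exp (s i + s i.rev) := Real.one_lt_exp_iff.2 (hp.mem_chamber i)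
    exact inv_mul_cancel₀ (by linarith)
  have e4 : (fun i => (exp (s i + s i.rev) + 1)⁻¹) * (fun i => exp (s i + s i.rev) + 1) =
      1 := by
    funext i
    have : 0 < exp (s i + s i.rev) := exp_pos _
    exact inv_mul_cancel₀ (by linarith)
  aesop

end IsPolar

include c in
theorem isPolar_of_mem_polarDomain (hγ : γ ∈ polarDomain h B) : IsPolar h B γ (polarScalar h γ)
    (polarSphere h B θ γ) (ℓ γ) := by
  obtain ⟨hγ1, hγ2⟩ := hγ
  set g := polarUnit h γ with hg
  set s := ℓ γ with hs
  have hq : ∀ i, 0 < B.quad g i := by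
    intro i
    have h1 := hγ2 i
    refine lt_of_le_of_ne (c.quad_nonneg g i) fun h0 => ?_
    rw [← h0, zero_mul] at h1
    linarith
  have hsum : ∀ i, s i + s i.rev = arcosh √(B.quad g i * B.quad g i.rev) := by
    intro i
    rw [hs, polarLog, polarLog, rev_rev, ← hg, mul_comm (B.quad g i.rev)]
    ring
  have hdiff : ∀ i, s i - s i.rev = (log (B.quad g i) - log (B.quad g i.rev)) / 2 := by
    intro i
    rw [hs, polarLog, polarLog, rev_rev, ← hg, mul_comm (B.quad g i.rev)]
    ring
  have hone : ∀ i, 1 < √(B.quad g i * B.quad g i.rev) := fun i =>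
    Real.lt_sqrt_of_sq_lt (by simpa using hγ2 i)
  have hch : s ∈ chamber k := fun i => by grind [Real.arcosh_pos]
  have hQ : ∀ i, exp (2 * s i.rev) * B.quad g i =
      exp (s i + s i.rev) * cosh (s i + s i.rev) := by
    intro i
    have e1 : cosh (s i + s i.rev) = √(B.quad g i) * √(B.quad g i.rev) := by
      grind [Real.cosh_arcosh, Real.sqrt_mul]
    have e2 : exp (s i - s i.rev) = √(B.quad g i) / √(B.quad g i.rev) := by
      rw [hdiff, ← Real.log_div (hq i).ne' (hq i.rev).ne', ← Real.log_sqrt (div_pos (hq i) (hq _)).le,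
        Real.exp_log (Real.sqrt_pos.2 (div_pos (hq i) (hq _))), Real.sqrt_div (hq i).le]
    have e3 : exp (s i + s i.rev) = exp (2 * s i.rev) * exp (s i - s i.rev) := by
      rw [← exp_add]; congr 1; ring
    grind
  set p : 𝔞 := fun i => exp (s i + s i.rev) with hp
  have hprev : (fun i : Fin k.card => p i.rev) = p := by grind
  have hp1 : ∀ i, 1 < p i := fun i => Real.one_lt_exp_iff.2 (hch i)
  have hpc : ∀ i, 2 * (p i * cosh (s i + s i.rev)) = p i * p i + 1 := by
    intro i
    rw [Real.cosh_eq, Real.exp_neg]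
    grind
  set n := polarAux h B γ with hn
  have hn' : n = realCoe L (fun i => exp (s i.rev)) • g := rfl
  have hform : h.form n n = -realCoe L p := by
    rw [hn', h.smul_left, h.smul_right, form_polarUnit hγ1, tau_realCoe, mul_neg, mul_neg, mul_one,
      ← map_mul]
    congr 2
    funext i
    grind [Pi.mul_apply, rev_rev, exp_add, add_comm]
  have hpos : B.form n n = realCoe L fun i => p i * cosh (s i + s i.rev) := by
    rw [hn', B.smul_left, B.smul_right, B.form_self, star_realCoe, ← map_mul, ← map_mul]
    congr 1
    funext i
    simp only [Pi.mul_apply]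
    rw [← hQ i, ← mul_assoc, ← exp_add]
    congr 2; ring
  have h11 : B.form n (θ n) = -realCoe L p := by rw [← c.form_eq', hform]
  have h21 : B.form (θ n) n = -realCoe L p := by
    rw [c.pos_theta_left, hform, sigma_neg, sigma_realCoe, hprev]
  have h22 : B.form (θ n) (θ n) = realCoe L fun i => p i * cosh (s i + s i.rev) := by
    rw [c.pos_theta_theta, hpos, sigma_realCoe]
    congr 1; funext i
    have := congrFun hprev i
    simp [rev_rev, this, add_comm (s i.rev)]
  set a : 𝔞 := fun i => (p i - 1)⁻¹ with ha
  set b : 𝔞 := fun i => (p i + 1)⁻¹ with hb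
  have hws : polarSphere h B θ γ = (realCoe L a • (n + θ n), realCoe L b • (n - θ n)) := rfl
  have harev : (fun i : Fin k.card => a i.rev) = a := by
    funext i; simp only [ha, congrFun hprev i]
  have hbrev : (fun i : Fin k.card => b i.rev) = b := by
    funext i; simp only [hb, congrFun hprev i]
  have hmem : polarSphere h B θ γ ∈ 𝕊 := by
    rw [c.mem_sphereF_top, hws]
    refine ⟨?_, ?_, ?_, ?_, ?_⟩
    · simp only [c.theta_realCoe_smul, harev, map_add, c.theta_theta, add_comm]
    · simp only [c.theta_realCoe_smul, hbrev, map_sub, c.theta_theta, ← smul_neg, neg_sub]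
    · simp only [B.smul_left, B.smul_right, star_realCoe, map_add, add_app, hpos, h11,
        h21, h22]
      simp only [← map_neg, ← map_mul, ← map_add]
      rw [← map_one (realCoe L)]
      congr 1
      funext i
      have h1 := hp1 i
      have h2 := hpc i
      simp only [Pi.mul_apply, Pi.add_apply, Pi.neg_apply, Pi.one_apply, ha]
      have h3 : p i - 1 ≠ 0 := by linarith
      field_simp
      linarith
    · simp only [B.smul_left, B.smul_right, star_realCoe, map_sub, sub_app, hpos, h11,
        h21, h22]
      simp only [← map_neg, ← map_mul, ← map_sub]
      rw [← map_one (realCoe L)]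
      congr 1
      funext i
      have h1 := hp1 i
      have h2 := hpc i
      simp only [Pi.mul_apply, Pi.sub_apply, Pi.neg_apply, Pi.one_apply, hb]
      have h3 : p i + 1 ≠ 0 := by linarith
      field_simp
      linarith
    · simp only [B.smul_left, B.smul_right, map_add, map_sub, add_app, hpos, h11,
        h21, h22]
      ring
  refine ⟨tau_polarScalar γ, re_polarScalar_pos hγ1, hmem, hch, ?_⟩
  have : etaF (L := L) (polarSphere h B θ γ) (expPos s) = g := by
    have hcancel : ∀ v : E, realCoe L (fun i => exp (s i.rev)) • v = n → v = g := by
      intro v hv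
      have h1 := sub_eq_zero.2 (hv.trans hn')
      rw [← smul_sub] at h1
      exact sub_eq_zero.1 (eq_zero_of_realCoe_smul (fun i => (exp_pos _).ne') h1)
    apply hcancel
    rw [etaF_expPos, smul_add, smul_smul, smul_smul, ← map_mul, ← map_mul, hws]
    simp only [smul_smul, ← map_mul]
    have e1 : ((fun i => exp (s i.rev)) * hypSub s * a) = fun _ => 2⁻¹ := by
      funext i
      have h3 : p i - 1 ≠ 0 := by linarith [hp1 i]
      simp only [Pi.mul_apply, ha, exp_rev_mul_hypSub]
      grind
    have e2 : ((fun i => exp (s i.rev)) * hypAdd s * b) = fun _ => 2⁻¹ := by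
      funext i
      have h3 : p i + 1 ≠ 0 := by linarith [hp1 i]
      simp only [Pi.mul_apply, hb, exp_rev_mul_hypAdd]
      grind
    rw [e1, e2, realCoe_const, algebraMap_smul, algebraMap_smul, ← smul_add, add_add_sub_cancel,
      ← two_smul ℝ n, smul_smul]
    norm_num
  rw [this, hg, polarScalar_smul_polarUnit hγ1]

section GramDeterminants

variable {V W ι ι' : Type*} [AddCommGroup V] [Module ℝ V] [AddCommGroup W] [Module ℝ W] [Fintype ι]
  [DecidableEq ι] [Fintype ι'] [DecidableEq ι']

theorem det_toMatrix_comp_endomorphism (b : Basis ι ℝ V) (g : BilinForm ℝ V)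
    (A : V →ₗ[ℝ] V) : (toMatrix b (g.comp A A)).det = det A ^ 2 *
    (toMatrix b g).det := by
  rw [LinearMap.BilinForm.toMatrix_comp b b, Matrix.det_mul, Matrix.det_mul, Matrix.det_transpose,
    LinearMap.det_toMatrix]
  ring

theorem exists_det_toMatrix_eq (b : Basis ι ℝ V) (b' : Basis ι' ℝ V) : ∃ c : ℝ, c ≠ 0
    ∧ ∀ g : BilinForm ℝ V, (toMatrix b' g).det = c ^ 2 *
    (toMatrix b g).det := by
  set e := b.equiv b' (b.indexEquiv b') with he
  refine ⟨det (e : V →ₗ[ℝ] V), (LinearEquiv.isUnit_det' e).ne_zero, fun g => ?_⟩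
  rw [← det_toMatrix_comp_endomorphism, ← Matrix.det_submatrix_equiv_self (b.indexEquiv b')]
  congr 1
  aesop

theorem det_toMatrix_ne_zero (b : Basis ι ℝ V) (g : BilinForm ℝ V)
    (hg : ∀ x, (∀ y, g x y = 0) → x = 0) : (toMatrix b g).det ≠ 0 := by
  intro h0
  obtain ⟨x, hx, hx0⟩ := Matrix.exists_vecMul_eq_zero_iff.2 h0
  apply hx
  have h1 : b.equivFun.symm x = 0 := by
    apply hg
    intro y
    have := LinearMap.BilinForm.dotProduct_toMatrix_mulVec b g x (b.equivFun y)
    rw [Matrix.dotProduct_mulVec, hx0, LinearEquiv.symm_apply_apply, zero_dotProduct] at this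
    exact this.symm
  exact (LinearEquiv.map_eq_zero_iff _).1 h1

theorem det_toMatrix_pos (b : Basis ι ℝ V) (g : BilinForm ℝ V)
    (hs : ∀ x y, g x y = g y x) (hg : ∀ x, x ≠ 0 → 0 < g x x) : 0 <
    (toMatrix b g).det := by
  apply Matrix.PosDef.det_pos
  refine Matrix.PosDef.of_dotProduct_mulVec_pos ?_ fun x hx => ?_
  · ext i j
    aesop
  · rw [star_trivial, LinearMap.BilinForm.dotProduct_toMatrix_mulVec]
    exact hg _ fun h0 => hx ((LinearEquiv.map_eq_zero_iff _).1 h0)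

end GramDeterminants

/-- Scalar multiplication as an `ℝ`-bilinear map. -/
noncomputable def smulBilin (L : Type*) [RCLike L] (k : ScalarKind) (E : Type*)
    [NormedAddCommGroup E] [NormedSpace ℝ E] [Module (Scalar L k) E]
    [IsScalarTower ℝ (Scalar L k) E] : Scalar L k →ₗ[ℝ] E →ₗ[ℝ] E :=
  mk₂ ℝ (fun a v => a • v) (fun a b v => add_smul a b v) (fun c a v => smul_assoc c a v)
    (fun a v w => smul_add a v w) (fun c a v => by module)

@[simp] theorem smulBilin_apply (a : 𝕂) (v : E) : smulBilin L k E a v = a • v := rfl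

/-- Scalar multiplication as a continuous bilinear map. -/
noncomputable def smulCLM (L : Type*) [RCLike L] (k : ScalarKind) (E : Type*) [NormedAddCommGroup E]
    [NormedSpace ℝ E] [Module (Scalar L k) E] [IsScalarTower ℝ (Scalar L k) E]
    [FiniteDimensional ℝ E] : Scalar L k →L[ℝ] E →L[ℝ] E :=
  (smulBilin L k E).toContinuousBilinearMap

@[simp] theorem smulCLM_apply [FiniteDimensional ℝ E] (a : 𝕂) (v : E) :
    smulCLM L k E a v = a • v := rfl

/-- The derivative of `s ↦ (t - t^{-τ})/2` at `t = exp s`. -/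
noncomputable def hypSubDir (s ξ : 𝔞) : 𝔞 :=
  fun i => (exp (s i) * ξ i + exp (-s i.rev) * ξ i.rev) / 2

/-- The derivative of `s ↦ (t + t^{-τ})/2` at `t = exp s`. -/
noncomputable def hypAddDir (s ξ : 𝔞) : 𝔞 :=
  fun i => (exp (s i) * ξ i - exp (-s i.rev) * ξ i.rev) / 2

/-- The derivative of `(w, s) ↦ η(w, exp s)`. -/
noncomputable def etaDir (L : Type*) [RCLike L] {k : ScalarKind} {E : Type*} [NormedAddCommGroup E]
    [NormedSpace ℝ E] [Module (Scalar L k) E] [IsScalarTower ℝ (Scalar L k) E] (w : E × E)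
    (s : Fin k.card → ℝ) : (E × E) × (Fin k.card → ℝ) →ₗ[ℝ] E where
  toFun z := realCoe L (hypSub s) • z.1.1 + realCoe L (hypAdd s) • z.1.2 +
    (realCoe L (hypSubDir s z.2) • w.1 + realCoe L (hypAddDir s z.2) • w.2)
  map_add' z z' := by
    have e1 : hypSubDir s (z.2 + z'.2) = hypSubDir s z.2 + hypSubDir s z'.2 := by
      funext i; simp only [hypSubDir, Pi.add_apply]; ring
    have e2 : hypAddDir s (z.2 + z'.2) = hypAddDir s z.2 + hypAddDir s z'.2 := by
      funext i; simp only [hypAddDir, Pi.add_apply]; ring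
    simp only [Prod.fst_add, snd_add, e1, e2, map_add, add_smul, smul_add]
    abel
  map_smul' c z := by
    have e1 : hypSubDir s (c • z.2) = c • hypSubDir s z.2 := by
      funext i; simp only [hypSubDir, Pi.smul_apply, smul_eq_mul]; ring
    have e2 : hypAddDir s (c • z.2) = c • hypAddDir s z.2 := by
      funext i; simp only [hypAddDir, Pi.smul_apply, smul_eq_mul]; ring
    have e3 : ∀ (a : Scalar L k) (v : E), a • c • v = c • a • v := fun a v =>
      map_smul (smulBilin L k E a) c v
    aesop

theorem etaDir_apply (w : E × E) (s : 𝔞) (z : (E × E) × 𝔞) : etaDir L w s z = realCoe L (hypSub s) •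
    z.1.1 + realCoe L (hypAdd s) • z.1.2 +
    (realCoe L (hypSubDir s z.2) • w.1 + realCoe L (hypAddDir s z.2) • w.2) := rfl

theorem hasFDerivAt_hypSub (s : 𝔞) : ∃ D : 𝔞 →L[ℝ] 𝔞, HasFDerivAt hypSub D s ∧ ∀ ξ, D ξ = hypSubDir
    s ξ := by
  have h1 : ∀ i, HasFDerivAt (fun s : 𝔞 => hypSub s i)
      ((2 : ℝ)⁻¹ • (exp (s i) • ContinuousLinearMap.proj (R := ℝ) (φ := fun _ => ℝ) i -
        exp (-s i.rev) • -ContinuousLinearMap.proj (R := ℝ) (φ := fun _ => ℝ) i.rev)) s := by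
    intro i
    have := (((hasFDerivAt_apply i s).exp).sub ((hasFDerivAt_apply i.rev s).neg.exp)).const_mul
      (2 : ℝ)⁻¹
    simp_all [hypSub, div_eq_inv_mul, Pi.sub_apply, Pi.neg_apply]
  refine ⟨ContinuousLinearMap.pi fun i => _, hasFDerivAt_pi.2 h1, fun ξ => ?_⟩
  funext i
  simp [hypSubDir, div_eq_inv_mul, mul_add]

theorem hasFDerivAt_hypAdd (s : 𝔞) : ∃ D : 𝔞 →L[ℝ] 𝔞, HasFDerivAt hypAdd D s ∧ ∀ ξ, D ξ = hypAddDir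
    s ξ := by
  have h1 : ∀ i, HasFDerivAt (fun s : 𝔞 => hypAdd s i)
      ((2 : ℝ)⁻¹ • (exp (s i) • ContinuousLinearMap.proj (R := ℝ) (φ := fun _ => ℝ) i +
        exp (-s i.rev) • -ContinuousLinearMap.proj (R := ℝ) (φ := fun _ => ℝ) i.rev)) s := by
    intro i
    have := (((hasFDerivAt_apply i s).exp).add ((hasFDerivAt_apply i.rev s).neg.exp)).const_mul
      (2 : ℝ)⁻¹
    simp_all [hypAdd, div_eq_inv_mul, Pi.add_apply, Pi.neg_apply]
  refine ⟨ContinuousLinearMap.pi fun i => _, hasFDerivAt_pi.2 h1, fun ξ => ?_⟩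
  funext i
  simp [hypAddDir, div_eq_inv_mul, sub_eq_add_neg, mul_add]

/-- The inclusion of `ℝ`-vectors in `𝕂` as a continuous linear map. -/
noncomputable def realCoeCLM (L : Type*) [RCLike L] (k : ScalarKind) : (Fin k.card → ℝ) →L[ℝ] Scalar
    L k :=
  toContinuousLinearMap (realCoe L (k := k)).toLinearMap

theorem hasFDerivAt_etaF [FiniteDimensional ℝ E] (w : E × E) (s : 𝔞) : HasFDerivAt
    (fun q : (E × E) × 𝔞 => etaF (L := L) q.1 (expPos q.2))
      (toContinuousLinearMap (etaDir L w s)) (w, s) := by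
  obtain ⟨D1, hD1, hD1'⟩ := hasFDerivAt_hypSub s
  obtain ⟨D2, hD2, hD2'⟩ := hasFDerivAt_hypAdd s
  have hs : HasFDerivAt (fun q : (E × E) × 𝔞 => q.2)
    (ContinuousLinearMap.snd ℝ (E × E) 𝔞) (w, s) := hasFDerivAt_snd
  have hw : HasFDerivAt (fun q : (E × E) × 𝔞 => q.1)
    (ContinuousLinearMap.fst ℝ (E × E) 𝔞) (w, s) := hasFDerivAt_fst
  have h1 := ((realCoeCLM L k).hasFDerivAt (x := hypSub s)).comp (w, s)
    (HasFDerivAt.comp (w, s) (g := hypSub) hD1 hs)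
  have h2 := ((realCoeCLM L k).hasFDerivAt (x := hypAdd s)).comp (w, s)
    (HasFDerivAt.comp (w, s) (g := hypAdd) hD2 hs)
  have h3 := (smulCLM L k E).hasFDerivAt_of_bilinear h1 hw.fst
  have h4 := (smulCLM L k E).hasFDerivAt_of_bilinear h2 hw.snd
  have h5 := h3.add h4
  refine (h5.congr_of_eventuallyEq (Filter.Eventually.of_forall fun q => ?_)).congr_fderiv ?_
  · rw [etaF_expPos]; rfl
  · refine ContinuousLinearMap.ext fun z => ?_
    change (realCoe L (hypSub s) • z.1.1 + realCoe L (D1 z.2) • w.1) +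
      (realCoe L (hypAdd s) • z.1.2 + realCoe L (D2 z.2) • w.2) = etaDir L w s z
    rw [hD1', hD2', etaDir_apply]
    abel

theorem posFlow_expPos (s ξ : 𝔞) : posFlow (expPos s) ξ = expPos (s + ξ) := by
  funext i
  exact Subtype.ext (exp_add _ _).symm

theorem etaDeriv_expPos [FiniteDimensional ℝ E] (w : E × E) (s : 𝔞) (z : (E × E) × 𝔞) : etaDeriv L w
    (expPos s) z = etaDir L w s z := by
  have h1 : HasDerivAt (fun x : ℝ => (w, s) + x • z) z 0 := by
    have := ((hasDerivAt_id (0 : ℝ)).smul_const z).const_add (w, s)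
    simpa using this
  have h2 : HasFDerivAt (fun q : (E × E) × 𝔞 => etaF (L := L) q.1 (expPos q.2))
      (toContinuousLinearMap (etaDir L w s)) ((w, s) + (0 : ℝ) • z) := by
    rw [zero_smul, add_zero]; exact hasFDerivAt_etaF w s
  have h3 := h2.comp_hasDerivAt (0 : ℝ) h1
  rw [etaDeriv]
  refine Eq.trans ?_ h3.deriv
  congr 1
  funext x
  rw [posFlow_expPos]
  rfl

section EtaJacobian

variable (h B)

/-- The real bilinear form given by the normalized trace of `⟨ , ⟩`. -/
noncomputable def HermitianForm.trace : BilinForm ℝ E := h.form.compr₂ (normTraceLinear L k)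

theorem HermitianForm.trace_apply (u v : E) : h.trace u v = normTrace (h.form u v) := rfl

/-- The inclusion of the tangent space. -/
def tangentIncl (F : Submodule 𝕂 E) (w : E × E) : TangentSK h B F w →ₗ[ℝ] (E × E) × 𝔞 :=
  (tangentF h B F w).subtype.prodMap LinearMap.id

/-- The pull-back of the pseudo-Riemannian metric along `η`. -/
noncomputable def etaGram (F : Submodule 𝕂 E) (w : E × E) (s : 𝔞) : BilinForm ℝ
    (TangentSK h B F w) :=
  h.trace.comp (etaDir L w s ∘ₗ tangentIncl h B F w) (etaDir L w s ∘ₗ tangentIncl h B F w)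

/-- The Riemannian metric as a bilinear form. -/
noncomputable def metricBilin (F : Submodule 𝕂 E) (w : E × E) : BilinForm ℝ
    (TangentSK h B F w) :=
  mk₂ ℝ (metricSK h B F w)
    (fun a a' b => by
      have e : (a + a').1.1.1 + (a + a').1.1.2 = (a.1.1.1 + a.1.1.2) + (a'.1.1.1 + a'.1.1.2) := by
        simp only [Prod.fst_add, coe_add, snd_add]; abel
      simp only [metricSK, e, map_add, add_app, normTrace_add, snd_add,
        Pi.add_apply, add_mul, sum_add_distrib]
      abel)
    (fun c a b => by
      have e : (c • a).1.1.1 + (c • a).1.1.2 = c • (a.1.1.1 + a.1.1.2) := by simp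
      have e2 := fun z => map_smul (normTraceLinear L k) c z
      simp only [normTraceLinear_apply] at e2
      simp only [metricSK, e, map_smul, LinearMap.smul_apply, e2, smul_snd,
        Pi.smul_apply, smul_eq_mul, mul_add, Finset.mul_sum, mul_assoc])
    (fun a b b' => by
      have e : (b + b').1.1.1 + (b + b').1.1.2 = (b.1.1.1 + b.1.1.2) + (b'.1.1.1 + b'.1.1.2) := by
        simp only [Prod.fst_add, coe_add, snd_add]; abel
      simp only [metricSK, e, map_add, add_app, normTrace_add, snd_add,
        Pi.add_apply, mul_add, sum_add_distrib]
      abel)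
    (fun c a b => by
      have e : (c • b).1.1.1 + (c • b).1.1.2 = c • (b.1.1.1 + b.1.1.2) := by simp
      have e2 := fun z => map_smul (normTraceLinear L k) c z
      simp only [normTraceLinear_apply] at e2
      simp only [metricSK, e, map_smul, LinearMap.smul_apply, e2, smul_snd,
        Pi.smul_apply, smul_eq_mul, mul_add, Finset.mul_sum, mul_left_comm])

theorem metricBilin_apply (F : Submodule 𝕂 E) (w : E × E) (a b : TangentSK h B F w) : metricBilin h
    B F w a b = metricSK h B F w a b := rfl

variable [Module.Finite (Scalar L k) E]

theorem jacobianEta_eq_of_basis (F : Submodule 𝕂 E) (w : E × E) (s : 𝔞) {ι : Type*} [Fintype ι]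
    [DecidableEq ι] (b : Basis ι ℝ (TangentSK h B F w)) : jacobianEta h B F w (expPos s) =
    √|(toMatrix b (etaGram h B F w s)).det| /
    √(toMatrix b (metricBilin h B F w)).det := by
  have : FiniteDimensional ℝ E := Module.Finite.trans 𝕂 E
  obtain ⟨c, hc, hdet⟩ := exists_det_toMatrix_eq b (finBasis ℝ (TangentSK h B F w))
  have e1 : jacobianEta h B F w (expPos s) =
      √|(toMatrix (finBasis ℝ (TangentSK h B F w))
        (etaGram h B F w s)).det| /
      √(toMatrix (finBasis ℝ (TangentSK h B F w))
        (metricBilin h B F w)).det := by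
    rw [jacobianEta]
    congr 4
    · ext i j
      rw [toMatrix_apply, Matrix.of_apply, etaDeriv_expPos, etaDeriv_expPos]
      rfl
    · ext i j
      rw [toMatrix_apply]
      rfl
  rw [e1, hdet, hdet, abs_mul, abs_of_nonneg (sq_nonneg c), Real.sqrt_mul (sq_nonneg c),
    Real.sqrt_mul (sq_nonneg c)]
  exact mul_div_mul_left _ _ (by positivity)

end EtaJacobian

section PolarJacobian

include c in
theorem IsCartan.mem_tangentF_top (w z : E × E) : z ∈ tangentF h B ⊤ w ↔ θ z.1 = z.1 ∧ θ z.2 = -z.2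
    ∧ B.form z.1 w.1 + B.form w.1 z.1 = 0 ∧ B.form z.2 w.2 + B.form w.2 z.2 = 0 ∧ B.form z.1 w.2 +
    B.form w.1 z.2 = 0 := by
  change (z.1 ∈ thetaEigen h B ⊤ 1 ∧ z.2 ∈ thetaEigen h B ⊤ (-1) ∧ _) ↔ _
  simp [c.mem_thetaEigen_top, one_smul, neg_one_smul]

/-- The `τ`-fixed scalars. -/
noncomputable def tauFixed (L : Type*) [RCLike L] (k : ScalarKind) : Submodule ℝ (Scalar L k) :=
  ker (tauLinear L k - LinearMap.id)

theorem mem_tauFixed (z : 𝕂) : z ∈ tauFixed L k ↔ tau z = z := by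
  rw [tauFixed, mem_ker, sub_app, sub_eq_zero]; rfl

theorem polar_injective_aux {s ξ : 𝔞} (hs : s ∈ chamber k) {ζ q q₂ w : 𝕂} (hζ : tau ζ = ζ)
    (hq : sigma q = q) (hq' : star q = -q) (hq₂ : sigma q₂ = q₂) (hq₂' : star q₂ = -q₂)
    (hw : sigma w = -w) (E1 : realCoe L (hypSub s) * q - realCoe L (hypAdd s) * star w + realCoe L
    (hypSubDir s ξ) + ζ * realCoe L (hypSub s) = 0) (E2 : realCoe L (hypSub s) * w + realCoe L
    (hypAdd s) * q₂ + realCoe L (hypAddDir s ξ) + ζ * realCoe L (hypAdd s) = 0) : ζ = 0 ∧ ξ = 0 :=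
    by
  set p : 𝔞 := fun i => exp (s i + s i.rev) with hp
  set D := realCoe L (fun i => exp (s i.rev)) with hD
  set P := realCoe L p with hP
  set X := realCoe L ξ with hX
  set X' := realCoe L (fun i => ξ i.rev) with hX'
  have hp1 : ∀ i, 1 < p i := fun i => Real.one_lt_exp_iff.2 (hs i)
  have hexp : ∀ i : Fin k.card, exp (s i.rev) * exp (s i) = p i := by
    intro i; rw [← exp_add, add_comm]
  have hexp' : ∀ i : Fin k.card, exp (s i.rev) * exp (-s i.rev) = 1 := by
    intro i; rw [← exp_add]; simp
  have two : (2 : 𝕂) = realCoe L 2 := (map_ofNat (realCoe L) 2).symm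
  have e : ∀ f g : 𝔞, (∀ i, 2 * (exp (s i.rev) * f i) = g i) →
      2 * D * realCoe L f = realCoe L g := fun f g hfg => by
    rw [two, mul_assoc, ← map_mul, ← map_mul]
    exact congrArg _ (funext hfg)
  have e1 : 2 * D * realCoe L (hypSub s) = P - 1 := by
    rw [e _ (p - 1) fun i => by rw [exp_rev_mul_hypSub]; simp [hp]; ring, map_sub, map_one]
  have e2 : 2 * D * realCoe L (hypAdd s) = P + 1 := by
    rw [e _ (p + 1) fun i => by rw [exp_rev_mul_hypAdd]; simp [hp]; ring, map_add, map_one]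
  have e3 : 2 * D * realCoe L (hypSubDir s ξ) = P * X + X' := by
    rw [hP, ← map_mul, ← map_add]
    refine e _ _ fun i => ?_
    simp only [Pi.mul_apply, Pi.add_apply, hypSubDir]
    linear_combination ξ i * hexp i + ξ i.rev * hexp' i
  have e4 : 2 * D * realCoe L (hypAddDir s ξ) = P * X - X' := by
    rw [hP, ← map_mul, ← map_sub]
    refine e _ _ fun i => ?_
    simp only [Pi.mul_apply, Pi.sub_apply, hypAddDir]
    linear_combination ξ i * hexp i - ξ i.rev * hexp' i
  have F1 : (P - 1) * q - (P + 1) * star w + (P * X + X') + (P - 1) * ζ = 0 := by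
    linear_combination 2 * D * E1 - (q + ζ) * e1 + star w * e2 - e3
  have F2 : (P - 1) * w + (P + 1) * q₂ + (P * X - X') + (P + 1) * ζ = 0 := by
    linear_combination 2 * D * E2 - w * e1 - (q₂ + ζ) * e2 - e4
  have sP : sigma P = P := by simp [hP, sigma_realCoe, hp, rev_rev, add_comm]
  have sX : sigma X = X' := sigma_realCoe ξ
  have sX' : sigma X' = X := by rw [← sX, sigma_sigma]
  have tP : star P = P := star_realCoe _
  have tX : star X = X := star_realCoe _
  have tX' : star X' = X' := star_realCoe _
  have hsw : sigma (star w) = -star w := by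
    have := congrArg star hw
    rw [star_sigma, star_neg] at this
    rw [sigma_star, this]
  have sζ : sigma ζ = star ζ := by rw [sigma, hζ]
  have G1 : (P - 1) * q + (P + 1) * star w + (P * X' + X) + (P - 1) * star ζ = 0 := by
    have := congrArg sigma F1
    simp only [sigma_add, sigma_sub, sigma_mul, sigma_one, sigma_zero, sP, sX, sX', hq, hsw, sζ] at this
    linear_combination this
  have G2 : -(P - 1) * w + (P + 1) * q₂ + (P * X' - X) + (P + 1) * star ζ = 0 := by
    have := congrArg sigma F2
    simp only [sigma_add, sigma_sub, sigma_mul, sigma_one, sigma_zero, sP, sX, sX', hq₂, hw, sζ] at this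
    linear_combination this
  have half : ∀ y z : 𝕂, 2 * y + z = 0 → star y = -y → star z = z → z = 0 :=
    fun y z h1 hy hz => by
    have h2 := congrArg star h1
    rw [star_add, star_mul, star_ofNat, hy, hz, star_zero] at h2
    exact eq_zero_of_realCoe_mul (fun _ => two_ne_zero) (two ▸ by linear_combination h1 + h2)
  have H1 : (P + 1) * (X + X') + (P - 1) * (ζ + star ζ) = 0 :=
    half ((P - 1) * q) _ (by linear_combination F1 + G1) (by simp [tP, hq', mul_comm])
      (by simp [tP, tX, tX', mul_comm, add_comm])
  have H2 : (P - 1) * (X + X') + (P + 1) * (ζ + star ζ) = 0 :=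
    half ((P + 1) * q₂) _ (by linear_combination F2 + G2) (by simp [tP, hq₂', mul_comm])
      (by simp [tP, tX, tX', mul_comm, add_comm])
  have h4P : ∀ z : 𝕂, 4 * P * z = 0 → z = 0 := by
    intro z hz
    have : (4 : 𝕂) * P = realCoe L (4 * p) := by
      rw [map_mul, map_ofNat]
    rw [this] at hz
    refine eq_zero_of_realCoe_mul (fun i => ?_) hz
    have := hp1 i
    simp only [Pi.mul_apply, Pi.ofNat_apply]
    positivity
  have Z0 : ζ + star ζ = 0 := h4P _ (by linear_combination (P + 1) * H2 - (P - 1) * H1)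
  have X0 : X + X' = 0 := h4P _ (by linear_combination (P + 1) * H1 - (P - 1) * H2)
  set R := (X - X') + (ζ - star ζ) with hR
  have K1 : (P - 1) * R = 2 * (P + 1) * star w := by
    linear_combination F1 - G1
  have K2 : (P + 1) * R = -2 * (P - 1) * w := by
    linear_combination F2 - G2
  have hw0 : w = 0 := by
    funext i
    have k1 := congrFun K1 i
    have k2 := congrFun K2 i
    simp only [Pi.mul_apply, Pi.sub_apply, Pi.add_apply, Pi.one_apply, Pi.star_apply,
      Pi.ofNat_apply, Pi.neg_apply, hP, realCoe_apply] at k1 k2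
    have n1 := congrArg norm k1
    have n2 := congrArg norm k2
    have g1 : ‖((p i : ℝ) : L) - 1‖ = p i - 1 := by
      rw [← RCLike.ofReal_one, ← RCLike.ofReal_sub, RCLike.norm_ofReal, abs_of_pos (by linarith [hp1 i])]
    have g2 : ‖((p i : ℝ) : L) + 1‖ = p i + 1 := by
      rw [← RCLike.ofReal_one, ← RCLike.ofReal_add, RCLike.norm_ofReal, abs_of_pos (by linarith [hp1 i])]
    simp only [norm_mul, norm_neg, norm_star, g1, g2, RCLike.norm_ofNat] at n1 n2
    have h5 : 4 * p i * ‖w i‖ = 0 := by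
      have h6 : (p i - 1) * ((p i + 1) * ‖R i‖) = (p i + 1) * ((p i - 1) * ‖R i‖) := by ring
      have h7 : 2 * (p i - 1) ^ 2 * ‖w i‖ = 2 * (p i + 1) ^ 2 * ‖w i‖ := by
        linear_combination (p i + 1) * n1 - (p i - 1) * n2
      linear_combination (1 / 2 : ℝ) * (-h7)
    have h8 : ‖w i‖ = 0 := by
      rcases mul_eq_zero.1 h5 with h | h
      · have := hp1 i; linarith
      · exact h
    simpa using h8
  have R0 : R = 0 := by
    have h1 : realCoe L (p + 1) * R = 0 := by
      rw [map_add, map_one, ← hP, K2, hw0, mul_zero]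
    exact eq_zero_of_realCoe_mul (fun i => by
      have := hp1 i; simp only [Pi.add_apply, Pi.one_apply]; linarith) h1
  have R0' : (X - X') - (ζ - star ζ) = 0 := by
    have := congrArg star R0
    rw [hR] at this
    simp only [star_add, star_sub, tX, tX', star_star, star_zero] at this
    linear_combination this
  constructor
  · have : 4 * ζ = 0 := by linear_combination 2 * Z0 + R0 - R0'
    rw [← map_ofNat (realCoe L) 4] at this
    exact eq_zero_of_realCoe_mul (fun i => four_ne_zero) this
  · have : 4 * X = 0 := by linear_combination 2 * X0 + R0 + R0'
    rw [← map_ofNat (realCoe L) 4] at this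
    have := eq_zero_of_realCoe_mul (fun i => four_ne_zero) this
    exact realCoe_injective (by rw [← hX, this, map_zero])

include c in
theorem IsCartan.tangentF_relations {w z : E × E} (hw : w ∈ 𝕊) (hz : z ∈ tangentF h B ⊤ w) :
    (B.form w.2 w.1 = 0 ∧ B.form z.2 w.1 = -star (B.form z.1 w.2)) ∧
    (sigma (B.form z.1 w.1) = B.form z.1 w.1 ∧ star (B.form z.1 w.1) = -B.form z.1 w.1) ∧
    (sigma (B.form z.2 w.2) = B.form z.2 w.2 ∧ star (B.form z.2 w.2) = -B.form z.2 w.2) ∧ sigma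
    (B.form z.1 w.2) = -B.form z.1 w.2 := by
  obtain ⟨hu, hv, -, -, huv⟩ := (c.mem_sphereF_top w).1 hw
  obtain ⟨hx, hy, hxu, hyv, hxv⟩ := (c.mem_tangentF_top w z).1 hz
  have h1 : B.form w.2 w.1 = 0 := by rw [B.conj_symm, huv, star_zero]
  have h2 : B.form z.2 w.1 + B.form w.2 z.1 = 0 := by
    rw [B.conj_symm, B.conj_symm w.2, ← star_add, add_comm, hxv, star_zero]
  simp only [← B.conj_symm, eq_neg_iff_add_eq_zero, ← c.pos_theta_theta, hx, hy, hu, hv]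
  simp [add_comm (B.form w.1 z.1), add_comm (B.form w.2 z.2), *]

variable (h B) in
/-- The derivative of `(ζ, w, s) ↦ ζ η(w, exp s)` at `ζ = 1`. -/
noncomputable def polarDir (w : E × E) (s : 𝔞) : tauFixed L k × TangentSK h B ⊤ w →ₗ[ℝ] E :=
  LinearMap.coprod ((smulBilin L k E).flip η[w, s] ∘ₗ (tauFixed L k).subtype)
    (etaDir L w s ∘ₗ tangentIncl h B ⊤ w)

theorem polarDir_apply (w : E × E) (s : 𝔞) (z : tauFixed L k × TangentSK h B ⊤ w) : polarDir h B w s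
    z = (z.1 : 𝕂) • η[w, s] + etaDir L w s (tangentIncl h B ⊤ w z.2) := rfl

include c in
theorem IsCartan.polarDir_injective (hw : w ∈ 𝕊) {s : 𝔞} (hs : s ∈ chamber k) : Injective
    (polarDir h B w s) := by
  rw [injective_iff_map_eq_zero]
  rintro ⟨⟨ζ, hζ⟩, ⟨⟨z, hz⟩, ξ⟩⟩ h0
  rw [mem_tauFixed] at hζ
  obtain ⟨hu, hv, huu, hvv, huv⟩ := (c.mem_sphereF_top w).1 hw
  obtain ⟨hx, hy, hxu, hyv, hxv⟩ := (c.mem_tangentF_top w z).1 hz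
  have h0' : ζ • η[w, s] + etaDir L w s (z, ξ) = 0 := h0
  rw [etaDir_apply, etaF_expPos] at h0'
  obtain ⟨⟨hvu, hyu⟩, ⟨hq, hq'⟩, ⟨hq₂, hq₂'⟩, hwσ⟩ := c.tangentF_relations hw hz
  have E1 := congrArg (fun x => B.form x w.1) h0'
  have E2 := congrArg (fun x => B.form x w.2) h0'
  simp only [map_add, add_app, B.smul_left, smul_add, map_zero, LinearMap.zero_apply,
    huu, hvv, huv, hvu, hyu] at E1 E2
  obtain ⟨rfl, rfl⟩ := polar_injective_aux hs hζ hq hq' hq₂ hq₂' hwσ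
    (by linear_combination E1) (by linear_combination E2)
  have d1 : hypSubDir s 0 = 0 := by funext i; simp [hypSubDir]
  have d2 : hypAddDir s 0 = 0 := by funext i; simp [hypAddDir]
  simp only [zero_smul, zero_add, d1, d2, map_zero, add_zero] at h0'
  set a : 𝔞 := fun i => (exp (s i + s i.rev) - 1) / 2 with ha
  set b : 𝔞 := fun i => (exp (s i + s i.rev) + 1) / 2 with hb
  have h1 : realCoe L a • z.1 + realCoe L b • z.2 = 0 := by
    have := congrArg (fun x => realCoe L (fun i => exp (s i.rev)) • x) h0'
    simp only [smul_add, smul_smul, ← map_mul, smul_zero] at this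
    rw [← this]
    congr 3
    · funext i; exact (exp_rev_mul_hypSub s i).symm
    · funext i; exact (exp_rev_mul_hypAdd s i).symm
  have h2 := congrArg θ h1
  have ar : (fun i : Fin k.card => a i.rev) = a := by simp [ha, rev_rev, add_comm]
  have br : (fun i : Fin k.card => b i.rev) = b := by simp [hb, rev_rev, add_comm]
  rw [map_add, c.theta_realCoe_smul, c.theta_realCoe_smul, ar, br, hx, hy, map_zero, smul_neg] at h2
  have h3 : realCoe L (2 * a) • z.1 = 0 := by
    rw [map_mul, map_ofNat, mul_smul, ofNat_smul_eq_nsmul, two_nsmul]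
    calc _ = (realCoe L a • z.1 + realCoe L b • z.2) + (realCoe L a • z.1 + -(realCoe L b • z.2)) := by
          abel
      _ = 0 := by rw [h1, h2, add_zero]
  have hz1 : z.1 = 0 := by
    refine eq_zero_of_realCoe_smul (fun i => ?_) h3
    have : 1 < exp (s i + s i.rev) := Real.one_lt_exp_iff.2 (hs i)
    simp only [Pi.mul_apply, Pi.ofNat_apply, ha]
    intro h; linarith
  have hz2 : z.2 = 0 := by
    rw [hz1, smul_zero, zero_add] at h1
    refine eq_zero_of_realCoe_smul (fun i => ?_) h1
    positivity
  have : z = 0 := Prod.ext hz1 hz2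
  subst this
  rfl

include c in
theorem IsCartan.form_etaDir_add (hw : w ∈ 𝕊) (s : 𝔞) {z : E × E} (hz : z ∈ tangentF h B ⊤ w)
    (ξ : 𝔞) : h.form (etaDir L w s (z, ξ)) η[w, s] + tau (h.form (etaDir L w s (z, ξ)) η[w, s]) = 0
    := by
  obtain ⟨hu, hv, huu, hvv, huv⟩ := (c.mem_sphereF_top w).1 hw
  obtain ⟨hx, hy, hxu, hyv, hxv⟩ := (c.mem_tangentF_top w z).1 hz
  obtain ⟨⟨hvu, hyu⟩, ⟨hq, hq'⟩, ⟨hq₂, hq₂'⟩, hwσ⟩ := c.tangentF_relations hw hz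
  have hq : tau (B.form z.1 w.1) = -B.form z.1 w.1 := by rw [← star_sigma, hq, hq']
  have hq₂ : tau (B.form z.2 w.2) = -B.form z.2 w.2 := by rw [← star_sigma, hq₂, hq₂']
  have hw1 : tau (B.form z.1 w.2) = -star (B.form z.1 w.2) := by
    rw [← star_sigma, hwσ, star_neg]
  have hw2 : tau (star (B.form z.1 w.2)) = -B.form z.1 w.2 := by
    rw [tau_star, hw1, star_neg, star_star]
  rw [etaDir_apply, etaF_expPos]
  simp only [map_add, add_app, h.smul_left, h.smul_right, c.form_eq', hu, hv, map_neg,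
    huu, hvv, huv, hvu, hyu, tau_add, tau_mul, tau_neg, tau_tau, tau_one, tau_zero, hq, hq₂, hw1,
    hw2, neg_zero, mul_zero, zero_add, add_zero, mul_one]
  have key : tau (realCoe L (hypSub s)) * realCoe L (hypSubDir s ξ) +
      realCoe L (hypSub s) * tau (realCoe L (hypSubDir s ξ)) =
      tau (realCoe L (hypAdd s)) * realCoe L (hypAddDir s ξ) +
      realCoe L (hypAdd s) * tau (realCoe L (hypAddDir s ξ)) := by
    simp only [tau_realCoe, ← map_mul, ← map_add]
    congr 1
    funext i
    simp only [Pi.add_apply, Pi.mul_apply, hypSub, hypAdd, hypSubDir, hypAddDir, rev_rev]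
    have h1 : exp (s i) * exp (-s i) = 1 := by rw [← exp_add]; simp
    have h2 : exp (s i.rev) * exp (-s i.rev) = 1 := by rw [← exp_add]; simp
    linear_combination (-1 / 2 * ξ i + 1 / 2 * ξ i) * h1
  linear_combination key

include c in
theorem IsCartan.trace_polarDir_cross (hw : w ∈ 𝕊) (s : 𝔞) {ζ : 𝕂} (hζ : tau ζ = ζ) {z : E × E}
    (hz : z ∈ tangentF h B ⊤ w) (ξ : 𝔞) : h.trace (etaDir L w s (z, ξ)) (ζ • η[w, s]) = 0 := by
  have h1 := c.form_etaDir_add hw s hz ξ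
  rw [HermitianForm.trace_apply, h.smul_right, hζ]
  set y := h.form (etaDir L w s (z, ξ)) η[w, s]
  have h2 : tau (ζ * y) = -(ζ * y) := by
    rw [tau_mul, hζ]
    linear_combination ζ * h1
  have h3 := normTrace_tau (ζ * y)
  rw [h2, normTrace_neg] at h3
  linarith

variable (h) in
theorem HermitianForm.trace_symm (u v : E) : h.trace u v = h.trace v u := by
  rw [trace_apply, h.tau_symm, normTrace_tau, trace_apply]

/-- The bilinear form on the `τ`-fixed scalars that `polarDir` induces. -/
noncomputable def tauFixedForm (L : Type*) [RCLike L] (k : ScalarKind) : BilinForm ℝ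
    (tauFixed L k) :=
  ((-(LinearMap.mul ℝ (Scalar L k))).compr₂ (normTraceLinear L k)).compl₁₂
    (tauFixed L k).subtype (tauFixed L k).subtype

include c in
theorem IsCartan.det_gram_polarDir (hw : w ∈ 𝕊) (s : 𝔞) {ι ι' : Type*} [Fintype ι] [DecidableEq ι]
    [Fintype ι'] [DecidableEq ι'] (b : Basis ι ℝ (tauFixed L k))
    (b' : Basis ι' ℝ (TangentSK h B ⊤ w)) : (toMatrix (b.prod b')
    (h.trace.comp (polarDir h B w s) (polarDir h B w s))).det =
    (toMatrix b (tauFixedForm L k)).det *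
    (toMatrix b' (etaGram h B ⊤ w s)).det := by
  rw [← Matrix.det_fromBlocks_zero₂₁ _ 0]
  congr 1
  have cross : ∀ i j, h.trace (etaDir L w s (tangentIncl h B ⊤ w (b' j)))
      ((b i : 𝕂) • η[w, s]) = 0 := fun i j =>
    c.trace_polarDir_cross hw s ((mem_tauFixed _).1 (b i).2) (b' j).1.2 _
  ext i j
  rw [toMatrix_apply, LinearMap.BilinForm.comp_apply]
  rcases i with i | i <;> rcases j with j | j
  · simp only [Matrix.fromBlocks_apply₁₁, toMatrix_apply, polarDir_apply,
      Module.Basis.prod_apply_inl_fst, Module.Basis.prod_apply_inl_snd, map_zero, add_zero]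
    rw [HermitianForm.trace_apply, h.smul_left, h.smul_right, c.form_etaF hw,
      (mem_tauFixed _).1 (b j).2]
    simp [tauFixedForm, normTraceLinear_apply]
  · simp only [Matrix.fromBlocks_apply₁₂, polarDir_apply,
      Module.Basis.prod_apply_inl_fst, Module.Basis.prod_apply_inl_snd,
      Module.Basis.prod_apply_inr_fst, Module.Basis.prod_apply_inr_snd, map_zero, add_zero,
      ZeroMemClass.coe_zero, zero_smul, zero_add, Matrix.zero_apply]
    rw [h.trace_symm, cross]
  · simp [Matrix.fromBlocks_apply₂₁, polarDir_apply, Module.Basis.prod_apply_inl_fst, Module.Basis.prod_apply_inl_snd, Module.Basis.prod_apply_inr_fst, Module.Basis.prod_apply_inr_snd, map_zero, add_zero, ZeroMemClass.coe_zero, zero_smul, zero_add, Matrix.zero_apply, cross]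
  · simp only [Matrix.fromBlocks_apply₂₂, toMatrix_apply, polarDir_apply,
      Module.Basis.prod_apply_inr_fst, Module.Basis.prod_apply_inr_snd,
      ZeroMemClass.coe_zero, zero_smul, zero_add]
    rfl

include c in
theorem IsCartan.det_gram_polarDir_ne_zero (hw : w ∈ 𝕊) {s : 𝔞} (hs : s ∈ chamber k)
    (hsurj : Surjective (polarDir h B w s)) {ι : Type*} [Fintype ι] [DecidableEq ι]
    (b : Basis ι ℝ (tauFixed L k × TangentSK h B ⊤ w)) :
    (toMatrix b (h.trace.comp (polarDir h B w s) (polarDir h B w s))).det ≠ 0 :=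
  det_toMatrix_ne_zero _ _ fun x hx => c.polarDir_injective hw hs <| by
    rw [map_zero]
    exact h.eq_zero_of_normTrace (hsurj.forall.2 hx)

include c in
theorem IsCartan.metric_det_pos (w : E × E) {ι : Type*} [Fintype ι] [DecidableEq ι]
    (b : Basis ι ℝ (TangentSK h B ⊤ w)) : 0 <
    (toMatrix b (metricBilin h B ⊤ w)).det := by
  refine det_toMatrix_pos b _ (fun x y => ?_) fun x hx => ?_
  · rw [metricBilin_apply, metricBilin_apply, metricSK, metricSK, B.conj_symm, normTrace_star]
    simp only [mul_comm]
  · have h1 := B.normTrace_nonneg c.exists_torsionFree (x.1.1.1 + x.1.1.2)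
    have h2 : 0 ≤ ∑ i, x.2 i * x.2 i := Finset.sum_nonneg fun i _ => mul_self_nonneg _
    rw [metricBilin_apply, metricSK]
    refine lt_of_le_of_ne (add_nonneg h1 h2) fun h0 => hx ?_
    have h3 : normTrace (B.form (x.1.1.1 + x.1.1.2) (x.1.1.1 + x.1.1.2)) = 0 := by linarith
    have h4 : ∑ i, x.2 i * x.2 i = 0 := by linarith
    have h5 := B.eq_zero_of_normTrace c.exists_torsionFree h3
    obtain ⟨hx1, hx2, -⟩ := (c.mem_tangentF_top w x.1.1).1 x.1.2
    have h6 := congrArg θ h5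
    rw [map_add, hx1, hx2, map_zero] at h6
    have h7 : (2 : ℝ) • x.1.1.1 = 0 := by
      rw [two_smul]
      calc _ = (x.1.1.1 + x.1.1.2) + (x.1.1.1 + -x.1.1.2) := by abel
        _ = 0 := by rw [h5, h6, add_zero]
    have h8 : x.1.1.1 = 0 := (smul_eq_zero.1 h7).resolve_left two_ne_zero
    have h9 : x.1.1.2 = 0 := by rw [h8, zero_add] at h5; exact h5
    refine Prod.ext (Subtype.ext (Prod.ext h8 h9)) ?_
    rw [Finset.sum_eq_zero_iff_of_nonneg fun i _ => mul_self_nonneg _] at h4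
    funext i
    exact mul_self_eq_zero.1 (h4 i (mem_univ i))

variable [Module.Finite (Scalar L k) E]

include c in
theorem IsCartan.jacobianEta_pos (hw : w ∈ 𝕊) {s : 𝔞} (hs : s ∈ chamber k)
    (hsurj : Surjective (polarDir h B w s)) : 0 < 𝐉 w (expPos s) := by
  have : FiniteDimensional ℝ E := Module.Finite.trans 𝕂 E
  set b := finBasis ℝ (tauFixed L k)
  set b' := finBasis ℝ (TangentSK h B ⊤ w)
  rw [jacobianEta_eq_of_basis h B ⊤ w s b']
  refine div_pos (Real.sqrt_pos.2 (abs_pos.2 fun h0 => ?_)) (Real.sqrt_pos.2 (c.metric_det_pos w b'))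
  have h1 := c.det_gram_polarDir hw s b b'
  rw [h0, mul_zero] at h1
  exact c.det_gram_polarDir_ne_zero hw hs hsurj _ h1

include c in
theorem IsCartan.abs_det_mul_jacobianEta (hw : w ∈ 𝕊) {s s' : 𝔞} (hs : s ∈ chamber k)
    (hsurj : Surjective (polarDir h B w s)) (A : E →ₗ[ℝ] E)
    (hA : A ∘ₗ polarDir h B w s = polarDir h B w s') : |det A| * 𝐉 w (expPos s) = 𝐉 w
    (expPos s') := by
  have : FiniteDimensional ℝ E := Module.Finite.trans 𝕂 E
  set b := finBasis ℝ (tauFixed L k)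
  set b' := finBasis ℝ (TangentSK h B ⊤ w)
  rw [jacobianEta_eq_of_basis h B ⊤ w s b', jacobianEta_eq_of_basis h B ⊤ w s' b', ← mul_div_assoc,
    ← Real.sqrt_sq_eq_abs, ← Real.sqrt_mul (sq_nonneg _)]
  have h1 := c.det_gram_polarDir hw s b b'
  have h2 := c.det_gram_polarDir hw s' b b'
  set e : (tauFixed L k × TangentSK h B ⊤ w) ≃ₗ[ℝ] E :=
    LinearEquiv.ofBijective (polarDir h B w s) ⟨c.polarDir_injective hw hs, hsurj⟩ with he
  have key : (toMatrix (b.prod b')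
      (h.trace.comp (polarDir h B w s') (polarDir h B w s'))).det = det A ^ 2 *
      (toMatrix (b.prod b')
      (h.trace.comp (polarDir h B w s) (polarDir h B w s))).det := by
    have e1 : ∀ g : BilinForm ℝ E, toMatrix (b.prod b')
        (g.comp (polarDir h B w s) (polarDir h B w s)) =
        toMatrix ((b.prod b').map e) g := by
      intro g
      ext i j
      simp only [toMatrix_apply, Module.Basis.map_apply]
      rfl
    rw [e1, ← det_toMatrix_comp_endomorphism, ← e1, ← hA]
    rfl
  have hne : (toMatrix b (tauFixedForm L k)).det ≠ 0 := by
    intro h0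
    rw [h0, zero_mul] at h1
    exact c.det_gram_polarDir_ne_zero hw hs hsurj _ h1
  rw [h1, h2] at key
  have h3 : (toMatrix b' (etaGram h B ⊤ w s')).det =
      det A ^ 2 * (toMatrix b' (etaGram h B ⊤ w s)).det := by
    apply mul_left_cancel₀ hne
    rw [key]; ring
  rw [h3, abs_mul, abs_of_nonneg (sq_nonneg (det A))]

end PolarJacobian

section Transport

variable {E' : Type*} [Module.Finite (Scalar L k) E] [NormedAddCommGroup E'] [NormedSpace ℝ E']
  [Module (Scalar L k) E'] [IsScalarTower ℝ (Scalar L k) E'] [Module.Finite (Scalar L k) E']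

/-- The Jacobian is invariant under isometries of tangent spaces. -/
theorem jacobianEta_transport {h : HermitianForm L k E} {B : PositiveForm L k E} {F : Submodule 𝕂 E}
    {h' : HermitianForm L k E'} {B' : PositiveForm L k E'} {F' : Submodule 𝕂 E'} {w' : E' × E'}
    {s s' : 𝔞} (e : TangentSK h B F w ≃ₗ[ℝ] TangentSK h' B' F' w')
    (hm : ∀ a b, metricSK h' B' F' w' (e a) (e b) = metricSK h B F w a b) (hη : ∀ a b, normTrace
    (h'.form (etaDir L w' s' (tangentIncl h' B' F' w' (e a))) (etaDir L w' s' (tangentIncl h' B' F'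
    w' (e b)))) = normTrace (h.form (etaDir L w s (tangentIncl h B F w a)) (etaDir L w s
    (tangentIncl h B F w b)))) : jacobianEta h B F w (expPos s) = jacobianEta h' B' F' w'
    (expPos s') := by
  have := finite_tangentSK h B F w
  set b := finBasis ℝ (TangentSK h B F w)
  rw [jacobianEta_eq_of_basis h B F w s b, jacobianEta_eq_of_basis h' B' F' w' s' (b.map e)]
  congr 4
  · ext i j
    simp only [toMatrix_apply, Module.Basis.map_apply]
    exact (hη _ _).symm
  · ext i j
    simp only [toMatrix_apply, Module.Basis.map_apply]
    exact (hm _ _).symm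

end Transport

section Bilinear

variable {X V W G : Type*} [NormedAddCommGroup X] [NormedSpace ℝ X] [NormedAddCommGroup V]
  [NormedSpace ℝ V] [FiniteDimensional ℝ V] [NormedAddCommGroup W] [NormedSpace ℝ W]
  [FiniteDimensional ℝ W] [NormedAddCommGroup G] [NormedSpace ℝ G]

theorem DifferentiableAt.bilin (b : V →ₗ[ℝ] W →ₗ[ℝ] G) {f : X → V} {g : X → W} {x : X}
    (hf : DifferentiableAt ℝ f x) (hg : DifferentiableAt ℝ g x) : DifferentiableAt ℝ
    (fun y => b (f y) (g y)) x :=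
  (b.toContinuousBilinearMap.hasFDerivAt_of_bilinear hf.hasFDerivAt hg.hasFDerivAt).differentiableAt

theorem Continuous.bilin {T : Type*} [TopologicalSpace T] (b : V →ₗ[ℝ] W →ₗ[ℝ] G) {f : T → V}
    {g : T → W} (hf : Continuous f) (hg : Continuous g) : Continuous fun y => b (f y) (g y) :=
  b.toContinuousBilinearMap.continuous₂.comp (hf.prodMk hg)

end Bilinear

section PolarCalculus

variable [FiniteDimensional ℝ E]

theorem DifferentiableAt.scalar_smul {X : Type*} [NormedAddCommGroup X] [NormedSpace ℝ X]
    {f : X → 𝕂} {g : X → E} {x : X} (hf : DifferentiableAt ℝ f x) (hg : DifferentiableAt ℝ g x) :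
    DifferentiableAt ℝ (fun y => f y • g y) x :=
  hf.bilin (smulBilin L k E) hg

theorem Continuous.scalar_smul {X : Type*} [TopologicalSpace X] {f : X → 𝕂} {g : X → E}
    (hf : Continuous f) (hg : Continuous g) : Continuous fun y => f y • g y :=
  hf.bilin (smulBilin L k E) hg

theorem DifferentiableAt.realCoe {X : Type*} [NormedAddCommGroup X] [NormedSpace ℝ X] {f : X → 𝔞}
    {x : X} (hf : DifferentiableAt ℝ f x) : DifferentiableAt ℝ (fun y => realCoe L (f y)) x :=
  (realCoeCLM L k).differentiableAt.comp x hf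

theorem DifferentiableAt.re {X : Type*} [NormedAddCommGroup X] [NormedSpace ℝ X] {f : X → L} {x : X}
    (hf : DifferentiableAt ℝ f x) : DifferentiableAt ℝ (fun y => re (f y)) x :=
  (reCLM (K := L)).differentiableAt.comp x hf

theorem differentiableAt_polarScalar (hγ : h.IsTimelike γ) : DifferentiableAt ℝ (polarScalar h) γ :=
    by
  refine differentiableAt_pi.2 fun i => ?_
  have h1 : DifferentiableAt ℝ (fun γ => -h.form γ γ i) γ :=
    (differentiableAt_pi.1 (differentiableAt_id.bilin h.form differentiableAt_id) i).neg
  exact (differentiableAt_csqrt (by simpa [sub_eq_add_neg] using hγ i)).comp γ h1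

theorem polarScalar_ne_zero (hγ : h.IsTimelike γ) (i : Fin k.card) : polarScalar h γ i ≠ 0 := by
  intro h0
  have := re_polarScalar_pos hγ i
  grind

theorem differentiableAt_polarUnit (hγ : h.IsTimelike γ) : DifferentiableAt ℝ (polarUnit h) γ := by
  have h1 : DifferentiableAt ℝ (fun γ => (fun i => (polarScalar h γ i)⁻¹ : 𝕂)) γ := by
    refine differentiableAt_pi.2 fun i => ?_
    have h2 := (ContinuousLinearMap.proj (R := ℝ) (φ := fun _ : Fin k.card => L) i
      ).differentiableAt.comp γ (differentiableAt_polarScalar hγ)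
    exact h2.inv (polarScalar_ne_zero hγ i)
  exact h1.scalar_smul differentiableAt_id

theorem DifferentiableAt.quad {X : Type*} [NormedAddCommGroup X] [NormedSpace ℝ X] {f : X → E}
    {x : X} (hf : DifferentiableAt ℝ f x) (i : Fin k.card) : DifferentiableAt ℝ
    (fun y => B.quad (f y) i) x :=
  (differentiableAt_pi.1 (hf.bilin B.form hf) i).re

include c in
theorem IsCartan.quad_polarUnit_pos (hγ : γ ∈ polarDomain h B) (i : Fin k.card) : 0 < B.quad
    (polarUnit h γ) i := by
  have h1 := hγ.2 i
  refine lt_of_le_of_ne (c.quad_nonneg _ i) fun h0 => ?_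
  rw [← h0, zero_mul] at h1
  linarith

include c in
theorem differentiableAt_polarLog (hγ : γ ∈ polarDomain h B) : DifferentiableAt ℝ (ℓ) γ := by
  refine differentiableAt_pi.2 fun i => ?_
  have hq : ∀ j, DifferentiableAt ℝ (fun γ => B.quad (polarUnit h γ) j) γ := fun j =>
    (differentiableAt_polarUnit hγ.1).quad j
  have h1 : DifferentiableAt ℝ (fun γ => arcosh
      √(B.quad (polarUnit h γ) i * B.quad (polarUnit h γ) i.rev)) γ := by
    refine DifferentiableAt.comp γ (g := arcosh) (Real.differentiableAt_arcosh ?_)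
      (((hq i).mul (hq i.rev)).sqrt ?_)
    · exact Real.lt_sqrt_of_sq_lt (by simpa using hγ.2 i)
    · have := hγ.2 i
      grind [Pi.mul_apply]
  have h2 : ∀ j, DifferentiableAt ℝ (fun γ => log (B.quad (polarUnit h γ) j)) γ := fun j =>
    (hq j).log (c.quad_polarUnit_pos hγ j).ne'
  have h3 : DifferentiableAt ℝ (fun γ => (log (B.quad (polarUnit h γ) i) -
      log (B.quad (polarUnit h γ) i.rev)) / 2) γ := by simp_all [div_eq_mul_inv]
  simp only [polarLog]
  simp only [div_eq_mul_inv _ (2 : ℝ)] at h3 ⊢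
  exact (h1.add h3).mul_const _

include c in
theorem differentiableAt_polarSphere (hγ : γ ∈ polarDomain h B) : DifferentiableAt ℝ
    (polarSphere h B θ) γ := by
  have hs := fun i => differentiableAt_pi.1 (differentiableAt_polarLog c hγ) i
  have he : DifferentiableAt ℝ (fun γ => (fun i => exp (ℓ γ i.rev) :
      𝔞)) γ := differentiableAt_pi.2 fun i => (hs i.rev).exp
  have ha : DifferentiableAt ℝ (polarAux h B) γ :=
    (he.realCoe (L := L)).scalar_smul (differentiableAt_polarUnit hγ.1)
  have hθ : DifferentiableAt ℝ (fun γ => θ (polarAux h B γ)) γ :=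
    (toContinuousLinearMap θ).differentiableAt.comp γ ha
  have hch := (isPolar_of_mem_polarDomain c hγ).mem_chamber
  have hp : ∀ i, DifferentiableAt ℝ (fun γ => exp (ℓ γ i + ℓ γ i.rev))
      γ := fun i => ((hs i).add (hs i.rev)).exp
  have h1 : DifferentiableAt ℝ (fun γ => (fun i =>
      (exp (ℓ γ i + ℓ γ i.rev) - 1)⁻¹ : 𝔞)) γ := by
    refine differentiableAt_pi.2 fun i => ((hp i).sub_const 1).inv ?_
    have : 1 < exp (ℓ γ i + ℓ γ i.rev) :=
      Real.one_lt_exp_iff.2 (hch i)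
    linarith
  have h2 : DifferentiableAt ℝ (fun γ => (fun i =>
      (exp (ℓ γ i + ℓ γ i.rev) + 1)⁻¹ : 𝔞)) γ := by
    refine differentiableAt_pi.2 fun i => ((hp i).add_const 1).inv ?_
    positivity
  exact ((h1.realCoe (L := L)).scalar_smul (ha.add hθ)).prodMk
    ((h2.realCoe (L := L)).scalar_smul (ha.sub hθ))

theorem isOpen_form_condition : IsOpen {γ : E | h.IsTimelike γ} := by
  have h1 : Continuous fun γ : E => h.form γ γ := continuous_id.bilin h.form continuous_id
  simp only [Set.ofPred_forall]
  refine isOpen_iInter_of_finite fun i => ?_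
  have h2 : Continuous fun γ : E => h.form γ γ i := (continuous_apply i).comp h1
  exact isOpen_lt continuous_const (h2.norm.sub (RCLike.continuous_re.comp h2))

theorem isOpen_polarDomain : IsOpen (polarDomain h B) := by
  rw [isOpen_iff_mem_nhds]
  rintro γ hγ
  have h1 := isOpen_form_condition.mem_nhds hγ.1
  have hq : ∀ j, ContinuousAt (fun γ => B.quad (polarUnit h γ) j) γ := fun j =>
    ((differentiableAt_polarUnit hγ.1).quad j).continuousAt
  have h2 : ∀ᶠ γ' in nhds γ, ∀ i,
      1 < B.quad (polarUnit h γ') i * B.quad (polarUnit h γ') i.rev :=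
    Filter.eventually_all.2 fun i =>
      ((hq i).mul (hq i.rev)).eventually_const_lt (hγ.2 i)
  filter_upwards [h1, h2] with γ' h3 h4 using ⟨h3, h4⟩

variable (h B θ) in
/-- Translation of the coordinate `log t` in the polar decomposition. -/
noncomputable def polarShift (z : 𝔞) (γ : E) : E :=
  polarScalar h γ • etaF (L := L) (polarSphere h B θ γ) (expPos (ℓ γ + z))

include c in
theorem exists_hasFDerivAt_polarShift (hγ : γ ∈ polarDomain h B) : ∃ C : E →ₗ[ℝ] tauFixed L k ×
    TangentSK h B ⊤ (polarSphere h B θ γ), ∀ z, HasFDerivAt (polarShift h B θ z)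
    (toContinuousLinearMap (smulBilin L k E (polarScalar h γ) ∘ₗ polarDir h B (polarSphere
    h B θ γ) (ℓ γ + z) ∘ₗ C)) γ := by
  set w := polarSphere h B θ γ with hw
  set s := ℓ γ with hs
  set ζ := polarScalar h γ with hζ
  set zi : 𝕂 := fun i => (ζ i)⁻¹ with hzi
  have hζzi : ζ * zi = 1 := by
    funext i; exact mul_inv_cancel₀ (polarScalar_ne_zero hγ.1 i)
  have hzi_tau : tau zi = zi := by rw [hzi, tau_inv, hζ, tau_polarScalar]
  have hev := isOpen_polarDomain.mem_nhds hγ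
  have dζ := (differentiableAt_polarScalar (h := h) hγ.1).hasFDerivAt
  have dw := (differentiableAt_polarSphere c hγ).hasFDerivAt
  have ds := (differentiableAt_polarLog c hγ).hasFDerivAt
  set Z := fderiv ℝ (polarScalar h) γ
  set W := fderiv ℝ (polarSphere h B θ) γ
  set S := fderiv ℝ (ℓ) γ
  have hZ : ∀ X, tau (Z X) = Z X := by
    have h1 : HasFDerivAt (fun γ => tau (polarScalar h γ))
        ((toContinuousLinearMap (tauLinear L k)).comp Z) γ :=
      (toContinuousLinearMap (tauLinear L k)).hasFDerivAt.comp γ dζ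
    have h2 : (fun γ => tau (polarScalar h γ)) = polarScalar h := by
      funext γ; exact tau_polarScalar γ
    rw [h2] at h1
    intro X
    exact congrArg (fun D => D X) (h1.unique dζ)
  have hmem : ∀ᶠ γ' in nhds γ, polarSphere h B θ γ' ∈ 𝕊 := by
    filter_upwards [hev] with γ' h' using (isPolar_of_mem_polarDomain c h').mem_sphere
  have dw1 : HasFDerivAt (fun γ => (polarSphere h B θ γ).1) ((ContinuousLinearMap.fst ℝ E E).comp W) γ :=
    dw.fst
  have dw2 : HasFDerivAt (fun γ => (polarSphere h B θ γ).2) ((ContinuousLinearMap.snd ℝ E E).comp W) γ :=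
    dw.snd
  have hconst : ∀ (f : E → 𝕂) (D : E →L[ℝ] 𝕂) (a : 𝕂),
      HasFDerivAt f D γ → (∀ᶠ γ' in nhds γ, f γ' = a) → ∀ X, D X = 0 := by
    intro f D a hf ha X
    have h1 : HasFDerivAt f (0 : E →L[ℝ] 𝕂) γ :=
      (hasFDerivAt_const a γ).congr_of_eventuallyEq ha
    rw [hf.unique h1]; rfl
  have hW : ∀ X, W X ∈ tangentF h B ⊤ w := by
    intro X
    rw [c.mem_tangentF_top]
    refine ⟨?_, ?_, ?_, ?_, ?_⟩
    · have h1 := (toContinuousLinearMap θ).hasFDerivAt.comp γ dw1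
      have h2 := h1.congr_of_eventuallyEq (f₁ := fun γ => (polarSphere h B θ γ).1) (by
        filter_upwards [hmem] with γ' h'
        exact ((c.mem_sphereF_top _).1 h').1.symm)
      exact congrArg (fun D => D X) (h2.unique dw1)
    · have h1 := (toContinuousLinearMap θ).hasFDerivAt.comp γ dw2
      have h2 := h1.congr_of_eventuallyEq (f₁ := fun γ => -(polarSphere h B θ γ).2) (by
        filter_upwards [hmem] with γ' h'
        exact ((c.mem_sphereF_top _).1 h').2.1.symm)
      exact congrArg (fun D => D X) (h2.unique dw2.neg)
    · have h1 := B.form.toContinuousBilinearMap.hasFDerivAt_of_bilinear dw1 dw1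
      have h2 := hconst _ _ 1 h1 (by
        filter_upwards [hmem] with γ' h'
        exact ((c.mem_sphereF_top _).1 h').2.2.1) X
      rw [← h2, add_comm]; rfl
    · have h1 := B.form.toContinuousBilinearMap.hasFDerivAt_of_bilinear dw2 dw2
      have h2 := hconst _ _ 1 h1 (by
        filter_upwards [hmem] with γ' h'
        exact ((c.mem_sphereF_top _).1 h').2.2.2.1) X
      rw [← h2, add_comm]; rfl
    · have h1 := B.form.toContinuousBilinearMap.hasFDerivAt_of_bilinear dw1 dw2
      have h2 := hconst _ _ 0 h1 (by
        filter_upwards [hmem] with γ' h'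
        exact ((c.mem_sphereF_top _).1 h').2.2.2.2) X
      rw [← h2, add_comm]; rfl
  have hZ' : ∀ X, zi * Z X ∈ tauFixed L k := fun X => by
    rw [mem_tauFixed, tau_mul, hzi_tau, hZ]
  let C1 : E →ₗ[ℝ] tauFixed L k :=
    (mulLeft ℝ zi ∘ₗ Z.toLinearMap).codRestrict (tauFixed L k) hZ'
  let C2 : E →ₗ[ℝ] tangentF h B ⊤ w := W.toLinearMap.codRestrict _ hW
  refine ⟨C1.prod (C2.prod S.toLinearMap), fun z => ?_⟩
  have hq : HasFDerivAt (fun γ => (polarSphere h B θ γ, ℓ γ + z)) (W.prod S) γ :=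
    dw.prodMk (ds.add_const z)
  have hη := (hasFDerivAt_etaF (L := L) w (s + z)).comp γ hq
  have hm := (smulCLM L k E).hasFDerivAt_of_bilinear dζ hη
  refine (hm.congr_of_eventuallyEq (Filter.Eventually.of_forall fun _ => rfl)).congr_fderiv ?_
  refine ContinuousLinearMap.ext fun X => ?_
  change ζ • etaDir L w (s + z) (W X, S X) + Z X • etaF (L := L) w (expPos (s + z)) =
    ζ • ((zi * Z X) • etaF (L := L) w (expPos (s + z)) + etaDir L w (s + z) (W X, S X))
  rw [smul_add, smul_smul, ← mul_assoc, hζzi, one_mul, add_comm]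

include c in
theorem polarShift_zero (hγ : γ ∈ polarDomain h B) : polarShift h B θ 0 γ = γ := by
  rw [polarShift, add_zero]
  exact (isPolar_of_mem_polarDomain c hγ).eq.symm

include c in
theorem isPolar_polarShift (hγ : γ ∈ polarDomain h B) {z : 𝔞} (hz : ℓ γ + z ∈ chamber k) : IsPolar h
    B (polarShift h B θ z γ) (polarScalar h γ) (polarSphere h B θ γ) (ℓ γ + z) :=
  have hp := isPolar_of_mem_polarDomain c hγ
  ⟨hp.tau_eq, hp.re_pos, hp.mem_sphere, hz, rfl⟩

include c in
theorem polarShift_polarShift (hγ : γ ∈ polarDomain h B) {z z' : 𝔞} (hz : ℓ γ + z ∈ chamber k) :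
    polarShift h B θ z' (polarShift h B θ z γ) = polarShift h B θ (z + z') γ := by
  have hp := isPolar_polarShift c hγ hz
  rw [polarShift, hp.polarScalar_eq c, hp.polarSphere_eq c, hp.polarLog_eq c, polarShift, add_assoc]

variable [Module.Finite (Scalar L k) E]

include c in
theorem exists_hasFDerivAt_polarShift_det (hγ : γ ∈ polarDomain h B) : 0 < 𝐉 (polarSphere h B θ γ)
    (expPos (ℓ γ)) ∧ ∀ z, ∃ A : E →L[ℝ] E, HasFDerivAt (polarShift h B θ z) A γ ∧ |A.det| * 𝐉
    (polarSphere h B θ γ) (expPos (ℓ γ)) = 𝐉 (polarSphere h B θ γ) (expPos (ℓ γ + z)) := by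
  have hp := isPolar_of_mem_polarDomain c hγ
  have hex := exists_hasFDerivAt_polarShift c hγ
  set w := polarSphere h B θ γ with hw
  set s := ℓ γ with hs
  set ζ := polarScalar h γ with hζ
  obtain ⟨C, hC⟩ := hex
  have hid : smulBilin L k E ζ ∘ₗ polarDir h B w s ∘ₗ C = LinearMap.id := by
    have h1 := hC 0
    have h2 : HasFDerivAt (polarShift h B θ 0) (ContinuousLinearMap.id ℝ E) γ := by
      refine (hasFDerivAt_id γ).congr_of_eventuallyEq ?_
      filter_upwards [isOpen_polarDomain.mem_nhds hγ] with γ' h' using polarShift_zero c h'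
    have h3 := h1.unique h2
    rw [add_zero] at h3
    refine LinearMap.ext fun X => ?_
    exact congrArg (fun D => D X) h3
  have hinj := c.polarDir_injective hp.mem_sphere hp.mem_chamber
  set zi : 𝕂 := fun i => (ζ i)⁻¹ with hzi
  have hζzi : zi * ζ = 1 := by
    funext i; exact inv_mul_cancel₀ (polarScalar_ne_zero hγ.1 i)
  have hPC : ∀ X, polarDir h B w s (C (ζ • X)) = X := by
    intro X
    have h1 : ζ • polarDir h B w s (C (ζ • X)) = ζ • X := congrArg (fun D => D (ζ • X)) hid
    have h2 := congrArg (fun y => zi • y) h1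
    simpa only [smul_smul, hζzi, one_smul] using h2
  have hsurj : Surjective (polarDir h B w s) := fun X => ⟨_, hPC X⟩
  refine ⟨c.jacobianEta_pos hp.mem_sphere hp.mem_chamber hsurj, fun z => ⟨_, hC z, ?_⟩⟩
  rw [← c.abs_det_mul_jacobianEta (s' := s + z) hp.mem_sphere hp.mem_chamber hsurj
    (polarDir h B w (s + z) ∘ₗ C ∘ₗ smulBilin L k E ζ) ?_]
  · congr 2
    change det (smulBilin L k E ζ ∘ₗ (polarDir h B w (s + z) ∘ₗ C)) =
      det ((polarDir h B w (s + z) ∘ₗ C) ∘ₗ smulBilin L k E ζ)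
    rw [det_comp, det_comp, mul_comm]
  · refine LinearMap.ext fun y => ?_
    change polarDir h B w (s + z) (C (ζ • polarDir h B w s y)) = _
    congr 1
    apply hinj
    rw [hPC]

end PolarCalculus

/-- Two measures that are invariant under a semigroup of translations are proportional on that
semigroup. -/
theorem lintegral_mul_lintegral_of_semigroup {V : Type*} [AddCommGroup V] [MeasurableSpace V]
    [MeasurableAdd₂ V] [MeasurableSub₂ V] [MeasurableNeg V] (μ ν : Measure V) [SFinite μ]
    [SFinite ν] [μ.IsAddLeftInvariant] [μ.IsNegInvariant] (C : Set V) (f g : V → ℝ≥0∞)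
    (hf : Measurable f) (hg : Measurable g) (hfC : ∀ x ∉ C, f x = 0) (hgC : ∀ x ∉ C, g x = 0)
    (hfν : ∀ z ∈ C, ∫⁻ x, f (x - z) ∂ν = ∫⁻ x, f x ∂ν)
    (hgν : ∀ z ∈ C, ∫⁻ x, g (x - z) ∂ν = ∫⁻ x, g x ∂ν) : (∫⁻ x, f x ∂ν) * ∫⁻ y, g y ∂μ =
    (∫⁻ x, g x ∂ν) * ∫⁻ y, f y ∂μ := by
  have e : ∀ (f g : V → ℝ≥0∞), Measurable f → Measurable g → (∀ x ∉ C, g x = 0) →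
      (∀ z ∈ C, ∫⁻ x, f (x - z) ∂ν = ∫⁻ x, f x ∂ν) →
      ∫⁻ y, ∫⁻ x, g y * f (x - y) ∂ν ∂μ = (∫⁻ x, f x ∂ν) * ∫⁻ y, g y ∂μ := by
    intro f g hf hg hgC hfν
    rw [← lintegral_const_mul _ hg]
    refine lintegral_congr fun y => ?_
    rw [lintegral_const_mul _ (by fun_prop)]
    by_cases hy : y ∈ C
    · rw [hfν y hy, mul_comm]
    grind
  rw [← e f g hf hg hgC hfν, ← e g f hg hf hfC hgν]
  refine (lintegral_lintegral_swap (by fun_prop)).trans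
    (Eq.trans ?_ (lintegral_lintegral_swap (by fun_prop)).symm)
  refine lintegral_congr fun x => ?_
  rw [← lintegral_sub_left_eq_self (fun y => g y * f (x - y)) x]
  simp [sub_sub_cancel, mul_comm]

section NullSets

variable [FiniteDimensional ℝ E] [MeasurableSpace E] [BorelSpace E]

theorem ae_quartic_ne_zero (μ : Measure E) [μ.IsAddHaarMeasure]
    (b₁ b₂ b₃ b₄ : BilinForm ℝ E) (e : E)
    (he : b₁ e e * b₂ e e - b₃ e e * b₃ e e - b₄ e e * b₄ e e ≠ 0) : ∀ᵐ x ∂μ, b₁ x x * b₂ x x - b₃ x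
    x * b₃ x x - b₄ x x * b₄ x x ≠ 0 := by
  have hcont : ∀ b : BilinForm ℝ E, Continuous fun x => b x x := fun b =>
    continuous_id.bilin b continuous_id
  have hm : MeasurableSet
      {x : E | b₁ x x * b₂ x x - b₃ x x * b₃ x x - b₄ x x * b₄ x x ≠ 0} := by
    refine (isOpen_ne_fun ?_ continuous_const).measurableSet
    have h1 := hcont b₁
    have h2 := hcont b₂
    have h3 := hcont b₃
    have h4 := hcont b₄
    exact ((h1.mul h2).sub (h3.mul h3)).sub (h4.mul h4)
  refine ae_mem_of_ae_add_linearMap_mem (LinearMap.toSpanSingleton ℝ E e) volume μ hm fun y => ?_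
  let q : BilinForm ℝ E → Polynomial ℝ := fun b =>
    Polynomial.C (b e e) * Polynomial.X ^ 2 + Polynomial.C (b y e + b e y) * Polynomial.X +
      Polynomial.C (b y y)
  have hq : ∀ b (x : ℝ), b (y + x • e) (y + x • e) = (q b).eval x := by
    intro b x
    simp [q]
    ring
  have hdeg : ∀ b, (q b).natDegree ≤ 2 := fun b => Polynomial.natDegree_quadratic_le
  have hcoeff : ∀ b, (q b).coeff 2 = b e e := by simp [q]
  have hmul : ∀ b b', (q b * q b').coeff 4 = b e e * b' e e := by
    intro b b'
    have := Polynomial.coeff_mul_add_eq_of_natDegree_le (hdeg b) (hdeg b')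
    simp_all
  set p := q b₁ * q b₂ - q b₃ * q b₃ - q b₄ * q b₄ with hp
  have hp0 : p ≠ 0 := by
    intro h0
    apply he
    rw [← hmul, ← hmul, ← hmul, ← Polynomial.coeff_sub, ← Polynomial.coeff_sub, ← hp, h0,
      Polynomial.coeff_zero]
  have hfin : (p.roots.toFinset : Set ℝ).Finite := Finset.finite_toSet _
  refine (measure_eq_zero_iff_ae_notMem.1 (hfin.measure_zero volume)).mono fun x hx h0 => hx ?_
  simp_all

end NullSets

section PolarMeasure

include c in
theorem IsCartan.cauchySchwarz (u v : E) (i : Fin k.card) : ‖B.form u v i‖ ^ 2 ≤ B.quad u i * B.quad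
    v i := by
  set q := B.quad v i with hq
  set a := B.form u v i with ha
  rcases eq_or_lt_of_le (c.quad_nonneg v i) with h0 | h0
  · have h1 : (single i 1 : 𝕂) • v = 0 := by
      by_contra hne
      exact absurd h0 (B.quad_pos c.exists_torsionFree hne).ne
    have h2 := B.smul_right (single i 1 : 𝕂) u v
    rw [h1, map_zero, star_single_one] at h2
    have h3 := congrFun h2 i
    rw [Pi.mul_apply, Pi.single_eq_same, one_mul] at h3
    rw [← hq] at h0
    rw [ha, ← h3, ← h0]; simp
  · rw [← hq] at h0
    set Q : 𝕂 := fun _ => ((q : ℝ) : L)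
    set A : 𝕂 := fun _ => a
    have h1 := c.quad_nonneg (Q • u - A • v) i
    have h2 : B.quad (Q • u - A • v) i = q * (q * B.quad u i - ‖a‖ ^ 2) := by
      have e1 : B.form v u i = star a := by rw [B.conj_symm]; rfl
      have e2 : B.form u u i = ((B.quad u i : ℝ) : L) := congrFun (B.form_self u) i
      have e3 : B.form v v i = ((q : ℝ) : L) := congrFun (B.form_self v) i
      have e4 : B.form (Q • u - A • v) (Q • u - A • v) i =
          ((q * (q * B.quad u i - ‖a‖ ^ 2) : ℝ) : L) := by
        simp only [map_sub, sub_app, B.smul_left, B.smul_right, Pi.sub_apply,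
          Pi.mul_apply, Pi.star_apply, e1, e2, e3]
        rw [← ha]
        have e5 : a * star a = ((‖a‖ : ℝ) : L) ^ 2 := mul_conj a
        have e6 : star ((q : ℝ) : L) = ((q : ℝ) : L) := RCLike.conj_ofReal q
        simp only [Q, A, e6]
        push_cast
        linear_combination (-((q : ℝ) : L)) * e5
      have e7 := congrArg re e4
      rw [ofReal_re] at e7
      exact e7
    rw [h2] at h1
    have h3 := nonneg_of_mul_nonneg_right h1 h0
    linarith

theorem norm_polarScalar_sq (hγ : h.IsTimelike γ) (i : Fin k.card) : ‖polarScalar h γ i‖ ^ 2 =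
    ‖h.form γ γ i‖ := by
  have h1 := congrFun (polarScalar_mul_self hγ) i
  have h2 := congrArg norm h1
  simpa [sq] using h2

theorem quad_smul (a : 𝕂) (v : E) (i : Fin k.card) : B.quad (a • v) i = ‖a i‖ ^ 2 * B.quad v i := by
  have h1 : B.form (a • v) (a • v) i = ((‖a i‖ ^ 2 * B.quad v i : ℝ) : L) := by
    rw [B.smul_left, B.smul_right, B.form_self]
    simp only [Pi.mul_apply, Pi.star_apply, realCoe_apply]
    have e5 : a i * star (a i) = ((‖a i‖ : ℝ) : L) ^ 2 := mul_conj _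
    grind
  have h2 := congrArg re h1
  rw [ofReal_re] at h2
  exact h2

theorem norm_form_rev (u : E) (i : Fin k.card) : ‖h.form u u i.rev‖ = ‖h.form u u i‖ := by
  have := norm_tau_apply (h.form u u) i
  rw [← h.tau_symm] at this
  exact this.symm

include c in
theorem mem_polarDomain_of_ne (hγ : h.IsTimelike γ)
    (hne : ∀ i, B.quad γ i * B.quad γ i.rev ≠ ‖h.form γ γ i‖ ^ 2) : γ ∈ polarDomain h B := by
  refine ⟨hγ, fun i => ?_⟩
  have hq : ∀ j, B.quad γ j = ‖h.form γ γ j‖ * B.quad (polarUnit h γ) j := by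
    intro j
    rw [← norm_polarScalar_sq hγ, ← quad_smul, polarScalar_smul_polarUnit hγ]
  have hpos : 0 < ‖h.form γ γ i‖ := by grind [norm_pos_iff]
  have h1 : ‖h.form γ γ i‖ ^ 2 ≤ B.quad γ i * B.quad γ i.rev := by
    have h2 := c.cauchySchwarz γ (θ γ) i
    rw [← c.form_eq'] at h2
    have h3 : B.quad (θ γ) i = B.quad γ i.rev := by
      rw [PositiveForm.quad, c.pos_theta_theta, B.form_self, sigma_realCoe, realCoe_apply,
        ofReal_re]
    rwa [h3] at h2
  have h2 := lt_of_le_of_ne h1 (hne i).symm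
  rw [hq, hq i.rev, norm_form_rev, mul_mul_mul_comm, ← sq] at h2
  aesop

variable [FiniteDimensional ℝ E] [MeasurableSpace E] [BorelSpace E]

include c in
theorem ae_mem_polarDomain (μ : Measure E) [μ.IsAddHaarMeasure] (hw : w ∈ 𝕊) : ∀ᵐ γ ∂μ, h.IsTimelike
    γ → γ ∈ polarDomain h B := by
  obtain ⟨hu, hv, huu, hvv, huv⟩ := (c.mem_sphereF_top w).1 hw
  have hvu : B.form w.2 w.1 = 0 := by rw [B.conj_symm, huv, star_zero]
  have h1 : ∀ i, ∀ᵐ γ ∂μ, B.quad γ i * B.quad γ i.rev ≠ ‖h.form γ γ i‖ ^ 2 := by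
    intro i
    let reAt : Fin k.card → 𝕂 →ₗ[ℝ] ℝ := fun j =>
      (reCLM (K := L)).toLinearMap ∘ₗ LinearMap.proj (R := ℝ) (φ := fun _ => L) j
    let imAt : Fin k.card → 𝕂 →ₗ[ℝ] ℝ := fun j =>
      (RCLike.imCLM (K := L)).toLinearMap ∘ₗ LinearMap.proj (R := ℝ) (φ := fun _ => L) j
    have h2 := ae_quartic_ne_zero μ (B.form.compr₂ (reAt i)) (B.form.compr₂ (reAt i.rev))
      (h.form.compr₂ (reAt i)) (h.form.compr₂ (imAt i)) (w.1 + w.2) (by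
        have e1 : B.form (w.1 + w.2) (w.1 + w.2) = 2 := by
          simp only [map_add, add_app, huu, hvv, huv, hvu]; norm_num
        have e2 : h.form (w.1 + w.2) (w.1 + w.2) = 0 := by
          simp [map_add, add_app, c.form_eq', hu, hv, map_neg, huu, hvv, huv, hvu]
        generalize w.1 + w.2 = e at e1 e2
        aesop)
    filter_upwards [h2] with γ h3 h4
    apply h3
    have h5 : re (B.form γ γ i) * re (B.form γ γ i.rev) = ‖h.form γ γ i‖ ^ 2 := h4
    rw [← RCLike.normSq_eq_def', RCLike.normSq_apply] at h5
    simp [reAt, imAt, LinearMap.compr₂_apply, comp_apply, h5]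
  filter_upwards [ae_all_iff.2 h1] with γ h2 h3 using mem_polarDomain_of_ne c h3 h2

end PolarMeasure

section PolarMeasurability

variable [FiniteDimensional ℝ E] [MeasurableSpace E] [BorelSpace E]

theorem measurable_csqrt : Measurable (csqrt : L → L) := by
  have h1 : Measurable fun z : L => (√(2 * (‖z‖ + re z)))⁻¹ := by fun_prop
  have h2 : (csqrt : L → L) = fun z => (((√(2 * (‖z‖ + re z)))⁻¹ : ℝ) : L) *
      (z + ((‖z‖ : ℝ) : L)) := by
    funext z; rw [csqrt, RCLike.ofReal_inv]
  rw [h2]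
  fun_prop

theorem measurable_polarScalar : Measurable (polarScalar h : E → 𝕂) := by
  have h1 : Continuous fun γ : E => h.form γ γ := continuous_id.bilin h.form continuous_id
  exact measurable_pi_iff.2 fun i =>
    measurable_csqrt.comp (((continuous_apply i).comp h1).neg.measurable)

theorem Measurable.scalar_smul {X : Type*} [MeasurableSpace X] {f : X → 𝕂} {g : X → E}
    (hf : Measurable f) (hg : Measurable g) : Measurable fun y => f y • g y := by
  have : Continuous fun p : 𝕂 × E => p.1 • p.2 := continuous_fst.scalar_smul continuous_snd
  fun_prop

theorem measurable_polarUnit : Measurable (polarUnit h : E → E) :=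
  (measurable_pi_iff.2 fun i => (measurable_pi_iff.1 measurable_polarScalar i).inv).scalar_smul
    measurable_id

theorem continuous_quad (i : Fin k.card) : Continuous fun v : E => B.quad v i :=
  RCLike.continuous_re.comp ((continuous_apply i).comp (continuous_id.bilin B.form continuous_id))

theorem measurable_polarLog : Measurable (ℓ : E → 𝔞) := by
  have hq : ∀ i, Measurable fun γ : E => B.quad (polarUnit h γ) i := fun i =>
    (continuous_quad i).measurable.comp measurable_polarUnit
  have ha : Measurable arcosh := by unfold arcosh; fun_prop
  refine measurable_pi_iff.2 fun i => ?_
  have h1 := hq i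
  have h2 := hq i.rev
  have h3 : Measurable fun γ : E => arcosh √(B.quad (polarUnit h γ) i *
      B.quad (polarUnit h γ) i.rev) := ha.comp (by fun_prop)
  exact (h3.add ((h1.log.sub h2.log).div_const _)).div_const _

variable (h) in
/-- The set of all `γ` with `|√(-⟨γ, γ⟩)| < 2`. -/
def polarShell : Set E :=
  {γ | h.IsTimelike γ ∧ ∀ i, ‖polarScalar h γ i‖ < 2}

theorem isOpen_polarShell : IsOpen (polarShell h) := by
  rw [isOpen_iff_mem_nhds]
  rintro γ hγ
  have h1 := isOpen_form_condition.mem_nhds hγ.1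
  have h2 : ∀ᶠ γ' in nhds γ, ∀ i, ‖polarScalar h γ' i‖ < 2 := by
    refine Filter.eventually_all.2 fun i => ?_
    have h3 := ((continuous_apply i).continuousAt.comp
      (differentiableAt_polarScalar hγ.1).continuousAt).norm
    exact h3.eventually_lt_const (hγ.2 i)
  filter_upwards [h1, h2] with γ' h3 h4 using ⟨h3, h4⟩

theorem continuous_etaF : Continuous fun q : (E × E) × 𝔞 => etaF (L := L) q.1 (expPos q.2) := by
  have h1 : Continuous (hypSub : 𝔞 → _) := by unfold hypSub; fun_prop
  have h2 : Continuous (hypAdd : 𝔞 → _) := by unfold hypAdd; fun_prop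
  have h3 : Continuous fun q : (E × E) × 𝔞 => realCoeCLM L k (hypSub q.2) :=
    (realCoeCLM L k).continuous.comp (h1.comp continuous_snd)
  have h4 : Continuous fun q : (E × E) × 𝔞 => realCoeCLM L k (hypAdd q.2) :=
    (realCoeCLM L k).continuous.comp (h2.comp continuous_snd)
  simp only [etaF_expPos]
  exact (h3.scalar_smul continuous_fst.fst).add (h4.scalar_smul continuous_fst.snd)

theorem continuous_jacobianEta [Module.Finite 𝕂 E] (F : Submodule 𝕂 E) (w : E × E) : Continuous fun
    s => jacobianEta h B F w (expPos s) := by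
  set b := finBasis ℝ (TangentSK h B F w)
  simp only [jacobianEta_eq_of_basis h B F w _ b]
  refine Continuous.div_const (Continuous.sqrt (Continuous.abs (Continuous.matrix_det ?_))) _
  have h1 : Continuous (hypSub : 𝔞 → _) := by unfold hypSub; fun_prop
  have h2 : Continuous (hypAdd : 𝔞 → _) := by unfold hypAdd; fun_prop
  have hd : ∀ z : (E × E) × 𝔞, Continuous fun s => etaDir L w s z := by
    intro z
    have h3 : Continuous fun s : 𝔞 => hypSubDir s z.2 := by unfold hypSubDir; fun_prop
    have h4 : Continuous fun s : 𝔞 => hypAddDir s z.2 := by unfold hypAddDir; fun_prop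
    simp only [etaDir_apply]
    have hr := (realCoeCLM L k).continuous
    exact (((hr.comp h1).scalar_smul continuous_const).add
      ((hr.comp h2).scalar_smul continuous_const)).add
      (((hr.comp h3).scalar_smul continuous_const).add
      ((hr.comp h4).scalar_smul continuous_const))
  refine continuous_matrix fun i j => ?_
  simp only [toMatrix_apply]
  exact (hd _).bilin h.trace (hd _)

theorem isOpen_chamber : IsOpen (chamber k) := by
  unfold chamber
  simp only [Set.ofPred_forall]
  exact isOpen_iInter_of_finite fun i => isOpen_lt continuous_const (by fun_prop)

theorem add_mem_chamber {s t : 𝔞} (hs : s ∈ chamber k) (ht : t ∈ chamber k) : s + t ∈ chamber k :=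
    fun i => by
  have h1 := hs i
  have h2 := ht i
  grind [Pi.add_apply]

end PolarMeasurability

section PolarShiftInvariance

variable [FiniteDimensional ℝ E] [Module.Finite (Scalar L k) E] [MeasurableSpace E] [BorelSpace E]

include c in
theorem lintegral_polarLog_sub (μ : Measure E) [μ.IsAddHaarMeasure] (J : 𝔞 → ℝ)
    (hJ : ∀ w ∈ sphereF h B ⊤, ∀ s, 𝐉 w (expPos s) = J s) (g : 𝔞 → ℝ≥0∞)
    (hg0 : ∀ s ∉ chamber k, g s = 0) {z : 𝔞} (hz : z ∈ chamber k) : ∫⁻ γ in polarShell h ∩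
    polarDomain h B, g (ℓ γ - z) * (ofReal (J (ℓ γ)))⁻¹ ∂μ = ∫⁻ γ in polarShell h ∩
    polarDomain h B, g (ℓ γ) * (ofReal (J (ℓ γ)))⁻¹ ∂μ := by
  set M := polarShell h ∩ polarDomain h B with hM
  have hMm : MeasurableSet M := (isOpen_polarShell.inter isOpen_polarDomain).measurableSet
  have hch : ∀ γ ∈ M, ℓ γ ∈ chamber k := fun γ hγ =>
    (isPolar_of_mem_polarDomain c hγ.2).mem_chamber
  have hchz : ∀ γ ∈ M, ℓ γ + z ∈ chamber k := fun γ hγ => add_mem_chamber (hch γ hγ) hz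
  have hinj : Set.InjOn (polarShift h B θ z) M := by
    intro γ hγ γ' hγ' heq
    have h1 := polarShift_polarShift c (z' := -z) hγ.2 (hchz γ hγ)
    have h2 := polarShift_polarShift c (z' := -z) hγ'.2 (hchz γ' hγ')
    simp_all [add_neg_cancel, polarShift_zero c hγ.2, polarShift_zero c hγ'.2, heq]
  have himage : polarShift h B θ z '' M = M ∩ {γ | ℓ γ - z ∈ chamber k} := by
    ext γ
    constructor
    · rintro ⟨γ, hγ, rfl⟩
      have hp := isPolar_polarShift c hγ.2 (hchz γ hγ)
      have hd := hp.mem_polarDomain c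
      refine ⟨⟨⟨hd.1, ?_⟩, hd⟩, ?_⟩
      · rw [hp.polarScalar_eq c]; exact hγ.1.2
      simp_all [hp.polarLog_eq c, add_sub_cancel_right]
    · rintro ⟨hγ, hγz⟩
      have hγz' : ℓ γ + -z ∈ chamber k := by tauto
      have hp := isPolar_polarShift c hγ.2 hγz'
      have hd := hp.mem_polarDomain c
      refine ⟨polarShift h B θ (-z) γ, ⟨⟨hd.1, ?_⟩, hd⟩, ?_⟩
      · rw [hp.polarScalar_eq c]; exact hγ.1.2
      · rw [polarShift_polarShift c hγ.2 hγz', neg_add_cancel, polarShift_zero c hγ.2]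
  have hNm : MeasurableSet {γ : E | ℓ γ - z ∈ chamber k} :=
    (measurable_polarLog.sub_const z) isOpen_chamber.measurableSet
  have hder : ∀ γ, ∃ A : E →L[ℝ] E, γ ∈ M → HasFDerivAt (polarShift h B θ z) A γ ∧
      |A.det| * J (ℓ γ) = J (ℓ γ + z) := by
    intro γ
    by_cases hγ : γ ∈ M
    · obtain ⟨A, h1, h2⟩ := (exists_hasFDerivAt_polarShift_det c hγ.2).2 z
      have hp := isPolar_of_mem_polarDomain c hγ.2
      rw [hJ _ hp.mem_sphere, hJ _ hp.mem_sphere] at h2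
      tauto
    aesop
  choose A hA using hder
  have hJpos : ∀ γ ∈ M, 0 < J (ℓ γ) := by
    intro γ hγ
    have h1 := (exists_hasFDerivAt_polarShift_det c hγ.2).1
    rwa [hJ _ (isPolar_of_mem_polarDomain c hγ.2).mem_sphere] at h1
  have key := lintegral_image_eq_lintegral_abs_det_fderiv_mul μ hMm
    (fun γ hγ => (hA γ hγ).1.hasFDerivWithinAt) hinj
    (fun γ => g (ℓ γ - z) * (ofReal (J (ℓ γ)))⁻¹)
  have e1 : ∫⁻ γ in M, g (ℓ γ - z) * (ofReal (J (ℓ γ)))⁻¹ ∂μ =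
      ∫⁻ γ in polarShift h B θ z '' M,
        g (ℓ γ - z) * (ofReal (J (ℓ γ)))⁻¹ ∂μ := by
    rw [himage, Set.inter_comm, ← Measure.restrict_restrict hNm, ← lintegral_indicator hNm]
    refine lintegral_congr fun γ => ?_
    by_cases hγ : ℓ γ - z ∈ chamber k
    · aesop
    aesop
  rw [e1, key]
  refine setLIntegral_congr_fun hMm fun γ hγ => ?_
  have hp := isPolar_polarShift c hγ.2 (hchz γ hγ)
  have h2 := (hA γ hγ).2
  have h3 := hJpos γ hγ
  have h4 : 0 < J (ℓ γ + z) := by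
    have h5 := (exists_hasFDerivAt_polarShift_det c (hp.mem_polarDomain c)).1
    rwa [hp.polarLog_eq c, hp.polarSphere_eq c,
      hJ _ (isPolar_of_mem_polarDomain c hγ.2).mem_sphere] at h5
  simp only [hp.polarLog_eq c, add_sub_cancel_right]
  rw [mul_left_comm]
  congr 1
  rw [← h2, ENNReal.ofReal_mul (abs_nonneg _)]
  have h6 : 0 < |(A γ).det| := by
    rw [← h2] at h4
    exact (pos_iff_pos_of_mul_pos h4).2 h3
  rw [ENNReal.mul_inv (Or.inl (by simpa using h6)) (Or.inl ofReal_ne_top), ← mul_assoc,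
    ENNReal.mul_inv_cancel (by simpa using h6) ofReal_ne_top, one_mul]

end PolarShiftInvariance

section Transport

variable {E' : Type*} [Module.Finite (Scalar L k) E] [NormedAddCommGroup E'] [NormedSpace ℝ E']
  [Module (Scalar L k) E'] [IsScalarTower ℝ (Scalar L k) E'] [Module.Finite (Scalar L k) E']

/-- The Jacobian is invariant under a linear map that induces isometries of tangent spaces. -/
theorem jacobianEta_eq_of_map {h : HermitianForm L k E} {B : PositiveForm L k E} {F : Submodule 𝕂 E}
    {h' : HermitianForm L k E'} {B' : PositiveForm L k E'} {F' : Submodule 𝕂 E'} {w' : E' × E'}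
    {s s' : 𝔞} (f : (E × E) →ₗ[ℝ] (E' × E')) (hfi : Injective f) (T : 𝔞 ≃ₗ[ℝ] 𝔞)
    (hT : ∀ x y, ∑ i, T x i * T y i = ∑ i, x i * y i)
    (hf : ∀ z ∈ tangentF h B F w, f z ∈ tangentF h' B' F' w')
    (hf' : ∀ z' ∈ tangentF h' B' F' w', ∃ z ∈ tangentF h B F w, f z = z') (hm : ∀ z ∈ tangentF h B F
    w, ∀ z' ∈ tangentF h B F w, normTrace (B'.form ((f z).1 + (f z).2) ((f z').1 + (f z').2)) =
    normTrace (B.form (z.1 + z.2) (z'.1 + z'.2))) (hη : ∀ z ∈ tangentF h B F w, ∀ z' ∈ tangentF h B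
    F w, ∀ ξ ξ', normTrace (h'.form (etaDir L w' s' (f z, T ξ)) (etaDir L w' s' (f z', T ξ'))) =
    normTrace (h.form (etaDir L w s (z, ξ)) (etaDir L w s (z', ξ')))) : jacobianEta h B F w
    (expPos s) = jacobianEta h' B' F' w' (expPos s') := by
  let g : tangentF h B F w ≃ₗ[ℝ] tangentF h' B' F' w' :=
    LinearEquiv.ofBijective (f.restrict hf) ⟨fun x y hxy => Subtype.ext (hfi (congrArg Subtype.val hxy)),
      fun z => by
        obtain ⟨y, hy, hyz⟩ := hf' z.1 z.2
        exact ⟨⟨y, hy⟩, Subtype.ext hyz⟩⟩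
  refine jacobianEta_transport (g.prodCongr T) (fun a b => ?_)
    fun a b => hη a.1.1 a.1.2 b.1.1 b.1.2 a.2 b.2
  change normTrace (B'.form ((f a.1.1).1 + (f a.1.1).2) ((f b.1.1).1 + (f b.1.1).2)) +
    ∑ i, T a.2 i * T b.2 i = _
  rw [hm _ a.1.2 _ b.1.2, hT]
  rfl

end Transport

section CompactAction

variable {KK : Type*} [Group KK] [TopologicalSpace KK]

/-- A continuous action by isometries of both forms that is transitive on `S_E`. -/
structure IsSphereAction (h : HermitianForm L k E) (B : PositiveForm L k E)
    (ρ : KK →* (E →ₗ[ℝ] E)) (w : E × E) : Prop where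
  continuous : Continuous fun p : KK × E => ρ p.1 p.2
  smul : ∀ x (a : 𝕂) v, ρ x (a • v) = a • ρ x v
  form : ∀ x u v, h.form (ρ x u) (ρ x v) = h.form u v
  pos : ∀ x u v, B.form (ρ x u) (ρ x v) = B.form u v
  transitive : ∀ w' ∈ sphereF h B ⊤, ∃ x, w' = (ρ x w.1, ρ x w.2)

variable {ρ : KK →* (E →ₗ[ℝ] E)} {w : E × E}

theorem monoidHom_inv_apply (ρ : KK →* (E →ₗ[ℝ] E)) (x : KK) (v : E) : ρ x (ρ x⁻¹ v) = v := by simp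

namespace IsSphereAction

theorem theta_comm (q : IsSphereAction h B ρ w) (c : IsCartan h B θ) (x : KK) (v : E) : θ (ρ x v) =
    ρ x (θ v) := by
  refine c.pos_ext_right fun u => ?_
  have e1 : B.form u (θ (ρ x v)) = h.form u (ρ x v) := (c.form_eq' _ _).symm
  have e2 := q.pos x (ρ x⁻¹ u) (θ v)
  grind [q.form, monoidHom_inv_apply, c.form_eq']

theorem etaDir_apply (q : IsSphereAction h B ρ w) (x : KK) (s : 𝔞) (z : E × E) (ξ : 𝔞) : etaDir L
    (ρ x w.1, ρ x w.2) s ((ρ x z.1, ρ x z.2), ξ) = ρ x (etaDir L w s (z, ξ)) := by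
  simp only [_root_.etaDir_apply, map_add, q.smul]

theorem etaF_apply (q : IsSphereAction h B ρ w) (x : KK) (w' : E × E) (t : PosScalar k) : etaF
    (L := L) (ρ x w'.1, ρ x w'.2) t = ρ x (etaF (L := L) w' t) := by
  simp only [etaF, map_add, q.smul, map_smul]

theorem jacobianEta_eq [Module.Finite 𝕂 E] (q : IsSphereAction h B ρ w) (c : IsCartan h B θ)
    {w' : E × E} (hw' : w' ∈ 𝕊) (s : 𝔞) : 𝐉 w' (expPos s) = 𝐉 w (expPos s) := by
  obtain ⟨x, rfl⟩ := q.transitive w' hw'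
  refine (jacobianEta_eq_of_map ((ρ x).prodMap (ρ x)) ?_ (LinearEquiv.refl ℝ _) (fun _ _ => rfl)
    ?_ ?_ ?_ ?_).symm
  · refine Function.LeftInverse.injective (g := (ρ x⁻¹).prodMap (ρ x⁻¹)) fun z => ?_
    simp
  · intro z hz
    simp_all [c.mem_tangentF_top, prodMap_apply, q.theta_comm c, q.pos, hz.1, hz.2.1, true_and]
  · intro z hz
    refine ⟨(ρ x⁻¹ z.1, ρ x⁻¹ z.2), ?_, ?_⟩
    · have e : ∀ u v, B.form (ρ x⁻¹ u) v = B.form u (ρ x v) := fun u v => by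
        rw [← q.pos x, monoidHom_inv_apply]
      have e' : ∀ u v, B.form v (ρ x⁻¹ u) = B.form (ρ x v) u := fun u v => by
        rw [← q.pos x, monoidHom_inv_apply]
      rw [c.mem_tangentF_top] at hz ⊢
      simp_all [e, e', q.theta_comm c, hz.1, hz.2.1, true_and]
    simp
  · simp [prodMap_apply, q.pos]
  · intro z _ z' _ ξ ξ'
    grind [q.etaDir_apply, prodMap_apply, refl_apply, q.form]

end IsSphereAction

include c in
theorem IsCartan.normTrace_pos_eq_zero {x y : E} (hx : θ x = x) (hy : θ y = -y) : normTrace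
    (B.form x y) = 0 := by
  have h1 : B.form x y = sigma (h.form x y) := by rw [← c.pos_theta_left, hx]
  have h2 := congrArg normTrace h1
  rw [normTrace_sigma, c.form_eq', hy, map_neg, normTrace_neg] at h2
  linarith

include c in
theorem IsCartan.jacobianEta_neg_rev [Module.Finite 𝕂 E] (w : E × E) (s : 𝔞) : 𝐉 w (expPos s) = 𝐉
    (-w.1, w.2) (expPos fun i => -s i.rev) := by
  let T : 𝔞 ≃ₗ[ℝ] 𝔞 :=
    (funCongrLeft ℝ ℝ revPerm).trans (LinearEquiv.neg ℝ)
  have hT : ∀ ξ i, T ξ i = -ξ i.rev := fun ξ i => rfl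
  refine jacobianEta_eq_of_map ((-LinearMap.id).prodMap LinearMap.id) ?_ T ?_ ?_ ?_ ?_ ?_
  · intro z z' hz
    aesop
  · intro x y
    simp only [hT, neg_mul_neg]
    exact Equiv.sum_comp revPerm fun i => x i * y i
  · intro z hz
    rw [c.mem_tangentF_top] at hz ⊢
    simp only [prodMap_apply, LinearMap.neg_apply, id_apply, map_neg, neg_neg,
      hz.1, hz.2.1, true_and, LinearMap.neg_apply]
    refine ⟨hz.2.2.1, hz.2.2.2.1, ?_⟩
    rw [← neg_add, hz.2.2.2.2, neg_zero]
  · intro z hz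
    refine ⟨(-z.1, z.2), ?_, by simp⟩
    rw [c.mem_tangentF_top] at hz ⊢
    simp only [map_neg, LinearMap.neg_apply, hz.1, hz.2.1, true_and] at hz ⊢
    grind
  · intro z hz z' hz'
    rw [c.mem_tangentF_top] at hz hz'
    have e1 := c.normTrace_pos_eq_zero hz.1 hz'.2.1
    have e2 := c.normTrace_pos_eq_zero hz'.1 hz.2.1
    rw [B.conj_symm, normTrace_star] at e2
    simp [prodMap_apply, LinearMap.neg_apply, id_apply, map_neg, map_add, add_app, normTrace_add, normTrace_neg, e1, e2, neg_neg, neg_zero]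
  · intro z _ z' _ ξ ξ'
    have e : ∀ z ξ, etaDir L (-w.1, w.2) (fun i => -s i.rev)
        (((-LinearMap.id).prodMap LinearMap.id : (E × E) →ₗ[ℝ] (E × E)) z, T ξ) =
        etaDir L w s (z, ξ) := by
      intro z ξ
      have e1 : hypSub (fun i => -s i.rev) = -hypSub s := by
        funext i; simp only [hypSub, rev_rev, Pi.neg_apply, neg_neg]; ring
      have e2 : hypAdd (fun i => -s i.rev) = hypAdd s := by
        funext i; simp only [hypAdd, rev_rev, neg_neg]; ring
      have e3 : hypSubDir (fun i => -s i.rev) (T ξ) = -hypSubDir s ξ := by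
        funext i; simp only [hypSubDir, rev_rev, Pi.neg_apply, neg_neg, hT]; ring
      have e4 : hypAddDir (fun i => -s i.rev) (T ξ) = hypAddDir s ξ := by
        funext i; simp only [hypAddDir, rev_rev, neg_neg, hT]; ring
      simp [_root_.etaDir_apply, e1, e2, e3, e4, prodMap_apply, LinearMap.neg_apply, id_apply, map_neg, neg_smul_neg]
    simp only [e]

end CompactAction

section PolarIntegration

variable [FiniteDimensional ℝ E] [Module.Finite (Scalar L k) E] [MeasurableSpace E] [BorelSpace E]

variable (h) in
theorem HermitianForm.abs_det_eq_one (g : E →ₗ[ℝ] E) (hg : ∀ u v, h.form (g u) (g v) = h.form u v) :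
    |det g| = 1 := by
  set b := finBasis ℝ E
  have h1 := det_toMatrix_comp_endomorphism b h.trace g
  have h2 : h.trace.comp g g = h.trace := by
    ext u v
    simp only [LinearMap.BilinForm.comp_apply, HermitianForm.trace_apply, hg]
  have h3 : (toMatrix b h.trace).det ≠ 0 :=
    det_toMatrix_ne_zero b _ fun x hx => h.eq_zero_of_normTrace fun v => hx v
  rw [h2] at h1
  have h4 : det g ^ 2 = 1 := mul_right_cancel₀ h3 (by rw [one_mul, ← h1])
  rw [← sq_abs] at h4
  exact (pow_eq_one_iff_of_nonneg (abs_nonneg _) two_ne_zero).1 h4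

variable (h) in
theorem HermitianForm.lintegral_comp_isometry (μ : Measure E) [μ.IsAddHaarMeasure] (g : E →ₗ[ℝ] E)
    (hg : ∀ u v, h.form (g u) (g v) = h.form u v) {f : E → ℝ≥0∞} (hf : Measurable f) : ∫⁻ v, f (g v)
    ∂μ = ∫⁻ v, f v ∂μ := by
  have h1 := h.abs_det_eq_one g hg
  have h2 : det g ≠ 0 := by intro h0; rw [h0, abs_zero] at h1; exact zero_ne_one h1
  have h3 := Measure.map_linearMap_addHaar_eq_smul_addHaar μ h2
  rw [abs_inv, h1, inv_one, ENNReal.ofReal_one, one_smul] at h3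
  conv_rhs => rw [← h3]
  rw [lintegral_map hf (continuous_of_finiteDimensional g).measurable]

section

variable {g : E →ₗ[ℝ] E} (hgK : ∀ (a : Scalar L k) v, g (a • v) = a • g v)
  (hgh : ∀ u v, h.form (g u) (g v) = h.form u v) (hgB : ∀ u v, B.form (g u) (g v) = B.form u v)

include hgh in
theorem polarScalar_isometry (γ : E) : polarScalar h (g γ) = polarScalar h γ := by
  funext i; rw [polarScalar, hgh]; rfl

include hgK hgh in
theorem polarUnit_isometry (γ : E) : polarUnit h (g γ) = g (polarUnit h γ) := by
  rw [polarUnit, polarScalar_isometry hgh, polarUnit, hgK]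

include hgh in
theorem mem_polarShell_isometry (γ : E) : g γ ∈ polarShell h ↔ γ ∈ polarShell h := by
  simp only [polarShell, Set.mem_ofPred_eq, HermitianForm.IsTimelike, hgh, polarScalar_isometry hgh]

include hgK hgh hgB in
theorem mem_polarDomain_isometry (γ : E) : g γ ∈ polarDomain h B ↔ γ ∈ polarDomain h B := by
  simp only [polarDomain, Set.mem_ofPred_eq, HermitianForm.IsTimelike, hgh, polarUnit_isometry hgK hgh, PositiveForm.quad, hgB]

end

variable {KK : Type*} [Group KK] [TopologicalSpace KK] [IsTopologicalGroup KK] [MeasurableSpace KK]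
  [BorelSpace KK] {ρ : KK →* (E →ₗ[ℝ] E)} {w : E × E}

theorem IsSphereAction.measurable (q : IsSphereAction h B ρ w) : Measurable fun p : KK × E => ρ p.1
    p.2 := q.continuous.measurable

theorem IsSphereAction.measurable_average (q : IsSphereAction h B ρ w) (κ : Measure KK) [SFinite κ]
    {F : E → ℝ≥0∞} (hF : Measurable F) : Measurable fun s : 𝔞 => ∫⁻ x, F (ρ x η[w, s]) ∂κ := by
  have h1 : Continuous fun s : 𝔞 => η[w, s] :=
    continuous_etaF.comp (continuous_const.prodMk continuous_id)
  have h2 : Measurable fun p : 𝔞 × KK => ρ p.2 (etaF (L := L) w (expPos p.1)) :=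
    q.measurable.comp (measurable_snd.prodMk (h1.measurable.comp measurable_fst))
  exact (hF.comp h2).lintegral_prod_right'

theorem IsSphereAction.lintegral_polarUnit (q : IsSphereAction h B ρ w) (c : IsCartan h B θ)
    (μ : Measure E) [μ.IsAddHaarMeasure] (κ : Measure KK) [IsProbabilityMeasure κ]
    [κ.IsMulRightInvariant] {F : E → ℝ≥0∞} (hF : Measurable F) : ∫⁻ γ in polarShell h ∩ polarDomain
    h B, F (polarUnit h γ) ∂μ = ∫⁻ γ in polarShell h ∩ polarDomain h B, ∫⁻ x, F
    (ρ x (etaF (L := L) w (expPos (ℓ γ)))) ∂κ ∂μ := by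
  set M := polarShell h ∩ polarDomain h B with hM
  have hMm : MeasurableSet M := (isOpen_polarShell.inter isOpen_polarDomain).measurableSet
  have h1 : ∀ x : KK, ∫⁻ γ in M, F (ρ x (polarUnit h γ)) ∂μ = ∫⁻ γ in M, F (polarUnit h γ) ∂μ := by
    intro x
    rw [← lintegral_indicator hMm, ← lintegral_indicator hMm,
      ← h.lintegral_comp_isometry μ (ρ x) (q.form x)
        (f := M.indicator fun γ => F (polarUnit h γ)) ((hF.comp measurable_polarUnit).indicator hMm)]
    refine lintegral_congr fun γ => ?_
    have e : ρ x γ ∈ M ↔ γ ∈ M := and_congr (mem_polarShell_isometry (q.form x) γ)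
      (mem_polarDomain_isometry (q.smul x) (q.form x) (q.pos x) γ)
    by_cases hγ : γ ∈ M
    · rw [indicator_of_mem hγ, indicator_of_mem (e.2 hγ),
        polarUnit_isometry (q.smul x) (q.form x)]
    · rw [indicator_of_notMem hγ, indicator_of_notMem fun h => hγ (e.1 h)]
  have h2 : ∫⁻ γ in M, F (polarUnit h γ) ∂μ =
      ∫⁻ x, ∫⁻ γ in M, F (ρ x (polarUnit h γ)) ∂μ ∂κ := by
    simp only [h1, lintegral_const, measure_univ, mul_one]
  rw [h2, lintegral_lintegral_swap]
  · refine setLIntegral_congr_fun hMm fun γ hγ => ?_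
    have hp := isPolar_of_mem_polarDomain c hγ.2
    obtain ⟨x₀, hx₀⟩ := q.transitive _ hp.mem_sphere
    have e1 : polarUnit h γ = ρ x₀ (etaF (L := L) w (expPos (ℓ γ))) := by
      rw [hp.polarUnit_eq c, ← q.etaF_apply, hx₀]
    simp only [e1]
    rw [← lintegral_mul_right_eq_self
      (fun x => F (ρ x (etaF (L := L) w (expPos (ℓ γ))))) x₀]
    simp only [map_mul, Module.End.mul_apply]
  · have : Measurable fun p : KK × E => F (ρ p.1 (polarUnit h p.2)) :=
      hF.comp (q.measurable.comp (measurable_fst.prodMk (measurable_polarUnit.comp measurable_snd)))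
    exact this.aemeasurable

theorem chamber_or_neg {s : 𝔞} (hs : ∀ i, s i + s i.rev ≠ 0) : s ∈ chamber k ↔ ¬ (fun i => -s i.rev)
    ∈ chamber k := by
  have h1 : ∀ i j, s i + s i.rev = s j + s j.rev := by
    cases k <;> intro i j <;> fin_cases i <;> fin_cases j <;>
      first | rfl | exact add_comm _ _
  have i₀ : Fin k.card := ⟨0, card_pos' k⟩
  have h2 : ∀ i : Fin k.card, 0 < -s i.rev + -s i.rev.rev ↔ ¬ 0 < s i + s i.rev := by
    intro i
    have := hs i
    rw [rev_rev]
    constructor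
    · intro h3; linarith
    · intro h3
      have : s i + s i.rev < 0 := lt_of_le_of_ne (not_lt.1 h3) this
      linarith
  have h3 : s ∈ chamber k ↔ 0 < s i₀ + s i₀.rev := ⟨fun h => h i₀, fun h i => by rw [h1 i i₀]; exact h⟩
  have h4 : (fun i => -s i.rev) ∈ chamber k ↔ ¬ 0 < s i₀ + s i₀.rev :=
    ⟨fun h => (h2 i₀).1 (h i₀), fun h i => (h2 i).2 (by rw [h1 i i₀]; exact h)⟩
  rw [h3, h4, not_not]

theorem ae_add_rev_ne_zero : ∀ᵐ s : 𝔞, ∀ i, s i + s i.rev ≠ 0 := by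
  rw [ae_all_iff]
  intro i
  let f : 𝔞 →ₗ[ℝ] ℝ := LinearMap.proj (R := ℝ) (φ := fun _ => ℝ) i +
    LinearMap.proj (R := ℝ) (φ := fun _ => ℝ) i.rev
  have h1 := Measure.addHaar_submodule (volume : Measure 𝔞) (ker f) (by
    intro h0
    have h2 : (fun _ => 1 : 𝔞) ∈ ker f := by rw [h0]; trivial
    have h3 : (1 : ℝ) + 1 = 0 := h2
    norm_num at h3)
  rw [ae_iff]
  convert h1 using 2
  ext s
  simp [f]

theorem lintegral_eq_two_mul_chamber (Φ : 𝔞 → ℝ≥0∞) (hΦ' : ∀ s, Φ (fun i => -s i.rev) = Φ s) : ∫⁻ s,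
    Φ s = 2 * ∫⁻ s in chamber k, Φ s := by
  have hm : MeasurableSet (chamber k) := isOpen_chamber.measurableSet
  let T : 𝔞 ≃ᵐ 𝔞 :=
    (piCongrLeft (fun _ => ℝ) revPerm).trans (MeasurableEquiv.neg _)
  have hT : ∀ s, T s = fun i => -s i.rev := by
    intro s; funext i
    change -(piCongrLeft (fun _ => ℝ) revPerm s i) = _
    have := MeasurableEquiv.piCongrLeft_apply_apply (β := fun _ : Fin k.card => ℝ) revPerm s i.rev
    simp only [Fin.revPerm_apply, rev_rev] at this
    rw [this]
  have hTv : MeasurePreserving T := 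
    (volume_measurePreserving_piCongrLeft (fun _ => ℝ) revPerm).trans
      (Measure.measurePreserving_neg _)
  have h1 : ∫⁻ s in (chamber k)ᶜ, Φ s = ∫⁻ s in chamber k, Φ s := by
    rw [← lintegral_indicator hm, ← lintegral_indicator hm.compl,
      ← hTv.lintegral_comp_emb T.measurableEmbedding]
    refine lintegral_congr_ae ?_
    filter_upwards [ae_add_rev_ne_zero] with s hs
    have h2 := chamber_or_neg hs
    rw [← hT] at h2
    have h3 : Φ (T s) = Φ s := by rw [hT, hΦ']
    by_cases h4 : s ∈ chamber k
    · rw [indicator_of_mem h4, indicator_of_mem (show T s ∈ (chamber k)ᶜ from h2.1 h4), h3]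
    · rw [indicator_of_notMem h4, indicator_of_notMem fun h5 => h4 (h2.2 h5)]
  rw [← lintegral_add_compl Φ hm, h1, two_mul]

end PolarIntegration

section PolarFormula

variable [FiniteDimensional ℝ E] [Module.Finite (Scalar L k) E] [MeasurableSpace E] [BorelSpace E]
  {KK : Type*} [Group KK] [TopologicalSpace KK] [IsTopologicalGroup KK] [CompactSpace KK]
  [MeasurableSpace KK] [BorelSpace KK] {ρ : KK →* (E →ₗ[ℝ] E)} {w : E × E}

theorem isPolar_etaF (hw : w ∈ 𝕊) {s : 𝔞} (hs : s ∈ chamber k) : IsPolar h B η[w, s] 1 w s where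
  tau_eq := tau_one
  re_pos i := by simp
  mem_sphere := hw
  mem_chamber := hs
  eq := (one_smul _ _).symm

include c in
theorem etaF_mem_polarShell (hw : w ∈ 𝕊) {s : 𝔞} (hs : s ∈ chamber k) : η[w, s] ∈ polarShell h ∩
    polarDomain h B := by
  have hp := isPolar_etaF (L := L) hw hs
  have hd := hp.mem_polarDomain c
  refine ⟨⟨hd.1, fun i => ?_⟩, hd⟩
  rw [hp.polarScalar_eq c]
  simp

include c in
theorem IsCartan.jacobianEta_pos_of_mem_chamber (hw : w ∈ 𝕊) {s : 𝔞} (hs : s ∈ chamber k) : 0 < 𝐉 w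
    (expPos s) := by
  have hp := isPolar_etaF (L := L) hw hs
  have h1 := (exists_hasFDerivAt_polarShift_det c (hp.mem_polarDomain c)).1
  rwa [hp.polarLog_eq c, hp.polarSphere_eq c] at h1

/-- The polar coordinates are proper. -/
theorem IsSphereAction.exists_isCompact (q : IsSphereAction h B ρ w) (c : IsCartan h B θ)
    {Q : Set 𝔞} (hQ : IsCompact Q) : ∃ C : Set E, IsCompact C ∧ ∀ γ ∈ polarShell h ∩ polarDomain h
    B, ℓ γ ∈ Q → γ ∈ C := by
  refine ⟨(fun p : 𝕂 × KK × 𝔞 =>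
    p.1 • ρ p.2.1 (etaF (L := L) w (expPos p.2.2))) '' (closedBall 0 2 ×ˢ Set.univ ×ˢ Q), ?_, ?_⟩
  · refine IsCompact.image ((isCompact_closedBall _ _).prod (isCompact_univ.prod hQ)) ?_
    have h1 : Continuous fun s : 𝔞 => η[w, s] :=
      continuous_etaF.comp (continuous_const.prodMk continuous_id)
    exact continuous_fst.scalar_smul (q.continuous.comp
      (continuous_snd.fst.prodMk (h1.comp continuous_snd.snd)))
  · intro γ hγ hQγ
    have hp := isPolar_of_mem_polarDomain c hγ.2
    obtain ⟨x, hx⟩ := q.transitive _ hp.mem_sphere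
    refine ⟨(polarScalar h γ, x, ℓ γ), ⟨?_, trivial, hQγ⟩, ?_⟩
    · rw [mem_closedBall_zero_iff, pi_norm_le_iff_of_nonneg zero_le_two]
      exact fun i => (hγ.1.2 i).le
    · conv_rhs => rw [hp.eq, hx, q.etaF_apply]

theorem exists_lintegral_polarLog (q : IsSphereAction h B ρ w) (c : IsCartan h B θ) (hw : w ∈ 𝕊)
    (μ : Measure E) [μ.IsAddHaarMeasure] : ∃ D : ℝ≥0∞, D ≠ 0 ∧ D ≠ ∞ ∧ ∀ φ : 𝔞 → ℝ≥0∞, Measurable φ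
    → (∀ s ∉ chamber k, φ s = 0) → ∫⁻ γ in polarShell h ∩ polarDomain h B, φ (ℓ γ) *
    (ofReal (𝐉 w (expPos (ℓ γ))))⁻¹ ∂μ = D * ∫⁻ s, φ s := by
  set J : 𝔞 → ℝ := fun s => 𝐉 w (expPos s) with hJdef
  have hJc : Continuous J := continuous_jacobianEta ⊤ w
  have hJpos : ∀ s ∈ chamber k, 0 < J s := fun s hs => c.jacobianEta_pos_of_mem_chamber hw hs
  have hJ : ∀ w' ∈ sphereF h B ⊤, ∀ s, 𝐉 w' (expPos s) = J s :=
    fun w' hw' s => q.jacobianEta_eq c hw' s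
  set M := polarShell h ∩ polarDomain h B with hM
  have hMo : IsOpen M := isOpen_polarShell.inter isOpen_polarDomain
  have hd : Measurable fun γ => (ofReal (J (ℓ γ)))⁻¹ :=
    (hJc.measurable.comp measurable_polarLog).ennreal_ofReal.inv
  set ν := Measure.map (ℓ) ((μ.restrict M).withDensity
    fun γ => (ofReal (J (ℓ γ)))⁻¹) with hν
  have hνf : ∀ φ : 𝔞 → ℝ≥0∞, Measurable φ → ∫⁻ s, φ s ∂ν =
      ∫⁻ γ in M, φ (ℓ γ) * (ofReal (J (ℓ γ)))⁻¹ ∂μ := by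
    intro φ hφ
    rw [hν, lintegral_map hφ measurable_polarLog]
    refine (lintegral_withDensity_eq_lintegral_mul _ hd (hφ.comp measurable_polarLog)).trans ?_
    exact lintegral_congr fun γ => mul_comm _ _
  have hinv : ∀ φ : 𝔞 → ℝ≥0∞, Measurable φ → (∀ s ∉ chamber k, φ s = 0) →
      ∀ z ∈ chamber k, ∫⁻ s, φ (s - z) ∂ν = ∫⁻ s, φ s ∂ν := by
    intro φ hφ h0 z hz
    rw [hνf _ hφ, hνf _ (by fun_prop)]
    exact lintegral_polarLog_sub c μ J hJ φ h0 hz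
  set s₀ : 𝔞 := fun _ => 2 with hs₀
  have hQ : ∀ s ∈ closedBall s₀ 1, s ∈ chamber k := by
    intro s hs i
    rw [mem_closedBall_iff_norm, pi_norm_le_iff_of_nonneg zero_le_one] at hs
    have h1 := abs_le.1 (hs i)
    have h2 := abs_le.1 (hs i.rev)
    grind [Pi.sub_apply]
  set g : 𝔞 → ℝ≥0∞ := (Metric.ball s₀ 1).indicator 1 with hg
  have hgm : Measurable g := measurable_one.indicator Metric.isOpen_ball.measurableSet
  have hg0 : ∀ s ∉ chamber k, g s = 0 := fun s hs =>
    indicator_of_notMem (fun h => hs (hQ s (Metric.ball_subset_closedBall h))) _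
  have hgv : ∫⁻ s, g s = volume (Metric.ball s₀ 1) :=
    lintegral_indicator_one Metric.isOpen_ball.measurableSet
  have hgv0 : ∫⁻ s, g s ≠ 0 := by simp [hgv]
  have hgv1 : ∫⁻ s, g s ≠ ∞ := by simp [hgv]
  have hlog : ContinuousOn (ℓ) M := fun γ hγ =>
    (differentiableAt_polarLog c hγ.2).continuousAt.continuousWithinAt
  set U := M ∩ ℓ ⁻¹' Metric.ball s₀ 1 with hU
  have hUo : IsOpen U := hlog.isOpen_inter_preimage hMo Metric.isOpen_ball
  have hUne : U.Nonempty := by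
    have h1 : s₀ ∈ chamber k := hQ s₀ (Metric.mem_closedBall_self zero_le_one)
    refine ⟨_, etaF_mem_polarShell (L := L) c hw h1, ?_⟩
    simp [Set.mem_preimage, (isPolar_etaF (L := L) hw h1).polarLog_eq c]
  have hνg : ∫⁻ s, g s ∂ν = ∫⁻ γ in U, (ofReal (J (ℓ γ)))⁻¹ ∂μ := by
    rw [hνf g hgm, ← lintegral_indicator hMo.measurableSet, ← lintegral_indicator hUo.measurableSet]
    refine lintegral_congr fun γ => ?_
    by_cases h1 : γ ∈ M
    · by_cases h2 : ℓ γ ∈ Metric.ball s₀ 1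
      · rw [indicator_of_mem h1, indicator_of_mem (show γ ∈ U from ⟨h1, h2⟩), hg,
          indicator_of_mem h2, Pi.one_apply, one_mul]
      simp [indicator_of_mem h1, indicator_of_notMem (show γ ∉ U from fun h => h2 h.2), hg, indicator_of_notMem h2, zero_mul]
    grind [indicator_of_notMem]
  have hνg0 : ∫⁻ s, g s ∂ν ≠ 0 := by
    rw [hνg, ← pos_iff_ne_zero, lintegral_pos_iff_support hd]
    have : Function.support (fun γ => (ofReal (J (ℓ γ)))⁻¹) = Set.univ := by
      ext γ; simp
    rw [this, Measure.restrict_apply_univ]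
    exact hUo.measure_pos μ hUne
  have hνg1 : ∫⁻ s, g s ∂ν ≠ ∞ := by
    obtain ⟨s₁, hs₁, hmin⟩ := (isCompact_closedBall s₀ 1).exists_isMinOn
      ⟨s₀, Metric.mem_closedBall_self zero_le_one⟩ hJc.continuousOn
    obtain ⟨C, hC, hCM⟩ := q.exists_isCompact c (isCompact_closedBall s₀ 1)
    have h1 : ∫⁻ γ in U, (ofReal (J (ℓ γ)))⁻¹ ∂μ ≤
        ∫⁻ γ in U, (ofReal (J s₁))⁻¹ ∂μ := by
      refine setLIntegral_mono' hUo.measurableSet fun γ hγ => ?_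
      exact ENNReal.inv_le_inv.2 (ENNReal.ofReal_le_ofReal
        (hmin (Metric.ball_subset_closedBall hγ.2)))
    rw [hνg]
    refine ne_top_of_le_ne_top ?_ h1
    rw [setLIntegral_const]
    refine mul_ne_top ?_ ?_
    · have := hJpos s₁ (hQ s₁ hs₁)
      simpa using this
    · exact ne_top_of_le_ne_top hC.measure_ne_top
        (measure_mono fun γ hγ => hCM γ hγ.1 (Metric.ball_subset_closedBall hγ.2))
  refine ⟨(∫⁻ s, g s ∂ν) / ∫⁻ s, g s, ENNReal.div_ne_zero.2 ⟨hνg0, hgv1⟩,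
    div_ne_top hνg1 hgv0, fun φ hφ hφ0 => ?_⟩
  have key := lintegral_mul_lintegral_of_semigroup volume ν (chamber k) φ g hφ hgm hφ0 hg0
    (hinv φ hφ hφ0) (hinv g hgm hg0)
  rw [← hνf φ hφ, div_eq_mul_inv, mul_right_comm, ← key, mul_assoc,
    ENNReal.mul_inv_cancel hgv0 hgv1, mul_one]

variable (h B) in
/-- The polar measure on `{γ | ⟨γ, γ⟩ = -1}`, as a functional. -/
noncomputable def polarIntegral (ρ : KK →* (E →ₗ[ℝ] E)) (w : E × E) (κ : Measure KK)
    (F : E → ℝ≥0∞) : ℝ≥0∞ :=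
  ∫⁻ s, ofReal (𝐉 w (expPos s)) *
    ∫⁻ x, F (ρ x η[w, s]) ∂κ

theorem IsSphereAction.average_neg_rev (q : IsSphereAction h B ρ w) (c : IsCartan h B θ)
    (hw : w ∈ 𝕊) (κ : Measure KK) [κ.IsMulRightInvariant] (F : E → ℝ≥0∞) (s : 𝔞) : ∫⁻ x, F
    (ρ x (etaF (L := L) w (expPos fun i => -s i.rev))) ∂κ =
      ∫⁻ x, F (ρ x η[w, s]) ∂κ ∧
    𝐉 w (expPos fun i => -s i.rev) = 𝐉 w (expPos s) := by
  have hw' : (-w.1, w.2) ∈ 𝕊 := by simp_all [c.mem_sphereF_top, hw.1]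
  constructor
  · obtain ⟨x₀, hx₀⟩ := q.transitive _ hw'
    have e : etaF (L := L) w (expPos fun i => -s i.rev) =
        ρ x₀ η[w, s] := by
      rw [← q.etaF_apply, ← hx₀, etaF_expPos, etaF_expPos]
      have e1 : hypSub (fun i => -s i.rev) = -hypSub s := by
        funext i; simp only [hypSub, rev_rev, Pi.neg_apply, neg_neg]; ring
      have e2 : hypAdd (fun i => -s i.rev) = hypAdd s := by
        funext i; simp only [hypAdd, rev_rev, neg_neg]; ring
      simp [e1, e2]
    rw [e, ← lintegral_mul_right_eq_self (fun x => F (ρ x η[w, s])) x₀]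
    simp
  · rw [c.jacobianEta_neg_rev w s, q.jacobianEta_eq c hw']

/-- Lebesgue measure near `{γ | ⟨γ, γ⟩ = -1}` in polar coordinates. -/
theorem exists_polarIntegral (q : IsSphereAction h B ρ w) (c : IsCartan h B θ) (hw : w ∈ 𝕊)
    (μ : Measure E) [μ.IsAddHaarMeasure] (κ : Measure KK) [IsProbabilityMeasure κ]
    [κ.IsMulRightInvariant] : ∃ D : ℝ≥0∞, D ≠ 0 ∧ D ≠ ∞ ∧ ∀ F : E → ℝ≥0∞, Measurable F → ∫⁻ γ in
    polarShell h, F (polarUnit h γ) ∂μ = D * polarIntegral h B ρ w κ F := by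
  obtain ⟨D, hD0, hD1, hD⟩ := exists_lintegral_polarLog q c hw μ
  refine ⟨D / 2, ENNReal.div_ne_zero.2 ⟨hD0, ENNReal.ofNat_ne_top⟩,
    div_ne_top hD1 two_ne_zero, fun F hF => ?_⟩
  have hMm : MeasurableSet (polarShell h ∩ polarDomain h B) :=
    (isOpen_polarShell.inter isOpen_polarDomain).measurableSet
  have hch : MeasurableSet (chamber k) := isOpen_chamber.measurableSet
  have h1 : (polarShell h ∩ polarDomain h B : Set E) =ᵐ[μ] polarShell h := by
    filter_upwards [ae_mem_polarDomain c μ hw] with γ hγ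
    exact propext ⟨fun h1 => h1.1, fun h1 => ⟨h1, hγ h1.1⟩⟩
  set Fb : 𝔞 → ℝ≥0∞ := fun s => ∫⁻ x, F (ρ x η[w, s]) ∂κ with hFb
  have hFbm : Measurable Fb := q.measurable_average κ hF
  have hJm : Measurable fun s => ofReal (𝐉 w (expPos s)) :=
    (continuous_jacobianEta ⊤ w).measurable.ennreal_ofReal
  set φ : 𝔞 → ℝ≥0∞ := (chamber k).indicator fun s =>
    ofReal (𝐉 w (expPos s)) * Fb s with hφ
  have h2 := hD φ ((hJm.mul hFbm).indicator hch) fun s hs => indicator_of_notMem hs _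
  rw [← setLIntegral_congr h1, q.lintegral_polarUnit c μ κ hF]
  have h3 : ∫⁻ γ in polarShell h ∩ polarDomain h B, Fb (ℓ γ) ∂μ =
      D * ∫⁻ s, φ s := by
    rw [← h2]
    refine setLIntegral_congr_fun hMm fun γ hγ => ?_
    have hs := (isPolar_of_mem_polarDomain c hγ.2).mem_chamber
    have hJ := c.jacobianEta_pos_of_mem_chamber hw hs
    simp only [hφ, indicator_of_mem hs]
    rw [mul_right_comm, ENNReal.mul_inv_cancel (by simpa using hJ) ofReal_ne_top, one_mul]
  have h4 : polarIntegral h B ρ w κ F = 2 * ∫⁻ s, φ s := by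
    rw [hφ, lintegral_indicator hch]
    refine lintegral_eq_two_mul_chamber _ fun s => ?_
    obtain ⟨e1, e2⟩ := q.average_neg_rev c hw κ F s
    simp only [hFb, e1, e2]
  rw [h3, h4, ← mul_assoc, ENNReal.div_mul_cancel two_ne_zero ENNReal.ofNat_ne_top]

/-- The polar measure is invariant under the unitary group. -/
theorem polarIntegral_isometry (q : IsSphereAction h B ρ w) (c : IsCartan h B θ) (hw : w ∈ 𝕊)
    (κ : Measure KK) [IsProbabilityMeasure κ] [κ.IsMulRightInvariant] (g : E →ₗ[ℝ] E)
    (hgK : ∀ (a : 𝕂) v, g (a • v) = a • g v) (hgh : ∀ u v, h.form (g u) (g v) = h.form u v)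
    {F : E → ℝ≥0∞} (hF : Measurable F) : polarIntegral h B ρ w κ (fun v => F (g v)) = polarIntegral
    h B ρ w κ F := by
  obtain ⟨D, hD0, hD1, hD⟩ := exists_polarIntegral q c hw (MeasureTheory.Measure.addHaar (G := E)) κ
  have hgm : Measurable g := (continuous_of_finiteDimensional g).measurable
  have hm : MeasurableSet (polarShell h) := isOpen_polarShell.measurableSet
  refine (ENNReal.mul_right_inj hD0 hD1).1 ?_
  rw [← hD (fun v => F (g v)) (hF.comp hgm), ← hD _ hF, ← lintegral_indicator hm, ← lintegral_indicator hm,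
    ← h.lintegral_comp_isometry _ g hgh (f := (polarShell h).indicator fun γ => F (polarUnit h γ))
      ((hF.comp measurable_polarUnit).indicator hm)]
  refine lintegral_congr fun γ => ?_
  have e := mem_polarShell_isometry hgh γ
  by_cases hγ : γ ∈ polarShell h
  · rw [indicator_of_mem hγ, indicator_of_mem (e.2 hγ), polarUnit_isometry hgK hgh]
  aesop

theorem polarIntegral_one_ne_zero (q : IsSphereAction h B ρ w) (c : IsCartan h B θ) (hw : w ∈ 𝕊)
    (κ : Measure KK) [IsProbabilityMeasure κ] [κ.IsMulRightInvariant] : polarIntegral h B ρ w κ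
    (fun _ => 1) ≠ 0 := by
  obtain ⟨D, hD0, hD1, hD⟩ := exists_polarIntegral q c hw (MeasureTheory.Measure.addHaar (G := E)) κ
  intro h0
  have h1 := hD (fun _ => 1) measurable_const
  rw [h0, mul_zero, lintegral_one, Measure.restrict_apply_univ] at h1
  have hs : (fun _ => 1 : 𝔞) ∈ chamber k := fun i => by norm_num
  exact (isOpen_polarShell.measure_pos _ ⟨_, (etaF_mem_polarShell (L := L) c hw hs).1⟩).ne' h1

theorem polarIntegral_ne_top (q : IsSphereAction h B ρ w) (c : IsCartan h B θ) (hw : w ∈ 𝕊)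
    (κ : Measure KK) [IsProbabilityMeasure κ] [κ.IsMulRightInvariant] {C : Set E}
    (hC : IsCompact C) : polarIntegral h B ρ w κ (C.indicator 1) ≠ ∞ := by
  obtain ⟨D, hD0, hD1, hD⟩ := exists_polarIntegral q c hw (MeasureTheory.Measure.addHaar (G := E)) κ
  intro h0
  have h1 := hD (C.indicator 1) (measurable_one.indicator hC.measurableSet)
  rw [h0, mul_top hD0] at h1
  set C' : Set E := (fun p : 𝕂 × E => p.1 • p.2) '' (closedBall 0 2 ×ˢ C) with hC'
  have hCc : IsCompact C' := by
    refine ((isCompact_closedBall _ _).prod hC).image ?_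
    exact continuous_fst.scalar_smul continuous_snd
  refine hCc.measure_ne_top (μ := MeasureTheory.Measure.addHaar (G := E)) (top_le_iff.1 ?_)
  rw [← h1, ← lintegral_indicator_one hCc.measurableSet,
    ← lintegral_indicator isOpen_polarShell.measurableSet]
  refine lintegral_mono fun γ => ?_
  by_cases hγ : γ ∈ polarShell h
  · rw [indicator_of_mem hγ]
    by_cases h2 : polarUnit h γ ∈ C
    · rw [indicator_of_mem h2]
      have h3 : γ ∈ C' := by
        refine ⟨(polarScalar h γ, polarUnit h γ), ⟨?_, h2⟩, polarScalar_smul_polarUnit hγ.1⟩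
        rw [mem_closedBall_zero_iff, pi_norm_le_iff_of_nonneg zero_le_two]
        exact fun i => (hγ.2 i).le
      aesop
    aesop
  aesop

end PolarFormula

variable [Module.Finite (Scalar L k) E] [FiniteDimensional ℝ E] {r : ℕ} {D : BesselData h r}

section UnitaryConstructions

variable (h) in
theorem HermitianForm.injective_of_isometry (f : E →ₗ[ℝ] E)
    (hh : ∀ u v, h.form (f u) (f v) = h.form u v) : Injective f := by
  refine (injective_iff_map_eq_zero f).2 fun u hu => h.nondegenerate u fun v => ?_
  rw [← hh, hu, map_zero, LinearMap.zero_apply]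

variable (h) in
/-- The element of `U(E)` defined by an isometry. -/
noncomputable def HermitianForm.mkUnitary (f : E →ₗ[ℝ] E) (hK : ∀ (a : 𝕂) v, f (a • v) = a • f v)
    (hh : ∀ u v, h.form (f u) (f v) = h.form u v) : h.unitary :=
  ⟨ContinuousLinearEquiv.toUnit
    (LinearEquiv.ofInjectiveEndo f (h.injective_of_isometry f hh)).toContinuousLinearEquiv, hK, hh⟩

@[simp] theorem HermitianForm.mkUnitary_apply (h : HermitianForm L k E) (f : E →ₗ[ℝ] E)
    (hK : ∀ (a : 𝕂) v, f (a • v) = a • f v)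
    (hh : ∀ u v, h.form (f u) (f v) = h.form u v) (v : E) :
    (h.mkUnitary f hK hh).1.val v = f v := rfl

theorem HermitianForm.unitary_ext {x y : h.unitary} (hxy : ∀ v, x.1.val v = y.1.val v) : x = y :=
  Subtype.ext (Units.ext (ContinuousLinearMap.ext hxy))

theorem HermitianForm.unitary_mul_apply (x y : h.unitary) (v : E) : (x * y).1.val v = x.1.val
    (y.1.val v) := rfl

theorem HermitianForm.unitary_apply_inv (x : h.unitary) (v : E) : x.1.val ((x⁻¹).1.val v) = v :=
  unit_apply_inv x.1 v

theorem HermitianForm.unitary_inv_apply (x : h.unitary) (v : E) : (x⁻¹).1.val (x.1.val v) = v :=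
  unit_inv_apply x.1 v

theorem HermitianForm.form_unitary_left (x : h.unitary) (u v : E) : h.form (x.1.val u) v = h.form u
    ((x⁻¹).1.val v) := by
  rw [← x.2.2 u, h.unitary_apply_inv]

theorem HermitianForm.form_unitary_right (x : h.unitary) (u v : E) : h.form u (x.1.val v) = h.form
    ((x⁻¹).1.val u) v := by
  rw [← x.2.2 _ v, h.unitary_apply_inv]

include c in
theorem IsCartan.theta_compact (x : h.compact B) (v : E) : θ (x.1.1.val v) = x.1.1.val (θ v) := by
  refine c.pos_ext_right fun u => ?_
  have e1 : B.form u (θ (x.1.1.val v)) = h.form u (x.1.1.val v) := (c.form_eq' _ _).symm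
  have e2 := x.2 ((x.1⁻¹).1.val u) (θ v)
  rw [h.unitary_apply_inv] at e2
  rw [e1, e2, h.form_unitary_right, c.form_eq']

include c in
theorem IsCartan.mem_compact (x : h.unitary) (hx : ∀ v, θ (x.1.val v) = x.1.val (θ v)) : x ∈
    h.compact B := by
  intro u v
  have e : ∀ u v, B.form u v = h.form u (θ v) := fun u v => by rw [c.form_eq', c.theta_theta]
  rw [e, e, hx, x.2.2]

/-- The inverse in each component. -/
noncomputable def compInv (z : 𝕂) : 𝕂 := fun i => (z i)⁻¹

theorem compInv_relation (z x y : 𝕂) (h1 : ∀ i, z i = 0 → y i = 0)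
    (h2 : ∀ i, tau z i = 0 → x i = 0) : x * y *
    (compInv z + tau (compInv z) - compInv z * tau (compInv z) * (z + tau z)) = 0 := by
  have e : tau (compInv z) = compInv (tau z) := tau_inv z
  rw [e]
  funext i
  simp only [compInv, Pi.mul_apply, Pi.add_apply, Pi.sub_apply, Pi.zero_apply]
  grind

variable (h) in
/-- The quasi-reflection along `a - b`. -/
noncomputable def quasiReflection (a b : E) : E →ₗ[ℝ] E :=
  LinearMap.id - ((smulBilin L k E).flip (compInv (h.form a (a - b)) • (a - b))) ∘ₗ
    h.form.flip (a - b)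

theorem quasiReflection_apply (a b v : E) : quasiReflection h a b v = v - h.form v (a - b) • compInv
    (h.form a (a - b)) • (a - b) := rfl

theorem quasiReflection_smul (a b : E) (s : 𝕂) (v : E) : quasiReflection h a b (s • v) = s •
    quasiReflection h a b v := by
  rw [quasiReflection_apply, quasiReflection_apply, h.smul_left, mul_smul, ← smul_sub]

theorem quasiReflection_of_orthogonal {a b v : E} (hv : h.form v (a - b) = 0) : quasiReflection h a
    b v = v := by
  rw [quasiReflection_apply, hv, zero_smul, sub_zero]

theorem form_comp_eq_zero_left {i : Fin k.card} (hu : (single i 1 : 𝕂) • u = 0) (v : E) : h.form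
    u v i = 0 := by
  have h1 := h.smul_left (single i 1) u v
  rw [hu, map_zero, LinearMap.zero_apply] at h1
  have h2 := congrFun h1 i
  simpa using h2.symm

theorem form_comp_eq_zero_right {i : Fin k.card} (hu : (single i.rev 1 : 𝕂) • u = 0) (v : E) :
    h.form v u i = 0 := by
  have h1 := form_comp_eq_zero_left (h := h) hu v
  have h2 := tau_apply_eq (h.form u v) i
  rw [← h.tau_symm] at h2
  aesop

theorem quasiReflection_form {a b : E} (hab : h.form a a = h.form b b)
    (h0 : ∀ i, h.form a (a - b) i = 0 → (single i 1 : 𝕂) • (a - b) = 0) (u v : E) : h.form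
    (quasiReflection h a b u) (quasiReflection h a b v) = h.form u v := by
  obtain ⟨w, hw⟩ : ∃ w, w = a - b := ⟨_, rfl⟩
  obtain ⟨z, hz⟩ : ∃ z, z = h.form a w := ⟨_, rfl⟩
  rw [← hw, ← hz] at h0
  have e : h.form w w = z + tau z := by
    rw [hz, ← h.tau_symm, hw]
    simp only [map_sub, sub_app, hab]
    ring
  have key := compInv_relation z (h.form u w) (h.form w v)
    (fun i hi => form_comp_eq_zero_left (h0 i hi) v) (fun i hi => by
      have h2 : z i.rev = 0 := by
        have := norm_tau_apply z i
        rw [hi, norm_zero] at this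
        exact norm_eq_zero.1 this.symm
      exact form_comp_eq_zero_right (h0 _ h2) u)
  rw [quasiReflection_apply, quasiReflection_apply, ← hw, ← hz]
  simp only [map_sub, sub_app, h.smul_left, h.smul_right, e, tau_mul]
  rw [← h.tau_symm]
  linear_combination -key

theorem quasiReflection_self {a b : E}
    (h0 : ∀ i, h.form a (a - b) i = 0 → (single i 1 : 𝕂) • (a - b) = 0) : quasiReflection h a b a
    = b := by
  have h1 : h.form a (a - b) • compInv (h.form a (a - b)) • (a - b) = a - b := by
    suffices h2 : (h.form a (a - b) * compInv (h.form a (a - b)) - 1) • (a - b) = 0 by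
      rwa [sub_smul, one_smul, sub_eq_zero, ← smul_smul] at h2
    refine eq_zero_of_single_smul (L := L) (k := k) fun i => ?_
    by_cases hi : h.form a (a - b) i = 0
    · rw [smul_comm, h0 i hi, smul_zero]
    · rw [smul_smul]
      have : (single i 1 : 𝕂) * (h.form a (a - b) * compInv (h.form a (a - b)) - 1) = 0 := by
        funext j
        by_cases hj : j = i
        · subst hj
          simp only [compInv, Pi.mul_apply, Pi.sub_apply, mul_inv_cancel₀ hi, Pi.one_apply,
            sub_self, mul_zero, Pi.zero_apply]
        · simp [Pi.single_eq_of_ne hj]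
      rw [this, zero_smul]
  rw [quasiReflection_apply, h1, sub_sub_cancel]

include c in
theorem IsCartan.quasiReflection_theta {a b : E} {ε : ℝ} (hε : ε * ε = 1) (ha : θ a = ε • a)
    (hb : θ b = ε • b) (v : E) : θ (quasiReflection h a b v) = quasiReflection h a b (θ v) := by
  have hw : θ (a - b) = ε • (a - b) := by rw [map_sub, ha, hb, smul_sub]
  have e1 : ∀ v, sigma (h.form v (a - b)) = ε • h.form (θ v) (a - b) := fun v => by
    rw [← c.form_theta_theta, hw, map_smul]
  have e2 : sigma (compInv (h.form a (a - b))) = compInv (h.form a (a - b)) := by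
    have h1 : sigma (h.form a (a - b)) = h.form a (a - b) := by
      rw [e1, ha, map_smul, LinearMap.smul_apply, smul_smul, hε, one_smul]
    have h2 : ∀ z : 𝕂, sigma (compInv z) = compInv (sigma z) := fun z => by
      rw [sigma_def, show tau (compInv z) = compInv (tau z) from tau_inv z]
      funext i
      simp [compInv, sigma]
    rw [h2, h1]
  simp_all [quasiReflection_apply, map_sub, c.theta_smul, e1, e2, hw, smul_comm _ ε (a - b), smul_assoc, smul_comm _ ε (_ • (a - b)), smul_smul, hε, one_smul]

include c in
theorem IsCartan.single_smul_eq_zero {a b : E} {ε : ℝ} (hε : ε * ε = 1) (ha : θ a = ε • a)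
    (hb : θ b = ε • b) (haa : B.form a a = 1) (hbb : B.form b b = 1) {i : Fin k.card}
    (hi : h.form a (a - b) i = 0) : (single i 1 : 𝕂) • (a - b) = 0 := by
  have hε0 : ε ≠ 0 := by rintro rfl; simp at hε
  have h1 : B.form a b i = 1 := by
    rw [c.form_eq', map_sub, ha, hb, ← smul_sub, map_smul, Pi.smul_apply, smul_eq_zero] at hi
    have h2 := hi.resolve_left hε0
    rw [map_sub, haa] at h2
    exact (sub_eq_zero.1 h2).symm
  have h2 : B.form (a - b) (a - b) i = 0 := by
    have h3 : B.form b a i = 1 := by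
      rw [B.conj_symm, Pi.star_apply, h1, star_one]
    aesop
  apply c.eq_zero_of_quad
  rw [B.smul_left, B.smul_right]
  funext j
  by_cases hj : j = i
  · subst hj; simp only [Pi.mul_apply, h2, mul_zero, Pi.zero_apply]
  · simp [Pi.single_eq_of_ne hj]

include c in
/-- Witt's theorem for orthonormal families of eigenvectors of `θ`. -/
theorem IsCartan.exists_compact_map {ι : Type*} [DecidableEq ι] (p q : ι → E) (ε : ι → ℝ)
    (hε : ∀ i, ε i * ε i = 1) (hp : ∀ i, θ (p i) = ε i • p i) (hq : ∀ i, θ (q i) = ε i • q i)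
    (hpp : ∀ i j, B.form (p i) (p j) = if i = j then 1 else 0)
    (hqq : ∀ i j, B.form (q i) (q j) = if i = j then 1 else 0) (s : Finset ι) : ∃ x : h.compact B,
    (∀ i ∈ s, x.1.1.val (p i) = q i) ∧ ∀ v, (∀ i ∈ s, h.form v (p i) = 0 ∧ h.form v (q i) = 0) →
    x.1.1.val v = v := by
  induction s using Finset.induction_on with
  | empty => exact ⟨1, by simp, fun v _ => rfl⟩
  | insert j s hj ih =>
    obtain ⟨x, hx1, hx2⟩ := ih
    set a := x.1.1.val (p j) with ha
    have hθa : θ a = ε j • a := by rw [ha, c.theta_compact, hp, map_smul]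
    have haa : B.form a a = 1 := by rw [ha, x.2, hpp, if_pos rfl]
    have hbb : B.form (q j) (q j) = 1 := by rw [hqq, if_pos rfl]
    have h0 := fun i => c.single_smul_eq_zero (hε j) hθa (hq j) haa hbb (i := i)
    have hform : h.form a a = h.form (q j) (q j) := by
      simp [c.form_eq', hθa, hq, map_smul, haa, hbb]
    set y : h.unitary := h.mkUnitary (quasiReflection h a (q j)) (quasiReflection_smul a (q j))
      (quasiReflection_form hform h0) with hy
    have hyK : y ∈ h.compact B := c.mem_compact y (c.quasiReflection_theta (hε j) hθa (hq j))
    refine ⟨⟨y, hyK⟩ * x, fun i hi => ?_, fun v hv => ?_⟩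
    · change quasiReflection h a (q j) (x.1.1.val (p i)) = q i
      rcases Finset.mem_insert.1 hi with rfl | hi
      · exact quasiReflection_self h0
      · rw [hx1 i hi]
        have hne : j ≠ i := fun h => hj (h ▸ hi)
        refine quasiReflection_of_orthogonal ?_
        have e1 : B.form (q i) a = 0 := by
          rw [ha, ← hx1 i hi, x.2, hpp, if_neg hne.symm]
        simp [c.form_eq', map_sub, hθa, hq, map_smul, e1, hqq, if_neg hne.symm, sub_self]
    · change quasiReflection h a (q j) (x.1.1.val v) = v
      have e1 := hx2 v fun i hi => hv i (Finset.mem_insert_of_mem hi)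
      rw [e1]
      refine quasiReflection_of_orthogonal ?_
      have h1 := hv j (Finset.mem_insert_self _ _)
      have h2 : h.form v a = 0 := by
        rw [← e1, ha, x.1.2.2, h1.1]
      rw [map_sub, h2, h1.2, sub_zero]

/-- The map that acts on a hyperbolic family `e, y` by the scalars `a, b`. -/
noncomputable def hyperbolicMap {ι : Type*} [Fintype ι] (h : HermitianForm L k E) (e y : ι → E)
    (a b : ι → 𝕂) : E →ₗ[ℝ] E :=
  LinearMap.id + ∑ i, (((smulBilin L k E).flip ((a i - 1) • e i)) ∘ₗ h.form.flip (y i) +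
    ((smulBilin L k E).flip ((b i - 1) • y i)) ∘ₗ h.form.flip (e i))

section

variable {ι : Type*} [Fintype ι] [DecidableEq ι] {e y : ι → E}

theorem hyperbolicMap_apply (a b : ι → 𝕂) (v : E) : hyperbolicMap h e y a b v = v + ∑ i,
    (h.form v (y i) • (a i - 1) • e i + h.form v (e i) • (b i - 1) • y i) := by
  simp [hyperbolicMap, sum_app]

theorem hyperbolicMap_smul (a b : ι → 𝕂) (s : 𝕂) (v : E) : hyperbolicMap h e y a b (s • v) = s •
    hyperbolicMap h e y a b v := by
  simp only [hyperbolicMap_apply, h.smul_left, smul_add, smul_sum, mul_smul]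

theorem hyperbolicMap_of_orthogonal (a b : ι → 𝕂)
    (hv : ∀ i, h.form v (e i) = 0 ∧ h.form v (y i) = 0) : hyperbolicMap h e y a b v = v := by
  simp only [hyperbolicMap_apply, (hv _).1, (hv _).2, zero_smul, add_zero, Finset.sum_const_zero]

variable (hee : ∀ i j, h.form (e i) (e j) = 0) (hyy : ∀ i j, h.form (y i) (y j) = 0)
  (hey : ∀ i j, h.form (e i) (y j) = if i = j then 1 else 0)

include hee hyy hey

theorem hyperbolicMap_left (a b : ι → 𝕂) (j : ι) : hyperbolicMap h e y a b (e j) = a j • e j := by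
  simp [hyperbolicMap_apply, hee, hey, zero_smul, add_zero, ite_smul, one_smul, Finset.sum_ite_eq, mem_univ, if_true, sub_smul]

theorem form_hyperbolic_symm (i j : ι) : h.form (y i) (e j) = if i = j then 1 else 0 := by
  rw [h.tau_symm, hey]
  by_cases hij : i = j
  · subst hij; simp
  aesop

theorem hyperbolicMap_right (a b : ι → 𝕂) (j : ι) : hyperbolicMap h e y a b (y j) = b j • y j := by
  simp [hyperbolicMap_apply, hyy, form_hyperbolic_symm hee hyy hey, zero_smul, zero_add, ite_smul, one_smul, Finset.sum_ite_eq, mem_univ, if_true, sub_smul]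

theorem form_hyperbolicMap_left (a b : ι → 𝕂) (v : E) (j : ι) : h.form (hyperbolicMap h e y a b v)
    (y j) = a j * h.form v (y j) := by
  simp only [hyperbolicMap_apply, map_add, add_app, map_sum, sum_app,
    h.smul_left, hyy, hey, mul_zero, add_zero, mul_ite, mul_one,
    Finset.sum_ite_eq', mem_univ, if_true]
  ring

theorem form_hyperbolicMap_right (a b : ι → 𝕂) (v : E) (j : ι) : h.form (hyperbolicMap h e y a b v)
    (e j) = b j * h.form v (e j) := by
  simp only [hyperbolicMap_apply, map_add, add_app, map_sum, sum_app,
    h.smul_left, hee, form_hyperbolic_symm hee hyy hey, mul_zero, zero_add, mul_ite, mul_one,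
    Finset.sum_ite_eq', mem_univ, if_true]
  ring

theorem hyperbolicMap_comp (a b a' b' : ι → 𝕂) (v : E) : hyperbolicMap h e y a b
    (hyperbolicMap h e y a' b' v) = hyperbolicMap h e y (fun i => a i * a' i) (fun i => b i * b' i)
    v := by
  rw [hyperbolicMap_apply]
  simp only [form_hyperbolicMap_left hee hyy hey, form_hyperbolicMap_right hee hyy hey]
  rw [hyperbolicMap_apply, hyperbolicMap_apply, add_assoc, ← sum_add_distrib]
  congr 1
  refine sum_congr rfl fun i _ => ?_
  module

theorem hyperbolicMap_one (v : E) : hyperbolicMap h e y (fun _ => 1) (fun _ => 1) v = v := by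
  simp only [hyperbolicMap_apply, sub_self, zero_smul, smul_zero, add_zero, Finset.sum_const_zero]

theorem form_hyperbolicMap_adjoint (a b : ι → 𝕂) (u v : E) : h.form (hyperbolicMap h e y a b u) v =
    h.form u (hyperbolicMap h e y (fun i => tau (b i)) (fun i => tau (a i)) v) := by
  simp only [hyperbolicMap_apply, map_add, add_app, map_sum, sum_app,
    h.smul_left, h.smul_right, tau_sub, tau_tau, tau_one]
  congr 1
  refine sum_congr rfl fun i _ => ?_
  rw [h.tau_symm (e i) v, h.tau_symm (y i) v]
  ring

theorem hyperbolicMap_form {a b : ι → 𝕂} (hab : ∀ i, a i * tau (b i) = 1) (u v : E) : h.form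
    (hyperbolicMap h e y a b u) (hyperbolicMap h e y a b v) = h.form u v := by
  have hba : ∀ i, tau (b i) * a i = 1 := fun i => by rw [mul_comm, hab]
  have hba' : ∀ i, tau (a i) * b i = 1 := fun i => by
    rw [← tau_tau (b i), ← tau_mul, hab, tau_one]
  simp [form_hyperbolicMap_adjoint hee hyy hey, hyperbolicMap_comp hee hyy hey, hba, hba', hyperbolicMap_one hee hyy hey]

end

end UnitaryConstructions

section OrthogonalFamilies

variable (B : PositiveForm L k E)

instance nonempty_fin_card (k : ScalarKind) : Nonempty (Fin k.card) := ⟨⟨0, card_pos' k⟩⟩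

theorem exists_ne_zero_sum_mul_eq_zero {m n : ℕ} (hmn : n < m) (N : Fin m → Fin n → L) : ∃ a : Fin m
    → L, a ≠ 0 ∧ ∀ j, ∑ i, a i * N i j = 0 := by
  have h1 : ker (Matrix.vecMulLinear (Matrix.of N)) ≠ ⊥ :=
    LinearMap.ker_ne_bot_of_finrank_lt (by simpa using hmn)
  obtain ⟨a, ha, ha0⟩ := Submodule.exists_mem_ne_zero_of_ne_bot h1
  tauto

theorem exists_mem_orthogonal_component (M : Submodule 𝕂 E) [Module.Free 𝕂 M] {m n : ℕ}
    (hm : finrank 𝕂 M = m) (hmn : n < m) (f : Fin n → E) (i : Fin k.card) : ∃ v ∈ M, v ≠ 0 ∧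
    (single i 1 : 𝕂) • v = v ∧ ∀ j, B.form v (f j) = 0 := by
  set b := Module.finBasisOfFinrankEq 𝕂 M hm
  obtain ⟨a, ha0, ha⟩ := exists_ne_zero_sum_mul_eq_zero hmn fun l j => B.form (b l).1 (f j) i
  set u : M := ∑ l, (single i (a l) : 𝕂) • b l with hu
  have hu0 : u ≠ 0 := by
    intro h0
    apply ha0
    funext l
    have h1 := Fintype.linearIndependent_iff.1 b.linearIndependent _ h0 l
    simpa using congrFun h1 i
  refine ⟨u.1, u.2, fun h0 => hu0 (Subtype.ext h0), ?_, fun j => ?_⟩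
  · rw [← coe_smul, hu, smul_sum]
    simp only [smul_smul, single_mul_single]
    congr 1
    refine sum_congr rfl fun l _ => ?_
    congr 1
    rw [← Pi.single_mul, one_mul]
  · rw [hu, AddSubmonoidClass.coe_finsetSum, map_sum, sum_app]
    funext d
    simp only [coe_smul, B.smul_left, Finset.sum_apply, Pi.zero_apply]
    by_cases hd : d = i
    all_goals simp_all

theorem card_le_of_orthogonal_family (M : Submodule 𝕂 E) [Module.Free 𝕂 M] {m n : ℕ}
    (hn : finrank 𝕂 M = n) (g : Fin m → E) (hgM : ∀ i, g i ∈ M)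
    (hg : ∀ i j, i ≠ j → B.form (g i) (g j) = 0) (i : Fin k.card)
    (hi : ∀ l, B.form (g l) (g l) i ≠ 0) : m ≤ n := by
  by_contra! hmn
  set b := Module.finBasisOfFinrankEq 𝕂 M hn
  obtain ⟨a, ha0, ha⟩ := exists_ne_zero_sum_mul_eq_zero hmn
    fun l j => b.repr (⟨g l, hgM l⟩ : M) j i
  have h1 : ∑ l, (single i (a l) : 𝕂) • (⟨g l, hgM l⟩ : M) = 0 := by
    apply b.repr.injective
    ext j d
    simp only [map_sum, map_smul, Finsupp.coe_finsetSum, Finset.sum_apply, Finsupp.smul_apply,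
      smul_eq_mul, Pi.mul_apply, map_zero, Finsupp.zero_apply, Pi.zero_apply]
    by_cases hd : d = i
    · aesop
    aesop
  apply ha0
  funext l
  have h2 := congrArg (fun v : M => B.form v.1 (g l) i) h1
  simp only [AddSubmonoidClass.coe_finsetSum, coe_smul, map_sum, sum_app,
    B.smul_left, Finset.sum_apply, Pi.mul_apply, ZeroMemClass.coe_zero, map_zero,
    LinearMap.zero_apply, Pi.zero_apply] at h2
  rw [Finset.sum_eq_single l (fun l' _ hl' => by rw [hg l' l hl']; simp) (by simp)] at h2
  simpa [hi l] using h2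

theorem PositiveForm.exists_normalize (B : PositiveForm L k E) (hu : ∀ i, 0 < B.quad u i) : ∃ x : 𝔞,
    (∀ i, 0 < x i) ∧ B.form (realCoe L x • u) (realCoe L x • u) = 1 := by
  refine ⟨fun i => (√(B.quad u i))⁻¹, fun i => inv_pos.2 (Real.sqrt_pos.2 (hu i)), ?_⟩
  rw [B.smul_left, B.smul_right, star_realCoe, B.form_self, ← map_mul, ← map_mul,
    ← map_one (realCoe L)]
  congr 1
  funext i
  have h1 := Real.sqrt_pos.2 (hu i)
  have h2 := Real.mul_self_sqrt (hu i).le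
  simp only [Pi.mul_apply, Pi.one_apply]
  field_simp
  nlinarith

end OrthogonalFamilies

theorem map_mem_of_mem_span {F : Type*} [FunLike F E E] [AddMonoidHomClass F E E] {f : F}
    {σ : 𝕂 → 𝕂} (hf : ∀ (a : 𝕂) v, f (a • v) = σ a • f v) {s : Set E} {M : Submodule 𝕂 E}
    (hs : ∀ x ∈ s, f x ∈ M) (hv : v ∈ span 𝕂 s) : f v ∈ M := by
  induction hv using span_induction with
  | mem x hx => exact hs x hx
  | zero => rw [map_zero]; exact zero_mem _
  | add x y _ _ hx hy => rw [map_add]; exact add_mem hx hy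
  | smul a x _ hx => rw [hf]; exact M.smul_mem _ hx

theorem eq_of_mem_span {N F G : Type*} [AddCommGroup N] [Module 𝕂 N] [FunLike F E N]
    [AddMonoidHomClass F E N] [FunLike G E N] [AddMonoidHomClass G E N] {f : F} {g : G} {σ : 𝕂 → 𝕂}
    (hf : ∀ (a : 𝕂) v, f (a • v) = σ a • f v) (hg : ∀ (a : 𝕂) v, g (a • v) = σ a • g v) {s : Set E}
    (hs : ∀ x ∈ s, f x = g x) (hv : v ∈ span 𝕂 s) : f v = g v := by
  induction hv using span_induction with
  | mem x hx => exact hs x hx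
  | zero => rw [map_zero, map_zero]
  | add x y _ _ hx hy => rw [map_add, map_add, hx, hy]
  | smul a x _ hx => rw [hf, hg, hx]

theorem mem_orthogonal_span {s : Set E} (hv : ∀ x ∈ s, h.form v x = 0) {x : E}
    (hx : x ∈ span 𝕂 s) : h.form v x = 0 :=
  eq_of_mem_span (g := (0 : E →+ 𝕂)) (σ := tau) (fun a v => h.smul_right a _ v)
    (fun a _ => (smul_zero _).symm) hv hx

variable (B) in
theorem PositiveForm.sub_sum_orthogonal {ι : Type*} [DecidableEq ι] (s : Finset ι) (e : ι → E)
    (he : ∀ i ∈ s, ∀ j ∈ s, B.form (e i) (e j) = if i = j then 1 else 0) (v : E) (j : ι)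
    (hj : j ∈ s) : B.form (v - ∑ i ∈ s, B.form v (e i) • e i) (e j) = 0 := by
  simp only [map_sub, sub_app, map_sum, sum_app, B.smul_left]
  aesop

include c in
theorem exists_flag_basis_succ (M N : Submodule 𝕂 E) (hNM : N ≤ M) [Module.Free 𝕂 M] {n : ℕ}
    (hM : finrank 𝕂 M = n + 1) (e : ℕ → E)
    (he : ∀ i < n, ∀ j < n, B.form (e i) (e j) = if i = j then 1 else 0)
    (hN : N = span 𝕂 (e '' {i | i < n})) : ∃ u : E, B.form u u = 1 ∧
    (∀ i < n, B.form u (e i) = 0) ∧ M = N ⊔ span 𝕂 {u} := by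
  have h1 := fun i => exists_mem_orthogonal_component B M hM n.lt_succ_self
    (fun j : Fin n => e j) i
  choose v hvM hv0 hvi hve using h1
  set u₀ := ∑ i, v i with hu₀
  have hvd : ∀ i d, i ≠ d → (single i 1 : 𝕂) • v d = 0 := by
    intro i d hid
    rw [← hvi d, smul_smul, mul_single_one, Pi.single_eq_of_ne hid.symm, Pi.single_zero, zero_smul]
  have hu₀i : ∀ i, (single i 1 : 𝕂) • u₀ = v i := by
    intro i
    rw [hu₀, smul_sum, Finset.sum_eq_single i (fun d _ hd => hvd i d hd.symm) (by simp), hvi]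
  have hquad : ∀ i, 0 < B.quad u₀ i := fun i =>
    B.quad_pos c.exists_torsionFree (by rw [hu₀i]; exact hv0 i)
  obtain ⟨x, -, hx⟩ := B.exists_normalize hquad
  set u := realCoe L x • u₀ with hu
  have huM : u ∈ M := M.smul_mem _ (M.sum_mem fun i _ => hvM i)
  have hue : ∀ i < n, B.form u (e i) = 0 := by
    intro i hi
    rw [hu, B.smul_left, hu₀, map_sum, sum_app,
      sum_eq_zero fun d _ => hve d ⟨i, hi⟩, mul_zero]
  have heu : ∀ i < n, B.form (e i) u = 0 := fun i hi => by rw [B.conj_symm, hue i hi, star_zero]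
  have heN : ∀ i < n, e i ∈ N := fun i hi => by
    rw [hN]; exact subset_span ⟨i, hi, rfl⟩
  refine ⟨u, hx, hue, le_antisymm (fun w hw => ?_) (sup_le hNM ?_)⟩
  · set w' := w - (∑ i ∈ Finset.range n, B.form w (e i) • e i) - B.form w u • u with hw'
    have hs : ∑ i ∈ Finset.range n, B.form w (e i) • e i ∈ N :=
      N.sum_mem fun i hi => N.smul_mem _ (heN i (Finset.mem_range.1 hi))
    have hw'M : w' ∈ M := M.sub_mem (M.sub_mem hw (hNM hs)) (M.smul_mem _ huM)
    have hw'e : ∀ i < n, B.form w' (e i) = 0 := by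
      intro i hi
      have h2 := B.sub_sum_orthogonal (Finset.range n) e
        (fun i hi j hj => he i (Finset.mem_range.1 hi) j (Finset.mem_range.1 hj)) w i
        (Finset.mem_range.2 hi)
      rw [hw', map_sub, sub_app, h2, B.smul_left, hue i hi, mul_zero, sub_zero]
    have hw'u : B.form w' u = 0 := by
      rw [hw']
      simp only [map_sub, sub_app, map_sum, sum_app, B.smul_left, hx]
      rw [sum_eq_zero fun i hi => by rw [heu i (Finset.mem_range.1 hi), mul_zero]]
      ring
    have hw'0 : w' = 0 := by
      apply c.eq_zero_of_quad
      by_contra hne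
      obtain ⟨d, hd⟩ := Function.ne_iff.1 hne
      let g : Fin (n + 2) → E := fun i =>
        if (i : ℕ) < n then e i else if (i : ℕ) = n then u else w'
      have h2 := card_le_of_orthogonal_family B M hM g (fun i => by
          dsimp only [g]
          split_ifs with h3 h4
          · exact hNM (heN _ h3)
          · exact huM
          · exact hw'M) (fun i j hij => by
          have hij' : (i : ℕ) ≠ j := fun h => hij (Fin.ext h)
          have e1 : ∀ i < n, B.form (e i) w' = 0 := fun i hi => by
            rw [B.conj_symm, hw'e i hi, star_zero]
          have e2 : B.form u w' = 0 := by rw [B.conj_symm, hw'u, star_zero]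
          have hi := i.2
          have hj := j.2
          dsimp only [g]
          split_ifs with h3 h4 h5 h6 h7 h8 h9 h10
          · rw [he _ h3 _ h4, if_neg hij']
          · exact heu _ h3
          · exact e1 _ h3
          · exact hue _ h7
          · omega
          · exact e2
          · exact hw'e _ h9
          · exact hw'u
          · omega) d (fun i => by
          dsimp only [g]
          split_ifs with h3 h4
          · rw [he _ h3 _ h3, if_pos rfl]; simp
          · rw [hx]; simp
          · exact hd)
      omega
    have : w = (∑ i ∈ Finset.range n, B.form w (e i) • e i) + B.form w u • u := by
      rw [← sub_eq_zero, ← hw'0, hw']; abel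
    rw [this]
    exact Submodule.add_mem_sup hs (smul_mem _ _ (mem_span_singleton_self u))
  · rw [Submodule.span_singleton_le_iff_mem]
    exact huM

variable (D) in
include c in
theorem exists_flag_basis : ∃ e : ℕ → E,
    (∀ i < r, ∀ j < r, B.form (e i) (e j) = if i = j then 1 else 0) ∧ ∀ j : Fin (r + 1), D.X j =
    span 𝕂 (e '' {i | i < (j : ℕ)}) := by
  have key : ∀ n ≤ r, ∃ e : ℕ → E,
      (∀ i < n, ∀ j < n, B.form (e i) (e j) = if i = j then 1 else 0) ∧
      ∀ j : Fin (r + 1), (j : ℕ) ≤ n → D.X j = span 𝕂 (e '' {i | i < (j : ℕ)}) := by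
    intro n
    induction n with
    | zero =>
      simp [D.X_zero]
    | succ n ih =>
      intro hn
      obtain ⟨e, he, hX⟩ := ih (Nat.le_of_succ_le hn)
      have hn' : n < r := hn
      have := D.X_free (Fin.succ ⟨n, hn'⟩)
      obtain ⟨u, huu, hue, hM⟩ := exists_flag_basis_succ c (D.X (Fin.succ ⟨n, hn'⟩))
        (D.X (Fin.castSucc ⟨n, hn'⟩)) (D.X_le ⟨n, hn'⟩) (n := n) (D.X_rank _) e he
        (hX _ le_rfl)
      have hue' : ∀ i < n, B.form (e i) u = 0 := fun i hi => by
        rw [B.conj_symm, hue i hi, star_zero]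
      have himage : ∀ m ≤ n, Function.update e n u '' {i | i < m} = e '' {i | i < m} := by
        intro m hm
        refine Set.image_congr fun i hi => ?_
        rw [update_of_ne]
        grind
      refine ⟨Function.update e n u, fun i hi j hj => ?_, fun j hj => ?_⟩
      · rcases Nat.lt_succ_iff_lt_or_eq.1 hi with hi | rfl <;>
          rcases Nat.lt_succ_iff_lt_or_eq.1 hj with hj | rfl
        · rw [update_of_ne hi.ne, update_of_ne hj.ne, he i hi j hj]
        · rw [update_of_ne hi.ne, update_self, hue' i hi, if_neg hi.ne]
        · rw [update_of_ne hj.ne, update_self, hue j hj, if_neg hj.ne']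
        · rw [update_self, huu, if_pos rfl]
      · rcases Nat.lt_succ_iff_lt_or_eq.1 (Nat.lt_succ_of_le hj) with hj | hj
        · grind
        · have : j = Fin.succ ⟨n, hn'⟩ := Fin.ext hj
          subst this
          rw [hM, hX _ le_rfl]
          have h3 : {i | i < ((Fin.succ ⟨n, hn'⟩ : Fin (r + 1)) : ℕ)} =
              insert n {i | i < ((Fin.castSucc ⟨n, hn'⟩ : Fin (r + 1)) : ℕ)} := by
            ext i
            simp only [Fin.val_succ, Fin.val_castSucc, Set.mem_ofPred_eq, Set.mem_insert_iff]
            omega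
          rw [h3, Set.image_insert_eq, update_self,
            himage ((Fin.castSucc ⟨n, hn'⟩ : Fin (r + 1)) : ℕ) le_rfl, sup_comm,
            ← span_union, Set.singleton_union]
  obtain ⟨e, he, hX⟩ := key r le_rfl
  exact ⟨e, he, fun j => hX j (Nat.le_of_lt_succ j.2)⟩

/-- A `[ , ]`-orthonormal basis adapted to the flag. -/
structure AdaptedFrame (D : BesselData h r) (B : PositiveForm L k E) (θ : E →ₗ[ℝ] E)
    (e : Fin r → E) : Prop where
  pos_e : ∀ i j, B.form (e i) (e j) = if i = j then 1 else 0
  X_eq : ∀ j, D.X j = span 𝕂 (e '' {i | i.castSucc < j})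
  Y_eq : D.Y = span 𝕂 (Set.range fun i => θ (e i))
  theta_v₀ : θ D.v₀ = D.v₀
  theta_v₀' : θ D.v₀' = -D.v₀'

theorem exists_dual_family (e : Fin r → E) (D : BesselData h r)
    (hX : D.Xr = span 𝕂 (Set.range e)) : ∃ y : Fin r → E, (∀ i, y i ∈ D.Y) ∧
    (∀ i j, h.form (y i) (e j) = if i = j then 1 else 0) ∧ D.Y = span 𝕂 (Set.range y) :=
    by
  have := D.Y_free
  set b := Module.finBasisOfFinrankEq 𝕂 D.Y D.Y_rank
  let f : D.Y →ₗ[𝕂] (Fin r → 𝕂) :=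
    { toFun := fun v j => h.form v.1 (e j)
      map_add' := fun u v => by funext j; simp
      map_smul' := fun a v => by funext j; simp [h.smul_left] }
  have hf : Injective f := by
    refine (injective_iff_map_eq_zero f).2 fun v hv => Subtype.ext ?_
    refine D.pairing_right v.1 v.2 fun x hx => ?_
    rw [← BesselData.Xr, hX] at hx
    rw [h.tau_symm, mem_orthogonal_span (by rintro _ ⟨j, rfl⟩; exact congrFun hv j) hx, tau_zero]
  let g : (Fin r → 𝕂) →ₗ[ℝ] (Fin r → 𝕂) :=
    (f ∘ₗ b.equivFun.symm.toLinearMap).restrictScalars ℝ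
  have hg : Injective g := hf.comp b.equivFun.symm.injective
  have hgs := LinearMap.surjective_of_injective hg
  have hfs : Surjective f := fun z => by
    obtain ⟨w, hw⟩ := hgs z
    exact ⟨_, hw⟩
  choose y hy using fun i : Fin r => hfs (fun j => if i = j then 1 else 0)
  have hy' : ∀ i j, h.form (y i).1 (e j) = if i = j then 1 else 0 := fun i j => congrFun (hy i) j
  refine ⟨fun i => (y i).1, fun i => (y i).2, hy', le_antisymm (fun v hv => ?_) ?_⟩
  · have h1 : (⟨v, hv⟩ : D.Y) = ∑ i, h.form v (e i) • y i := by
      apply hf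
      funext j
      change h.form v (e j) = f _ j
      simp_all
    have h2 := congrArg Subtype.val h1
    rw [AddSubmonoidClass.coe_finsetSum] at h2
    change v = _ at h2
    rw [h2]
    exact Submodule.sum_mem _ fun i _ => smul_mem _ _ (subset_span ⟨i, rfl⟩)
  · rw [Submodule.span_le]
    rintro _ ⟨i, rfl⟩
    exact (y i).2

variable (D) in
theorem exists_adaptedFrame (hB : B.IsCommuting h) (hD : D.IsAdapted B) : ∃ (θ : E →ₗ[ℝ] E)
    (e : Fin r → E), IsCartan h B θ ∧ AdaptedFrame D B θ e := by
  obtain ⟨θ, hθ, hθθ⟩ := hB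
  have c : IsCartan h B θ := ⟨hθ, hθθ, D.v₀', fun a ha =>
    h.torsionFree (c := -1) (by norm_num) (by rw [D.v₀'_norm]; simp) a ha⟩
  obtain ⟨e', he', hX'⟩ := exists_flag_basis c D
  set e : Fin r → E := fun i => e' i with he
  have hee : ∀ i j, B.form (e i) (e j) = if i = j then 1 else 0 := fun i j => by
    rw [he, he' i i.2 j j.2]; simp [Fin.ext_iff]
  have hX : ∀ j, D.X j = span 𝕂 (e '' {i | i.castSucc < j}) := by
    intro j
    rw [hX' j]
    congr 1
    ext v
    constructor
    · rintro ⟨i, hi, rfl⟩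
      exact ⟨⟨i, lt_of_lt_of_le hi (Nat.le_of_lt_succ j.2)⟩, hi, rfl⟩
    · rintro ⟨i, hi, rfl⟩
      exact ⟨i, hi, rfl⟩
  have hXr : D.Xr = span 𝕂 (Set.range e) := by
    simp [BesselData.Xr, hX, Fin.castSucc_lt_last]
  obtain ⟨y, hyY, hye, hY⟩ := exists_dual_family e D hXr
  have heX : ∀ i, e i ∈ D.Xr := fun i => by rw [hXr]; exact subset_span ⟨i, rfl⟩
  have hey : ∀ i j, h.form (e i) (y j) = if i = j then 1 else 0 := fun i j => by
    rw [h.tau_symm, hye]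
    by_cases hij : i = j
    · subst hij; simp
    · rw [if_neg hij, if_neg (Ne.symm hij), tau_zero]
  have hxx := fun i j => D.X_isotropic _ (heX i) _ (heX j)
  have hyy := fun i j => D.Y_isotropic _ (hyY i) _ (hyY j)
  obtain ⟨hO, h0, h0'⟩ := hD
  have hv0' : ∀ x ∈ D.Xr ⊔ D.Y, h.form D.v₀' x = 0 := by
    intro x hx
    obtain ⟨a, ha, b, hb, rfl⟩ := Submodule.mem_sup.1 hx
    rw [map_add, h.tau_symm, D.X_orthogonal a ha, h.tau_symm, D.Y_orthogonal b hb, tau_zero, add_zero]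
  have hv0 : ∀ x ∈ D.Xr ⊔ D.Y, h.form D.v₀ x = 0 := by
    intro x hx
    obtain ⟨a, ha, b, hb, rfl⟩ := Submodule.mem_sup.1 hx
    rw [map_add, D.v₀_orthogonal_X a ha, D.v₀_orthogonal_Y b hb, add_zero]
  have hv00 : h.form D.v₀' D.v₀ = 0 := by rw [h.tau_symm, D.v₀_orthogonal_v₀', tau_zero]
  have hdec : ∀ v, ∃ x ∈ D.Xr, ∃ w ∈ D.Y, ∃ z ∈ D.Z₀, ∃ a b : 𝕂,
      v = x + w + z + a • D.v₀ + b • D.v₀' := by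
    intro v
    set x := ∑ i, h.form v (y i) • e i with hx
    set w := ∑ i, h.form v (e i) • y i with hw
    have hxX : x ∈ D.Xr := Submodule.sum_mem _ fun i _ => smul_mem _ _ (heX i)
    have hwY : w ∈ D.Y := Submodule.sum_mem _ fun i _ => smul_mem _ _ (hyY i)
    have hf : ∀ u ∈ D.Xr ⊔ D.Y, h.form (v - x - w) u = 0 := by
      intro u hu
      rw [hXr, hY, ← span_union] at hu
      refine mem_orthogonal_span ?_ hu
      rintro _ (⟨j, rfl⟩ | ⟨j, rfl⟩)
      · simp [hx, hw, map_sub, sub_app, map_sum, sum_app, h.smul_left, hxx, hye]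
      simp [hx, hw, map_sub, sub_app, map_sum, sum_app, h.smul_left, hyy, hey]
    set f := v - x - w with hfdef
    refine ⟨x, hxX, w, hwY, f - h.form f D.v₀ • D.v₀ + h.form f D.v₀' • D.v₀', ?_,
      h.form f D.v₀, -h.form f D.v₀', ?_⟩
    · have hl' : ∀ u, h.form u D.v₀' = 0 → ∀ x ∈ D.line', h.form u x = 0 := fun u hu x hx =>
        mem_orthogonal_span (by rintro _ rfl; exact hu) hx
      have hl : ∀ u, h.form u D.v₀ = 0 → ∀ x ∈ D.line, h.form u x = 0 := fun u hu x hx =>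
        mem_orthogonal_span (by rintro _ rfl; exact hu) hx
      refine ⟨⟨hl' _ ?_, fun u hu => ?_⟩, hl _ ?_⟩
      · simp only [map_add, map_sub, add_app, sub_app, h.smul_left,
          D.v₀'_norm, D.v₀_orthogonal_v₀']
        ring
      · simp only [map_add, map_sub, add_app, sub_app, h.smul_left,
          hf u hu, hv0 u hu, hv0' u hu]
        ring
      · simp only [map_add, map_sub, add_app, sub_app, h.smul_left,
          D.v₀_norm, hv00]
        ring
    · rw [neg_smul, hfdef]; abel
  have hB' : ∀ i j : Fin 5, i ≠ j → ∀ x ∈ (![D.Xr, D.Y, D.Z₀, D.line, D.line'] :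
      Fin 5 → Submodule 𝕂 E) i, ∀ y ∈ (![D.Xr, D.Y, D.Z₀, D.line, D.line'] :
      Fin 5 → Submodule 𝕂 E) j, B.form x y = 0 := hO
  have hv0l : D.v₀ ∈ D.line := mem_span_singleton_self _
  have hv0l' : D.v₀' ∈ D.line' := mem_span_singleton_self _
  have hext : ∀ u u' : E, (∀ v, h.form v u = h.form v u') → u = u' := fun u u' huu =>
    h.ext_left fun v => by rw [h.tau_symm, huu, ← h.tau_symm]
  refine ⟨θ, e, c, hee, hX, ?_, hext _ _ fun v => ?_, hext _ _ fun v => ?_⟩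
  · have : (fun i => θ (e i)) = y := by
      funext i
      refine hext _ _ fun v => ?_
      rw [← hθ]
      obtain ⟨x, hx, w, hw, z, hz, a, b, rfl⟩ := hdec v
      have e1 : B.form x (e i) = h.form x (y i) := by
        rw [hXr] at hx
        exact eq_of_mem_span (f := B.form.flip (e i)) (g := h.form.flip (y i)) (σ := id)
          (fun a v => B.smul_left a v _) (fun a v => h.smul_left a v _)
          (by rintro _ ⟨j, rfl⟩; simp [hee, hey]) hx
      have e2 : B.form w (e i) = 0 := hB' 1 0 (by decide) w hw _ (heX i)
      have e3 : B.form z (e i) = 0 := hB' 2 0 (by decide) z hz _ (heX i)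
      have e4 : B.form D.v₀ (e i) = 0 := hB' 3 0 (by decide) _ hv0l _ (heX i)
      have e5 : B.form D.v₀' (e i) = 0 := hB' 4 0 (by decide) _ hv0l' _ (heX i)
      have yXY : y i ∈ D.Xr ⊔ D.Y := mem_sup_right (hyY i)
      have f2 : h.form w (y i) = 0 := D.Y_isotropic w hw _ (hyY i)
      have f3 : h.form z (y i) = 0 := hz.1.2 _ yXY
      simp only [map_add, add_app, h.smul_left, B.smul_left, e1, e2, e3, e4, e5, f2, f3,
        hv0 _ yXY, hv0' _ yXY]
    rw [this, hY]
  · rw [← hθ]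
    obtain ⟨x, hx, w, hw, z, hz, a, b, rfl⟩ := hdec v
    have e1 : B.form x D.v₀ = 0 := hB' 0 3 (by decide) x hx _ hv0l
    have e2 : B.form w D.v₀ = 0 := hB' 1 3 (by decide) w hw _ hv0l
    have e3 : B.form z D.v₀ = 0 := hB' 2 3 (by decide) z hz _ hv0l
    have e5 : B.form D.v₀' D.v₀ = 0 := hB' 4 3 (by decide) _ hv0l' _ hv0l
    have f1 : h.form x D.v₀ = 0 := by rw [h.tau_symm, D.v₀_orthogonal_X x hx, tau_zero]
    have f2 : h.form w D.v₀ = 0 := by rw [h.tau_symm, D.v₀_orthogonal_Y w hw, tau_zero]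
    have f3 : h.form z D.v₀ = 0 := hz.2 _ hv0l
    simp only [map_add, add_app, h.smul_left, B.smul_left, e1, e2, e3, e5, f1, f2, f3,
      hv00, h0, D.v₀_norm]
  · rw [← hθ, map_neg]
    obtain ⟨x, hx, w, hw, z, hz, a, b, rfl⟩ := hdec v
    have e1 : B.form x D.v₀' = 0 := hB' 0 4 (by decide) x hx _ hv0l'
    have e2 : B.form w D.v₀' = 0 := hB' 1 4 (by decide) w hw _ hv0l'
    have e3 : B.form z D.v₀' = 0 := hB' 2 4 (by decide) z hz _ hv0l'
    have e4 : B.form D.v₀ D.v₀' = 0 := hB' 3 4 (by decide) _ hv0l _ hv0l'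
    have f3 : h.form z D.v₀' = 0 := hz.1.1 _ hv0l'
    simp only [map_add, add_app, h.smul_left, B.smul_left, e1, e2, e3, e4,
      D.X_orthogonal x hx, D.Y_orthogonal w hw, f3, D.v₀_orthogonal_v₀', h0', D.v₀'_norm]
    ring

variable (D) in
/-- The group of all `x ∈ U(E)` that act trivially on the quotients of the flag. -/
def BesselData.flagGroup : Subgroup h.unitary where
  carrier := {x | ∀ i : Fin r, ∀ v ∈ D.X i.succ, x.1.val v - v ∈ D.X i.castSucc}
  mul_mem' := by
    intro x y hx hy i v hv
    have key : (x * y).1.val v - v =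
        (x.1.val (y.1.val v - v) - (y.1.val v - v)) + (x.1.val v - v) + (y.1.val v - v) := by
      have : (x * y).1.val v = x.1.val (y.1.val v) := rfl
      rw [this, map_sub]; abel
    rw [key]
    exact add_mem (add_mem (hx i _ (D.X_le i (hy i v hv))) (hx i v hv)) (hy i v hv)
  one_mem' := by simp
  inv_mem' := by
    intro x hx
    have key : ∀ v, (x⁻¹).1.val v - v = -((x⁻¹).1.val (x.1.val v - v)) := by
      intro v
      have : (x⁻¹).1.val (x.1.val v) = v := unit_inv_apply x.1 v
      rw [map_sub, this]; abel
    have stab : ∀ i : Fin (r + 1), ∀ v ∈ D.X i, (x⁻¹).1.val v ∈ D.X i := by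
      intro i
      induction i using Fin.induction with
      | zero =>
        intro v hv
        rw [D.X_zero, mem_bot] at hv
        simp [hv]
      | succ i ih =>
        intro v hv
        have h1 : (x⁻¹).1.val v = v + -((x⁻¹).1.val (x.1.val v - v)) := by rw [← key]; abel
        rw [h1]
        exact add_mem hv (neg_mem (D.X_le i (ih _ (hx i v hv))))
    intro i v hv
    rw [key]
    exact neg_mem (stab _ _ (hx i v hv))

theorem BesselData.bessel_le_flagGroup : D.bessel ≤ D.flagGroup := fun _ hx => hx.1

theorem BesselData.flagGroup_mem_X (hx : x ∈ D.flagGroup) (i : Fin (r + 1)) (hv : v ∈ D.X i) :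
    x.1.val v ∈ D.X i := by
  induction i using Fin.cases with
  | zero =>
    rw [D.X_zero, mem_bot] at hv
    aesop
  | succ i =>
    have h1 : x.1.val v = (x.1.val v - v) + v := by abel
    rw [h1]
    exact add_mem (D.X_le i (hx i v hv)) hv

theorem BesselData.flagGroup_mem_Xr (hx : x ∈ D.flagGroup) (hv : v ∈ D.Xr) : x.1.val v ∈ D.Xr :=
    D.flagGroup_mem_X hx _ hv

variable {e : Fin r → E} (fr : AdaptedFrame D B θ e)

namespace AdaptedFrame

include fr

theorem Xr_eq : D.Xr = span 𝕂 (Set.range e) := by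
  simp [BesselData.Xr, fr.X_eq, Fin.castSucc_lt_last]

theorem e_mem (i : Fin r) : e i ∈ D.Xr := by
  rw [fr.Xr_eq]; exact subset_span ⟨i, rfl⟩

theorem e_mem_succ (i : Fin r) : e i ∈ D.X i.succ := by
  rw [fr.X_eq]; exact subset_span ⟨i, Fin.castSucc_lt_succ, rfl⟩

theorem y_mem (i : Fin r) : θ (e i) ∈ D.Y := by
  rw [fr.Y_eq]; exact subset_span ⟨i, rfl⟩

theorem form_ee (i j : Fin r) : h.form (e i) (e j) = 0 :=
  D.X_isotropic _ (fr.e_mem i) _ (fr.e_mem j)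

theorem form_yy (i j : Fin r) : h.form (θ (e i)) (θ (e j)) = 0 :=
  D.Y_isotropic _ (fr.y_mem i) _ (fr.y_mem j)

theorem mem_orthogonal_Xr (hv : ∀ i, h.form v (e i) = 0) {x : E} (hx : x ∈ D.Xr) : h.form v x = 0 :=
    by
  rw [fr.Xr_eq] at hx
  exact mem_orthogonal_span (by grind) hx

include c

theorem form_ey (i j : Fin r) : h.form (e i) (θ (e j)) = if i = j then 1 else 0 := by
  rw [← c.form_eq, fr.pos_e]

theorem form_ye (i j : Fin r) : h.form (θ (e i)) (e j) = if i = j then 1 else 0 :=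
  form_hyperbolic_symm fr.form_ee fr.form_yy (fr.form_ey c) i j

theorem mem_E₀' (v : E) : v ∈ D.E₀' ↔ ∀ i, h.form v (e i) = 0 ∧ h.form v (θ (e i)) = 0 := by
  have hl : ∀ u ∈ D.line', ∃ a : 𝕂, a • D.v₀' = u := fun u hu =>
    Submodule.mem_span_singleton.1 hu
  constructor
  · intro hv i
    obtain ⟨a, ha, b, hb, rfl⟩ := Submodule.mem_sup.1 hv
    obtain ⟨s, rfl⟩ := hl b hb
    have h1 := ha.2 _ (mem_sup_left (fr.e_mem i))
    have h2 := ha.2 _ (mem_sup_right (fr.y_mem i))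
    have h3 : h.form D.v₀' (e i) = 0 := by rw [h.tau_symm, D.X_orthogonal _ (fr.e_mem i), tau_zero]
    have h4 : h.form D.v₀' (θ (e i)) = 0 := by
      rw [h.tau_symm, D.Y_orthogonal _ (fr.y_mem i), tau_zero]
    simp [map_add, add_app, h.smul_left, h1, h2, h3, h4, mul_zero, add_zero, and_self]
  · intro hv
    have h1 : v = (v + h.form v D.v₀' • D.v₀') + -(h.form v D.v₀' • D.v₀') := by abel
    rw [h1]
    refine Submodule.add_mem_sup ⟨?_, ?_⟩
      (neg_mem (smul_mem _ _ (mem_span_singleton_self _)))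
    · intro u hu
      refine mem_orthogonal_span ?_ hu
      simp [map_add, add_app, h.smul_left, D.v₀'_norm]
    · intro u hu
      rw [fr.Xr_eq, fr.Y_eq, ← span_union] at hu
      refine mem_orthogonal_span ?_ hu
      rintro _ (⟨j, rfl⟩ | ⟨j, rfl⟩)
      · have h3 : h.form D.v₀' (e j) = 0 := by
          rw [h.tau_symm, D.X_orthogonal _ (fr.e_mem j), tau_zero]
        simp only [map_add, add_app, h.smul_left, (hv j).1, h3, mul_zero, add_zero]
      · have h4 : h.form D.v₀' (θ (e j)) = 0 := by
          rw [h.tau_symm, D.Y_orthogonal _ (fr.y_mem j), tau_zero]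
        simp only [map_add, add_app, h.smul_left, (hv j).2, h4, mul_zero, add_zero]

theorem v₀_mem : D.v₀ ∈ D.E₀' := (fr.mem_E₀' c _).2 fun i =>
  ⟨D.v₀_orthogonal_X _ (fr.e_mem i), D.v₀_orthogonal_Y _ (fr.y_mem i)⟩

variable (D) in
omit fr c in
theorem _root_.BesselData.v₀'_mem : D.v₀' ∈ D.E₀' :=
  mem_sup_right (mem_span_singleton_self _)

theorem theta_mem (hv : v ∈ D.E₀') : θ v ∈ D.E₀' := by
  rw [fr.mem_E₀' c] at hv ⊢
  intro i
  have h1 := c.form_theta_theta v (e i)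
  have h2 := c.form_theta_theta v (θ (e i))
  rw [(hv i).1, sigma_def, tau_zero, star_zero] at h1
  rw [(hv i).2, sigma_def, tau_zero, star_zero, c.theta_theta] at h2
  exact ⟨h2, h1⟩

omit fr in
theorem pos_v₀ (fr : AdaptedFrame D B θ e) : B.form D.v₀ D.v₀ = 1 ∧ B.form D.v₀' D.v₀' = 1 ∧ B.form
    D.v₀ D.v₀' = 0 := by
  simp [c.form_eq, fr.theta_v₀, fr.theta_v₀', map_neg, D.v₀_norm, D.v₀'_norm, D.v₀_orthogonal_v₀', neg_neg, neg_zero]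

omit fr c in
/-- The projection onto `E₀'`. -/
noncomputable def projF (_ : AdaptedFrame D B θ e) : E →ₗ[ℝ] E :=
  hyperbolicMap h e (fun i => θ (e i)) (fun _ => 0) (fun _ => 0)

omit c in
theorem projF_smul (a : 𝕂) (v : E) : fr.projF (a • v) = a • fr.projF v :=
  hyperbolicMap_smul _ _ a v

omit c in
theorem projF_apply (v : E) : fr.projF v = v -
    ((∑ i, h.form v (θ (e i)) • e i) + ∑ i, h.form v (e i) • θ (e i)) := by
  rw [projF, hyperbolicMap_apply, ← sum_add_distrib, sub_eq_add_neg v]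
  simp only [zero_sub, neg_smul, one_smul, smul_neg, ← neg_add, Finset.sum_neg_distrib]

theorem projF_mem (v : E) : fr.projF v ∈ D.E₀' := by
  rw [fr.mem_E₀' c]
  intro i
  have h1 := form_hyperbolicMap_right fr.form_ee fr.form_yy (fr.form_ey c) (fun _ => 0) (fun _ => 0) v i
  have h2 := form_hyperbolicMap_left fr.form_ee fr.form_yy (fr.form_ey c) (fun _ => 0) (fun _ => 0) v i
  aesop

theorem projF_of_mem (hv : v ∈ D.E₀') : fr.projF v = v :=
  hyperbolicMap_of_orthogonal _ _ ((fr.mem_E₀' c v).1 hv)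

theorem projF_projF (v : E) : fr.projF (fr.projF v) = fr.projF v :=
  fr.projF_of_mem c (fr.projF_mem c v)

theorem projF_adjoint (u v : E) : h.form (fr.projF u) v = h.form u (fr.projF v) := by
  have := form_hyperbolicMap_adjoint fr.form_ee fr.form_yy (fr.form_ey c) (fun _ => 0) (fun _ => 0) u v
  aesop

theorem projF_eq_zero (hv : ∀ f ∈ D.E₀', h.form v f = 0) : fr.projF v = 0 :=
  h.nondegenerate _ fun u => by rw [fr.projF_adjoint c]; exact hv _ (fr.projF_mem c u)

theorem form_E₀'_Xr {v x : E} (hv : v ∈ D.E₀') (hx : x ∈ D.Xr) : h.form v x = 0 :=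
  fr.mem_orthogonal_Xr (fun i => ((fr.mem_E₀' c v).1 hv i).1) hx

theorem projF_of_Xr {x : E} (hx : x ∈ D.Xr) : fr.projF x = 0 :=
  fr.projF_eq_zero c fun f hf => by rw [h.tau_symm, fr.form_E₀'_Xr c hf hx, tau_zero]

omit fr c in
theorem form_add_add_of_orthogonal {u v u' v' : E} (h1 : h.form u v' = 0) (h2 : h.form v u' = 0) :
    h.form (u + v) (u' + v') = h.form u u' + h.form v v' := by aesop

theorem form_projF_sub (u v : E) : h.form (fr.projF u) (v - fr.projF v) = 0 := by
  rw [fr.projF_adjoint c, map_sub, fr.projF_projF c, sub_self, map_zero]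

theorem form_sub_projF (u v : E) : h.form (v - fr.projF v) (fr.projF u) = 0 := by
  rw [h.tau_symm, fr.form_projF_sub c, tau_zero]

omit c in
/-- A vector orthogonal to `X_r` differs from its projection by an element of `X_r`. -/
theorem sub_projF_mem (hv : ∀ i, h.form v (e i) = 0) : v - fr.projF v ∈ D.Xr := by
  rw [projF_apply, sub_sub_cancel]
  simp only [hv, zero_smul, Finset.sum_const_zero, add_zero]
  exact Submodule.sum_mem _ fun i _ => smul_mem _ _ (fr.e_mem i)

theorem flagGroup_sub_projF (hx : x ∈ D.flagGroup) {f : E} (hf : f ∈ D.E₀') : x.1.val f - fr.projF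
    (x.1.val f) ∈ D.Xr := by
  refine fr.sub_projF_mem fun i => ?_
  rw [h.form_unitary_left]
  exact fr.form_E₀'_Xr c hf (D.flagGroup_mem_Xr (inv_mem hx) (fr.e_mem i))

theorem projF_flagGroup (hx : x ∈ D.flagGroup) (huv : u - v ∈ D.Xr) : fr.projF (x.1.val u) =
    fr.projF (x.1.val v) := by
  rw [← sub_eq_zero, ← map_sub, ← map_sub]
  exact fr.projF_of_Xr c (D.flagGroup_mem_Xr hx huv)

/-- The action on `X_r^⊥ / X_r = E₀'` is multiplicative. -/
theorem projF_mul {x y : h.unitary} (hx : x ∈ D.flagGroup) (hy : y ∈ D.flagGroup) {f : E}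
    (hf : f ∈ D.E₀') : fr.projF ((x * y).1.val f) = fr.projF (x.1.val (fr.projF (y.1.val f))) :=
  fr.projF_flagGroup c hx (fr.flagGroup_sub_projF c hy hf)

theorem form_projF_flagGroup (hx : x ∈ D.flagGroup) {f f' : E} (hf : f ∈ D.E₀') (hf' : f' ∈ D.E₀') :
    h.form (fr.projF (x.1.val f)) (fr.projF (x.1.val f')) = h.form f f' := by
  have h1 := fr.flagGroup_sub_projF c hx hf
  have h2 := fr.flagGroup_sub_projF c hx hf'
  rw [← x.2.2 f f']
  set a := fr.projF (x.1.val f)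
  set b := fr.projF (x.1.val f')
  have e1 : x.1.val f = a + (x.1.val f - a) := by abel
  have e2 : x.1.val f' = b + (x.1.val f' - b) := by abel
  have h3 : h.form (x.1.val f - a) b = 0 := by
    rw [h.tau_symm, fr.form_E₀'_Xr c (fr.projF_mem c _) h1, tau_zero]
  rw [e1, e2, form_add_add_of_orthogonal (fr.form_E₀'_Xr c (fr.projF_mem c _) h2) h3,
    D.X_isotropic _ h1 _ h2, add_zero]

theorem mem_bessel_iff (hx : x ∈ D.flagGroup) : x ∈ D.bessel ↔ fr.projF (x.1.val D.v₀') = D.v₀' :=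
    by
  have hv := D.v₀'_mem
  constructor
  · intro h1
    have h2 := h1.2 D.v₀' (mem_sup_right (mem_span_singleton_self _))
    have h3 := fr.projF_of_Xr c h2
    rwa [map_sub, fr.projF_of_mem c hv, sub_eq_zero] at h3
  · intro h1
    refine ⟨hx, fun v hv' => ?_⟩
    obtain ⟨a, ha, b, hb, rfl⟩ := Submodule.mem_sup.1 hv'
    obtain ⟨s, rfl⟩ := Submodule.mem_span_singleton.1 hb
    have h2 := fr.flagGroup_sub_projF c hx hv
    rw [h1] at h2
    rw [map_add, x.2.1, add_sub_add_comm, ← smul_sub]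
    exact add_mem (sub_mem (D.flagGroup_mem_Xr hx ha) ha) (smul_mem _ _ h2)

/-- The Levi component of an element of the flag group, acting on `E₀'`. -/
noncomputable def levi (hx : x ∈ D.flagGroup) : h.unitary :=
  h.mkUnitary (fr.projF ∘ₗ x.1.val.toLinearMap ∘ₗ fr.projF + (LinearMap.id - fr.projF))
    (fun a v => by
      simp [add_app, comp_apply, sub_app, id_apply, ContinuousLinearMap.coe_coe, fr.projF_smul, x.2.1, smul_add, smul_sub])
    (fun u v => by
      simp only [add_app, comp_apply, sub_app, id_apply,
        ContinuousLinearMap.coe_coe]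
      rw [form_add_add_of_orthogonal (fr.form_projF_sub c _ _) (fr.form_sub_projF c _ _),
        fr.form_projF_flagGroup c hx (fr.projF_mem c _) (fr.projF_mem c _)]
      conv_rhs => rw [← add_sub_cancel (fr.projF u) u, ← add_sub_cancel (fr.projF v) v]
      rw [form_add_add_of_orthogonal (fr.form_projF_sub c _ _) (fr.form_sub_projF c _ _)])

theorem levi_apply (hx : x ∈ D.flagGroup) (v : E) : (fr.levi c hx).1.val v = fr.projF
    (x.1.val (fr.projF v)) + (v - fr.projF v) := rfl

theorem levi_of_mem (hx : x ∈ D.flagGroup) (hv : v ∈ D.E₀') : (fr.levi c hx).1.val v = fr.projF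
    (x.1.val v) := by
  rw [levi_apply, fr.projF_of_mem c hv, sub_self, add_zero]

theorem levi_of_projF (hx : x ∈ D.flagGroup) (hv : fr.projF v = 0) : (fr.levi c hx).1.val v = v :=
    by
  rw [levi_apply, hv, map_zero, map_zero, zero_add, sub_zero]

theorem projF_y (i : Fin r) : fr.projF (θ (e i)) = 0 :=
  fr.projF_eq_zero c fun f hf => by rw [h.tau_symm, ((fr.mem_E₀' c f).1 hf i).2, tau_zero]

theorem projF_X (j : Fin (r + 1)) (hv : v ∈ D.X j) : fr.projF v = 0 := by
  refine fr.projF_of_Xr c ?_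
  rw [fr.Xr_eq]
  rw [fr.X_eq] at hv
  exact span_mono (Set.image_subset_range _ _) hv

theorem levi_mem (hx : x ∈ D.flagGroup) : fr.levi c hx ∈ D.flagGroup := by
  intro i v hv
  simp [fr.levi_of_projF c hx (fr.projF_X c _ hv), sub_self]

end AdaptedFrame

section TraceForm

variable {V : Type*} [AddCommGroup V] [Module ℝ V] [FiniteDimensional ℝ V]

theorem eq_zero_of_trace_adjoint (g : BilinForm ℝ V) (hs : ∀ u v, g u v = g v u)
    (hnn : ∀ u, 0 ≤ g u u) (hp : ∀ u, g u u = 0 → u = 0) (A A' : V →ₗ[ℝ] V)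
    (hA : ∀ u v, g (A u) v = g u (A' v)) (ht : trace ℝ V (A ∘ₗ A') = 0) : A = 0 := by
  have hsym : LinearMap.IsSymm g := ⟨hs⟩
  obtain ⟨b, hb⟩ := LinearMap.BilinForm.exists_orthogonal_basis hsym
  have hbp : ∀ i, 0 < g (b i) (b i) := fun i =>
    lt_of_le_of_ne (hnn _) fun h0 => b.ne_zero i (hp _ h0.symm)
  have h1 : ∀ v i, g v (b i) = b.repr v i * g (b i) (b i) := by
    intro v i
    conv_lhs => rw [← b.sum_repr v]
    rw [map_sum, sum_app, Finset.sum_eq_single i]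
    · simp
    · intro j _ hj
      rw [map_smul, LinearMap.smul_apply, show g (b j) (b i) = 0 from hb hj, smul_zero]
    · simp
  have h2 : ∀ i, b.repr (A (A' (b i))) i = g (A' (b i)) (A' (b i)) / g (b i) (b i) := fun i => by
    grind
  rw [LinearMap.trace_eq_matrix_trace ℝ b, Matrix.trace] at ht
  have h3 : ∀ i, (LinearMap.toMatrix b b (A ∘ₗ A')).diag i =
      g (A' (b i)) (A' (b i)) / g (b i) (b i) := fun i => by
    rw [Matrix.diag_apply, LinearMap.toMatrix_apply, comp_apply, h2]
  rw [sum_congr rfl fun i _ => h3 i,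
    Finset.sum_eq_zero_iff_of_nonneg fun i _ => div_nonneg (hnn _) (hbp i).le] at ht
  have h4 : A' = 0 := b.ext fun i => hp _ (by
    have := ht i (mem_univ i)
    rcases div_eq_zero_iff.1 this with h | h
    · exact h
    grind)
  ext u
  refine hp _ ?_
  simp [hA, h4]

theorem abs_det_eq_one_of_invariant (g : BilinForm ℝ V)
    (hg : ∀ x, (∀ y, g x y = 0) → x = 0) (f : V →ₗ[ℝ] V) (hf : ∀ x y, g (f x) (f y) = g x y) :
    |det f| = 1 := by
  set b := finBasis ℝ V
  have h1 := det_toMatrix_comp_endomorphism b g f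
  have h2 : g.comp f f = g := by
    ext u v
    simp [hf]
  have h3 := det_toMatrix_ne_zero b g hg
  grind

theorem LinearMap.det_one_add_of_isNilpotent {f : V →ₗ[ℝ] V} (hf : IsNilpotent f) : det
    (1 + f) = 1 := by
  have h1 : (-f).charpoly = Polynomial.X ^ finrank ℝ V :=
    ((LinearMap.charpoly_nilpotent_tfae (-f)).out 0 1).1 hf.neg
  have h2 := LinearMap.eval_charpoly (-f) 1
  simp_all [h1, Polynomial.eval_pow, Polynomial.eval_X, one_pow, map_one, sub_neg_eq_add]

theorem LinearMap.det_restrict_eq_mul {V' : Type*} [AddCommGroup V'] [Module ℝ V'] (f : V →ₗ[ℝ] V)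
    (f' : V' →ₗ[ℝ] V') (Γ : V →ₗ[ℝ] V') (S N : Submodule ℝ V) (R : Submodule ℝ V')
    (hS : ∀ x ∈ S, f x ∈ S) (hN : ∀ x ∈ N, f x ∈ N) (hR : ∀ x ∈ R, f' x ∈ R)
    (hΓ : ∀ x ∈ S, Γ (f x) = f' (Γ x)) (hSR : ∀ x ∈ S, Γ x ∈ R) (hRS : ∀ y ∈ R, ∃ x ∈ S, Γ x = y)
    (hker : ∀ x, x ∈ N ↔ x ∈ S ∧ Γ x = 0) : det (f.restrict hS) = det
    (f.restrict hN) * det (f'.restrict hR) := by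
  set γ : S →ₗ[ℝ] R := Γ.restrict hSR with hγ
  have hsurj : Surjective γ := by
    rintro ⟨y, hy⟩
    obtain ⟨x, hx, hxy⟩ := hRS y hy
    exact ⟨⟨x, hx⟩, Subtype.ext hxy⟩
  have hW : ker γ ≤ (ker γ).comap (f.restrict hS) := by
    intro x hx
    have hx' : Γ x = 0 := congrArg Subtype.val (LinearMap.mem_ker.1 hx)
    refine LinearMap.mem_ker.2 (Subtype.ext ?_)
    aesop
  rw [LinearMap.det_eq_det_mul_det (ker γ) (f.restrict hS) hW]
  congr 1
  · let e : ker γ ≃ₗ[ℝ] N :=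
      { toFun := fun x => ⟨x.1.1, (hker _).2 ⟨x.1.2, congrArg Subtype.val x.2⟩⟩
        map_add' := fun _ _ => rfl
        map_smul' := fun _ _ => rfl
        invFun := fun x => ⟨⟨x.1, ((hker _).1 x.2).1⟩, Subtype.ext ((hker _).1 x.2).2⟩
        left_inv := fun _ => rfl
        right_inv := fun _ => rfl }
    rw [← LinearMap.det_conj _ e]
    rfl
  · rw [← LinearMap.det_conj _ (γ.quotKerEquivOfSurjective hsurj)]
    congr 1
    refine LinearMap.ext fun y => ?_
    obtain ⟨x, rfl⟩ := hsurj y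
    have : (γ.quotKerEquivOfSurjective hsurj).symm (γ x) = Submodule.Quotient.mk x := by simp
    rw [comp_apply, comp_apply, LinearEquiv.coe_coe, LinearEquiv.coe_coe, this]
    exact Subtype.ext (hΓ x x.2)

end TraceForm

include c in
theorem IsCartan.comp_mem_lieUnitary (w : E →ₗ[ℝ] E) (hwK : ∀ (a : 𝕂) v, w (a • v) = a • w v)
    (hwh : ∀ u v, h.form (w u) v = h.form u (w v)) {A : E →L[ℝ] E} (hA : A ∈ h.lieUnitary) :
    toContinuousLinearMap (w ∘ₗ θ ∘ₗ A.toLinearMap ∘ₗ θ ∘ₗ w) ∈ h.lieUnitary := by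
  have had : ∀ u v, h.form (w (θ u)) v = sigma (h.form u (θ (w v))) := fun u v => by
    rw [hwh, c.form_theta_left, c.form_eq]
  refine ⟨fun a v => ?_, fun u v => ?_⟩
  · simp [hwK, c.theta_smul, hA.1, sigma_sigma]
  · change h.form (w (θ (A (θ (w u))))) v + h.form u (w (θ (A (θ (w v))))) = 0
    have h1 := hA.2 (θ (w u)) (θ (w v))
    rw [h.tau_symm u, had, had, h.tau_symm (A (θ (w v))), sigma_def, sigma_def, tau_star, tau_tau,
      ← star_add, ← tau_add, h1, tau_zero, star_zero]

include c in
theorem IsCartan.abs_det_conjEnd (w : E →ₗ[ℝ] E) (hww : ∀ v, w (w v) = v)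
    (hwK : ∀ (a : 𝕂) v, w (a • v) = a • w v) (hwh : ∀ u v, h.form (w u) v = h.form u (w v))
    (x : h.unitary) (hxw : ∀ v, x.1.val (w v) = w (x.1.val v)) (S : Submodule ℝ (E →L[ℝ] E))
    (hS : S ≤ h.lieUnitary) (hxS : ∀ A ∈ S, conjEnd x.1 A ∈ S)
    (hwS : ∀ A ∈ S, ∀ A' ∈ h.lieUnitary, (∀ v, A' v = w (θ (A (θ (w v))))) → A' ∈ S) :
    |det ((conjEnd x.1).restrict hxS)| = 1 := by
  let Q : BilinForm ℝ S := mk₂ ℝ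
    (fun A C => trace ℝ E (A.1.toLinearMap ∘ₗ w ∘ₗ C.1.toLinearMap ∘ₗ w))
    (fun A A' C => by
      rw [← map_add]; rfl)
    (fun s A C => by
      rw [← map_smul]; rfl)
    (fun A C C' => by
      rw [← map_add, ← LinearMap.comp_add, ← LinearMap.comp_add]; rfl)
    (fun s A C => by
      rw [← map_smul, ← LinearMap.comp_smul, ← LinearMap.comp_smul]; rfl)
  refine abs_det_eq_one_of_invariant Q (fun A hA => ?_) _ (fun A C => ?_)
  · have hA1 := hS A.2
    have h1 := hA ⟨_, hwS A.1 A.2 _ (c.comp_mem_lieUnitary w hwK hwh hA1) fun v => rfl⟩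
    have h2 : A.1.toLinearMap = 0 := by
      refine eq_zero_of_trace_adjoint (B.form.compr₂ (normTraceLinear L k)) (fun u v => ?_)
        (fun u => B.normTrace_nonneg c.exists_torsionFree u)
        (fun u hu => B.eq_zero_of_normTrace c.exists_torsionFree hu) _
        (-(θ ∘ₗ A.1.toLinearMap ∘ₗ θ)) (fun u v => ?_) ?_
      · change normTrace (B.form u v) = normTrace (B.form v u)
        rw [B.conj_symm, normTrace_star]
      · change normTrace (B.form (A.1 u) v) = normTrace (B.form u (-(θ (A.1 (θ v)))))
        rw [c.form_eq, map_neg, ← c.form_eq', eq_neg_of_add_eq_zero_left (hA1.2 u (θ v))]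
      · rw [LinearMap.comp_neg, map_neg, neg_eq_zero, ← h1]
        change _ = trace ℝ E _
        congr 1
        ext v
        simp_all
    exact Subtype.ext (ContinuousLinearMap.ext fun v => LinearMap.congr_fun h2 v)
  · change trace ℝ E _ = trace ℝ E _
    have e1 : ∀ v, (x⁻¹).1.val (w v) = w ((x⁻¹).1.val v) := fun v => by
      conv_lhs => rw [← h.unitary_apply_inv x v, ← hxw, h.unitary_inv_apply]
    set T := A.1.toLinearMap ∘ₗ w ∘ₗ C.1.toLinearMap ∘ₗ w with hT
    have e2 : (conjEnd x.1 A.1).toLinearMap ∘ₗ w ∘ₗ (conjEnd x.1 C.1).toLinearMap ∘ₗ w =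
        x.1.val.toLinearMap * (T * (x⁻¹).1.val.toLinearMap) := by
      ext v
      change x.1.val (A.1 ((x⁻¹).1.val (w (x.1.val (C.1 ((x⁻¹).1.val (w v))))))) =
        x.1.val (A.1 (w (C.1 (w ((x⁻¹).1.val v)))))
      rw [e1, h.unitary_inv_apply, e1]
    have e3 : T * (x⁻¹).1.val.toLinearMap * x.1.val.toLinearMap = T := by
      ext v
      change T ((x⁻¹).1.val (x.1.val v)) = T v
      rw [h.unitary_inv_apply]
    refine (congrArg (trace ℝ E) e2).trans ?_
    rw [LinearMap.trace_mul_comm, e3]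

theorem det_conjEnd_of_isNilpotent (x : (E →L[ℝ] E)ˣ) (hx : IsNilpotent (x.val - 1))
    (S : Submodule ℝ (E →L[ℝ] E)) (hxS : ∀ A ∈ S, conjEnd x A ∈ S) : det
    ((conjEnd x).restrict hxS) = 1 := by
  set N := x.val - 1 with hN
  set M := x⁻¹.val - 1 with hM
  have hMn : IsNilpotent M := by
    have e : M = -x⁻¹.val * N := by
      rw [hM, hN, mul_sub, neg_mul, x.inv_mul, mul_one]; abel
    have hc : Commute (-x⁻¹.val) N := by aesop
    rw [e]
    exact hc.isNilpotent_mul_left hx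
  have hL := (LinearMap.isNilpotent_mulLeft_iff ℝ N).2 hx
  have hR := (LinearMap.isNilpotent_mulRight_iff ℝ M).2 hMn
  set l : Module.End ℝ (E →L[ℝ] E) := mulLeft ℝ N
  set m : Module.End ℝ (E →L[ℝ] E) := mulRight ℝ M
  have hc : Commute l m := LinearMap.commute_mulLeft_right N M
  have hn : IsNilpotent (l + m + l * m) := by
    refine Commute.isNilpotent_add ?_ (hc.isNilpotent_add hL hR) (hc.isNilpotent_mul_right hL)
    exact ((Commute.refl l).add_left hc.symm).mul_right (hc.add_left (Commute.refl m))
  have e : conjEnd x = 1 + (l + m + l * m) := by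
    refine LinearMap.ext fun A => ?_
    change x.val * (A * x⁻¹.val) = A + (N * A + A * M + N * (A * M))
    rw [hN, hM]
    noncomm_ring
  have hS' : ∀ A ∈ S, (l + m + l * m) A ∈ S := fun A hA => by
    have h1 : (l + m + l * m) A = conjEnd x A - A := by simp [e]
    rw [h1]
    exact sub_mem (hxS A hA) hA
  have h2 : (conjEnd x).restrict hxS = 1 + (l + m + l * m).restrict hS' := by
    refine LinearMap.ext fun A => Subtype.ext ?_
    simp [e]
  rw [h2]
  exact LinearMap.det_one_add_of_isNilpotent (Module.End.isNilpotent.restrict hS' hn)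

include c in
theorem IsCartan.abs_det_conjEnd_lieUnitary (x : h.unitary) : |det
    ((conjEnd x.1).restrict fun _ => conjEnd_mem_lieUnitary h x)| = 1 :=
  c.abs_det_conjEnd LinearMap.id (fun _ => rfl) (fun _ _ => rfl) (fun _ _ => rfl) x (fun _ => rfl) _
    le_rfl _ fun _ _ _ hA' _ => hA'

variable (D) in
/-- The Lie algebra of the flag group. -/
def BesselData.lieFlag : Submodule ℝ (E →L[ℝ] E) where
  carrier := {A | A ∈ h.lieUnitary ∧ ∀ i : Fin r, ∀ v ∈ D.X i.succ, A v ∈ D.X i.castSucc}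
  add_mem' := by
    rintro A C ⟨hA, hA'⟩ ⟨hC, hC'⟩
    exact ⟨add_mem hA hC, fun i v hv => add_mem (hA' i v hv) (hC' i v hv)⟩
  zero_mem' := ⟨zero_mem _, fun i v _ => by simp⟩
  smul_mem' := by
    rintro c A ⟨hA, hA'⟩
    exact ⟨smul_mem _ c hA, fun i v hv => Submodule.smul_of_tower_mem _ c (hA' i v hv)⟩

variable (D) in
/-- The Lie algebra of `GL(X_r)`. -/
def BesselData.lieLinear : Submodule ℝ (E →L[ℝ] E) where
  carrier := {A | A ∈ h.lieUnitary ∧ (∀ v ∈ D.Xr, A v ∈ D.Xr) ∧ (∀ v ∈ D.Y, A v ∈ D.Y) ∧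
    ∀ v ∈ D.E₀', A v = 0}
  add_mem' := by
    rintro A C ⟨hA, hA1, hA2, hA3⟩ ⟨hC, hC1, hC2, hC3⟩
    refine ⟨add_mem hA hC, fun v hv => add_mem (hA1 v hv) (hC1 v hv),
      fun v hv => add_mem (hA2 v hv) (hC2 v hv), fun v hv => ?_⟩
    aesop
  zero_mem' := ⟨zero_mem _, fun v _ => by simp, fun v _ => by simp, fun v _ => by simp⟩
  smul_mem' := by
    rintro c A ⟨hA, hA1, hA2, hA3⟩
    refine ⟨smul_mem _ c hA, fun v hv => Submodule.smul_of_tower_mem _ c (hA1 v hv),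
      fun v hv => Submodule.smul_of_tower_mem _ c (hA2 v hv), fun v hv => ?_⟩
    aesop

theorem BesselData.conjEnd_mem_lieFlag (hx : ∀ i, ∀ v ∈ D.X i, x.1.val v ∈ D.X i)
    (hx' : ∀ i, ∀ v ∈ D.X i, (x⁻¹).1.val v ∈ D.X i) : ∀ A ∈ D.lieFlag, conjEnd x.1 A ∈ D.lieFlag :=
    fun _ hA =>
  ⟨conjEnd_mem_lieUnitary h x hA.1, fun i _ hv => hx _ _ (hA.2 i _ (hx' _ _ hv))⟩

theorem BesselData.conjEnd_flagGroup (hx : x ∈ D.flagGroup) : ∀ A ∈ D.lieFlag, conjEnd x.1 A ∈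
    D.lieFlag :=
  D.conjEnd_mem_lieFlag (fun i _ => D.flagGroup_mem_X hx i)
    fun i _ => D.flagGroup_mem_X (inv_mem hx) i

theorem BesselData.conjEnd_borelGroup (x : D.borelGroup) : ∀ A ∈ D.lieFlag, conjEnd x.1.1 A ∈
    D.lieFlag :=
  D.conjEnd_mem_lieFlag (fun i v hv => (x.2.1 i v).2 hv) fun i v hv => ((x⁻¹).2.1 i v).2 hv

namespace AdaptedFrame

/-- The isometry that exchanges `e i` and `θ (e i)` and fixes `E₀'`. -/
noncomputable def swap (_ : AdaptedFrame D B θ e) : E →ₗ[ℝ] E :=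
  LinearMap.id + ∑ i, ((smulBilin L k E).flip (e i - θ (e i))) ∘ₗ h.form.flip (e i - θ (e i))

theorem swap_apply (v : E) : fr.swap v = v + ∑ i, h.form v (e i - θ (e i)) • (e i - θ (e i)) := by
  simp only [swap, add_app, id_apply, sum_app,
    comp_apply, flip_apply, smulBilin_apply]

theorem swap_smul (a : 𝕂) (v : E) : fr.swap (a • v) = a • fr.swap v := by
  simp only [swap_apply, h.smul_left, mul_smul, smul_add, smul_sum]

theorem form_swap (u v : E) : h.form (fr.swap u) v = h.form u (fr.swap v) := by
  simp only [swap_apply]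
  have : ∀ n : Fin r → E, h.form (u + ∑ i, h.form u (n i) • n i) v =
      h.form u (v + ∑ i, h.form v (n i) • n i) := fun n => by
    simp only [map_add, add_app, map_sum, sum_app, h.smul_left,
      h.smul_right, ← h.tau_symm]
    grind
  exact this _

include fr c in
theorem form_sub_theta (i j : Fin r) : h.form (e i - θ (e i)) (e j - θ (e j)) = if i = j then -2
    else 0 := by
  simp only [map_sub, sub_app, fr.form_ee, fr.form_yy, fr.form_ey c, fr.form_ye c]
  split_ifs <;> ring

include c in
theorem swap_swap (v : E) : fr.swap (fr.swap v) = v := by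
  have h1 : ∀ j, h.form (fr.swap v) (e j - θ (e j)) = -h.form v (e j - θ (e j)) := fun j => by
    rw [swap_apply, map_add, add_app, map_sum, sum_app]
    simp only [h.smul_left, fr.form_sub_theta c, mul_ite, mul_zero, Finset.sum_ite_eq',
      mem_univ, if_true]
    ring
  rw [swap_apply (v := fr.swap v)]
  simp only [h1, neg_smul, Finset.sum_neg_distrib]
  rw [swap_apply, add_neg_cancel_right]

include c in
theorem swap_theta_e (i : Fin r) : fr.swap (θ (e i)) = e i := by
  simp [swap_apply, map_sub, fr.form_yy, fr.form_ye c, sub_zero, ite_smul, one_smul, zero_smul, Finset.sum_ite_eq, mem_univ, if_true]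

include c in
theorem swap_e (i : Fin r) : fr.swap (e i) = θ (e i) := by
  rw [← fr.swap_swap c (θ (e i)), fr.swap_theta_e c]

include fr in
/-- A semilinear map that fixes the frame preserves the flag. -/
theorem mem_X_of_fixed (f : E →ₗ[ℝ] E) (hf : ∀ (a : 𝕂) v, f (a • v) = sigma a • f v)
    (he : ∀ i, f (e i) = e i) (j : Fin (r + 1)) {v : E} (hv : v ∈ D.X j) : f v ∈ D.X j := by
  rw [fr.X_eq] at hv ⊢
  induction hv using span_induction with
  | mem x hx =>
    obtain ⟨i, hi, rfl⟩ := hx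
    rw [he]
    exact subset_span ⟨i, hi, rfl⟩
  | zero => rw [map_zero]; exact zero_mem _
  | add x y _ _ hx hy => rw [map_add]; exact add_mem hx hy
  | smul a x _ hx => rw [hf]; exact smul_mem _ _ hx

include c in
theorem abs_det_conjEnd_levi {x : h.unitary} (hx : x ∈ D.flagGroup) : |det
    ((conjEnd (fr.levi c hx).1).restrict (D.conjEnd_flagGroup (fr.levi_mem c hx)))| = 1 := by
  refine c.abs_det_conjEnd fr.swap (fr.swap_swap c) fr.swap_smul fr.form_swap _ (fun v => ?_) _
    (fun A (hA : A ∈ D.lieFlag) => hA.1) _ fun A hA A' hA' hAA' => ⟨hA', fun i v hv => ?_⟩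
  · have h1 : ∀ i, (fr.levi c hx).1.val (e i - θ (e i)) = e i - θ (e i) := fun i =>
      fr.levi_of_projF c hx (by rw [map_sub, fr.projF_of_Xr c (fr.e_mem i), fr.projF_y c, sub_zero])
    rw [swap_apply, swap_apply, map_add, map_sum]
    congr 1
    refine sum_congr rfl fun i _ => ?_
    rw [(fr.levi c hx).2.1, h1]
    conv_rhs => rw [← h1 i, (fr.levi c hx).2.2, h1]
  · rw [hAA']
    have h1 := fr.mem_X_of_fixed (θ ∘ₗ fr.swap)
      (fun a v => by rw [comp_apply, fr.swap_smul, c.theta_smul]; rfl)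
      (fun i => by rw [comp_apply, fr.swap_e c, c.theta_theta]) i.succ hv
    exact fr.mem_X_of_fixed (fr.swap ∘ₗ θ)
      (fun a v => by rw [comp_apply, c.theta_smul, fr.swap_smul]; rfl)
      (fun i => fr.swap_theta_e c i) i.castSucc (hA.2 i _ h1)

include fr c in
theorem isNilpotent_of_unipotent {n : h.unitary} (hn : n ∈ D.flagGroup)
    (hF : ∀ f ∈ D.E₀', n.1.val f - f ∈ D.Xr) : IsNilpotent (n.1.val - 1) := by
  set N := n.1.val - 1 with hN
  have hNv : ∀ v, N v = n.1.val v - v := fun v => rfl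
  have h1 : ∀ j : Fin (r + 1), ∀ v, ∀ x ∈ D.X j, h.form ((N ^ (j : ℕ)) v) x = 0 := by
    intro j
    induction j using Fin.induction with
    | zero =>
      intro v x hx
      rw [D.X_zero, mem_bot] at hx
      rw [hx, map_zero]
    | succ j ih =>
      intro v x hx
      rw [Fin.val_succ, pow_succ', mul_apply_eq_comp, hNv, map_sub, sub_app,
        h.form_unitary_left, ← map_sub]
      exact ih v _ (inv_mem hn j x hx)
  have h2 : ∀ u, (∀ i, h.form u (e i) = 0) → N u ∈ D.Xr := by
    intro u hu
    have h3 := fr.sub_projF_mem hu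
    have h4 : N u = (n.1.val (fr.projF u) - fr.projF u) +
        (n.1.val (u - fr.projF u) - (u - fr.projF u)) := by
      rw [hNv, map_sub]; abel
    rw [h4]
    exact add_mem (hF _ (fr.projF_mem c u)) (sub_mem (D.flagGroup_mem_Xr hn h3) h3)
  have h3 : ∀ j : Fin (r + 1), ∀ v ∈ D.X j, (N ^ (j : ℕ)) v = 0 := by
    intro j
    induction j using Fin.induction with
    | zero =>
      intro v hv
      rw [D.X_zero, mem_bot] at hv
      rw [hv, map_zero]
    | succ j ih =>
      tauto
  refine ⟨r + 1 + r, ContinuousLinearMap.ext fun v => ?_⟩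
  rw [pow_add, pow_succ, mul_apply_eq_comp, mul_apply_eq_comp]
  exact h3 (Fin.last r) _ (h2 _ fun i => h1 (Fin.last r) v _ (fr.e_mem i))

include fr c in
theorem abs_det_conjEnd_flagGroup {x : h.unitary} (hx : x ∈ D.flagGroup) : |det
    ((conjEnd x.1).restrict (D.conjEnd_flagGroup hx))| = 1 := by
  set l := fr.levi c hx with hl
  have hlm := fr.levi_mem c hx
  set n := x * l⁻¹ with hn
  have hnm : n ∈ D.flagGroup := mul_mem hx (inv_mem hlm)
  have hF : ∀ f ∈ D.E₀', n.1.val f - f ∈ D.Xr := by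
    intro f hf
    have h1 : (l⁻¹).1.val f ∈ D.E₀' := by
      rw [fr.mem_E₀' c] at hf ⊢
      intro i
      rw [← h.form_unitary_right, ← h.form_unitary_right,
        fr.levi_of_projF c hx (fr.projF_of_Xr c (fr.e_mem i)), fr.levi_of_projF c hx (fr.projF_y c i)]
      exact hf i
    have h2 := fr.flagGroup_sub_projF c hx h1
    rw [← fr.levi_of_mem c hx h1, ← hl, h.unitary_apply_inv] at h2
    exact h2
  have h1 := det_conjEnd_of_isNilpotent n.1 (fr.isNilpotent_of_unipotent c hnm hF) D.lieFlag
    (D.conjEnd_flagGroup hnm)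
  have h2 := fr.abs_det_conjEnd_levi c hx
  have h3 : (conjEnd x.1).restrict (D.conjEnd_flagGroup hx) =
      (conjEnd n.1).restrict (D.conjEnd_flagGroup hnm) ∘ₗ
        (conjEnd l.1).restrict (D.conjEnd_flagGroup hlm) := by
    refine LinearMap.ext fun A => Subtype.ext (ContinuousLinearMap.ext fun v => ?_)
    change x.1.val (A.1 ((x⁻¹).1.val v)) =
      x.1.val ((l⁻¹).1.val (l.1.val (A.1 ((l⁻¹).1.val ((n⁻¹).1.val v)))))
    have h4 : (l⁻¹).1.val ((n⁻¹).1.val v) = (x⁻¹).1.val v := by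
      rw [← h.unitary_mul_apply, hn]
      congr 2
      group
    rw [h.unitary_inv_apply, h4]
  rw [h3, det_comp, abs_mul, h1, h2, abs_one, one_mul]

end AdaptedFrame

namespace AdaptedFrame

variable (h) in
theorem _root_.HermitianForm.form_eq_zero_symm (huv : h.form u v = 0) : h.form v u = 0 := by
  rw [h.tau_symm, huv, tau_zero]

/-- The projection onto `X_r`. -/
noncomputable def projX (_ : AdaptedFrame D B θ e) : E →L[ℝ] E :=
  toContinuousLinearMap
    (∑ i, ((smulBilin L k E).flip (e i)) ∘ₗ h.form.flip (θ (e i)))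

/-- The projection onto `Y`. -/
noncomputable def projY (_ : AdaptedFrame D B θ e) : E →L[ℝ] E :=
  toContinuousLinearMap
    (∑ i, ((smulBilin L k E).flip (θ (e i))) ∘ₗ h.form.flip (e i))

theorem projX_apply (v : E) : fr.projX v = ∑ i, h.form v (θ (e i)) • e i := by
  simp only [projX, LinearMap.coe_toContinuousLinearMap', sum_app, comp_apply,
    flip_apply, smulBilin_apply]

theorem projY_apply (v : E) : fr.projY v = ∑ i, h.form v (e i) • θ (e i) := by
  simp only [projY, LinearMap.coe_toContinuousLinearMap', sum_app, comp_apply,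
    flip_apply, smulBilin_apply]

theorem projX_smul (a : 𝕂) (v : E) : fr.projX (a • v) = a • fr.projX v := by
  simp only [projX_apply, h.smul_left, mul_smul, smul_sum]

theorem projY_smul (a : 𝕂) (v : E) : fr.projY (a • v) = a • fr.projY v := by
  simp only [projY_apply, h.smul_left, mul_smul, smul_sum]

theorem form_projX (u v : E) : h.form (fr.projX u) v = h.form u (fr.projY v) := by
  simp only [projX_apply, projY_apply, map_sum, sum_app, h.smul_left, h.smul_right,
    ← h.tau_symm]
  grind

theorem form_projY (u v : E) : h.form (fr.projY u) v = h.form u (fr.projX v) := by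
  rw [h.tau_symm, ← fr.form_projX, ← h.tau_symm]

theorem projX_mem (v : E) : fr.projX v ∈ D.Xr := by
  rw [projX_apply]
  exact Submodule.sum_mem _ fun i _ => smul_mem _ _ (fr.e_mem i)

theorem projY_mem (v : E) : fr.projY v ∈ D.Y := by
  rw [projY_apply]
  exact Submodule.sum_mem _ fun i _ => smul_mem _ _ (fr.y_mem i)

include fr

theorem mem_orthogonal_Y (hv : ∀ i, h.form v (θ (e i)) = 0) {y : E} (hy : y ∈ D.Y) : h.form v y = 0
    := by
  rw [fr.Y_eq] at hy
  exact mem_orthogonal_span (by grind) hy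

theorem projX_add (v : E) : fr.projF v + (fr.projX v + fr.projY v) = v := by
  rw [projF_apply, projX_apply, projY_apply, sub_add_cancel]

include c

theorem projF_of_Y (hv : v ∈ D.Y) : fr.projF v = 0 :=
  fr.projF_eq_zero c fun f hf => by
    rw [h.tau_symm, fr.mem_orthogonal_Y (fun i => ((fr.mem_E₀' c f).1 hf i).2) hv, tau_zero]

omit c in
theorem projY_of_Xr (hv : v ∈ D.Xr) : fr.projY v = 0 := by
  rw [projY_apply]
  exact sum_eq_zero fun i _ => by rw [D.X_isotropic _ hv _ (fr.e_mem i), zero_smul]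

omit c in
theorem projX_of_Y (hv : v ∈ D.Y) : fr.projX v = 0 := by
  rw [projX_apply]
  exact sum_eq_zero fun i _ => by rw [D.Y_isotropic _ hv _ (fr.y_mem i), zero_smul]

theorem projX_of_Xr (hv : v ∈ D.Xr) : fr.projX v = v := by
  have := fr.projX_add v
  grind [fr.projF_of_Xr c hv, fr.projY_of_Xr hv, zero_add, add_zero]

theorem projY_of_Y (hv : v ∈ D.Y) : fr.projY v = v := by
  have := fr.projX_add v
  grind [fr.projF_of_Y, fr.projX_of_Y, zero_add]

theorem proj_of_E₀' (hv : v ∈ D.E₀') : fr.projX v = 0 ∧ fr.projY v = 0 := by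
  have h1 := (fr.mem_E₀' c v).1 hv
  rw [projX_apply, projY_apply]
  aesop

omit fr c in
/-- The projection of an endomorphism onto its diagonal blocks on `X_r` and `Y`. -/
noncomputable def linearBlock (fr : AdaptedFrame D B θ e) : (E →L[ℝ] E) →ₗ[ℝ] (E →L[ℝ] E) :=
  (mulLeft ℝ fr.projX).comp (mulRight ℝ fr.projX) +
    (mulLeft ℝ fr.projY).comp (mulRight ℝ fr.projY)

omit c in
theorem linearBlock_apply (A : E →L[ℝ] E) (v : E) : fr.linearBlock A v = fr.projX (A (fr.projX v)) +
    fr.projY (A (fr.projY v)) := rfl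

theorem linearBlock_mem {A : E →L[ℝ] E} (hA : A ∈ h.lieUnitary) : fr.linearBlock A ∈ D.lieLinear :=
    by
  refine ⟨⟨fun a v => ?_, fun u v => ?_⟩, fun v hv => ?_, fun v hv => ?_, fun v hv => ?_⟩
  · simp only [linearBlock_apply, projX_smul, projY_smul, hA.1, smul_add]
  · simp only [linearBlock_apply, map_add, add_app]
    have h1 := hA.2 (fr.projX u) (fr.projY v)
    have h2 := hA.2 (fr.projY u) (fr.projX v)
    simp [fr.form_projX, fr.form_projY, eq_neg_of_add_eq_zero_left h1, eq_neg_of_add_eq_zero_left h2]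
  · rw [linearBlock_apply, fr.projY_of_Xr hv, map_zero, map_zero, add_zero]
    exact fr.projX_mem _
  · rw [linearBlock_apply, fr.projX_of_Y hv, map_zero, map_zero, zero_add]
    exact fr.projY_mem _
  grind [linearBlock_apply, fr.proj_of_E₀', map_zero, add_zero]

theorem linearBlock_of_mem {A : E →L[ℝ] E} (hA : A ∈ D.lieLinear) : fr.linearBlock A = A := by
  refine ContinuousLinearMap.ext fun v => ?_
  conv_rhs => rw [← fr.projX_add v]
  simp [linearBlock_apply, map_add, hA.2.2.2 _ (fr.projF_mem c v), zero_add, fr.projX_of_Xr c (hA.2.1 _ (fr.projX_mem v)), fr.projY_of_Y c (hA.2.2.1 _ (fr.projY_mem v))]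

theorem linearBlock_of_Xr {A : E →L[ℝ] E} (hv : v ∈ D.Xr) (hA : A v ∈ D.Xr) : fr.linearBlock A v = A
    v := by
  grind [linearBlock_apply, fr.projY_of_Xr, map_zero, add_zero, fr.projX_of_Xr]

omit c in
theorem mem_Xr_of_mem (j : Fin (r + 1)) (hv : v ∈ D.X j) : v ∈ D.Xr := by
  rw [fr.Xr_eq]
  rw [fr.X_eq] at hv
  exact span_mono (Set.image_subset_range _ _) hv

/-- A vector of `X_{i+1}` without component along `e i` lies in `X_i`. -/
theorem mem_castSucc {i : Fin r} (hv : v ∈ D.X i.succ) (h0 : h.form v (θ (e i)) = 0) : v ∈ D.X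
    i.castSucc := by
  rw [← fr.projX_of_Xr c (fr.mem_Xr_of_mem _ hv), projX_apply]
  refine Submodule.sum_mem _ fun j _ => ?_
  rcases lt_trichotomy j i with hij | rfl | hij
  · refine smul_mem _ _ ?_
    rw [fr.X_eq]
    exact subset_span ⟨j, Fin.castSucc_lt_castSucc_iff.2 hij, rfl⟩
  · aesop
  · have : h.form v (θ (e j)) = 0 := by
      refine h.form_eq_zero_symm ?_
      rw [fr.X_eq] at hv
      refine mem_orthogonal_span ?_ hv
      rintro _ ⟨m, hm, rfl⟩
      have hm' : m ≤ i := Fin.castSucc_lt_succ_iff.1 hm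
      rw [fr.form_ye c, if_neg (hm'.trans_lt hij).ne']
    aesop

theorem X_succ_induction {i : Fin r} (hv : v ∈ D.X i.succ) : ∃ a : 𝕂, ∃ u ∈ D.X i.castSucc, v = a •
    e i + u := by
  refine ⟨h.form v (θ (e i)), v - h.form v (θ (e i)) • e i, ?_, by abel⟩
  refine fr.mem_castSucc c (sub_mem hv (smul_mem _ _ (fr.e_mem_succ i))) ?_
  rw [map_sub, sub_app, h.smul_left, fr.form_ey c, if_pos rfl, mul_one, sub_self]

theorem theta_mem_X (hv : v ∈ D.Y) : θ v ∈ D.Xr := by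
  rw [fr.Y_eq] at hv
  exact map_mem_of_mem_span c.theta_smul
    (by rintro _ ⟨i, rfl⟩; rw [c.theta_theta]; exact fr.e_mem i) hv

theorem theta_mem_Y (hv : v ∈ D.Xr) : θ v ∈ D.Y := by
  rw [fr.Xr_eq] at hv
  exact map_mem_of_mem_span c.theta_smul (by rintro _ ⟨i, rfl⟩; exact fr.y_mem i) hv

omit fr c in
/-- An element of `GL(X_r)` that acts on the frame by scalars. -/
structure IsDiagonal (fr : AdaptedFrame D B θ e) (x : D.borelGroup) (s s' : Fin r → 𝕂) :
    Prop where
  apply_e : ∀ i, x.1.1.val (e i) = s i • e i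
  apply_y : ∀ i, x.1.1.val (θ (e i)) = s' i • θ (e i)
  mul_tau : ∀ i, s i * tau (s' i) = 1

omit c in
theorem IsDiagonal.form_y {x : D.borelGroup} {s s' : Fin r → 𝕂} (hx : fr.IsDiagonal x s s') (v : E)
    (i : Fin r) : h.form (x.1.1.val v) (θ (e i)) = s i * h.form v (θ (e i)) := by
  have h1 := x.1.2.2 v (θ (e i))
  rw [hx.apply_y, h.smul_right] at h1
  rw [← h1, ← mul_assoc, hx.mul_tau, one_mul]

omit c in
theorem IsDiagonal.form_e {x : D.borelGroup} {s s' : Fin r → 𝕂} (hx : fr.IsDiagonal x s s') (v : E)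
    (i : Fin r) : h.form (x.1.1.val v) (e i) = s' i * h.form v (e i) := by
  have h1 := x.1.2.2 v (e i)
  rw [hx.apply_e, h.smul_right] at h1
  have h2 := congrArg tau (hx.mul_tau i)
  rw [tau_mul, tau_tau, tau_one, mul_comm] at h2
  grind

omit c in
theorem IsDiagonal.projX_comm {x : D.borelGroup} {s s' : Fin r → 𝕂} (hx : fr.IsDiagonal x s s')
    (v : E) : fr.projX (x.1.1.val v) = x.1.1.val (fr.projX v) := by
  simp [projX_apply, map_sum, hx.form_y, x.1.2.1, hx.apply_e, smul_smul, mul_comm]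

omit c in
theorem IsDiagonal.projY_comm {x : D.borelGroup} {s s' : Fin r → 𝕂} (hx : fr.IsDiagonal x s s')
    (v : E) : fr.projY (x.1.1.val v) = x.1.1.val (fr.projY v) := by
  simp [projY_apply, map_sum, hx.form_e, x.1.2.1, hx.apply_y, smul_smul, mul_comm]

omit c in
theorem linearBlock_conjEnd {x : D.borelGroup} {s s' : Fin r → 𝕂} (hx : fr.IsDiagonal x s s')
    (A : E →L[ℝ] E) : fr.linearBlock (conjEnd x.1.1 A) = conjEnd x.1.1 (fr.linearBlock A) := by
  have h1 : ∀ v, fr.projX ((x.1⁻¹).1.val v) = (x.1⁻¹).1.val (fr.projX v) := fun v => by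
    conv_rhs => rw [← h.unitary_apply_inv x.1 v, hx.projX_comm, h.unitary_inv_apply]
  have h2 : ∀ v, fr.projY ((x.1⁻¹).1.val v) = (x.1⁻¹).1.val (fr.projY v) := fun v => by
    conv_rhs => rw [← h.unitary_apply_inv x.1 v, hx.projY_comm, h.unitary_inv_apply]
  refine ContinuousLinearMap.ext fun v => ?_
  change fr.projX (x.1.1.val (A ((x.1⁻¹).1.val (fr.projX v)))) +
    fr.projY (x.1.1.val (A ((x.1⁻¹).1.val (fr.projY v)))) =
    x.1.1.val (fr.projX (A (fr.projX ((x.1⁻¹).1.val v))) +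
      fr.projY (A (fr.projY ((x.1⁻¹).1.val v))))
  rw [h1, h2, hx.projX_comm, hx.projY_comm, map_add]

theorem abs_det_conjEnd_diagonal {x : D.borelGroup} {s s' : Fin r → 𝕂} (hx : fr.IsDiagonal x s s') :
    |det ((conjEnd x.1.1).restrict (D.conjEnd_borelGroup x))| = D.deltaP
    ⟨x.1, D.borelGroup_le_parabolic x.2⟩ * D.deltaB x := by
  have hE : ∀ v ∈ D.E₀', (x.1⁻¹).1.val v = v := (x⁻¹).2.2.2
  have hgl : ∀ A ∈ D.lieLinear, conjEnd x.1.1 A ∈ D.lieLinear := fun A hA =>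
    ⟨conjEnd_mem_lieUnitary h x.1 hA.1,
      fun v hv => (x.2.1 (Fin.last r) _).2 (hA.2.1 _ (((x⁻¹).2.1 (Fin.last r) v).2 hv)),
      fun v hv => (x.2.2.1 _).2 (hA.2.2.1 _ (((x⁻¹).2.2.1 v).2 hv)), fun v hv => by
        simp_all [conjEnd_apply, hA.2.2.2 v hv, map_zero]⟩
  have hfl := D.conjEnd_borelGroup x
  have hN : ∀ A ∈ D.lieFlag ⊓ D.lieLinear, conjEnd x.1.1 A ∈ D.lieFlag ⊓ D.lieLinear :=
    fun A hA => ⟨hfl A hA.1, hgl A hA.2⟩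
  have hK : ∀ A ∈ D.lieParabolic ⊓ ker fr.linearBlock,
      conjEnd x.1.1 A ∈ D.lieParabolic ⊓ ker fr.linearBlock := fun A hA =>
    ⟨D.conjEnd_mem_lieParabolic ⟨x.1, D.borelGroup_le_parabolic x.2⟩ A hA.1, by
      simp [fr.linearBlock_conjEnd hx, LinearMap.mem_ker.1 hA.2, map_zero]⟩
  have hflP : D.lieFlag ≤ D.lieParabolic := fun A hA => ⟨hA.1, fun v hv => by
    rw [fr.Xr_eq] at hv
    refine map_mem_of_mem_span hA.1.1 ?_ hv
    rintro _ ⟨i, rfl⟩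
    exact fr.mem_Xr_of_mem _ (hA.2 i _ (fr.e_mem_succ i))⟩
  have e1 := LinearMap.det_restrict_eq_mul (conjEnd x.1.1) (conjEnd x.1.1) fr.linearBlock
    D.lieParabolic (D.lieParabolic ⊓ ker fr.linearBlock) D.lieLinear
    (D.conjEnd_mem_lieParabolic ⟨x.1, D.borelGroup_le_parabolic x.2⟩) hK hgl
    (fun A _ => fr.linearBlock_conjEnd hx A) (fun A hA => fr.linearBlock_mem c hA.1)
    (fun C hC => ⟨C, ⟨hC.1, hC.2.1⟩, fr.linearBlock_of_mem c hC⟩) (fun A => Iff.rfl)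
  have e2 := LinearMap.det_restrict_eq_mul (conjEnd x.1.1) (conjEnd x.1.1) fr.linearBlock
    D.lieFlag (D.lieParabolic ⊓ ker fr.linearBlock) (D.lieFlag ⊓ D.lieLinear)
    hfl hK hN (fun A _ => fr.linearBlock_conjEnd hx A)
    (fun A hA => ⟨⟨(fr.linearBlock_mem c hA.1).1, fun i v hv => by
        have h1 := hA.2 i v hv
        simp_all [fr.linearBlock_of_Xr c (fr.mem_Xr_of_mem _ hv) (fr.mem_Xr_of_mem _ h1)]⟩, fr.linearBlock_mem c hA.1⟩)
    (fun C hC => ⟨C, hC.1, fr.linearBlock_of_mem c hC.2⟩)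
    (fun A => ⟨fun hA => ⟨⟨hA.1.1, fun i v hv => by
        have h1 := fr.mem_Xr_of_mem _ hv
        have h2 := fr.linearBlock_of_Xr c h1 (hA.1.2 v h1)
        rw [LinearMap.mem_ker.1 hA.2] at h2
        rw [← h2]
        exact zero_mem _⟩, hA.2⟩, fun hA => ⟨hflP hA.1, hA.2⟩⟩)
  let Γ : (E →L[ℝ] E) →ₗ[ℝ] (Fin r → 𝕂) := LinearMap.pi fun i =>
    (h.form.flip (θ (e i))) ∘ₗ ((coeLM ℝ : (E →L[ℝ] E) →ₗ[ℝ] _).flip (e i))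
  have hΓ : ∀ A i, Γ A i = h.form (A (e i)) (θ (e i)) := fun A i => rfl
  have e3 := LinearMap.det_restrict_eq_mul (conjEnd x.1.1) LinearMap.id Γ
    D.lieBorel (D.lieFlag ⊓ D.lieLinear) (D.lieBorel.map Γ) (D.conjEnd_mem_lieBorel x) hN
    (fun _ hC => hC) (fun A hA => funext fun i => by
      have h1 : (x.1⁻¹).1.val (e i) = tau (s' i) • e i := by
        have h2 := hx.apply_e i
        rw [← h.unitary_inv_apply x.1 (tau (s' i) • e i), x.1.2.1, h2, smul_smul, mul_comm,
          hx.mul_tau, one_smul]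
      change h.form (x.1.1.val (A ((x.1⁻¹).1.val (e i)))) (θ (e i)) = h.form (A (e i)) (θ (e i))
      rw [hx.form_y, h1, hA.1.1, h.smul_left, ← mul_assoc, hx.mul_tau, one_mul])
    (fun A hA => Submodule.mem_map_of_mem hA) (fun C hC => hC)
    (fun A => ⟨fun hA => ⟨⟨hA.1.1, fun i v hv => by
          induction i using Fin.cases with
          | zero =>
            simp_all [D.X_zero, mem_bot, hv, map_zero]
          | succ i => exact D.X_le i (hA.1.2 i v hv), hA.2.2.2⟩, funext fun i => by
        rw [hΓ]
        have h2 := hA.1.2 i _ (fr.e_mem_succ i)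
        refine h.form_eq_zero_symm ?_
        rw [fr.X_eq] at h2
        refine mem_orthogonal_span ?_ h2
        rintro _ ⟨m, hm, rfl⟩
        rw [fr.form_ye c, if_neg (Fin.castSucc_lt_castSucc_iff.1 hm).ne']⟩,
      fun hA => ⟨⟨hA.1.1, fun i v hv => by
          obtain ⟨a, u, hu, rfl⟩ := fr.X_succ_induction c hv
          rw [map_add, hA.1.1.1]
          refine add_mem (smul_mem _ _ ?_) (hA.1.2.1 _ _ hu)
          exact fr.mem_castSucc c (hA.1.2.1 _ _ (fr.e_mem_succ i)) (congrFun hA.2 i)⟩,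
        hA.1.1, hA.1.2.1 (Fin.last r), hA.1.2.2⟩⟩)
  have e4 : |det ((conjEnd x.1.1).restrict hgl)| = 1 := by
    refine c.abs_det_conjEnd LinearMap.id (fun _ => rfl) (fun _ _ => rfl) (fun _ _ => rfl) x.1
      (fun _ => rfl) _ (fun A (hA : A ∈ D.lieLinear) => hA.1) _ fun A hA A' hA' h1 => ⟨hA',
        fun v hv => ?_, fun v hv => ?_, fun v hv => ?_⟩ <;> rw [h1]
    · exact fr.theta_mem_X c (hA.2.2.1 _ (fr.theta_mem_Y c hv))
    · exact fr.theta_mem_Y c (hA.2.1 _ (fr.theta_mem_X c hv))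
    · have h2 := hA.2.2.2 _ (fr.theta_mem c hv)
      aesop
  have e5 : det ((LinearMap.id : (Fin r → 𝕂) →ₗ[ℝ] _).restrict
      (p := D.lieBorel.map Γ) (q := D.lieBorel.map Γ) fun _ hC => hC) = 1 := by
    have : ((LinearMap.id : (Fin r → 𝕂) →ₗ[ℝ] _).restrict
      (p := D.lieBorel.map Γ) (q := D.lieBorel.map Γ) fun _ hC => hC) = LinearMap.id := rfl
    rw [this, LinearMap.det_id]
  simp [e5, mul_one, BesselData.deltaP, BesselData.deltaB, e1, e2, e3, abs_mul, e4]

end AdaptedFrame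

section GroupMeasures

instance isMulRightInvariant_of_compact {H : Type*} [Group H] [TopologicalSpace H]
    [IsTopologicalGroup H] [CompactSpace H] [MeasurableSpace H] [BorelSpace H] (κ : Measure H)
    [κ.IsHaarMeasure] [IsProbabilityMeasure κ] : κ.IsMulRightInvariant := ⟨fun g => by
  have : IsProbabilityMeasure (κ.map (· * g)) :=
    Measure.isProbabilityMeasure_map (measurable_mul_const g).aemeasurable
  exact Measure.isHaarMeasure_eq_of_isProbabilityMeasure _ _⟩

instance isInvInvariant_of_compact {H : Type*} [Group H] [TopologicalSpace H]
    [IsTopologicalGroup H] [CompactSpace H] [MeasurableSpace H] [BorelSpace H] (κ : Measure H)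
    [κ.IsHaarMeasure] [IsProbabilityMeasure κ] : κ.IsInvInvariant := ⟨by
  have : IsProbabilityMeasure κ.inv := Measure.isProbabilityMeasure_map measurable_inv.aemeasurable
  have h1 := Measure.isMulInvariant_eq_smul_of_compactSpace κ.inv κ
  have h2 : Measure.haarScalarFactor κ.inv κ = 1 := by
    have := congrArg (fun m : Measure H => m Set.univ) h1
    simpa using this.symm
  rw [h1, h2, one_smul]⟩

/-- Conjugation by an element of the normalizer of a subgroup. -/
def Subgroup.conjContinuous {G : Type*} [Group G] [TopologicalSpace G] [IsTopologicalGroup G]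
    (H : Subgroup G) (a : G) (ha : ∀ x ∈ H, a * x * a⁻¹ ∈ H) (ha' : ∀ x ∈ H, a⁻¹ * x * a ∈ H) : H
    ≃ₜ* H where
  toFun x := ⟨a * x * a⁻¹, ha x x.2⟩
  invFun x := ⟨a⁻¹ * x * a, ha' x x.2⟩
  left_inv x := Subtype.ext (by group)
  right_inv x := Subtype.ext (by group)
  map_mul' x y := Subtype.ext (by simp)
  continuous_toFun := by fun_prop
  continuous_invFun := by fun_prop

variable {H : Type*} [Group H] [TopologicalSpace H] [IsTopologicalGroup H] [T2Space H]
  [LocallyCompactSpace H] [SecondCountableTopology H] [MeasurableSpace H] [BorelSpace H]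
  {υ : H →* (E →L[ℝ] E)ˣ} {S : Submodule ℝ (E →L[ℝ] E)}

theorem IsCayley.conj {X A : E →L[ℝ] E} (hX : IsCayley X A) (u : (E →L[ℝ] E)ˣ) : IsCayley
    (u.val * X * u⁻¹.val) (conjEnd u A) := by
  have e : ∀ C : E →L[ℝ] E, conjEnd u C = u.val * C * u⁻¹.val := fun C => (mul_assoc _ _ _).symm
  rw [IsCayley, e]
  calc u.val * X * u⁻¹.val * (1 - u.val * A * u⁻¹.val)
      = u.val * X * u⁻¹.val - u.val * X * (u⁻¹.val * u.val) * A * u⁻¹.val := by noncomm_ring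
    _ = u.val * (X * (1 - A)) * u⁻¹.val := by aesop
    _ = u.val * u⁻¹.val + u.val * A * u⁻¹.val := by rw [hX]; noncomm_ring
    _ = _ := by rw [u.mul_inv]

theorem IsCayleyChart.lintegral_conj (hc : IsCayleyChart ((coeHom _).comp υ) S)
    (hυ : IsClosedEmbedding υ) (μ : Measure H) [μ.IsHaarMeasure] (α : H ≃ₜ* H)
    (u : (E →L[ℝ] E)ˣ) (hu : ∀ x, υ (α x) = u * υ x * u⁻¹) (hS : ∀ A ∈ S, conjEnd u A ∈ S)
    (hS' : ∀ A ∈ S, conjEnd u⁻¹ A ∈ S) (f : H → ℝ≥0∞) (hf : Measurable f) : ofReal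
    |det ((conjEnd u).restrict hS)| * ∫⁻ x, f (α x) ∂μ = ∫⁻ x, f x ∂μ := by
  borelize (E →L[ℝ] E)
  have hρ : IsInducing ((coeHom (E →L[ℝ] E)).comp υ) :=
    Units.isOpenEmbedding_val.isInducing.comp hυ.isInducing
  have hme : MeasurableEmbedding ((coeHom (E →L[ℝ] E)).comp υ) :=
    Units.isOpenEmbedding_val.measurableEmbedding.comp hυ.measurableEmbedding
  refine hc.lintegral_comp_automorphism hρ hme μ α _ ((conjEnd u⁻¹).restrict hS') ?_ ?_ ?_ f hf
  · intro x A hA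
    change IsCayley (υ (α x)).val _
    rw [hu]
    exact hA.conj u
  · intro x A hA
    change IsCayley (υ (α.symm x)).val _
    have h1 : υ (α.symm x) = u⁻¹ * υ x * u⁻¹⁻¹ := by
      have := hu (α.symm x)
      rw [α.apply_symm_apply] at this
      rw [this]; group
    rw [h1]
    exact hA.conj u⁻¹
  · refine LinearMap.ext fun A => Subtype.ext (ContinuousLinearMap.ext fun v => ?_)
    change u⁻¹.val (u.val (A.1 (u⁻¹.val ((u⁻¹)⁻¹.val v)))) = A.1 v
    rw [inv_inv, unit_inv_apply, unit_inv_apply]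

theorem IsCayleyChart.isMulRightInvariant (hc : IsCayleyChart ((coeHom _).comp υ) S)
    (hυ : IsClosedEmbedding υ) (μ : Measure H) [μ.IsHaarMeasure]
    (hS : ∀ x, ∀ A ∈ S, conjEnd (υ x) A ∈ S)
    (hdet : ∀ x, |det ((conjEnd (υ x)).restrict (hS x))| = 1) : μ.IsMulRightInvariant :=
    ⟨fun y => by
  refine Measure.ext_of_lintegral _ fun f hf => ?_
  rw [lintegral_map hf (measurable_mul_const y), ← lintegral_mul_left_eq_self (fun x => f x) y]
  let α : H ≃ₜ* H :=
    { MulAut.conj y with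
      continuous_toFun := by
        change Continuous fun x => y * x * y⁻¹
        fun_prop
      continuous_invFun := by
        change Continuous fun x => y⁻¹ * x * y
        fun_prop }
  have h1 := hc.lintegral_conj hυ μ α (υ y) (fun x => by
    aesop) (hS y) (by rw [← map_inv]; exact hS y⁻¹) (fun x => f (x * y)) (by fun_prop)
  rw [hdet, ENNReal.ofReal_one, one_mul] at h1
  rw [← h1]
  refine lintegral_congr fun x => ?_
  change f (y * x * y⁻¹ * y) = _
  rw [inv_mul_cancel_right]⟩

end GroupMeasures

theorem exists_mem_apply_eq (f : E →L[ℝ] E) (hf : Injective f) (W : Submodule 𝕂 E)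
    (hW : ∀ v ∈ W, f v ∈ W) (hv : v ∈ W) : ∃ u ∈ W, f u = v := by
  let g : W.restrictScalars ℝ →ₗ[ℝ] W.restrictScalars ℝ := f.toLinearMap.restrict hW
  have hg : Injective g := fun x y hxy => Subtype.ext (hf (congrArg Subtype.val hxy))
  obtain ⟨u, hu⟩ := (LinearMap.injective_iff_surjective.1 hg) ⟨v, hv⟩
  exact ⟨u.1, u.2, congrArg Subtype.val hu⟩

theorem injective_one_add {A : E →L[ℝ] E} (hA : ‖A‖ < 1) : Injective ⇑(1 + A) := by
  refine (injective_iff_map_eq_zero _).2 fun v hv => ?_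
  by_contra h0
  have h1 : v = -A v := eq_neg_of_add_eq_zero_left hv
  have h2 : ‖v‖ ≤ ‖A‖ * ‖v‖ := by
    conv_lhs => rw [h1, norm_neg]
    exact A.le_opNorm v
  nlinarith [norm_pos_iff.2 h0]

theorem injective_add_one {X : E →L[ℝ] E} (hX : ‖X - 1‖ < 1) : Injective ⇑(X + 1) := by
  have h1 : X + 1 = (2 : ℝ) • (1 + (2⁻¹ : ℝ) • (X - 1)) := by module
  have h2 : ‖(2⁻¹ : ℝ) • (X - 1)‖ < 1 := by
    rw [norm_smul]; norm_num; linarith [norm_nonneg (X - 1)]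
  intro u v huv
  rw [h1, smul_apply, smul_apply] at huv
  exact injective_one_add h2 (smul_right_injective E two_ne_zero huv)

theorem IsCayley.apply {X A : E →L[ℝ] E} (hX : IsCayley X A) (v : E) : X (v - A v) = v + A v :=
  DFunLike.congr_fun hX v

theorem IsCayley.apply_add {X A : E →L[ℝ] E} (hX : IsCayley X A) (hX1 : ‖X - 1‖ < 1) (v : E) : A
    (X v + v) = X v - v := by
  apply injective_add_one hX1
  have h1 : ∀ u, X (A u) + A u = X u - u := fun u => by
    have := hX.apply u
    rw [map_sub, sub_eq_iff_eq_add] at this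
    rw [this]; abel
  change X (A (X v + v)) + A (X v + v) = X (X v - v) + (X v - v)
  rw [h1, map_add, map_sub]; abel

variable (h) in
theorem HermitianForm.exists_isCayley {A : E →L[ℝ] E} (hA : A ∈ h.lieUnitary) (hA1 : ‖A‖ < 1) : ∃
    x : h.unitary, IsCayley x.1.val A := by
  have hX := isCayley_ringInverse hA1
  set X := (1 + A) * Ring.inverse (1 - A)
  have hinj : Injective ⇑(1 + -A) := injective_one_add (by rwa [norm_neg])
  have hsurj : ∀ v, ∃ u, u - A u = v := fun v => by
    obtain ⟨u, -, hu⟩ := exists_mem_apply_eq (L := L) (k := k) (1 + -A) hinj ⊤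
      (fun _ _ => trivial) (v := v) trivial
    exact ⟨u, by rw [← hu, sub_eq_add_neg]; rfl⟩
  refine ⟨h.mkUnitary X.toLinearMap (fun a v => ?_) (fun v v' => ?_), hX⟩
  · obtain ⟨u, rfl⟩ := hsurj v
    change X _ = a • X _
    rw [hX.apply, smul_sub, ← hA.1, hX.apply, hA.1, smul_add]
  · obtain ⟨u, rfl⟩ := hsurj v
    obtain ⟨u', rfl⟩ := hsurj v'
    change h.form (X _) (X _) = _
    rw [hX.apply, hX.apply]
    have h1 := hA.2 u u'
    simp only [map_add, map_sub, add_app, sub_app]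
    linear_combination 2 * h1

variable (h) in
theorem HermitianForm.mem_lieUnitary_of_isCayley (x : h.unitary) {A : E →L[ℝ] E}
    (hx : ‖x.1.val - 1‖ < 1) (hA : IsCayley x.1.val A) : A ∈ h.lieUnitary := by
  have hsurj : ∀ v, ∃ u, x.1.val u + u = v := fun v => by
    obtain ⟨u, -, hu⟩ := exists_mem_apply_eq (L := L) (k := k) (x.1.val + 1) (injective_add_one hx) ⊤
      (fun _ _ => trivial) (v := v) trivial
    exact ⟨u, hu⟩
  refine ⟨fun a v => ?_, fun v v' => ?_⟩
  · obtain ⟨u, rfl⟩ := hsurj v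
    rw [hA.apply_add hx, smul_add, smul_sub, ← x.2.1, hA.apply_add hx]
  · obtain ⟨u, rfl⟩ := hsurj v
    obtain ⟨u', rfl⟩ := hsurj v'
    rw [hA.apply_add hx, hA.apply_add hx]
    have h1 := x.2.2 u u'
    generalize x.1.val u = p at *
    generalize x.1.val u' = p' at *
    simp only [map_add, map_sub, add_app, sub_app]
    linear_combination 2 * h1

variable (h) in
theorem HermitianForm.isCayleyChart : IsCayleyChart ((coeHom _).comp h.unitary.subtype)
    h.lieUnitary where
  exists_of_mem _ hA hA1 := h.exists_isCayley hA hA1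
  mem_of_isCayley x _ hx hA := h.mem_lieUnitary_of_isCayley x hx hA

theorem BesselData.isCayleyChart {r : ℕ} (D : BesselData h r) : IsCayleyChart
    ((coeHom _).comp (h.unitary.subtype.comp D.flagGroup.subtype)) D.lieFlag where
  exists_of_mem A hA hA1 := by
    obtain ⟨x, hx⟩ := h.exists_isCayley hA.1 hA1
    refine ⟨⟨x, fun i v hv => ?_⟩, hx⟩
    have hinj : Injective ⇑(1 + -A) := injective_one_add (by rwa [norm_neg])
    obtain ⟨u, hu, rfl⟩ := exists_mem_apply_eq (1 + -A) hinj (D.X i.succ) (fun v hv =>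
      add_mem hv (neg_mem (D.X_le i (hA.2 i v hv)))) hv
    have h1 : (1 + -A) u = u - A u := by rw [sub_eq_add_neg]; rfl
    rw [h1, hx.apply, add_sub_sub_cancel]
    exact add_mem (hA.2 i u hu) (hA.2 i u hu)
  mem_of_isCayley x A hx hA := by
    refine ⟨h.mem_lieUnitary_of_isCayley x.1 hx hA, fun i v hv => ?_⟩
    obtain ⟨u, hu, rfl⟩ := exists_mem_apply_eq (x.1.1.val + 1) (injective_add_one hx) (D.X i.succ)
      (fun v hv => add_mem (D.flagGroup_mem_X x.2 _ hv) hv) hv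
    have h1 := hA.apply_add hx u
    exact h1 ▸ x.2 i u hu

theorem HermitianForm.continuous_apply (v : E) : Continuous fun x : h.unitary => x.1.val v :=
  (Units.continuous_val.comp continuous_subtype_val).clm_apply continuous_const

variable (h) in
theorem HermitianForm.continuous_form : Continuous fun p : E × E => h.form p.1 p.2 := by
  let b : E →L[ℝ] E →L[ℝ] 𝕂 :=
    toContinuousLinearMap (LinearMap.toContinuousLinearMap.toLinearMap ∘ₗ h.form)
  exact (b.continuous.comp continuous_fst).clm_apply continuous_snd

variable (B) in
theorem PositiveForm.continuous_form : Continuous fun p : E × E => B.form p.1 p.2 := by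
  let b : E →L[ℝ] E →L[ℝ] 𝕂 :=
    toContinuousLinearMap (LinearMap.toContinuousLinearMap.toLinearMap ∘ₗ B.form)
  exact (b.continuous.comp continuous_fst).clm_apply continuous_snd

variable (h) in
theorem HermitianForm.isClosed_unitary : IsClosed (h.unitary : Set (E →L[ℝ] E)ˣ) := by
  have h0 : ∀ v, Continuous fun x : (E →L[ℝ] E)ˣ => x.val v := fun v =>
    Units.continuous_val.clm_apply continuous_const
  have e : (h.unitary : Set (E →L[ℝ] E)ˣ) =
      (⋂ (a : 𝕂) (v : E), {x | x.val (a • v) = a • x.val v}) ∩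
      ⋂ (u : E) (v : E), {x | h.form (x.val u) (x.val v) = h.form u v} := by
    ext x
    simp only [Set.mem_inter_iff, Set.mem_iInter]
    rfl
  rw [e]
  exact (isClosed_iInter fun a => isClosed_iInter fun v => isClosed_eq (h0 _)
    (continuous_const.scalar_smul (h0 v))).inter
    (isClosed_iInter fun u => isClosed_iInter fun v => isClosed_eq
      (h.continuous_form.comp ((h0 u).prodMk (h0 v))) continuous_const)

variable (B) in
theorem HermitianForm.isClosed_compact : IsClosed (h.compact B : Set h.unitary) := by
  have e : (h.compact B : Set h.unitary) =
      ⋂ (u : E) (v : E), {x | B.form (x.1.val u) (x.1.val v) = B.form u v} := by aesop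
  rw [e]
  exact isClosed_iInter fun u => isClosed_iInter fun v => isClosed_eq
    (B.continuous_form.comp ((h.continuous_apply u).prodMk (h.continuous_apply v))) continuous_const

theorem BesselData.isClosed_flagGroup {r : ℕ} (D : BesselData h r) : IsClosed
    (D.flagGroup : Set h.unitary) := by
  have e : (D.flagGroup : Set h.unitary) =
      ⋂ (i : Fin r) (v : D.X i.succ), {x | x.1.val v.1 - v.1 ∈ D.X i.castSucc} := by
    ext x
    simp only [Set.mem_iInter, Subtype.forall]
    rfl
  rw [e]
  exact isClosed_iInter fun i => isClosed_iInter fun v =>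
    (Submodule.closed_of_finiteDimensional ((D.X i.castSucc).restrictScalars ℝ)).preimage
      ((h.continuous_apply v.1).sub continuous_const)

instance : LocallyCompactSpace (E →L[ℝ] E)ˣ := Units.isOpenEmbedding_val.locallyCompactSpace

instance (h : HermitianForm L k E) : LocallyCompactSpace h.unitary :=
  h.isClosed_unitary.isClosedEmbedding_subtypeVal.locallyCompactSpace

section JacobianSymmetry

include c in
theorem IsCartan.jacobianEta_rev (w : E × E) (s : 𝔞) : 𝐉 w (expPos s) = 𝐉 (θ w.1, θ w.2)
    (expPos fun i => s i.rev) := by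
  have hmem : ∀ w z, z ∈ tangentF h B ⊤ w → (θ z.1, θ z.2) ∈ tangentF h B ⊤ (θ w.1, θ w.2) := by
    intro w z hz
    rw [c.mem_tangentF_top] at hz ⊢
    simp only [c.pos_theta_theta, ← sigma_add, hz.2.2.1, hz.2.2.2.1, hz.2.2.2.2, sigma_zero]
    grind
  refine jacobianEta_eq_of_map (θ.prodMap θ) ?_ (funCongrLeft ℝ ℝ revPerm) ?_
    (hmem w) ?_ ?_ ?_
  · refine Function.LeftInverse.injective (g := θ.prodMap θ) fun z => ?_
    simp only [prodMap_apply, c.theta_theta]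
  · exact fun x y => Equiv.sum_comp revPerm fun i => x i * y i
  · intro z hz
    refine ⟨(θ z.1, θ z.2), ?_, by simp only [prodMap_apply, c.theta_theta]⟩
    have := hmem _ z hz
    grind [c.theta_theta]
  · intro z _ z' _
    simp only [prodMap_apply, ← map_add, c.pos_theta_theta, normTrace_sigma]
  · intro z _ z' _ ξ ξ'
    have e : ∀ z ξ, etaDir L (θ w.1, θ w.2) (fun i => s i.rev) ((θ.prodMap θ) z,
        funCongrLeft ℝ ℝ revPerm ξ) = θ (etaDir L w s (z, ξ)) := by
      intro z ξ
      simp only [etaDir_apply, map_add, c.theta_realCoe_smul]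
      rfl
    simp only [e, c.form_theta_theta, normTrace_sigma]

variable {KK : Type*} [Group KK] [TopologicalSpace KK] [IsTopologicalGroup KK] [CompactSpace KK]
  [MeasurableSpace KK] [BorelSpace KK] {ρ : KK →* (E →ₗ[ℝ] E)} {w : E × E} [MeasurableSpace E]
  [BorelSpace E]

theorem IsSphereAction.lintegral_neg (q : IsSphereAction h B ρ w) (c : IsCartan h B θ) (hw : w ∈ 𝕊)
    (κ : Measure KK) [κ.IsMulRightInvariant] [κ.IsInvInvariant] (F : E → ℝ≥0∞) : ∫⁻ s,
    ofReal (𝐉 w (expPos s)) * ∫⁻ x, F (ρ x⁻¹ (etaF (L := L) w (expPos (-s)))) ∂κ =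
    polarIntegral h B ρ w κ F := by
  rw [polarIntegral, ← (volume_measurePreserving_piCongrLeft (fun _ : Fin k.card => ℝ)
    revPerm).lintegral_comp_emb (MeasurableEquiv.measurableEmbedding _)]
  refine lintegral_congr fun s => ?_
  have e0 : piCongrLeft (fun _ : Fin k.card => ℝ) revPerm s =
      fun i => s i.rev := by
    funext i
    conv_lhs => rw [← rev_rev i]
    exact Equiv.piCongrLeft_apply_apply (fun _ : Fin k.card => ℝ) revPerm s i.rev
  have h1 := c.jacobianEta_rev w s
  have hw' : (θ w.1, θ w.2) ∈ 𝕊 := by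
    rw [c.mem_sphereF_top] at hw ⊢
    aesop
  rw [q.jacobianEta_eq c hw'] at h1
  have h2 := (q.average_neg_rev c hw κ F s).1
  rw [e0, h1, ← h2, ← lintegral_inv_eq_self
    fun x => F (ρ x (etaF (L := L) w (expPos fun i => -s i.rev)))]
  rfl

end JacobianSymmetry

namespace AdaptedFrame

/-- The hermitian form of `E₀'`. -/
noncomputable def coreForm : HermitianForm L k D.E₀' where
  form := h.form.compl₁₂ (D.E₀'.subtype.restrictScalars ℝ) (D.E₀'.subtype.restrictScalars ℝ)
  smul_left a u v := h.smul_left a u.1 v.1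
  tau_symm u v := h.tau_symm u.1 v.1
  nondegenerate u hu := Subtype.ext (h.nondegenerate u.1 fun v => by
    rw [← fr.projF_of_mem c u.2, fr.projF_adjoint c]
    exact hu ⟨_, fr.projF_mem c v⟩)

variable (D) in
/-- The positive form of `E₀'`. -/
noncomputable def _root_.BesselData.corePos (B : PositiveForm L k E) : PositiveForm L k D.E₀' where
  form := B.form.compl₁₂ (D.E₀'.subtype.restrictScalars ℝ) (D.E₀'.subtype.restrictScalars ℝ)
  smul_left a u v := B.smul_left a u.1 v.1
  conj_symm u v := B.conj_symm u.1 v.1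
  pos u hu := B.pos u.1 fun a ha => hu a (Subtype.ext ha)

/-- The map `θ` on `E₀'`. -/
def coreTheta : D.E₀' →ₗ[ℝ] D.E₀' where
  toFun v := ⟨θ v.1, fr.theta_mem c v.2⟩
  map_add' u v := Subtype.ext (map_add θ u.1 v.1)
  map_smul' a v := Subtype.ext (map_smul θ a v.1)

theorem core_isCartan : IsCartan (fr.coreForm c) (D.corePos B) (fr.coreTheta c) where
  form_eq u v := c.form_eq u.1 v.1
  theta_theta v := Subtype.ext (c.theta_theta v.1)
  exists_torsionFree := ⟨⟨D.v₀, fr.v₀_mem c⟩, fun a ha =>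
    h.torsionFree one_ne_zero (by rw [D.v₀_norm, map_one]) a (congrArg Subtype.val ha)⟩

/-- The base point of the sphere in `E₀'`. -/
def corePoint : D.E₀' × D.E₀' := (⟨D.v₀, fr.v₀_mem c⟩, ⟨D.v₀', D.v₀'_mem⟩)

theorem mem_thetaEigen_iff (ε : ℝ) (u : D.E₀') : u.1 ∈ thetaEigen h B D.E₀' ε ↔ u ∈ thetaEigen
    (fr.coreForm c) (D.corePos B) ⊤ ε :=
  ⟨fun hu => ⟨trivial, fun x _ => hu.2 x.1 x.2⟩, fun hu => ⟨u.2, fun x hx => hu.2 ⟨x, hx⟩ trivial⟩⟩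

theorem mem_sphereF_iff (u v : D.E₀') : (u.1, v.1) ∈ sphereF h B D.E₀' ↔ (u, v) ∈ sphereF
    (fr.coreForm c) (D.corePos B) ⊤ :=
  and_congr (fr.mem_thetaEigen_iff c 1 u) (and_congr (fr.mem_thetaEigen_iff c (-1) v) Iff.rfl)

theorem corePoint_mem : fr.corePoint c ∈ sphereF (fr.coreForm c) (D.corePos B) ⊤ := by
  rw [(fr.core_isCartan c).mem_sphereF_top]
  obtain ⟨h1, h2, h3⟩ := pos_v₀ c fr
  exact ⟨Subtype.ext fr.theta_v₀, Subtype.ext fr.theta_v₀', h1, h2, h3⟩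

instance : Module.Finite 𝕂 D.E₀' := inferInstance

instance : FiniteDimensional ℝ D.E₀' := Module.Finite.trans 𝕂 D.E₀'

theorem jacobianEta_core (u v : D.E₀') (s : 𝔞) : jacobianEta h B D.E₀' (u.1, v.1) (expPos s) =
    jacobianEta (fr.coreForm c) (D.corePos B) ⊤ (u, v) (expPos s) := by
  let ι : D.E₀' →ₗ[ℝ] E := D.E₀'.subtype.restrictScalars ℝ
  have hι : Injective ι := Subtype.val_injective
  have h1 := fr.mem_thetaEigen_iff c
  have h2 : ∀ z ξ, etaDir L (u.1, v.1) s (ι.prodMap ι z, ξ) = ι (etaDir L (u, v) s (z, ξ)) :=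
    fun z ξ => by aesop
  refine (jacobianEta_eq_of_map (w := (u, v)) (w' := (u.1, v.1)) (ι.prodMap ι) (hι.prodMap hι)
    (LinearEquiv.refl ℝ _) (fun _ _ => rfl)
    (fun z hz => ⟨(h1 1 _).2 hz.1, (h1 (-1) _).2 hz.2.1, hz.2.2⟩)
    (fun z hz => ⟨(⟨z.1, hz.1.1⟩, ⟨z.2, hz.2.1.1⟩), ⟨(h1 1 ⟨z.1, hz.1.1⟩).1 hz.1,
      (h1 (-1) ⟨z.2, hz.2.1.1⟩).1 hz.2.1, hz.2.2⟩, rfl⟩)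
    (fun _ _ _ _ => rfl) fun z _ z' _ ξ ξ' => ?_).symm
  rw [refl_apply, refl_apply, h2, h2]
  rfl

include fr c in
theorem mem_sphereF : (D.v₀, D.v₀') ∈ sphereF h B D.E₀' :=
  (fr.mem_sphereF_iff c (fr.corePoint c).1 (fr.corePoint c).2).2 (fr.corePoint_mem c)

/-- The subgroup of `K` of all elements that fix `e i` and `θ (e i)`. -/
def coreCompact (_ : AdaptedFrame D B θ e) : Subgroup (h.compact B) where
  carrier := {x | ∀ i, x.1.1.val (e i) = e i ∧ x.1.1.val (θ (e i)) = θ (e i)}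
  mul_mem' := by aesop
  one_mem' := fun i => ⟨rfl, rfl⟩
  inv_mem' := by
    intro x hx i
    have e1 : ∀ v, (x⁻¹).1.1.val (x.1.1.val v) = v := h.unitary_inv_apply x.1
    grind

theorem isClosed_coreCompact : IsClosed (fr.coreCompact : Set (h.compact B)) := by
  have e1 : (fr.coreCompact : Set (h.compact B)) =
      ⋂ i, {x | x.1.1.val (e i) = e i} ∩ {x | x.1.1.val (θ (e i)) = θ (e i)} := by aesop
  have h1 : ∀ v, Continuous fun x : h.compact B => x.1.1.val v := fun v =>
    (h.continuous_apply v).comp continuous_subtype_val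
  rw [e1]
  exact isClosed_iInter fun i => (isClosed_eq (h1 _) continuous_const).inter
    (isClosed_eq (h1 _) continuous_const)

include c in
theorem coreCompact_apply_mem (x : fr.coreCompact) {v : E} (hv : v ∈ D.E₀') : x.1.1.1.val v ∈ D.E₀'
    := by
  rw [fr.mem_E₀' c] at hv ⊢
  intro i
  have h1 := (x⁻¹).2 i
  simp_all [h.form_unitary_left]

/-- The action on `E₀'`. -/
def coreAction : fr.coreCompact →* (D.E₀' →ₗ[ℝ] D.E₀') where
  toFun x :=
    { toFun := fun v => ⟨x.1.1.1.val v.1, fr.coreCompact_apply_mem c x v.2⟩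
      map_add' := fun u v => Subtype.ext (map_add _ u.1 v.1)
      map_smul' := fun a v => Subtype.ext (map_smul x.1.1.1.val a v.1) }
  map_one' := rfl
  map_mul' _ _ := rfl

theorem coreAction_isSphereAction : IsSphereAction (fr.coreForm c) (D.corePos B) (fr.coreAction c)
    (fr.corePoint c) where
  continuous := by
    refine subtype_mk ?_ _
    fun_prop
  smul x a v := Subtype.ext (x.1.1.2.1 a v.1)
  form x u v := x.1.1.2.2 u.1 v.1
  pos x u v := x.1.2 u.1 v.1
  transitive w' hw' := by
    have hw := (fr.core_isCartan c).mem_sphereF_top _ |>.1 (fr.corePoint_mem c)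
    rw [(fr.core_isCartan c).mem_sphereF_top] at hw'
    obtain ⟨h1, h2, h3, h4, h5⟩ := hw
    obtain ⟨h1', h2', h3', h4', h5'⟩ := hw'
    have hB : ∀ u v : E, B.form u v = 0 → B.form v u = 0 := fun u v huv => by
      rw [B.conj_symm, huv, star_zero]
    obtain ⟨x, hx1, hx2⟩ := c.exists_compact_map ![D.v₀, D.v₀'] ![w'.1.1, w'.2.1] ![1, -1]
      (by simp)
      (by simp [fr.theta_v₀, fr.theta_v₀'])
      (by intro i; fin_cases i
          · exact (congrArg Subtype.val h1').trans (one_smul ℝ w'.1.1).symm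
          · exact (congrArg Subtype.val h2').trans (neg_one_smul ℝ w'.2.1).symm)
      (by intro i j
          fin_cases i <;> fin_cases j
          exacts [h3, h5, hB _ _ h5, h4])
      (by intro i j
          fin_cases i <;> fin_cases j
          exacts [h3', h5', hB _ _ h5', h4']) univ
    have h0 : ∀ i, ∀ u ∈ D.E₀', h.form (e i) u = 0 ∧ h.form (θ (e i)) u = 0 := fun i u hu =>
      ⟨h.form_eq_zero_symm ((fr.mem_E₀' c u).1 hu i).1,
        h.form_eq_zero_symm ((fr.mem_E₀' c u).1 hu i).2⟩
    have h6 : ∀ v : E, (∀ u ∈ D.E₀', h.form v u = 0) → x.1.1.val v = v := fun v hv =>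
      hx2 v fun i _ => by
        fin_cases i
        exacts [⟨hv _ (fr.v₀_mem c), hv _ w'.1.2⟩, ⟨hv _ D.v₀'_mem, hv _ w'.2.2⟩]
    refine ⟨⟨x, fun i => ⟨h6 _ fun u hu => (h0 i u hu).1, h6 _ fun u hu => (h0 i u hu).2⟩⟩, ?_⟩
    exact Prod.ext (Subtype.ext (hx1 0 (mem_univ _)).symm)
      (Subtype.ext (hx1 1 (mem_univ _)).symm)

end AdaptedFrame

section Fibration

open scoped ENNReal Topology Pointwise

/-- If `π : H → V` is a continuous map whose fibers are the cosets `S x`, then the Haar measure of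
`H` disintegrates along any family of elements of `H` whose image in `V` is an invariant measure. -/
theorem exists_lintegral_fiber {H S P V : Type*} [Group H] [TopologicalSpace H]
    [IsTopologicalGroup H] [PolishSpace H] [LocallyCompactSpace H] [MeasurableSpace H]
    [BorelSpace H] [Group S] [TopologicalSpace S] [MeasurableSpace S] [BorelSpace S]
    [MeasurableMul S] [MeasurableSpace P] [TopologicalSpace V] [T2Space V]
    [SecondCountableTopology V] [MeasurableSpace V] [BorelSpace V] (μ : Measure H) [μ.IsHaarMeasure]
    [μ.IsMulRightInvariant] (σ : Measure S) [SFinite σ] [σ.IsMulRightInvariant]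
    [IsFiniteMeasureOnCompacts σ] (hσ : σ ≠ 0) (i : S →* H) (hi : IsClosedEmbedding i)
    (q : H → V) (hq : Continuous q) (hqS : ∀ s x, q (i s * x) = q x)
    (hqS' : ∀ x y, q x = q y → ∃ s, x = i s * y) (Λ : Measure P) [SFinite Λ] (hΛ : Λ ≠ 0)
    (p : P → H) (hp : Measurable p)
    (hinv : ∀ y (F : V → ℝ≥0∞), Measurable F → ∫⁻ x, F (q (p x * y)) ∂Λ = ∫⁻ x, F (q (p x)) ∂Λ)
    (hfin : ∀ C, IsCompact C → Λ {x | q (p x) ∈ C} ≠ ∞) : ∃ c : ℝ≥0∞, c ≠ 0 ∧ c ≠ ∞ ∧ ∀ f : H →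
    ℝ≥0∞, Measurable f → ∫⁻ x, f x ∂μ = c * ∫⁻ x, ∫⁻ s, f (i s * p x) ∂σ ∂Λ := by
  have him := hi.continuous.measurable
  have hm : Measurable fun z : P × S => i z.2 * p z.1 :=
    (him.comp measurable_snd).mul (hp.comp measurable_fst)
  set M : Measure H := (Λ.prod σ).map fun z => i z.2 * p z.1 with hM
  have hMf : ∀ f : H → ℝ≥0∞, Measurable f →
      ∫⁻ x, f x ∂M = ∫⁻ x, ∫⁻ s, f (i s * p x) ∂σ ∂Λ := fun f hf => by
    rw [hM, lintegral_map hf hm, lintegral_prod _ (by fun_prop)]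
  have hrange : MeasurableSet (Set.range q) := by
    obtain ⟨K, hK, hKU⟩ := isSigmaCompact_range hq
    rw [← hKU]
    exact MeasurableSet.iUnion fun n => (hK n).measurableSet
  have : M.IsMulRightInvariant := ⟨fun y => by
    refine Measure.ext_of_lintegral _ fun f hf => ?_
    rw [lintegral_map hf (measurable_mul_const y), hMf _ (by fun_prop), hMf f hf]
    have hf' : Measurable fun x => ∫⁻ s, f (i s * x) ∂σ := by fun_prop
    have hconst : ∀ x x', q x = q x' → ∫⁻ s, f (i s * x) ∂σ = ∫⁻ s, f (i s * x') ∂σ := by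
      intro x x' hx
      obtain ⟨s, rfl⟩ := hqS' x x' hx
      rw [← lintegral_mul_right_eq_self (fun s' => f (i s' * x')) s]
      simp only [map_mul, mul_assoc]
    classical
    set F : V → ℝ≥0∞ := fun v => if hv : v ∈ Set.range q then ∫⁻ s, f (i s * hv.choose) ∂σ else 0
      with hF
    have hFq : ∀ x, F (q x) = ∫⁻ s, f (i s * x) ∂σ := fun x => by
      have hx : q x ∈ Set.range q := ⟨x, rfl⟩
      simp only [hF, dif_pos hx]
      exact hconst _ _ hx.choose_spec
    have hFm : Measurable F := by
      have h1 : Measurable (F ∘ q) := by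
        convert hf' using 1
        exact funext hFq
      rw [hq.measurable.measurable_comp_iff_restrict] at h1
      refine measurable_of_restrict_of_restrict_compl hrange h1 ?_
      have : (Set.range q)ᶜ.domRestrict F = fun _ => 0 := funext fun v => dif_neg v.2
      rw [this]
      exact measurable_const
    have h2 := hinv y F hFm
    simp only [hFq] at h2
    simpa only [mul_assoc] using h2⟩
  obtain ⟨C, hC, hC1⟩ := exists_compact_mem_nhds (1 : H)
  have hCm : MeasurableSet C := hC.measurableSet
  have hCi := hC.inv
  have key : ∀ f : H → ℝ≥0∞, Measurable f → μ C * ∫⁻ x, f x ∂M = M C⁻¹ * ∫⁻ x, f x ∂μ := by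
    intro f hf
    have h1 := lintegral_mul_lintegral_of_right_invariant μ M f (C.indicator 1) hf
      (measurable_one.indicator hCm)
    have h2 : (fun x => C.indicator (1 : H → ℝ≥0∞) x⁻¹) = C⁻¹.indicator 1 := rfl
    rwa [h2, lintegral_indicator_one hCm, lintegral_indicator_one hCi.measurableSet] at h1
  have hμ0 : μ C ≠ 0 := (measure_pos_of_mem_nhds μ hC1).ne'
  have hμ1 : μ C ≠ ∞ := hC.measure_ne_top
  have hM0 : M C⁻¹ ≠ 0 := by
    intro h0
    have h1 := key (fun _ => 1) measurable_const
    rw [h0, zero_mul, mul_eq_zero] at h1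
    have h2 := h1.resolve_left hμ0
    rw [hMf _ measurable_const, lintegral_one, lintegral_const, mul_eq_zero] at h2
    rcases h2 with h2 | h2
    · exact hσ (Measure.measure_univ_eq_zero.1 h2)
    · exact hΛ (Measure.measure_univ_eq_zero.1 h2)
  have hM1 : M C⁻¹ ≠ ∞ := by
    set W : Set S := i ⁻¹' (C⁻¹ * C) with hW
    have hWf : σ W ≠ ∞ := (hi.isCompact_preimage (hCi.mul hC)).measure_ne_top
    have h1 : M C⁻¹ ≤ ∫⁻ x, {x | q (p x) ∈ q '' C⁻¹}.indicator (fun _ => σ W) x ∂Λ := by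
      rw [← lintegral_indicator_one hCi.measurableSet, hMf _ (measurable_one.indicator hCi.measurableSet)]
      refine lintegral_mono fun x => ?_
      have hxm : MeasurableSet {s | i s * p x ∈ C⁻¹} := (him.mul_const (p x)) hCi.measurableSet
      have e1 : ∫⁻ s, C⁻¹.indicator (1 : H → ℝ≥0∞) (i s * p x) ∂σ = σ {s | i s * p x ∈ C⁻¹} :=
        lintegral_indicator_one hxm
      rw [e1]
      rcases Set.eq_empty_or_nonempty {s | i s * p x ∈ C⁻¹} with h0 | ⟨s₀, hs₀⟩
      · rw [h0, measure_empty]; exact zero_le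
      · have hx : x ∈ {x | q (p x) ∈ q '' C⁻¹} := ⟨_, hs₀, hqS _ _⟩
        rw [indicator_of_mem hx, ← measure_preimage_mul_right σ s₀ {s | i s * p x ∈ C⁻¹}]
        refine measure_mono fun s hs => ?_
        have hs' : i s * i s₀ * p x ∈ C⁻¹ := by rw [← map_mul]; exact hs
        refine ⟨_, hs', (i s₀ * p x)⁻¹, Set.mem_inv.1 hs₀, ?_⟩
        change i s * i s₀ * p x * (i s₀ * p x)⁻¹ = i s
        rw [mul_assoc (i s), mul_inv_cancel_right]
    refine ne_top_of_le_ne_top ?_ h1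
    have hm2 : MeasurableSet {x | q (p x) ∈ q '' C⁻¹} :=
      (hq.measurable.comp hp) (hCi.image hq).measurableSet
    rw [lintegral_indicator hm2, setLIntegral_const]
    exact mul_ne_top hWf (hfin _ (hCi.image hq))
  refine ⟨μ C / M C⁻¹, (ENNReal.div_ne_zero.2 ⟨hμ0, hM1⟩), div_ne_top hμ1 hM0, fun f hf => ?_⟩
  rw [← hMf f hf, div_eq_mul_inv, mul_right_comm, key f hf, mul_right_comm,
    ENNReal.mul_inv_cancel hM0 hM1, one_mul]

end Fibration

instance {E : Type*} [NormedAddCommGroup E] [NormedSpace ℝ E] [FiniteDimensional ℝ E] :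
    PolishSpace (E →L[ℝ] E)ˣ := by
  have := proper ℝ (E →L[ℝ] E)
  have h1 := isOpenEmbedding_val (R := E →L[ℝ] E)
  have := h1.isOpen_range.polishSpace
  exact h1.toIsEmbedding.toHomeomorph.isClosedEmbedding.polishSpace

section Translations

variable {ι : Type*} [Fintype ι] [DecidableEq ι] {e y : ι → E}

/-- A family of hyperbolic pairs. -/
structure IsHyperbolicFamily (h : HermitianForm L k E) (e y : ι → E) : Prop where
  left : ∀ i j, h.form (e i) (e j) = 0
  right : ∀ i j, h.form (y i) (y j) = 0
  pair : ∀ i j, h.form (e i) (y j) = if i = j then 1 else 0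

theorem posCoe_expPos_add (s t : 𝔞) : posCoe L (expPos (s + t)) = posCoe L (expPos s) * posCoe L
    (expPos t) := by
  funext i
  simp [posCoe, expPos, exp_add]

theorem posInvTau_expPos (s : 𝔞) : posInvTau L (expPos s) = posCoe L (expPos fun i => -s i.rev) :=
    by
  simp [posInvTau_eq, posCoe_eq, expPos, Real.exp_neg]

theorem continuous_posCoe_expPos : Continuous fun s : 𝔞 => posCoe L (expPos s) := by
  refine continuous_pi fun i => ?_
  simp only [posCoe, expPos]
  fun_prop

theorem posCoe_mul_tau_posInvTau (t : PosScalar k) : posCoe L t * tau (posInvTau L t) = 1 := by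
  rw [posInvTau, tau_tau]
  funext i
  have : ((t i : ℝ) : L) ≠ 0 := by exact_mod_cast (t i).2.ne'
  simp [posCoe, this]

namespace IsHyperbolicFamily

variable (p : IsHyperbolicFamily h e y)

/-- The isometry that acts on `e i` by `exp (s i)` and on `y i` by `exp (s i) ^ (-τ)`. -/
noncomputable def translation (s : ι → 𝔞) : h.unitary :=
  h.mkUnitary (hyperbolicMap h e y (fun i => posCoe L (expPos (s i)))
    fun i => posInvTau L (expPos (s i))) (hyperbolicMap_smul _ _)
    (hyperbolicMap_form p.left p.right p.pair fun _ => posCoe_mul_tau_posInvTau _)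

theorem translation_left (s : ι → 𝔞) (i : ι) : (p.translation s).1.val (e i) = posCoe L
    (expPos (s i)) • e i :=
  hyperbolicMap_left p.left p.right p.pair _ _ i

theorem translation_right (s : ι → 𝔞) (i : ι) : (p.translation s).1.val (y i) = posInvTau L
    (expPos (s i)) • y i :=
  hyperbolicMap_right p.left p.right p.pair _ _ i

theorem translation_of_orthogonal (s : ι → 𝔞) (hv : ∀ i, h.form v (e i) = 0 ∧ h.form v (y i) = 0) :
    (p.translation s).1.val v = v :=
  hyperbolicMap_of_orthogonal _ _ hv

theorem translation_add (s t : ι → 𝔞) : p.translation (s + t) = p.translation s * p.translation t :=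
    by
  refine h.unitary_ext fun v => ?_
  refine Eq.trans ?_ (hyperbolicMap_comp p.left p.right p.pair _ _ _ _ v).symm
  change hyperbolicMap h e y _ _ v = _
  congr 2 <;> funext i
  · exact posCoe_expPos_add _ _
  · simp only [posInvTau_expPos, ← posCoe_expPos_add]
    congr 2
    funext j
    simp only [Pi.add_apply, neg_add]

theorem translation_zero : p.translation 0 = 1 := by
  have := p.translation_add 0 0
  aesop

theorem translation_neg (s : ι → 𝔞) : p.translation (-s) = (p.translation s)⁻¹ := by
  rw [eq_inv_iff_mul_eq_one, ← p.translation_add, neg_add_cancel, p.translation_zero]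

/-- An isometry that fixes all vectors of the family commutes with its translations. -/
theorem translation_comm (s : ι → 𝔞) (hx : ∀ i, x.1.val (e i) = e i ∧ x.1.val (y i) = y i) : x *
    p.translation s = p.translation s * x := by
  refine h.unitary_ext fun v => ?_
  change x.1.val (hyperbolicMap h e y _ _ v) = hyperbolicMap h e y _ _ (x.1.val v)
  simp only [hyperbolicMap_apply, map_add, map_sum, x.2.1, (hx _).1, (hx _).2]
  have h1 : ∀ i, h.form (x.1.val v) (e i) = h.form v (e i) := fun i => by
    conv_lhs => rw [← (hx i).1, x.2.2]
  have h2 : ∀ i, h.form (x.1.val v) (y i) = h.form v (y i) := fun i => by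
    conv_lhs => rw [← (hx i).2, x.2.2]
  simp only [h1, h2]

theorem continuous_translation : Continuous p.translation := by
  refine subtype_mk ?_ _
  rw [Units.isOpenEmbedding_val.continuous_iff, continuous_clm_apply]
  intro v
  change Continuous fun s : ι → 𝔞 => hyperbolicMap h e y
    (fun i => posCoe L (expPos (s i))) (fun i => posInvTau L (expPos (s i))) v
  simp only [hyperbolicMap_apply, posInvTau_expPos]
  refine continuous_const.add (continuous_finsetSum _ fun i _ => ?_)
  have h1 : Continuous fun s : ι → 𝔞 => posCoe L (expPos (s i)) :=
    continuous_posCoe_expPos.comp (continuous_apply i)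
  have h2 : Continuous fun s : ι → 𝔞 => posCoe L (expPos fun j => -s i j.rev) :=
    continuous_posCoe_expPos.comp (by fun_prop)
  exact (continuous_const.scalar_smul ((h1.sub continuous_const).scalar_smul continuous_const)).add
    (continuous_const.scalar_smul ((h2.sub continuous_const).scalar_smul continuous_const))

end IsHyperbolicFamily

end Translations

namespace AdaptedFrame

include fr c in
theorem isHyperbolicFamily : IsHyperbolicFamily h e fun i => θ (e i) :=
  ⟨fr.form_ee, fr.form_yy, fr.form_ey c⟩

variable (D) in
theorem _root_.BesselData.isHyperbolicFamily : IsHyperbolicFamily h (fun _ : Unit => D.v₀ + D.v₀')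
    fun _ => (2⁻¹ : ℝ) • (D.v₀ - D.v₀') := by
  have h1 : h.form D.v₀' D.v₀ = 0 := h.form_eq_zero_symm D.v₀_orthogonal_v₀'
  refine ⟨fun _ _ => ?_, fun _ _ => ?_, fun _ _ => ?_⟩ <;>
    simp only [map_add, map_sub, map_smul, add_app, sub_app,
      LinearMap.smul_apply, h1, D.v₀_norm, D.v₀'_norm, D.v₀_orthogonal_v₀']
  · simp
  · simp
  · rw [if_pos trivial, add_zero, zero_add, sub_neg_eq_add, ← two_smul ℝ, smul_smul]
    norm_num

/-- The group of all `a_t`, in logarithmic coordinates. -/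
noncomputable def torusU (s : Fin r → 𝔞) : h.unitary :=
  (fr.isHyperbolicFamily c).translation s

variable (D) in
/-- The group of all `g_t`, in logarithmic coordinates. -/
noncomputable def _root_.BesselData.hyperU (s : 𝔞) : h.unitary :=
  D.isHyperbolicFamily.translation fun _ => s

theorem torusU_mem_X (s : Fin r → 𝔞) (j : Fin (r + 1)) (hv : v ∈ D.X j) : (fr.torusU c s).1.val v ∈
    D.X j := by
  rw [fr.X_eq] at hv ⊢
  induction hv using span_induction with
  | mem x hx =>
    obtain ⟨i, hi, rfl⟩ := hx
    rw [torusU, IsHyperbolicFamily.translation_left]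
    aesop
  | zero => rw [map_zero]; exact zero_mem _
  | add x y _ _ hx hy => rw [map_add]; exact add_mem hx hy
  | smul a x _ hx => rw [(fr.torusU c s).2.1]; exact smul_mem _ _ hx

theorem torusU_mem_Y (s : Fin r → 𝔞) (hv : v ∈ D.Y) : (fr.torusU c s).1.val v ∈ D.Y := by
  rw [fr.Y_eq] at hv ⊢
  induction hv using span_induction with
  | mem x hx =>
    obtain ⟨i, rfl⟩ := hx
    rw [torusU, IsHyperbolicFamily.translation_right (fr.isHyperbolicFamily c)]
    aesop
  | zero => rw [map_zero]; exact zero_mem _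
  | add x y _ _ hx hy => rw [map_add]; exact add_mem hx hy
  | smul a x _ hx => rw [(fr.torusU c s).2.1]; exact smul_mem _ _ hx

theorem torusU_neg (s : Fin r → 𝔞) : fr.torusU c (-s) = (fr.torusU c s)⁻¹ :=
  (fr.isHyperbolicFamily c).translation_neg s

/-- The elements `a_t` of `B_r`, in logarithmic coordinates. -/
noncomputable def torus (s : Fin r → 𝔞) : D.borelGroup :=
  ⟨fr.torusU c s, fun j v => ⟨fun hv => by
    rw [← h.unitary_inv_apply (fr.torusU c s) v, ← fr.torusU_neg c]
    exact fr.torusU_mem_X c _ j hv, fr.torusU_mem_X c s j⟩, fun v => ⟨fun hv => by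
    rw [← h.unitary_inv_apply (fr.torusU c s) v, ← fr.torusU_neg c]
    exact fr.torusU_mem_Y c _ hv, fr.torusU_mem_Y c s⟩, fun v hv =>
    (fr.isHyperbolicFamily c).translation_of_orthogonal s ((fr.mem_E₀' c v).1 hv)⟩

theorem torus_isDiagonal (s : Fin r → 𝔞) : fr.IsDiagonal (fr.torus c s)
    (fun i => posCoe L (expPos (s i))) fun i => posInvTau L (expPos (s i)) where
  apply_e := (fr.isHyperbolicFamily c).translation_left s
  apply_y := (fr.isHyperbolicFamily c).translation_right s
  mul_tau _ := posCoe_mul_tau_posInvTau _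

theorem torus_isTorus (s : Fin r → 𝔞) : D.IsTorus B (fun i => expPos (s i)) (fr.torus c s) := by
  intro i v hv hv0
  obtain ⟨a, u, hu, rfl⟩ := fr.X_succ_induction c hv
  have h1 : ∀ w ∈ D.X i.castSucc, B.form (e i) w = 0 := fun w hw => by
    rw [fr.X_eq] at hw
    induction hw using span_induction with
    | mem x hx =>
      obtain ⟨j, hj, rfl⟩ := hx
      rw [fr.pos_e, if_neg (Fin.castSucc_lt_castSucc_iff.1 hj).ne']
    | zero => rw [map_zero]
    | add x y _ _ hx hy => rw [map_add, hx, hy, add_zero]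
    | smul a x _ hx => rw [B.smul_right, hx, mul_zero]
  have h2 := hv0 u hu
  rw [map_add, add_app, B.smul_left, h1 u hu, mul_zero, zero_add] at h2
  simp [c.eq_zero_of_quad h2, add_zero, (fr.torus c s).1.2.1, (fr.torus_isDiagonal c s).apply_e, smul_smul, mul_comm]

theorem hyper_isHyperbolic (s : 𝔞) : D.IsHyperbolic (expPos s) (D.hyperU s) := by
  have hp := D.isHyperbolicFamily
  refine ⟨hp.translation_left _ (), ?_, fun v hv => hp.translation_of_orthogonal _ fun _ => ?_⟩
  · have h1 := hp.translation_right (fun _ => s) ()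
    rw [map_smul, smul_comm] at h1
    aesop
  · have h1 : h.form v D.v₀ = 0 ∧ h.form v D.v₀' = 0 := by
      obtain ⟨v, hv', z, hz, rfl⟩ := Submodule.mem_sup.1 hv
      obtain ⟨x, hx, y, hy, rfl⟩ := Submodule.mem_sup.1 hv'
      have e1 := h.form_eq_zero_symm (D.v₀_orthogonal_X x hx)
      have e2 := h.form_eq_zero_symm (D.v₀_orthogonal_Y y hy)
      have e3 := D.X_orthogonal x hx
      have e4 := D.Y_orthogonal y hy
      have e5 := hz.2 D.v₀ (mem_span_singleton_self _)
      have e6 := hz.1.1 D.v₀' (mem_span_singleton_self _)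
      aesop
    aesop

include fr c in
theorem hyper_fix (s : 𝔞) (i : Fin r) : (D.hyperU s).1.val (e i) = e i ∧ (D.hyperU s).1.val
    (θ (e i)) = θ (e i) := by
  have h1 := (hyper_isHyperbolic (D := D) s).2.2
  exact ⟨h1 _ (mem_sup_left (mem_sup_left (fr.e_mem i))),
    h1 _ (mem_sup_left (mem_sup_right (fr.y_mem i)))⟩

include fr in
/-- An element that fixes the frame belongs to the flag group. -/
theorem mem_flagGroup_of_fix {x : h.unitary} (hx : ∀ i, x.1.val (e i) = e i) : x ∈ D.flagGroup := by
  intro i v hv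
  have h1 : x.1.val v = v := by
    rw [fr.X_eq] at hv
    induction hv using span_induction with
    | mem w hw => obtain ⟨j, -, rfl⟩ := hw; exact hx j
    | zero => rw [map_zero]
    | add v w _ _ hv hw => rw [map_add, hv, hw]
    | smul a v _ hv => rw [x.2.1, hv]
  aesop

theorem hyper_v₀' (s : 𝔞) : (D.hyperU s).1.val D.v₀' = etaF (L := L) (D.v₀, D.v₀') (expPos s) := by
  obtain ⟨h1, h2, -⟩ := hyper_isHyperbolic (D := D) s
  have e1 : D.v₀' = (2⁻¹ : ℝ) • ((D.v₀ + D.v₀') - (D.v₀ - D.v₀')) := by module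
  conv_lhs => rw [e1]
  rw [map_smul, map_sub, h1, h2, etaF]
  module

end AdaptedFrame

variable (D) in
theorem BesselData.isClosed_bessel : IsClosed (D.bessel : Set h.unitary) := by
  have e : (D.bessel : Set h.unitary) = (D.flagGroup : Set h.unitary) ∩
      ⋂ v : ↥(D.Xr ⊔ D.line'), {x | x.1.val v.1 - v.1 ∈ D.Xr} := by
    ext x
    simp only [Set.mem_inter_iff, Set.mem_iInter, Subtype.forall]
    rfl
  rw [e]
  exact D.isClosed_flagGroup.inter (isClosed_iInter fun v =>
    (Submodule.closed_of_finiteDimensional (D.Xr.restrictScalars ℝ)).preimage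
      ((h.continuous_apply v.1).sub continuous_const))

instance : PolishSpace h.unitary := h.isClosed_unitary.isClosedEmbedding_subtypeVal.polishSpace

instance (D : BesselData h r) : PolishSpace D.flagGroup :=
  D.isClosed_flagGroup.isClosedEmbedding_subtypeVal.polishSpace

instance (D : BesselData h r) : LocallyCompactSpace D.flagGroup :=
  D.isClosed_flagGroup.isClosedEmbedding_subtypeVal.locallyCompactSpace

instance (D : BesselData h r) : LocallyCompactSpace D.bessel :=
  D.isClosed_bessel.isClosedEmbedding_subtypeVal.locallyCompactSpace

instance (D : BesselData h r) : PolishSpace D.bessel :=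
  D.isClosed_bessel.isClosedEmbedding_subtypeVal.polishSpace

variable (D) in
theorem BesselData.isClosedEmbedding_inclusion : IsClosedEmbedding
    (inclusion D.bessel_le_flagGroup) :=
  Topology.IsClosedEmbedding.of_comp_iff D.isClosed_flagGroup.isClosedEmbedding_subtypeVal |>.1
    D.isClosed_bessel.isClosedEmbedding_subtypeVal

namespace AdaptedFrame

instance [CompactSpace (h.compact B)] : CompactSpace fr.coreCompact :=
  isCompact_iff_compactSpace.1 fr.isClosed_coreCompact.isCompact

/-- The elements `g_t`, as elements of the flag group. -/
noncomputable def hyperF (s : 𝔞) : D.flagGroup :=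
  ⟨D.hyperU s, fr.mem_flagGroup_of_fix fun i => (fr.hyper_fix c s i).1⟩

/-- The elements of `coreCompact`, as elements of the flag group. -/
def coreF (x : fr.coreCompact) : D.flagGroup :=
  ⟨x.1.1, fr.mem_flagGroup_of_fix fun i => (x.2 i).1⟩

theorem continuous_coreF : Continuous fr.coreF :=
  subtype_mk (continuous_subtype_val.comp continuous_subtype_val) _

theorem continuous_hyperF : Continuous (fr.hyperF c) :=
  subtype_mk (D.isHyperbolicFamily.continuous_translation.comp (by fun_prop)) _

/-- The orbit map of the vector `v₀'`. -/
noncomputable def orbitMap (x : D.flagGroup) : D.E₀' :=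
  ⟨fr.projF ((x⁻¹).1.1.val D.v₀'), fr.projF_mem c _⟩

theorem continuous_orbitMap : Continuous (fr.orbitMap c) := by
  refine subtype_mk ((continuous_of_finiteDimensional _).comp ?_) _
  exact (h.continuous_apply _).comp (continuous_subtype_val.comp continuous_inv)

/-- The action of an element of the flag group on `E₀'`. -/
noncomputable def orbitAction (y : D.flagGroup) : D.E₀' →ₗ[ℝ] D.E₀' where
  toFun v := ⟨fr.projF ((y⁻¹).1.1.val v.1), fr.projF_mem c _⟩
  map_add' u v := Subtype.ext (by simp only [coe_add, map_add])
  map_smul' a v := Subtype.ext (by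
    change fr.projF ((y⁻¹).1.1.val (a • v.1)) = a • fr.projF ((y⁻¹).1.1.val v.1)
    rw [map_smul, map_smul])

theorem orbitMap_mul (x y : D.flagGroup) : fr.orbitMap c (x * y) = fr.orbitAction c y
    (fr.orbitMap c x) := by
  refine Subtype.ext ?_
  change fr.projF (((x * y)⁻¹).1.1.val D.v₀') = fr.projF ((y⁻¹).1.1.val (fr.projF ((x⁻¹).1.1.val D.v₀')))
  rw [mul_inv_rev]
  exact fr.projF_mul c (y⁻¹).2 (x⁻¹).2 D.v₀'_mem

theorem orbitMap_bessel (s : D.bessel) (x : D.flagGroup) : fr.orbitMap c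
    (inclusion D.bessel_le_flagGroup s * x) = fr.orbitMap c x := by
  rw [orbitMap_mul]
  have h1 : fr.projF ((s⁻¹).1.1.val D.v₀') = D.v₀' :=
    (fr.mem_bessel_iff c (D.bessel_le_flagGroup (s⁻¹).2)).1 (s⁻¹).2
  have h2 : fr.orbitMap c (inclusion D.bessel_le_flagGroup s) = fr.orbitMap c 1 := by
    refine Subtype.ext (h1.trans ?_)
    change D.v₀' = fr.projF ((1⁻¹ : D.flagGroup).1.1.val D.v₀')
    rw [inv_one]
    exact (fr.projF_of_mem c D.v₀'_mem).symm
  rw [h2, ← orbitMap_mul, one_mul]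

theorem exists_bessel_mul (x y : D.flagGroup) (hxy : fr.orbitMap c x = fr.orbitMap c y) : ∃ s, x =
    inclusion D.bessel_le_flagGroup s * y := by
  have h1 : fr.orbitMap c (x * x⁻¹) = fr.orbitMap c (y * x⁻¹) := by
    rw [orbitMap_mul, hxy, ← orbitMap_mul]
  have h2 := congrArg Subtype.val h1
  rw [mul_inv_cancel] at h2
  change fr.projF ((1⁻¹ : D.flagGroup).1.1.val D.v₀') =
    fr.projF (((y * x⁻¹)⁻¹).1.1.val D.v₀') at h2
  rw [inv_one, mul_inv_rev, inv_inv] at h2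
  have h3 : (x * y⁻¹).1 ∈ D.bessel :=
    (fr.mem_bessel_iff c (x * y⁻¹).2).2 (h2.symm.trans (fr.projF_of_mem c D.v₀'_mem))
  exact ⟨⟨_, h3⟩, Subtype.ext (congrArg Subtype.val (inv_mul_cancel_right x y).symm)⟩

theorem orbitMap_polar (s : 𝔞) (x : fr.coreCompact) : fr.orbitMap c (fr.hyperF c s * fr.coreF x) =
    fr.coreAction c x⁻¹ (etaF (L := L) (fr.corePoint c) (expPos (-s))) := by
  refine Subtype.ext ?_
  change fr.projF (((fr.hyperF c s * fr.coreF x)⁻¹).1.1.val D.v₀') =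
    (x⁻¹).1.1.1.val (etaF (L := L) (fr.corePoint c) (expPos (-s))).1
  have h1 : (etaF (L := L) (fr.corePoint c) (expPos (-s))).1 =
      etaF (L := L) (D.v₀, D.v₀') (expPos (-s)) := rfl
  have h2 : (fr.hyperF c s)⁻¹.1 = D.hyperU (-s) :=
    (D.isHyperbolicFamily.translation_neg fun _ => s).symm
  have h3 : ((fr.hyperF c s * fr.coreF x)⁻¹).1.1.val D.v₀' =
      (x⁻¹).1.1.1.val ((D.hyperU (-s)).1.val D.v₀') := by
    rw [mul_inv_rev, ← h2]
    rfl
  rw [h1, h3, hyper_v₀', ← h1]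
  exact fr.projF_of_mem c (fr.coreCompact_apply_mem c x⁻¹ (Subtype.property _))

theorem continuous_jacobian (w : E × E) : Continuous fun s => jacobianEta h B D.E₀' w (expPos s) :=
    by
  borelize E
  exact continuous_jacobianEta _ _

/-- The Haar measure of the flag group in the coordinates `S × 𝕂₊ˣ × K`. -/
theorem exists_lintegral_flagGroup [CompactSpace (h.compact B)] (m : Measure D.flagGroup)
    [m.IsHaarMeasure] [m.IsMulRightInvariant] (σ : Measure D.bessel) [SFinite σ]
    [σ.IsMulRightInvariant] [IsFiniteMeasureOnCompacts σ] (hσ : σ ≠ 0) (κ : Measure fr.coreCompact)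
    [κ.IsHaarMeasure] [IsProbabilityMeasure κ] : ∃ C : ℝ≥0∞, C ≠ 0 ∧ C ≠ ∞ ∧ ∀ f : D.flagGroup →
    ℝ≥0∞, Measurable f → ∫⁻ x, f x ∂m = C * ∫⁻ s, ofReal
    (jacobianEta h B D.E₀' (D.v₀, D.v₀') (expPos s)) * ∫⁻ x, ∫⁻ t, f
    (inclusion D.bessel_le_flagGroup t * (fr.hyperF c s * fr.coreF x)) ∂σ ∂κ := by
  let _ : MeasurableSpace D.E₀' := borel _
  have : BorelSpace D.E₀' := ⟨rfl⟩
  have hJ : Measurable fun s => ofReal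
      (jacobianEta h B D.E₀' (D.v₀, D.v₀') (expPos s)) :=
    (continuous_jacobian _).measurable.ennreal_ofReal
  set Λ : Measure (𝔞 × fr.coreCompact) := (volume.withDensity fun s =>
    ofReal (jacobianEta h B D.E₀' (D.v₀, D.v₀') (expPos s))).prod κ with hΛ
  have hΛf : ∀ F : 𝔞 × fr.coreCompact → ℝ≥0∞, Measurable F → ∫⁻ z, F z ∂Λ =
      ∫⁻ s, ofReal (jacobianEta h B D.E₀' (D.v₀, D.v₀') (expPos s)) *
        ∫⁻ x, F (s, x) ∂κ := fun F hF => by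
    rw [hΛ, lintegral_prod _ hF.aemeasurable]
    exact lintegral_withDensity_eq_lintegral_mul _ hJ hF.lintegral_prod_right'
  have hpc : Continuous fun z : 𝔞 × fr.coreCompact =>
      fr.hyperF c z.1 * fr.coreF z.2 :=
    ((fr.continuous_hyperF c).comp continuous_fst).mul (fr.continuous_coreF.comp continuous_snd)
  have hqc := fr.continuous_orbitMap c
  have q := fr.coreAction_isSphereAction c
  have c' := fr.core_isCartan c
  have hw := fr.corePoint_mem c
  have hpol : ∀ F : D.E₀' → ℝ≥0∞, Measurable F →
      ∫⁻ z, F (fr.orbitMap c (fr.hyperF c z.1 * fr.coreF z.2)) ∂Λ =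
        polarIntegral (fr.coreForm c) (D.corePos B) (fr.coreAction c) (fr.corePoint c) κ F := by
    intro F hF
    refine (hΛf _ (hF.comp (hqc.comp hpc).measurable)).trans ?_
    rw [← q.lintegral_neg c' hw κ F]
    refine lintegral_congr fun s => ?_
    have h1 := fr.jacobianEta_core c (fr.corePoint c).1 (fr.corePoint c).2 s
    refine congrArg₂ _ (congrArg _ h1) (lintegral_congr fun x => ?_)
    exact congrArg F (fr.orbitMap_polar c s x)
  obtain ⟨C, hC0, hC1, hC⟩ := exists_lintegral_fiber m σ hσ _ D.isClosedEmbedding_inclusion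
    (fr.orbitMap c) hqc (fr.orbitMap_bessel c) (fr.exists_bessel_mul c) Λ
    (fun h0 => polarIntegral_one_ne_zero q c' hw κ (by
      rw [← hpol _ measurable_const, h0, lintegral_zero_measure]))
    (fun z => fr.hyperF c z.1 * fr.coreF z.2) hpc.measurable
    (fun y F hF => by
      have hm : Measurable (fr.orbitAction c y) :=
        (continuous_of_finiteDimensional _).measurable
      simp only [fr.orbitMap_mul c _ y]
      rw [hpol F hF]
      refine (hpol _ (hF.comp hm)).trans ?_
      refine polarIntegral_isometry q c' hw κ _ (fun a v => Subtype.ext ?_) (fun u v => ?_) hF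
      · change fr.projF ((y⁻¹).1.1.val (a • v.1)) = a • fr.projF ((y⁻¹).1.1.val v.1)
        rw [(y⁻¹).1.2.1, fr.projF_smul]
      · exact fr.form_projF_flagGroup c (y⁻¹).2 u.2 v.2)
    (fun C hC => by
      have h1 := lintegral_indicator_one (μ := Λ) ((hqc.comp hpc).measurable hC.measurableSet)
      refine ne_of_eq_of_ne h1.symm (ne_of_eq_of_ne ?_ <| polarIntegral_ne_top q c' hw κ hC)
      exact hpol _ (measurable_one.indicator hC.measurableSet))
  refine ⟨C, hC0, hC1, fun f hf => ?_⟩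
  rw [hC f hf, hΛf]
  have : Measurable fun z : (𝔞 × fr.coreCompact) × D.bessel =>
      f (inclusion D.bessel_le_flagGroup z.2 * (fr.hyperF c z.1.1 * fr.coreF z.1.2)) :=
    hf.comp ((D.isClosedEmbedding_inclusion.continuous.comp continuous_snd).mul
      (hpc.comp continuous_fst)).measurable
  exact this.lintegral_prod_right'

end AdaptedFrame

namespace AdaptedFrame

include c in
/-- `K` acts transitively on normalized isotropic vectors. -/
theorem _root_.IsCartan.exists_compact_isotropic (hu : B.form u u = 1) (hu0 : h.form u u = 0)
    (hv : B.form v v = 1) (hv0 : h.form v v = 0) : ∃ x : h.compact B, x.1.1.val u = v ∧ ∀ w, h.form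
    w u = 0 → h.form w (θ u) = 0 → h.form w v = 0 → h.form w (θ v) = 0 → x.1.1.val w = w := by
  set a : ℝ := (√2)⁻¹ with ha
  have ha2 : a * a = 2⁻¹ := by grind
  have hθ : ∀ (u : E) (i : Fin 2), θ (![a • (u + θ u), a • (u - θ u)] i) =
      (![1, -1] : Fin 2 → ℝ) i • ![a • (u + θ u), a • (u - θ u)] i := by
    intro u i
    fin_cases i
    · simp [map_smul, map_add, c.theta_theta, one_smul, add_comm]
    · change θ (a • (u - θ u)) = (-1 : ℝ) • a • (u - θ u)
      rw [map_smul, map_sub, c.theta_theta, neg_one_smul, ← smul_neg, neg_sub]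
  have hB : ∀ u : E, B.form u u = 1 → h.form u u = 0 → ∀ i j,
      B.form (![a • (u + θ u), a • (u - θ u)] i) (![a • (u + θ u), a • (u - θ u)] j) =
        if i = j then 1 else 0 := by
    intro u hu hu0 i j
    have e1 : B.form u (θ u) = 0 := by rw [← c.form_eq', hu0]
    have e2 : B.form (θ u) u = 0 := by rw [B.conj_symm, e1, star_zero]
    have e3 : B.form (θ u) (θ u) = 1 := by rw [c.pos_theta_theta, hu, sigma_def, tau_one, star_one]
    have e4 : (2⁻¹ : ℝ) • (1 + 1 : 𝕂) = 1 := by module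
    fin_cases i <;> fin_cases j
    · change B.form (a • (u + θ u)) (a • (u + θ u)) = 1
      simp only [map_smul, map_add, LinearMap.smul_apply, add_app, e1, e2, e3, hu,
        add_zero, zero_add]
      rw [← smul_add, smul_smul, ha2, e4]
    · simp [e1, e2, e3, hu]
    · simp [e1, e2, e3, hu]
    · change B.form (a • (u - θ u)) (a • (u - θ u)) = 1
      simp only [map_smul, map_sub, LinearMap.smul_apply, sub_app, e1, e2, e3, hu,
        sub_zero, zero_sub, smul_neg, sub_neg_eq_add]
      rw [← smul_add, smul_smul, ha2, e4]
  obtain ⟨x, hx1, hx2⟩ := c.exists_compact_map _ _ ![1, -1]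
    (by simp) (hθ u) (hθ v) (hB u hu hu0) (hB v hv hv0) univ
  have e0 : ∀ u : E, u = a • (a • (u + θ u) + a • (u - θ u)) := fun u => by
    rw [← smul_add, smul_smul, ha2, add_add_sub_cancel, ← two_smul ℝ, smul_smul]
    norm_num
  refine ⟨x, ?_, fun w h1 h2 h3 h4 => hx2 w fun i _ => ?_⟩
  · have h1 : x.1.1.val (a • (u + θ u)) = a • (v + θ v) := hx1 0 (mem_univ _)
    have h2 : x.1.1.val (a • (u - θ u)) = a • (v - θ v) := hx1 1 (mem_univ _)
    conv_lhs => rw [e0 u]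
    conv_rhs => rw [e0 v]
    rw [map_smul, map_add, h1, h2]
  · fin_cases i
    all_goals simp [h1, h2, h3, h4]

include fr c

theorem inv_mem_X {y : h.unitary} {n : ℕ} (hy : ∀ j : Fin r, (j : ℕ) < n → ∃ x : 𝔞, (∀ i, 0 < x i) ∧
    y.1.val (e j) - realCoe L x • e j ∈ D.X j.castSucc) (j : Fin (r + 1)) (hj : (j : ℕ) ≤ n)
    (hv : v ∈ D.X j) : (y⁻¹).1.val v ∈ D.X j := by
  induction j using Fin.induction generalizing v with
  | zero =>
    rw [D.X_zero, mem_bot] at hv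
    aesop
  | succ j ih =>
    have hj' : (j : ℕ) < n := Nat.lt_of_succ_le hj
    obtain ⟨a, u, hu, rfl⟩ := fr.X_succ_induction c hv
    obtain ⟨x, hx, hxm⟩ := hy j hj'
    have ih' : ∀ {v : E}, v ∈ D.X j.castSucc → (y⁻¹).1.val v ∈ D.X j.castSucc := ih hj'.le
    have h1 := ih' hxm
    rw [map_sub, h.unitary_inv_apply, (y⁻¹).2.1] at h1
    have h2 : realCoe L x • (y⁻¹).1.val (e j) ∈ D.X j.succ := by
      rw [← sub_sub_cancel (e j) (realCoe L x • (y⁻¹).1.val (e j))]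
      exact sub_mem (fr.e_mem_succ j) (D.X_le j h1)
    have h3 : realCoe L (fun i => (x i)⁻¹) * realCoe L x = 1 := by
      rw [← map_mul]
      refine (congrArg _ (funext fun i => ?_)).trans (map_one (realCoe L))
      exact inv_mul_cancel₀ (hx i).ne'
    rw [map_add, (y⁻¹).2.1, ← one_smul 𝕂 ((y⁻¹).1.val (e j)), ← h3, mul_smul]
    exact add_mem (smul_mem _ _ (smul_mem _ _ h2)) (D.X_le j (ih' hu))

/-- The Gram–Schmidt process. -/
theorem exists_compact_triangular (g : h.unitary) (n : ℕ) (hn : n ≤ r) : ∃ κ : h.compact B, ∀ j :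
    Fin r, (j : ℕ) < n → ∃ x : 𝔞, (∀ i, 0 < x i) ∧ (κ.1 * g).1.val (e j) - realCoe L x • e j ∈ D.X
    j.castSucc := by
  induction n with
  | zero => exact ⟨1, fun j hj => absurd hj (Nat.not_lt_zero _)⟩
  | succ n ih =>
    obtain ⟨κ, hκ⟩ := ih (Nat.le_of_succ_le hn)
    set y := κ.1 * g with hy
    set i₀ : Fin r := ⟨n, hn⟩
    have hinv : ∀ {v : E}, v ∈ D.X i₀.castSucc → (y⁻¹).1.val v ∈ D.X i₀.castSucc :=
      fr.inv_mem_X c hκ i₀.castSucc le_rfl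
    have hmem : ∀ j : Fin r, (j : ℕ) < n → e j ∈ D.X i₀.castSucc := fun j hj => by
      rw [fr.X_eq]
      exact subset_span ⟨j, Fin.castSucc_lt_castSucc_iff.2 (Fin.lt_def.2 hj), rfl⟩
    set u := y.1.val (e i₀) with hu
    have hue : ∀ v ∈ D.X i₀.castSucc, h.form u v = 0 := fun v hv => by
      rw [hu, h.form_unitary_left]
      exact D.X_isotropic _ (fr.e_mem _) _ (fr.mem_Xr_of_mem _ (hinv hv))
    set S : Finset (Fin r) := Finset.univ.filter fun j => (j : ℕ) < n
    set z : E := ∑ j ∈ S, B.form u (e j) • e j with hz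
    have hzm : z ∈ D.X i₀.castSucc := Submodule.sum_mem _ fun j hj =>
      smul_mem _ _ (hmem j (Finset.mem_filter.1 hj).2)
    have hzz : ∀ v ∈ D.X i₀.castSucc, h.form z v = 0 := fun v hv =>
      D.X_isotropic _ (fr.mem_Xr_of_mem _ hzm) _ (fr.mem_Xr_of_mem _ hv)
    have hB : ∀ j : Fin r, (j : ℕ) < n → B.form (u - z) (e j) = 0 := fun j hj =>
      B.sub_sum_orthogonal S e (fun i _ j _ => fr.pos_e i j) u j
        (Finset.mem_filter.2 ⟨mem_univ _, hj⟩)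
    have hh : ∀ v ∈ D.X i₀.castSucc, h.form (u - z) v = 0 := fun v hv => by
      rw [map_sub, sub_app, hue v hv, hzz v hv, sub_zero]
    have hh0 : h.form (u - z) (u - z) = 0 := by
      rw [map_sub (h.form (u - z)), hh z hzm, sub_zero, map_sub, sub_app,
        h.form_eq_zero_symm (hue z hzm), sub_zero, hu, y.2.2, fr.form_ee]
    have hpos : ∀ i, 0 < B.quad (u - z) i := fun i => by
      refine lt_of_le_of_ne (c.quad_nonneg _ i) fun h0 => ?_
      have h1 : (single i 1 : 𝕂) • (u - z) = 0 := by
        apply c.eq_zero_of_quad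
        rw [B.smul_left, B.smul_right, B.form_self]
        funext j
        by_cases hj : j = i
        · subst hj
          rw [Pi.mul_apply, Pi.mul_apply, realCoe_apply, ← h0]
          simp
        · simp [Pi.single_eq_of_ne hj]
      have h2 : (single i 1 : 𝕂) • e i₀ ∈ D.X i₀.castSucc := by
        rw [smul_sub, sub_eq_zero] at h1
        have h3 := hinv (h1 ▸ smul_mem _ _ hzm)
        rwa [(y⁻¹).2.1, hu, h.unitary_inv_apply] at h3
      have h4 : h.form (θ (e i₀)) ((single i 1 : 𝕂) • e i₀) = 0 := by
        rw [fr.X_eq] at h2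
        refine mem_orthogonal_span ?_ h2
        rintro _ ⟨m, hm, rfl⟩
        rw [fr.form_ye c, if_neg (Fin.castSucc_lt_castSucc_iff.1 hm).ne']
      have h5 := h.form_eq_zero_symm h4
      rw [h.smul_left, fr.form_ey c, if_pos rfl, mul_one] at h5
      simpa using congrFun h5 i
    obtain ⟨x, hx, hx1⟩ := B.exists_normalize hpos
    have hxx : realCoe L (fun i => (x i)⁻¹) * realCoe L x = 1 := by
      rw [← map_mul]
      refine (congrArg _ (funext fun i => ?_)).trans (map_one (realCoe L))
      exact inv_mul_cancel₀ (hx i).ne'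
    obtain ⟨t, ht1, ht2⟩ := c.exists_compact_isotropic hx1
      (by rw [h.smul_left, h.smul_right, hh0, mul_zero, mul_zero])
      ((fr.pos_e i₀ i₀).trans (if_pos rfl)) (fr.form_ee i₀ i₀)
    have hfix : ∀ v ∈ D.X i₀.castSucc, t.1.1.val v = v := fun v hv => by
      rw [fr.X_eq] at hv
      refine eq_of_mem_span (g := AddMonoidHom.id E) t.1.2.1 (fun _ _ => rfl) ?_ hv
      rintro _ ⟨j, hj, rfl⟩
      have hj' := Fin.castSucc_lt_castSucc_iff.1 hj
      refine ht2 _ ?_ ?_ (fr.form_ee _ _) (by rw [fr.form_ey c, if_neg hj'.ne])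
      · rw [h.smul_right, h.form_eq_zero_symm (hh _ (hmem j hj')), mul_zero]
      · rw [← c.form_eq, B.smul_right, B.conj_symm, hB j hj', star_zero, mul_zero]
    have htu : t.1.1.val u = realCoe L (fun i => (x i)⁻¹) • e i₀ + z := by
      have h1 : u = realCoe L (fun i => (x i)⁻¹) • realCoe L x • (u - z) + z := by
        rw [smul_smul, hxx, one_smul, sub_add_cancel]
      rw [h1, map_add, t.1.2.1, ht1, hfix z hzm]
    refine ⟨t * κ, fun j hj => ?_⟩
    have e1 : ((t * κ).1 * g).1.val (e j) = t.1.1.val (y.1.val (e j)) := rfl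
    rw [e1]
    rcases Nat.lt_succ_iff_lt_or_eq.1 hj with hj | hj
    · obtain ⟨x', hx', hxm⟩ := hκ j hj
      refine ⟨x', hx', ?_⟩
      have hX : ∀ v ∈ D.X j.castSucc, v ∈ D.X i₀.castSucc := fun v hv => by
        rw [fr.X_eq] at hv ⊢
        exact span_mono (Set.image_mono fun m hm => lt_trans hm
          (Fin.castSucc_lt_castSucc_iff.2 (Fin.lt_def.2 hj))) hv
      have h1 := hfix _ (hX _ hxm)
      rw [map_sub, t.1.2.1, hfix _ (hmem j hj)] at h1
      rwa [h1]
    · obtain rfl : j = i₀ := Fin.ext hj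
      refine ⟨fun i => (x i)⁻¹, fun i => inv_pos.2 (hx i), ?_⟩
      rw [← hu, htu, add_sub_cancel_left]
      exact hzm

include c in
theorem mem_flagGroup_of_frame {z : h.unitary} (hz : ∀ i, z.1.val (e i) - e i ∈ D.X i.castSucc) : z
    ∈ D.flagGroup := by
  have key : ∀ j : Fin (r + 1), ∀ v ∈ D.X j, z.1.val v ∈ D.X j := by
    intro j
    induction j using Fin.induction with
    | zero =>
      intro v hv
      rw [D.X_zero, mem_bot] at hv
      aesop
    | succ j ih =>
      intro v hv
      obtain ⟨a, u, hu, rfl⟩ := fr.X_succ_induction c hv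
      rw [map_add, z.2.1, ← sub_add_cancel (z.1.val (e j)) (e j)]
      exact add_mem (smul_mem _ _ (add_mem (D.X_le j (hz j)) (fr.e_mem_succ j)))
        (D.X_le j (ih u hu))
  intro i v hv
  obtain ⟨a, u, hu, rfl⟩ := fr.X_succ_induction c hv
  rw [map_add, z.2.1, add_sub_add_comm, ← smul_sub]
  exact add_mem (smul_mem _ _ (hz i)) (sub_mem (key _ u hu) hu)

theorem torusU_conj_mem (s : Fin r → 𝔞) (hx : x ∈ D.flagGroup) : fr.torusU c s * x *
    (fr.torusU c s)⁻¹ ∈ D.flagGroup := by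
  intro i v hv
  rw [← fr.torusU_neg c]
  have h1 := fr.torusU_mem_X c (-s) _ hv
  have h2 := fr.torusU_mem_X c s _ (hx i _ h1)
  have h3 : (fr.torusU c s).1.val ((fr.torusU c (-s)).1.val v) = v := by
    rw [fr.torusU_neg c, h.unitary_apply_inv]
  rwa [map_sub, h3] at h2

/-- The Iwasawa decomposition. -/
theorem exists_iwasawa (g : h.unitary) : ∃ (x : D.flagGroup) (s : Fin r → 𝔞) (κ : h.compact B), g =
    x.1 * fr.torusU c s * κ.1 := by
  obtain ⟨κ, hκ⟩ := fr.exists_compact_triangular c g⁻¹ r le_rfl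
  choose x hx hxm using fun j : Fin r => hκ j j.2
  set s : Fin r → 𝔞 := fun j i => log (x j i) with hs
  have hsx : ∀ j, posCoe L (expPos (s j)) = realCoe L (x j) := fun j =>
    congrArg (realCoe L) (funext fun i => Real.exp_log (hx j i))
  have hz : κ.1 * g⁻¹ * fr.torusU c (-s) ∈ D.flagGroup := by
    refine fr.mem_flagGroup_of_frame c fun i => ?_
    have e1 : (κ.1 * g⁻¹ * fr.torusU c (-s)).1.val (e i) =
        (κ.1 * g⁻¹).1.val ((fr.torusU c (-s)).1.val (e i)) := rfl
    have e2 : posCoe L (expPos ((-s) i)) * realCoe L (x i) = 1 := by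
      rw [← hsx, ← posCoe_expPos_add, Pi.neg_apply, neg_add_cancel]
      funext j
      simp [posCoe, expPos]
    have h1 := smul_mem _ (posCoe L (expPos ((-s) i))) (hxm i)
    rw [smul_sub, smul_smul, e2, one_smul] at h1
    have e3 : (fr.torusU c (-s)).1.val (e i) = _ := (fr.torus_isDiagonal c (-s)).apply_e i
    rw [e1, e3, (κ.1 * g⁻¹).2.1]
    exact h1
  refine ⟨⟨_, fr.torusU_conj_mem c (-s) (inv_mem hz)⟩, -s, κ, ?_⟩
  simp

end AdaptedFrame

namespace AdaptedFrame

/-- Conjugation by `a_t` on the flag group. -/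
noncomputable def torusConj (s : Fin r → 𝔞) : D.flagGroup ≃ₜ* D.flagGroup :=
  D.flagGroup.conjContinuous (fr.torusU c s) (fun _ => fr.torusU_conj_mem c s) fun x hx => by
    have := fr.torusU_conj_mem c (-s) hx
    rwa [fr.torusU_neg c, inv_inv] at this

theorem torusU_add (s t : Fin r → 𝔞) : fr.torusU c (s + t) = fr.torusU c s * fr.torusU c t :=
  (fr.isHyperbolicFamily c).translation_add s t

theorem continuous_torusU : Continuous (fr.torusU c) :=
  (fr.isHyperbolicFamily c).continuous_translation

theorem torusConj_add (s t : Fin r → 𝔞) (x : D.flagGroup) : fr.torusConj c (s + t) x = fr.torusConj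
    c s (fr.torusConj c t x) := by
  refine Subtype.ext ?_
  change fr.torusU c (s + t) * x.1 * (fr.torusU c (s + t))⁻¹ =
    fr.torusU c s * (fr.torusU c t * x.1 * (fr.torusU c t)⁻¹) * (fr.torusU c s)⁻¹
  rw [torusU_add]
  group

theorem torusConj_neg (s : Fin r → 𝔞) (x : D.flagGroup) : fr.torusConj c (-s) (fr.torusConj c s x) =
    x := by
  rw [← torusConj_add, neg_add_cancel]
  refine Subtype.ext ?_
  change fr.torusU c 0 * x.1 * (fr.torusU c 0)⁻¹ = x.1
  rw [torusU, (fr.isHyperbolicFamily c).translation_zero, one_mul, inv_one, mul_one]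

theorem continuous_torusConj : Continuous fun p : (Fin r → 𝔞) × D.flagGroup => fr.torusConj c p.1
    p.2 := by
  have h1 := (fr.continuous_torusU c).comp (continuous_fst (Y := D.flagGroup))
  exact subtype_mk ((h1.mul (continuous_subtype_val.comp continuous_snd)).mul h1.inv) _

/-- The inverse of the modular character `δ_P δ_B` of the torus. -/
noncomputable def weight (s : Fin r → 𝔞) : ℝ≥0∞ :=
  ofReal ((D.deltaP ⟨(fr.torus c s).1, D.borelGroup_le_parabolic (fr.torus c s).2⟩)⁻¹ *
    (D.deltaB (fr.torus c s))⁻¹)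

variable (m : Measure D.flagGroup) [m.IsHaarMeasure]

theorem lintegral_torusConj (s : Fin r → 𝔞) (f : D.flagGroup → ℝ≥0∞) (hf : Measurable f) : ∫⁻ x, f
    (fr.torusConj c s x) ∂m = fr.weight c s * ∫⁻ x, f x ∂m ∧ fr.weight c s ≠ 0 := by
  have hυ : IsClosedEmbedding (h.unitary.subtype.comp D.flagGroup.subtype) :=
    h.isClosed_unitary.isClosedEmbedding_subtypeVal.comp
      D.isClosed_flagGroup.isClosedEmbedding_subtypeVal
  have h1 := fun f hf => D.isCayleyChart.lintegral_conj hυ m (fr.torusConj c s) (fr.torus c s).1.1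
    (fun _ => rfl) (D.conjEnd_borelGroup (fr.torus c s)) (D.conjEnd_borelGroup (fr.torus c s)⁻¹) f hf
  rw [fr.abs_det_conjEnd_diagonal c (fr.torus_isDiagonal c s)] at h1
  set d := D.deltaP ⟨(fr.torus c s).1, D.borelGroup_le_parabolic (fr.torus c s).2⟩ *
    D.deltaB (fr.torus c s) with hd
  have hd0 : 0 < d := by
    refine lt_of_le_of_ne (mul_nonneg (abs_nonneg _) (abs_nonneg _)) fun h0 => ?_
    have h2 := h1 (fun _ => 1) measurable_const
    rw [← h0, ENNReal.ofReal_zero, zero_mul, lintegral_one] at h2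
    exact NeZero.ne m (Measure.measure_univ_eq_zero.1 h2.symm)
  have hw : fr.weight c s = (ofReal d)⁻¹ := by
    rw [weight, ← mul_inv, ← ENNReal.ofReal_inv_of_pos hd0]
  rw [hw]
  refine ⟨?_, ENNReal.inv_ne_zero.2 ofReal_ne_top⟩
  rw [← h1 f hf, ← mul_assoc, ENNReal.inv_mul_cancel (ENNReal.ofReal_pos.2 hd0).ne'
    ofReal_ne_top, one_mul]

theorem weight_ne_top (s : Fin r → 𝔞) : fr.weight c s ≠ ∞ := ofReal_ne_top

theorem weight_add (s t : Fin r → 𝔞) : fr.weight c (s + t) = fr.weight c s * fr.weight c t := by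
  obtain ⟨U, hU, hU1⟩ := exists_compact_mem_nhds (1 : D.flagGroup)
  let m : Measure D.flagGroup := haar
  have hUm := hU.measurableSet
  have hf : Measurable (U.indicator (1 : D.flagGroup → ℝ≥0∞)) := measurable_one.indicator hUm
  have h0 : m U ≠ 0 := (measure_pos_of_mem_nhds m hU1).ne'
  have h1 := (fr.lintegral_torusConj c m (s + t) _ hf).1
  simp only [torusConj_add] at h1
  rw [(fr.lintegral_torusConj c m t (fun x => U.indicator 1 (fr.torusConj c s x))
    (hf.comp (fr.torusConj c s).continuous_toFun.measurable)).1,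
    (fr.lintegral_torusConj c m s _ hf).1, lintegral_indicator_one hUm, ← mul_assoc,
    ENNReal.mul_left_inj h0 hU.measure_ne_top] at h1
  rw [← h1, mul_comm]

theorem measurable_weight : Measurable (fr.weight c) := by
  obtain ⟨U, hU, hU1⟩ := exists_compact_mem_nhds (1 : D.flagGroup)
  let m : Measure D.flagGroup := haar
  have hUm := hU.measurableSet
  have hf : Measurable (U.indicator (1 : D.flagGroup → ℝ≥0∞)) := measurable_one.indicator hUm
  have h0 : m U ≠ 0 := (measure_pos_of_mem_nhds m hU1).ne'
  have h1 : fr.weight c = fun s => (∫⁻ x, U.indicator 1 (fr.torusConj c s x) ∂m) / m U := by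
    funext s
    rw [(fr.lintegral_torusConj c m s _ hf).1, lintegral_indicator_one hUm,
      ENNReal.mul_div_cancel_right h0 hU.measure_ne_top]
  rw [h1]
  have h2 : Measurable fun p : (Fin r → 𝔞) × D.flagGroup =>
      U.indicator (1 : D.flagGroup → ℝ≥0∞) (fr.torusConj c p.1 p.2) :=
    hf.comp (fr.continuous_torusConj c).measurable
  exact h2.lintegral_prod_right'.div_const _

theorem measure_torusConj (s : Fin r → 𝔞) {U : Set D.flagGroup} (hU : MeasurableSet U) : m
    (fr.torusConj c s ⁻¹' U) = fr.weight c s * m U := by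
  have h1 := (fr.lintegral_torusConj c m s _ (measurable_one.indicator hU)).1
  rw [lintegral_indicator_one hU] at h1
  exact (lintegral_indicator_one ((fr.torusConj c s).continuous_toFun.measurable hU)).symm.trans h1

theorem exists_weight_le {Q : Set (Fin r → 𝔞)} (hQ : IsCompact Q) : ∃ M : ℝ≥0∞, M ≠ ∞ ∧ ∀ s ∈ Q,
    fr.weight c s ≤ M := by
  obtain ⟨U, hU, hU1⟩ := exists_compact_mem_nhds (1 : D.flagGroup)
  have h0 : haar U ≠ 0 := (measure_pos_of_mem_nhds _ hU1).ne'
  have hU' := (hQ.prod hU).image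
    ((fr.continuous_torusConj c).comp (continuous_fst.neg.prodMk continuous_snd))
  refine ⟨_, div_ne_top (hU'.measure_ne_top (μ := haar)) h0, fun s hs => ?_⟩
  rw [ENNReal.le_div_iff_mul_le (Or.inl h0) (Or.inl hU.measure_ne_top),
    ← fr.measure_torusConj c haar s hU.measurableSet]
  exact measure_mono fun x hx => ⟨(s, fr.torusConj c s x), ⟨hs, hx⟩, fr.torusConj_neg c s x⟩

/-- The diagonal matrix entries of an element of `N A`. -/
theorem form_flag_torus (x : D.flagGroup) (s : Fin r → 𝔞) (i : Fin r) : h.form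
    ((x.1 * fr.torusU c s).1.val (e i)) (θ (e i)) = posCoe L (expPos (s i)) ∧ h.form
    ((x.1 * fr.torusU c s)⁻¹.1.val (e i)) (θ (e i)) = posCoe L (expPos ((-s) i)) := by
  have h0 : ∀ u ∈ D.X i.castSucc, h.form u (θ (e i)) = 0 := fun u hu => by
    refine h.form_eq_zero_symm ?_
    rw [fr.X_eq] at hu
    refine mem_orthogonal_span ?_ hu
    rintro _ ⟨j, hj, rfl⟩
    rw [fr.form_ye c, if_neg (Fin.castSucc_lt_castSucc_iff.1 hj).ne']
  have h1 : ∀ x : D.flagGroup, h.form (x.1.1.val (e i)) (θ (e i)) = 1 := fun x => by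
    have h2 := h0 _ (x.2 i _ (fr.e_mem_succ i))
    rwa [map_sub, sub_app, fr.form_ey c, if_pos rfl, sub_eq_zero] at h2
  constructor
  · have e1 : (x.1 * fr.torusU c s).1.val (e i) = posCoe L (expPos (s i)) • x.1.1.val (e i) := by
      rw [← x.1.2.1, ← (fr.torus_isDiagonal c s).apply_e i]
      rfl
    rw [e1, h.smul_left, h1, mul_one]
  · have e1 : (x.1 * fr.torusU c s)⁻¹.1.val (e i) =
        (fr.torus c (-s)).1.1.val ((x⁻¹).1.1.val (e i)) := by
      rw [mul_inv_rev, ← fr.torusU_neg c]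
      rfl
    rw [e1, (fr.torus_isDiagonal c (-s)).form_y, h1, mul_one]

theorem exists_isCompact_torus {C : Set h.unitary} (hC : IsCompact C) : ∃ Q : Set (Fin r → 𝔞),
    IsCompact Q ∧ ∃ C' : Set D.flagGroup, IsCompact C' ∧ ∀ (x : D.flagGroup) s, x.1 * fr.torusU c s
    ∈ C → s ∈ Q ∧ x ∈ C' := by
  have hcont : ∀ i, Continuous fun g : h.unitary => h.form (g.1.val (e i)) (θ (e i)) := fun i =>
    h.continuous_form.comp ((h.continuous_apply _).prodMk continuous_const)
  have hb : ∀ i : Fin r, ∃ M : ℝ, ∀ g ∈ C, ‖h.form (g.1.val (e i)) (θ (e i))‖ ≤ M ∧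
      ‖h.form ((g⁻¹).1.val (e i)) (θ (e i))‖ ≤ M := fun i => by
    obtain ⟨M₁, h1⟩ := hC.exists_bound_of_continuousOn (hcont i).continuousOn
    obtain ⟨M₂, h2⟩ := hC.exists_bound_of_continuousOn ((hcont i).comp continuous_inv).continuousOn
    exact ⟨max M₁ M₂, fun g hg => ⟨(h1 g hg).trans (le_max_left _ _),
      (h2 g hg).trans (le_max_right _ _)⟩⟩
  choose M hM using hb
  have hle : ∀ (s : 𝔞) j b, ‖posCoe L (expPos s)‖ ≤ b → s j ≤ log b := by
    intro s j b hb
    have h1 := (norm_le_pi_norm (posCoe L (expPos s)) j).trans hb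
    have h2 : ‖posCoe L (expPos s) j‖ = exp (s j) := by
      rw [posCoe, RCLike.norm_ofReal]
      exact abs_of_pos (exp_pos _)
    rw [h2] at h1
    rw [← Real.log_exp (s j)]
    exact Real.log_le_log (exp_pos _) h1
  set Q : Set (Fin r → 𝔞) :=
    Set.Icc (fun i _ => -log (M i)) fun i _ => log (M i) with hQ
  have hQc : IsCompact Q := isCompact_Icc
  set C₁ := (fun p : h.unitary × (Fin r → 𝔞) => p.1 * (fr.torusU c p.2)⁻¹) '' (C ×ˢ Q)
  have hC₁ : IsCompact C₁ := (hC.prod hQc).image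
    (continuous_fst.mul ((fr.continuous_torusU c).comp continuous_snd).inv)
  refine ⟨Q, hQc, _, D.isClosed_flagGroup.isClosedEmbedding_subtypeVal.isCompact_preimage hC₁,
    fun x s hx => ?_⟩
  have hs : s ∈ Q := by
    refine ⟨fun i j => ?_, fun i j => ?_⟩
    · have h1 := (hM i _ hx).2
      rw [(fr.form_flag_torus c x s i).2] at h1
      exact neg_le.1 (hle _ j _ h1)
    · have h1 := (hM i _ hx).1
      rw [(fr.form_flag_torus c x s i).1] at h1
      exact hle _ j _ h1
  exact ⟨hs, (x.1 * fr.torusU c s, s), ⟨hx, hs⟩, mul_inv_cancel_right _ _⟩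

theorem lintegral_weight_ne_top {C : Set h.unitary} (hC : IsCompact C) : ∫⁻ s, fr.weight c s * ∫⁻ x,
    C.indicator 1 (x.1 * fr.torusU c s) ∂m ≠ ∞ := by
  obtain ⟨Q, hQ, C', hC', hQC⟩ := fr.exists_isCompact_torus c hC
  obtain ⟨M, hM, hMQ⟩ := fr.exists_weight_le c hQ
  refine ne_top_of_le_ne_top (b := ∫⁻ s, Q.indicator (fun _ => M * m C') s) ?_
    (lintegral_mono fun s => ?_)
  · rw [lintegral_indicator hQ.measurableSet, setLIntegral_const]
    exact mul_ne_top (mul_ne_top hM hC'.measure_ne_top) hQ.measure_ne_top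
  · have h1 : ∀ x : D.flagGroup, C.indicator (1 : h.unitary → ℝ≥0∞) (x.1 * fr.torusU c s) ≤
        C'.indicator 1 x := fun x => by
      by_cases hx : x.1 * fr.torusU c s ∈ C
      · simp_all [indicator_of_mem (hQC x s hx).2]
      aesop
    by_cases hs : s ∈ Q
    · rw [indicator_of_mem hs]
      refine mul_le_mul' (hMQ s hs) ?_
      rw [← lintegral_indicator_one hC'.measurableSet]
      exact lintegral_mono h1
    · have h2 : ∀ x : D.flagGroup, C.indicator (1 : h.unitary → ℝ≥0∞) (x.1 * fr.torusU c s) = 0 :=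
        fun x => indicator_of_notMem (fun hx => hs (hQC x s hx).1) _
      simp [h2]

theorem lintegral_weight_ne_zero [SFinite m] {C : Set h.unitary} (hC : MeasurableSet C)
    (hC1 : C ∈ 𝓝 1) : ∫⁻ s, fr.weight c s * ∫⁻ x, C.indicator 1 (x.1 * fr.torusU c s) ∂m ≠ 0 := by
  have hmul : Continuous fun p : (Fin r → 𝔞) × D.flagGroup => p.2.1 * fr.torusU c p.1 :=
    (continuous_subtype_val.comp continuous_snd).mul ((fr.continuous_torusU c).comp continuous_fst)
  have hf : Measurable fun p : (Fin r → 𝔞) × D.flagGroup =>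
      C.indicator (1 : h.unitary → ℝ≥0∞) (p.2.1 * fr.torusU c p.1) :=
    (measurable_one.indicator hC).comp hmul.measurable
  intro h0
  replace h0 := (lintegral_eq_zero_iff
    ((fr.measurable_weight c).mul hf.lintegral_prod_right')).1 h0
  set O : Set (Fin r → 𝔞) := fr.torusU c ⁻¹' interior C with hO
  have hOo : IsOpen O := isOpen_interior.preimage (fr.continuous_torusU c)
  have h00 : (0 : Fin r → 𝔞) ∈ O := by
    change fr.torusU c 0 ∈ interior C
    rw [torusU, (fr.isHyperbolicFamily c).translation_zero]
    exact mem_interior_iff_mem_nhds.2 hC1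
  refine (hOo.measure_pos volume ⟨0, h00⟩).ne' (measure_mono_null (fun s hs => ?_) (ae_iff.1 h0))
  change ¬ (fr.weight c s * ∫⁻ x, C.indicator 1 (x.1 * fr.torusU c s) ∂m = 0)
  rw [mul_eq_zero, not_or]
  refine ⟨(fr.lintegral_torusConj c m s _ measurable_one).2, ?_⟩
  have hcs : Continuous fun x : D.flagGroup => x.1 * fr.torusU c s :=
    continuous_subtype_val.mul continuous_const
  have h1 := lintegral_indicator_one (μ := m) (hcs.measurable hC)
  refine ne_of_eq_of_ne h1 (ne_of_gt ((isOpen_interior.preimage hcs).measure_pos m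
    ⟨1, ?_⟩ |>.trans_le (measure_mono (Set.preimage_mono interior_subset))))
  aesop

end AdaptedFrame

/-- The exponential map of `ℝ₊ˣ`. -/
noncomputable def expEquiv : ℝ ≃ᵐ {x : ℝ // 0 < x} where
  toFun s := ⟨exp s, exp_pos s⟩
  invFun x := log x
  left_inv s := Real.log_exp s
  right_inv x := Subtype.ext (Real.exp_log x.2)
  measurable_toFun := Real.measurable_exp.subtype_mk
  measurable_invFun := Real.measurable_log.comp measurable_subtype_coe

/-- The exponential map of `𝕂₊ˣ`. -/
noncomputable def expPosEquiv (k : ScalarKind) : (Fin k.card → ℝ) ≃ᵐ PosScalar k :=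
  piCongrRight fun _ => expEquiv

theorem expPos_symm (t : PosScalar k) : expPos ((expPosEquiv k).symm t) = t :=
  (expPosEquiv k).apply_symm_apply t

theorem posMeasure_eq : posMeasure k = volume.map (expPosEquiv k) :=
  (Measure.pi_map_pi (μ := fun _ : Fin k.card => volume) (f := fun _ => expEquiv)
    (hμ := fun _ => expEquiv.sigmaFinite_map)
    fun _ => expEquiv.measurable.aemeasurable).symm

instance : SigmaFinite (posMeasure k) := by
  rw [posMeasure_eq]
  exact (expPosEquiv k).sigmaFinite_map

theorem pi_posMeasure_eq (r : ℕ) : Measure.pi (fun _ : Fin r => posMeasure k) = volume.map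
    (piCongrRight fun _ : Fin r => expPosEquiv k) := by
  simp only [posMeasure_eq]
  exact (Measure.pi_map_pi (μ := fun _ : Fin r => volume) (f := fun _ => expPosEquiv k)
    (hμ := fun _ => (expPosEquiv k).sigmaFinite_map)
    fun _ => (expPosEquiv k).measurable.aemeasurable).symm

namespace AdaptedFrame

open scoped ENNReal Topology Pointwise

include c in
theorem isMulRightInvariant_flagGroup (fr : AdaptedFrame D B θ e) (m : Measure D.flagGroup)
    [m.IsHaarMeasure] : m.IsMulRightInvariant :=
  D.isCayleyChart.isMulRightInvariant (h.isClosed_unitary.isClosedEmbedding_subtypeVal.comp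
    D.isClosed_flagGroup.isClosedEmbedding_subtypeVal) m (fun x => D.conjEnd_flagGroup x.2)
    fun x => fr.abs_det_conjEnd_flagGroup c x.2

include c in
theorem _root_.IsCartan.isMulRightInvariant (μ : Measure h.unitary) [μ.IsHaarMeasure] :
    μ.IsMulRightInvariant :=
  h.isCayleyChart.isMulRightInvariant h.isClosed_unitary.isClosedEmbedding_subtypeVal μ
    (fun x _ => conjEnd_mem_lieUnitary h x) fun x => c.abs_det_conjEnd_lieUnitary x

theorem hyper_torus_comm (s : Fin r → 𝔞) (t : 𝔞) : D.hyperU t * fr.torusU c s = fr.torusU c s *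
    D.hyperU t :=
  (fr.isHyperbolicFamily c).translation_comm s (fr.hyper_fix c t)

/-- The Haar measure of `U(E)` in Iwasawa coordinates. -/
theorem exists_lintegral_unitary [CompactSpace (h.compact B)] (μ : Measure h.unitary)
    [μ.IsHaarMeasure] (σ : Measure D.bessel) [SFinite σ] [σ.IsMulRightInvariant]
    [IsFiniteMeasureOnCompacts σ] (hσ : σ ≠ 0) (κ : Measure (h.compact B)) [κ.IsHaarMeasure]
    [IsProbabilityMeasure κ] : ∃ C : ℝ≥0∞, C ≠ 0 ∧ C ≠ ∞ ∧ ∀ f : h.unitary → ℝ≥0∞, Measurable f → ∫⁻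
    g, f g ∂μ = C * ∫⁻ s, fr.weight c s * ∫⁻ t, ofReal
    (jacobianEta h B D.E₀' (D.v₀, D.v₀') (expPos t)) * ∫⁻ x, ∫⁻ b, f
    (b.1 * (fr.torusU c s * D.hyperU t * x.1)) ∂σ ∂κ := by
  have := (HermitianForm.isClosed_compact (h := h) B).isClosedEmbedding_subtypeVal.polishSpace
  let m : Measure D.flagGroup := haar
  have := isMulRightInvariant_flagGroup c fr m
  have := c.isMulRightInvariant μ
  let ω : Measure fr.coreCompact := Measure.haarMeasure ⊤
  have : IsProbabilityMeasure ω := ⟨Measure.haarMeasure_self⟩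
  obtain ⟨C', hC0, hC1, hC'⟩ := fr.exists_lintegral_flagGroup c m σ hσ ω
  obtain ⟨V, hV, hV1⟩ := exists_compact_mem_nhds (1 : h.unitary)
  set W : Set h.unitary := V * (h.compact B : Set h.unitary)
  have hW : IsCompact W := hV.mul (isCompact_iff_compactSpace.2 inferInstance)
  have hW1 : W ∈ 𝓝 1 := Filter.mem_of_superset hV1 fun v hv => ⟨v, hv, 1, one_mem _, mul_one v⟩
  have hβ : Measurable (W.indicator (1 : h.unitary → ℝ≥0∞)) :=
    measurable_one.indicator hW.measurableSet
  have hβi : ∀ g, W.indicator (1 : h.unitary → ℝ≥0∞) g⁻¹ = W⁻¹.indicator 1 g := fun g => rfl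
  have key := lintegral_iwasawa μ m κ volume D.flagGroup.subtype measurable_subtype_coe
    (h.compact B).subtype measurable_subtype_coe (fr.torusU c) (fr.continuous_torusU c).measurable
    (fr.torusU_add c) (fun s => fr.torusConj c s)
    (fun s => (fr.torusConj c s).continuous_toFun.measurable) (fun _ _ => rfl) (fr.weight c)
    (fr.measurable_weight c) (fun s => (fr.lintegral_torusConj c m s _ measurable_one).2)
    (fr.weight_ne_top c) (fr.weight_add c) (fun s f hf => (fr.lintegral_torusConj c m s f hf).1)
    (fr.exists_iwasawa c) (W.indicator 1) hβ (fun g x => by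
      have h1 : g * x.1 ∈ W ↔ g ∈ W := by
        constructor
        · intro hg
          obtain ⟨v, hv, y, hy, hvy⟩ := Set.mem_mul.1 hg
          exact Set.mem_mul.2 ⟨v, hv, y * x.1⁻¹, mul_mem hy (inv_mem x.2), by
            rw [← mul_assoc, hvy, mul_inv_cancel_right]⟩
        · rintro ⟨v, hv, y, hy, rfl⟩
          exact ⟨v, hv, y * x.1, mul_mem hy x.2, (mul_assoc _ _ _).symm⟩
      by_cases hg : g ∈ W
      · exact (indicator_of_mem (h1.2 hg) _).trans (indicator_of_mem hg (1 : h.unitary → ℝ≥0∞)).symm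
      · exact (indicator_of_notMem (mt h1.1 hg) _).trans (indicator_of_notMem hg (1 : h.unitary → ℝ≥0∞)).symm)
    (by simp only [hβi]
        exact fr.lintegral_weight_ne_zero c m hW.inv.measurableSet (inv_mem_nhds_one _ hW1))
    (by simp only [hβi]; exact fr.lintegral_weight_ne_top c m hW.inv)
    (fr.lintegral_weight_ne_zero c m hW.measurableSet hW1) (fr.lintegral_weight_ne_top c m hW)
  have hl0 := fr.lintegral_weight_ne_zero c m hW.measurableSet hW1
  have hl1 := fr.lintegral_weight_ne_top c m hW
  have hμ : ∫⁻ g, W.indicator 1 g ∂μ = μ W := lintegral_indicator_one hW.measurableSet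
  have hμ0 : μ W ≠ 0 := (measure_pos_of_mem_nhds μ hW1).ne'
  rw [hμ] at key
  set N := ∫⁻ s, fr.weight c s * ∫⁻ x, W.indicator 1 (x.1 * fr.torusU c s) ∂m with hN
  refine ⟨μ W / N * C', mul_ne_zero (ENNReal.div_ne_zero.2 ⟨hμ0, hl1⟩) hC0,
    mul_ne_top (div_ne_top hW.measure_ne_top hl0) hC1, fun f hf => ?_⟩
  have h1 : ∫⁻ g, f g ∂μ = μ W / N * ∫⁻ s, fr.weight c s * ∫⁻ x, ∫⁻ y,
      f (x.1 * fr.torusU c s * y.1) ∂κ ∂m := by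
    rw [← ENNReal.mul_div_right_comm, ENNReal.eq_div_iff hl0 hl1]
    exact key f hf
  have h2 : ∀ s, ∫⁻ x : D.flagGroup, ∫⁻ y, f (x.1 * fr.torusU c s * y.1) ∂κ ∂m = C' * ∫⁻ t,
      ofReal (jacobianEta h B D.E₀' (D.v₀, D.v₀') (expPos t)) * ∫⁻ x, ∫⁻ b,
          f (b.1 * (fr.torusU c s * D.hyperU t * x.1)) ∂σ ∂κ := by
    intro s
    have hm : Measurable fun p : D.flagGroup × h.compact B => f (p.1.1 * fr.torusU c s * p.2.1) :=
      hf.comp (by fun_prop)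
    rw [hC' _ hm.lintegral_prod_right']
    congr 1
    refine lintegral_congr fun t => ?_
    congr 1
    have h3 : ∀ (x : fr.coreCompact) (b : D.bessel), ∫⁻ y : h.compact B,
        f ((inclusion D.bessel_le_flagGroup b * (fr.hyperF c t * fr.coreF x)).1 *
          fr.torusU c s * y.1) ∂κ =
        ∫⁻ y : h.compact B, f (b.1 * (fr.torusU c s * D.hyperU t * y.1)) ∂κ := fun x b => by
      rw [← lintegral_mul_left_eq_self
        (fun y : h.compact B => f (b.1 * (fr.torusU c s * D.hyperU t * y.1))) x.1]
      refine lintegral_congr fun y => congrArg f ?_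
      change b.1 * (D.hyperU t * x.1.1) * fr.torusU c s * y.1 =
        b.1 * (fr.torusU c s * D.hyperU t * (x.1.1 * y.1))
      have h4 := (fr.isHyperbolicFamily c).translation_comm s (x := x.1.1) x.2
      change x.1.1 * fr.torusU c s = fr.torusU c s * x.1.1 at h4
      rw [← fr.hyper_torus_comm c]
      simp only [mul_assoc]
      rw [← mul_assoc x.1.1, h4, mul_assoc]
    simp only [h3, lintegral_const, measure_univ, mul_one]
    refine lintegral_lintegral_swap (Measurable.aemeasurable (hf.comp ?_))
    fun_prop
  rw [h1]
  simp only [h2]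
  rw [mul_assoc, ← lintegral_const_mul' _ _ hC1]
  simp only [mul_left_comm]

end AdaptedFrame

namespace LeftQuotient

open scoped ENNReal Topology Pointwise

variable {G : Type*} [Group G] [TopologicalSpace G] [IsTopologicalGroup G] {S : Subgroup G}

theorem mk_eq_mk {x y : G} : mk S x = mk S y ↔ y * x⁻¹ ∈ S :=
  (Quotient.eq (r := QuotientGroup.rightRel S)).trans QuotientGroup.rightRel_apply

theorem isOpenQuotientMap_mk : IsOpenQuotientMap (mk S) where
  surjective := Quotient.mk_surjective
  continuous := continuous_quotient_mk'
  isOpenMap U hU := by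
    have h1 : mk S ⁻¹' (mk S '' U) = (S : Set G) * U := by
      ext x
      rw [Set.mem_mul]
      constructor
      · rintro ⟨u, hu, hux⟩
        exact ⟨x * u⁻¹, mk_eq_mk.1 hux, u, hu, inv_mul_cancel_right _ _⟩
      · rintro ⟨s, hs, u, hu, rfl⟩
        exact ⟨u, hu, mk_eq_mk.2 (by aesop)⟩
    change IsOpen (mk S ⁻¹' (mk S '' U))
    rw [h1]
    exact hU.mul_left

theorem t2Space (hS : IsClosed (S : Set G)) : T2Space (LeftQuotient S) := by
  rw [t2Space_iff_of_isOpenQuotientMap isOpenQuotientMap_mk]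
  simp only [mk_eq_mk]
  exact hS.preimage (continuous_snd.mul continuous_fst.inv)

theorem continuous_translate (x : G) : Continuous (translate S x) :=
  isOpenQuotientMap_mk.isQuotientMap.continuous_iff.2
    (isOpenQuotientMap_mk.continuous.comp (continuous_mul_const x))

/-- The measure on `S \ G` obtained from a disintegration of the Haar measure of `G`. -/
theorem map_mk_of_disintegration [PolishSpace G] [LocallyCompactSpace G] [MeasurableSpace G]
    [BorelSpace G] (hS : IsClosed (S : Set G)) (μ : Measure G) [μ.IsHaarMeasure]
    [μ.IsMulRightInvariant] (σ : Measure S) [SFinite σ] [σ.IsMulRightInvariant] [σ.IsOpenPosMeasure]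
    {P : Type*} [MeasurableSpace P] (π : Measure P) [SFinite π] (j : P → G) (hj : Measurable j)
    (C : ℝ≥0∞) (hC0 : C ≠ 0) (hC1 : C ≠ ∞)
    (hdis : ∀ f : G → ℝ≥0∞, Measurable f → ∫⁻ g, f g ∂μ = C * ∫⁻ p, ∫⁻ s : S, f (s.1 * j p) ∂σ ∂π) :
    π.map (fun p => mk S (j p)) ≠ 0 ∧ (π.map fun p => mk S (j p)).Regular ∧ ∀ x,
    (π.map fun p => mk S (j p)).map (translate S x) = π.map fun p => mk S (j p) := by
  have hq := isOpenQuotientMap_mk (S := S)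
  have := t2Space hS
  have : SecondCountableTopology (LeftQuotient S) :=
    hq.isQuotientMap.secondCountableTopology hq.isOpenMap
  have : LocallyCompactSpace (LeftQuotient S) := hq.locallyCompactSpace
  have : PolishSpace S := hS.isClosedEmbedding_subtypeVal.polishSpace
  have : LocallyCompactSpace S := hS.isClosedEmbedding_subtypeVal.locallyCompactSpace
  have hqm := hq.continuous.measurable
  have hqS : ∀ (s : S) g, mk S (s.1 * g) = mk S g := fun s g =>
    (mk_eq_mk.2 (by simp)).symm
  refine ⟨fun h0 => ?_, ?_, fun x => ?_⟩
  · have h1 := congrArg (fun m : Measure (LeftQuotient S) => m Set.univ) h0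
    have hmj : Measurable fun p => mk S (j p) := hqm.comp hj
    simp only [map_apply hmj MeasurableSet.univ] at h1
    have h2 : π = 0 := Measure.measure_univ_eq_zero.1 h1
    have h3 := hdis (fun _ => 1) measurable_const
    rw [h2, lintegral_zero_measure, mul_zero, lintegral_one] at h3
    exact NeZero.ne μ (Measure.measure_univ_eq_zero.1 h3)
  · have : IsLocallyFiniteMeasure (π.map fun p => mk S (j p)) := ⟨fun v => by
      obtain ⟨g, rfl⟩ := hq.surjective v
      obtain ⟨V, hV, hVg⟩ := exists_compact_mem_nhds g
      obtain ⟨W, hW, hW1⟩ := exists_compact_mem_nhds (1 : S)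
      have hT : IsOpen (mk S '' interior V) := hq.isOpenMap _ isOpen_interior
      refine ⟨_, hT.mem_nhds ⟨g, mem_interior_iff_mem_nhds.2 hVg, rfl⟩, lt_top_iff_ne_top.2 ?_⟩
      have hD := (hW.image continuous_subtype_val).mul hV
      exact map_apply_ne_top_of_disintegration μ σ π S.subtype measurable_subtype_coe j hj C hC0
        hdis (mk S) hqm (fun g g' hg => ⟨⟨_, mk_eq_mk.1 hg.symm⟩, (inv_mul_cancel_right _ _).symm⟩)
        V W _ hD.measurableSet (fun s hs v hv => Set.mul_mem_mul ⟨s, hs, rfl⟩ hv)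
        (measure_pos_of_mem_nhds σ hW1).ne' hD.measure_ne_top _ hT.measurableSet
        (Set.image_mono interior_subset)⟩
    infer_instance
  · exact map_translate_eq_of_disintegration μ σ (NeZero.ne σ) π S.subtype measurable_subtype_coe j
      hj C hC0 hC1 hdis (mk S) hqm hqS x _ (continuous_translate x).measurable fun _ => rfl

end LeftQuotient

namespace AdaptedFrame

/-- The logarithm on `(𝕂₊ˣ)^r`. -/
noncomputable def logTorus (t : Fin r → PosScalar k) : Fin r → 𝔞 :=
  (piCongrRight fun _ : Fin r => expPosEquiv k).symm t

include fr c in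
theorem jacobianEta_eq {w : E × E} (hw : w ∈ sphereF h B D.E₀') (t : PosScalar k) : jacobianEta h B
    D.E₀' w t = jacobianEta h B D.E₀' (D.v₀, D.v₀') t := by
  rw [← expPos_symm t]
  have h1 := (fr.mem_sphereF_iff c ⟨w.1, hw.1.1⟩ ⟨w.2, hw.2.1.1⟩).1 hw
  exact (fr.jacobianEta_core c ⟨w.1, hw.1.1⟩ ⟨w.2, hw.2.1.1⟩ _).trans
    (((fr.coreAction_isSphereAction c).jacobianEta_eq (fr.core_isCartan c) h1 _).trans
      (fr.jacobianEta_core c (fr.corePoint c).1 (fr.corePoint c).2 _).symm)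

/-- The density of the measure on `S_r \ G`. -/
noncomputable def density (p : (Fin r → PosScalar k) × PosScalar k × h.compact B) : ℝ :=
  (D.deltaP ⟨(fr.torus c (logTorus p.1)).1,
      D.borelGroup_le_parabolic (fr.torus c (logTorus p.1)).2⟩)⁻¹ *
    (D.deltaB (fr.torus c (logTorus p.1)))⁻¹ * jacobianEta h B D.E₀' (D.v₀, D.v₀') p.2.1

/-- The point `a_t g_t k` of `U(E)`. -/
noncomputable def point (p : (Fin r → PosScalar k) × PosScalar k × h.compact B) : h.unitary :=
  (fr.torus c (logTorus p.1)).1 * D.hyperU ((expPosEquiv k).symm p.2.1) * p.2.2.1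

theorem density_nonneg (p : (Fin r → PosScalar k) × PosScalar k × h.compact B) : 0 ≤ fr.density c p
    :=
  mul_nonneg (mul_nonneg (inv_nonneg.2 (abs_nonneg _)) (inv_nonneg.2 (abs_nonneg _)))
    (div_nonneg (Real.sqrt_nonneg _) (Real.sqrt_nonneg _))

theorem ofReal_density (p : (Fin r → PosScalar k) × PosScalar k × h.compact B) : ofReal
    (fr.density c p) = fr.weight c (logTorus p.1) * ofReal
    (jacobianEta h B D.E₀' (D.v₀, D.v₀') p.2.1) :=
  ENNReal.ofReal_mul (mul_nonneg (inv_nonneg.2 (abs_nonneg _)) (inv_nonneg.2 (abs_nonneg _)))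

theorem measurable_jacobian : Measurable fun t : PosScalar k => ofReal
    (jacobianEta h B D.E₀' (D.v₀, D.v₀') t) := by
  have h1 := ((continuous_jacobian (h := h) (B := B) (D := D) (D.v₀, D.v₀')).measurable.comp
    (expPosEquiv k).symm.measurable).ennreal_ofReal
  grind [Function.comp_def, expPos_symm]

theorem measurable_density : Measurable fun p : (Fin r → PosScalar k) × PosScalar k × h.compact B =>
    ofReal (fr.density c p) := by
  simp only [ofReal_density]
  exact (((fr.measurable_weight c).comp (MeasurableEquiv.measurable _)).comp measurable_fst).mul
    (measurable_jacobian.comp (measurable_fst.comp measurable_snd))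

theorem measurable_point : Measurable (fr.point c) := by
  have h1 : Measurable fun p : (Fin r → PosScalar k) × PosScalar k × h.compact B =>
      fr.torusU c (logTorus p.1) :=
    (fr.continuous_torusU c).measurable.comp ((MeasurableEquiv.measurable _).comp measurable_fst)
  have h2 : Measurable fun p : (Fin r → PosScalar k) × PosScalar k × h.compact B =>
      D.hyperU ((expPosEquiv k).symm p.2.1) :=
    (D.isHyperbolicFamily.continuous_translation.comp
      (continuous_pi fun _ => continuous_id)).measurable.comp
      ((MeasurableEquiv.measurable _).comp (measurable_fst.comp measurable_snd))
  exact (h1.mul h2).mul (measurable_subtype_coe.comp (measurable_snd.comp measurable_snd))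

/-- Integration over the parameters in logarithmic coordinates. -/
theorem lintegral_param (κ : Measure (h.compact B)) [SFinite κ]
    (F : (Fin r → PosScalar k) × PosScalar k × h.compact B → ℝ≥0∞) (hF : Measurable F) : ∫⁻ p, F p
    ∂(((Measure.pi fun _ : Fin r => posMeasure k).prod ((posMeasure k).prod κ)).withDensity fun p =>
    ofReal (fr.density c p)) = ∫⁻ s, fr.weight c s * ∫⁻ t, ofReal
    (jacobianEta h B D.E₀' (D.v₀, D.v₀') (expPos t)) * ∫⁻ x, F
    ((fun i => expPos (s i)), expPos t, x) ∂κ := by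
  have hm := (fr.measurable_density c).mul hF
  refine (lintegral_withDensity_eq_lintegral_mul _ (fr.measurable_density c) hF).trans ?_
  rw [lintegral_prod _ hm.aemeasurable, pi_posMeasure_eq, lintegral_map_equiv]
  refine lintegral_congr fun s => ?_
  refine (lintegral_prod _ (hm.comp measurable_prodMk_left).aemeasurable).trans ?_
  rw [posMeasure_eq, lintegral_map_equiv, ← lintegral_const_mul' _ _ (fr.weight_ne_top c s)]
  refine lintegral_congr fun t => ?_
  rw [← mul_assoc, ← lintegral_const_mul' _ _
    (mul_ne_top (fr.weight_ne_top c s) ofReal_ne_top)]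
  refine lintegral_congr fun x => ?_
  change ofReal (fr.density c
    (piCongrRight (fun _ : Fin r => expPosEquiv k) s, expPosEquiv k t, x)) * F _ = _
  rw [ofReal_density]
  have h1 : logTorus (piCongrRight (fun _ : Fin r => expPosEquiv k) s) = s :=
    symm_apply_apply _ s
  rw [h1]
  rfl

end AdaptedFrame

end Iwasawa

open scoped ENNReal in
theorem mainTheorem4 {L : Type*} [RCLike L] {k : ScalarKind} {E : Type*} [NormedAddCommGroup E]
    [NormedSpace ℝ E] [Module (Scalar L k) E] [IsScalarTower ℝ (Scalar L k) E]
    [Module.Free (Scalar L k) E] [Module.Finite (Scalar L k) E]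
    (h : HermitianForm L k E) (r : ℕ) (D : BesselData h r)
    (B : PositiveForm L k E) (hB : B.IsCommuting h) (hD : D.IsAdapted B)
    (dk : Measure (h.compact B)) [dk.IsHaarMeasure] [IsProbabilityMeasure dk] :
    ∃ (a : (Fin r → PosScalar k) → D.borelGroup) (g : PosScalar k → h.unitary)
      (J : PosScalar k → ℝ),
      (∀ t, D.IsTorus B t (a t)) ∧
      (∀ t, D.IsHyperbolic t (g t)) ∧
      (D.v₀, D.v₀') ∈ sphereF h B D.E₀' ∧
      (∀ w ∈ sphereF h B D.E₀', ∀ t, jacobianEta h B D.E₀' w t = J t) ∧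
      ∃ ν : Measure (LeftQuotient D.bessel),
        ν ≠ 0 ∧ ν.Regular ∧
        (∀ x : h.unitary, ν.map (LeftQuotient.translate D.bessel x) = ν) ∧
        ∀ φ : LeftQuotient D.bessel → ℂ, Continuous φ →
          (Integrable φ ν ↔
            Integrable (fun p : (Fin r → PosScalar k) × PosScalar k × h.compact B =>
              φ (LeftQuotient.mk D.bessel ((a p.1).1 * g p.2.1 * p.2.2.1)) *
                (((D.deltaP ⟨(a p.1).1, D.borelGroup_le_parabolic (a p.1).2⟩)⁻¹ *
                  (D.deltaB (a p.1))⁻¹ * J p.2.1 : ℝ) : ℂ))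
              ((Measure.pi fun _ : Fin r => posMeasure k).prod ((posMeasure k).prod dk))) ∧
          ∫ x, φ x ∂ν =
            ∫ p : (Fin r → PosScalar k) × PosScalar k × h.compact B,
              φ (LeftQuotient.mk D.bessel ((a p.1).1 * g p.2.1 * p.2.2.1)) *
                (((D.deltaP ⟨(a p.1).1, D.borelGroup_le_parabolic (a p.1).2⟩)⁻¹ *
                  (D.deltaB (a p.1))⁻¹ * J p.2.1 : ℝ) : ℂ)
              ∂((Measure.pi fun _ : Fin r => posMeasure k).prod ((posMeasure k).prod dk)) := by
  have hfd : FiniteDimensional ℝ E := Module.Finite.trans (Scalar L k) E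
  obtain ⟨θ, e, c, fr⟩ := exists_adaptedFrame D hB hD
  have : LocallyCompactSpace (h.compact B) :=
    (HermitianForm.isClosed_compact (h := h) B).isClosedEmbedding_subtypeVal.locallyCompactSpace
  have : CompactSpace (h.compact B) := by
    by_contra hnc
    have := not_compactSpace_iff.1 hnc
    exact measure_ne_top dk _ (measure_univ_of_isMulLeftInvariant dk)
  let μ : Measure h.unitary := Measure.haar
  let σ : Measure D.bessel := (Measure.haar : Measure D.bessel).inv
  have := c.isMulRightInvariant μ
  obtain ⟨C, hC0, hC1, hC⟩ := fr.exists_lintegral_unitary c μ σ (NeZero.ne σ) dk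
  have hpm := fr.measurable_point c
  have hdm := fr.measurable_density c
  obtain ⟨h1, h2, h3⟩ := LeftQuotient.map_mk_of_disintegration D.isClosed_bessel μ σ
    (((Measure.pi fun _ : Fin r => posMeasure k).prod
      ((posMeasure k).prod dk)).withDensity fun p => ENNReal.ofReal (fr.density c p))
    (fr.point c) hpm C hC0 hC1 (fun f hf => by
      have hf' : Measurable fun z : ((Fin r → PosScalar k) × PosScalar k × h.compact B) × D.bessel =>
          f (z.2.1 * fr.point c z.1) := hf.comp
        ((measurable_subtype_coe.comp measurable_snd).mul (hpm.comp measurable_fst))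
      rw [hC f hf, fr.lintegral_param c dk _ hf'.lintegral_prod_right']
      congr 1
      refine lintegral_congr fun s => ?_
      have e1 : AdaptedFrame.logTorus (fun i => expPos (s i)) = s :=
        MeasurableEquiv.symm_apply_apply _ s
      have e2 : ∀ t, (expPosEquiv k).symm (expPos t) = t := (expPosEquiv k).symm_apply_apply
      simp only [AdaptedFrame.point, e1, e2]
      rfl)
  have hqm := (LeftQuotient.isOpenQuotientMap_mk (S := D.bessel)).continuous.measurable
  have hqp : Measurable fun p => LeftQuotient.mk D.bessel (fr.point c p) := hqm.comp hpm
  refine ⟨fun t => fr.torus c (AdaptedFrame.logTorus t),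
    fun t => D.hyperU ((expPosEquiv k).symm t), fun t => jacobianEta h B D.E₀' (D.v₀, D.v₀') t,
    fun t => ?_, fun t => ?_, fr.mem_sphereF c, fun w hw t => fr.jacobianEta_eq c hw t,
    _, h1, h2, h3, fun φ hφ => ?_⟩
  · have h4 := fr.torus_isTorus c (AdaptedFrame.logTorus t)
    have h5 : (fun i => expPos (AdaptedFrame.logTorus t i)) = t :=
      MeasurableEquiv.apply_symm_apply
        (MeasurableEquiv.piCongrRight fun _ : Fin r => expPosEquiv k) t
    rwa [h5] at h4
  · have h4 := AdaptedFrame.hyper_isHyperbolic (D := D) ((expPosEquiv k).symm t)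
    rwa [expPos_symm] at h4
  · have e1 : ∀ p, (ENNReal.ofReal (fr.density c p)).toReal •
        φ (LeftQuotient.mk D.bessel (fr.point c p)) =
        φ (LeftQuotient.mk D.bessel (fr.point c p)) * ((fr.density c p : ℝ) : ℂ) := fun p => by
      rw [ENNReal.toReal_ofReal (fr.density_nonneg c p), Complex.real_smul, mul_comm]
    have hlt : ∀ p, ENNReal.ofReal (fr.density c p) < ⊤ := fun p => ENNReal.ofReal_lt_top
    constructor
    · refine (integrable_map_measure hφ.aestronglyMeasurable hqp.aemeasurable).trans
        ((integrable_withDensity_iff_integrable_smul' hdm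
          (Filter.Eventually.of_forall hlt)).trans ?_)
      exact Iff.of_eq (congrArg₂ _ (funext e1) rfl)
    · refine (integral_map hqp.aemeasurable hφ.aestronglyMeasurable).trans
        ((integral_withDensity_eq_integral_toReal_smul hdm
          (Filter.Eventually.of_forall hlt) _).trans ?_)
      exact integral_congr_ae (Filter.Eventually.of_forall e1)
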